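/- **Setting.** Let $T=(V,E)$ be a tree with $n$ vertices and $l$ leaves (vertices of degree 1), with edge lengths $c_e>0$ and weights $w_{\{u,v\}}\ge 0$ for the unordered pairs of vertices, $w_{\{v,v\}}=0$; a pair of positive weight is called relevant. For a subtree $\hat T$ of $T$, an *s-sequence* of $\hat T$ is an ordering $S$ of its edges; the edges are constructed one after the other in this order, at unit speed from time $0$. The connection time $t_{\{u,v\}}$ is the time at which $u$ and $v$ become connected by constructed edges. *Problem A*$(\hat T)$ asks for an s-sequence of $\hat T$ that minimizes $\sum w_{\{u,v\}}t_{\{u,v\}}$ over the relevant pairs of vertices of $\hat T$; Problem A is Problem A$(T)$. *Problem A*$^{(e)}(\hat T)$ is the same problem with the restriction that the edge $e$ of $\hat T$ is constructed last. **Algorithm.** Put $S(\hat T)=()$ for single-vertex subtrees. For $p=1,\dots,n-1$, for all subtrees $\hat T$ of $T$ with $p$ edges: for every edge $e$ of $\hat T$, let $T',T''$ be the two subtrees obtained from $\hat T$ by deleting $e$; take an optimal solution of the scheduling problem $1|\mathrm{prec}|\sum w_jC_j$ whose jobs are the edges of $T'$ and $T''$, with processing times $c_{e'}$, with the weight of job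 $e'$ equal to the total weight of the relevant pairs of $T'$ (respectively $T''$) that become connected when $e'$ is constructed following $S(T')$ (respectively $S(T'')$), and with the two chains $S(T')$ and $S(T'')$ as precedence constraints; append $e$ to it, which gives a sequence $S^{(e)}(\hat T)$. Then choose as $S(\hat T)$ a sequence $S^{(e)}(\hat T)$, $e\in E(\hat T)$, with the smallest objective value for Problem A$(\hat T)$. Output $S(T)$. **Theorem.** For every fixed $l$ the following holds for all trees $T$ with $l$ leaves, with constants in the $O$-bounds that depend only on $l$. (i) $T$ has $O(n^l)$ subtrees. (ii) However ties are broken, the algorithm is correct: $S(\hat T)$ is an optimal solution of Problem A$(\hat T)$ and $S^{(e)}(\hat T)$ is an optimal solution of Problem A$^{(e)}(\hat T)$, for all subtrees $\hat T$ and all edges $e$ of $\hat T$. In particular, the output $S(T)$ is an optimal solution of Problem A. (iii) The algorithm can be implemented in $O(n^{l+2})$ time: there is a program (one for all $l$) for a random access machine with words of $O(\log n)$ bits and with exact real arithmetic (addition, subtraction, multiplication and comparison of reals), each operation taking one unit of time, which, given the list of the edges of $T$ with their lengths and the matrix of weights, carries out the algorithm in $O(n^{l+2})$ time, printing all the sequences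 $S^{(e)}(\hat T)$ and $S(\hat T)$ in the order of the algorithm, and finally $S(T)$. -/

import Mathlib

/-! ## Networks and the construction problem -/

/-- A network: an undirected graph with positive edge lengths and nonnegative weights on the
unordered pairs of vertices, degenerate pairs having weight zero. Only the lengths of edges of
the graph matter. -/
structure Network (V : Type*) where
  graph : SimpleGraph V
  len : Sym2 V → ℝ
  wt : Sym2 V → ℝ
  len_pos : ∀ e ∈ graph.edgeSet, 0 < len e
  wt_nonneg : ∀ q, 0 ≤ wt q
  wt_diag : ∀ v, wt s(v, v) = 0

/-- The number of leaves, that is, of vertices of degree one. -/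
noncomputable def leafCount {V : Type*} (G : SimpleGraph V) : ℕ :=
  {v : V | (G.neighborSet v).ncard = 1}.ncard

/-- The pair `q` is connected by a path all of whose edges are in the list `A`. -/
def ConnectedBy {V : Type*} (A : List (Sym2 V)) (q : Sym2 V) : Prop :=
  ∀ u ∈ q, ∀ v ∈ q, (SimpleGraph.fromEdgeSet {e | e ∈ A}).Reachable u v

namespace Network

variable {V : Type*} (N : Network V)

/-- The subtrees of the network. They have at least one vertex; single vertices are subtrees. -/
def IsSubtree (H : N.graph.Subgraph) : Prop := H.coe.IsTree

/-- An s-sequence of the subnetwork `H`: a sequence of distinct edges which form a spanning tree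
of `H`. -/
def IsSSequence (H : N.graph.Subgraph) (S : List (Sym2 V)) : Prop :=
  S.Nodup ∧ ∃ F : N.graph.Subgraph,
    F ≤ H ∧ F.verts = H.verts ∧ F.coe.IsTree ∧ F.edgeSet = {e | e ∈ S}

/-- The connection time of the pair `q` when the edges are constructed one after the other in
the order `S`, at unit speed, starting at time zero: the total length of the shortest initial
part of `S` which connects `q`. -/
noncomputable def connectionTime (S : List (Sym2 V)) (q : Sym2 V) : ℝ :=
  ((S.take (sInf {k : ℕ | ConnectedBy (S.take k) q})).map N.len).sum

open Classical in
/-- The relevant pairs (those of positive weight) that involve only vertices of `H`. -/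
noncomputable def relevantPairs [Fintype V] (H : N.graph.Subgraph) : Finset (Sym2 V) :=
  Finset.univ.filter fun q => 0 < N.wt q ∧ ∀ v ∈ q, v ∈ H.verts

/-- The objective of Problem A on `H`: the total weighted connection time. -/
noncomputable def objective [Fintype V] (H : N.graph.Subgraph) (S : List (Sym2 V)) : ℝ :=
  ∑ q ∈ N.relevantPairs H, N.wt q * N.connectionTime S q

/-- `S` is an optimal s-sequence for Problem A on `H`. -/
def IsOptimal [Fintype V] (H : N.graph.Subgraph) (S : List (Sym2 V)) : Prop :=
  N.IsSSequence H S ∧ ∀ S', N.IsSSequence H S' → N.objective H S ≤ N.objective H S'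

/-- `S` is an optimal s-sequence for Problem A on `H` with the additional restriction that the
edge `e` is constructed last. -/
def IsOptimalWithLast [Fintype V] (H : N.graph.Subgraph) (e : Sym2 V) (S : List (Sym2 V)) :
    Prop :=
  N.IsSSequence H S ∧ S.getLast? = some e ∧
    ∀ S', N.IsSSequence H S' → S'.getLast? = some e → N.objective H S ≤ N.objective H S'

end Network

/-! ## The scheduling problem `1 | prec | ∑ w_j C_j` -/

namespace Scheduling

variable {J : Type*} [DecidableEq J]

/-- The completion time of job `j` when a single machine processes the jobs in the order `σ`. -/
def completionTime (p : J → ℝ) (σ : List J) (j : J) : ℝ :=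
  ((σ.take (σ.idxOf j + 1)).map p).sum

/-- The total weighted completion time. -/
def cost (p w : J → ℝ) (σ : List J) : ℝ :=
  (σ.map fun j => w j * completionTime p σ j).sum

/-- `σ` is an order of all the jobs which respects the precedence constraints. -/
def IsFeasible (jobs : Set J) (prec : J → J → Prop) (σ : List J) : Prop :=
  σ.Nodup ∧ (∀ j, j ∈ σ ↔ j ∈ jobs) ∧
    ∀ i ∈ jobs, ∀ j ∈ jobs, prec i j → σ.idxOf i < σ.idxOf j

/-- `σ` is an optimal solution of `1 | prec | ∑ w_j C_j`. -/
def IsOptimal (jobs : Set J) (prec : J → J → Prop) (p w : J → ℝ) (σ : List J) : Prop :=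
  IsFeasible jobs prec σ ∧ ∀ τ, IsFeasible jobs prec τ → cost p w σ ≤ cost p w τ

/-- Precedence constraints in the form of two parallel chains. -/
def twoChains (S₁ S₂ : List J) (i j : J) : Prop :=
  [i, j].Sublist S₁ ∨ [i, j].Sublist S₂

end Scheduling

/-! ## The dynamic program -/

namespace Network

variable {V : Type*} [Fintype V] [DecidableEq V] (N : Network V)

/-- `H₁` and `H₂` are the two subtrees obtained from `H` by deleting the edge `e`. -/
def IsSplit (H : N.graph.Subgraph) (e : Sym2 V) (H₁ H₂ : N.graph.Subgraph) : Prop :=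
  N.IsSubtree H₁ ∧ N.IsSubtree H₂ ∧ Disjoint H₁.verts H₂.verts ∧ H₁ ⊔ H₂ = H.deleteEdges {e}

open Classical in
/-- The total weight of the relevant pairs of `H` which become connected when `e` is constructed
following `S`. -/
noncomputable def gain (H : N.graph.Subgraph) (S : List (Sym2 V)) (e : Sym2 V) : ℝ :=
  ∑ q ∈ (N.relevantPairs H).filter (fun q =>
    ConnectedBy (S.take (S.idxOf e + 1)) q ∧ ¬ ConnectedBy (S.take (S.idxOf e)) q), N.wt q

open Classical in
/-- `L` is an optimal solution of the merging problem for the subtrees `H₁` and `H₂` with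
sequences `S₁` and `S₂`: the jobs are the edges of both subtrees, the processing times are the
lengths, the weight of a job is the weight of the pairs that its edge connects in the sequence of
its own subtree, and the sequences are the two chains of precedence constraints. -/
def IsOptimalMerge (H₁ H₂ : N.graph.Subgraph) (S₁ S₂ L : List (Sym2 V)) : Prop :=
  Scheduling.IsOptimal (H₁.edgeSet ∪ H₂.edgeSet) (Scheduling.twoChains S₁ S₂) N.len
    (fun e => if e ∈ H₁.edgeSet then N.gain H₁ S₁ e else N.gain H₂ S₂ e) L

/-- The record of an execution of the dynamic program: the order in which the subtrees with at
least one edge are processed, the order in which the last edges are tried for each of them, the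
sequence `merged H e` obtained by merging for the subtree `H` and the last edge `e`, and the
sequence `best H` chosen for `H`. -/
structure DPRecord where
  order : List N.graph.Subgraph
  edgeOrder : N.graph.Subgraph → List (Sym2 V)
  merged : N.graph.Subgraph → Sym2 V → List (Sym2 V)
  best : N.graph.Subgraph → List (Sym2 V)

/-- `R` records a correct execution of the dynamic program:
for `p = 1, 2, …`, for all subtrees `H` with `p` edges, for all edges `e` of `H`, the sequence
for `(H, e)` is an optimal merge of the chosen sequences for the two sides of `e` in `H`, followed
by `e`; then the best of these sequences is chosen for `H`. -/
structure DPRecord.IsExecution {N : Network V} (R : N.DPRecord) : Prop where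
  order_nodup : R.order.Nodup
  mem_order : ∀ H, H ∈ R.order ↔ N.IsSubtree H ∧ H.edgeSet.Nonempty
  order_sorted : R.order.Pairwise fun H K => H.edgeSet.ncard ≤ K.edgeSet.ncard
  edgeOrder_nodup : ∀ H ∈ R.order, (R.edgeOrder H).Nodup
  mem_edgeOrder : ∀ H ∈ R.order, ∀ e, e ∈ R.edgeOrder H ↔ e ∈ H.edgeSet
  best_vertex : ∀ H, N.IsSubtree H → H.edgeSet = ∅ → R.best H = []
  merge : ∀ H ∈ R.order, ∀ e ∈ H.edgeSet, ∃ H₁ H₂ L, N.IsSplit H e H₁ H₂ ∧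
    N.IsOptimalMerge H₁ H₂ (R.best H₁) (R.best H₂) L ∧ R.merged H e = L ++ [e]
  choose_best : ∀ H ∈ R.order, ∃ e ∈ H.edgeSet, R.best H = R.merged H e ∧
    ∀ e' ∈ H.edgeSet, N.objective H (R.merged H e) ≤ N.objective H (R.merged H e')

/-- A sequence of edges as a list of words: its length, followed by the positions of its edges in
the given list `es` of all edges. -/
def encodeSeq (es : List (Sym2 V)) (S : List (Sym2 V)) : List ℕ :=
  S.length :: S.map fun e => es.idxOf e

/-- The transcript of an execution: for each subtree, in the order of processing, the merged
sequences for all choices of the last edge and then the chosen sequence; at the end the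
sequence that solves the whole problem. -/
def DPRecord.transcript {N : Network V} (R : N.DPRecord) (es : List (Sym2 V)) : List ℕ :=
  R.order.flatMap (fun H =>
    (R.edgeOrder H).flatMap (fun e => encodeSeq es (R.merged H e)) ++ encodeSeq es (R.best H))
    ++ encodeSeq es (R.best ⊤)

end Network

/-! ## The machine model

A random access machine with a bounded word size and exact real arithmetic, programmed in a
structured language. There are finitely many arrays of words and finitely many arrays of real
numbers (a program mentions only finitely many array names); a variable is an array of which only
one cell is used. Words are natural numbers smaller than a bound `M`, and arithmetic on words is
modulo `M`. Real numbers can only be added, subtracted, multiplied and compared: they cannot be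
rounded, converted to words or used as addresses. Each operation takes one time unit. -/

namespace RAM

/-- A memory state, together with the list of words printed so far. -/
structure State where
  word : ℕ → ℕ → ℕ
  num : ℕ → ℕ → ℝ
  out : List ℕ

/-- Expressions with words as values; `read a i` is cell `i` of the word array `a`. -/
inductive WExp where
  | const (k : ℕ)
  | read (a : ℕ) (i : WExp)
  | add (x y : WExp)
  | sub (x y : WExp)
  | mul (x y : WExp)
  | div (x y : WExp)
  | mod (x y : WExp)

/-- Expressions with real numbers as values; `read a i` is cell `i` of the real array `a`. -/
inductive NExp where
  | const (k : ℕ)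
  | read (a : ℕ) (i : WExp)
  | add (x y : NExp)
  | sub (x y : NExp)
  | mul (x y : NExp)

/-- Tests. -/
inductive Test where
  | wordLE (x y : WExp)
  | numLE (x y : NExp)
  | not (b : Test)
  | and (b c : Test)

/-- Programs. -/
inductive Program where
  | skip
  | setWord (a : ℕ) (i x : WExp)
  | setNum (a : ℕ) (i : WExp) (x : NExp)
  | print (x : WExp)
  | seq (P Q : Program)
  | ite (b : Test) (P Q : Program)
  | while (b : Test) (P : Program)

/-- The value of a word expression. Subtraction is truncated at zero. -/
def WExp.eval (M : ℕ) (s : State) : WExp → ℕ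
  | const k => k % M
  | read a i => s.word a (i.eval M s)
  | add x y => (x.eval M s + y.eval M s) % M
  | sub x y => x.eval M s - y.eval M s
  | mul x y => (x.eval M s * y.eval M s) % M
  | div x y => x.eval M s / y.eval M s
  | mod x y => x.eval M s % y.eval M s

/-- The time needed to evaluate a word expression: one unit per operation. -/
def WExp.time : WExp → ℕ
  | const _ => 1
  | read _ i => i.time + 1
  | add x y | sub x y | mul x y | div x y | mod x y => x.time + y.time + 1

/-- The value of a real expression. -/
noncomputable def NExp.eval (M : ℕ) (s : State) : NExp → ℝ
  | const k => (k : ℝ)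
  | read a i => s.num a (i.eval M s)
  | add x y => x.eval M s + y.eval M s
  | sub x y => x.eval M s - y.eval M s
  | mul x y => x.eval M s * y.eval M s

/-- The time needed to evaluate a real expression. -/
def NExp.time : NExp → ℕ
  | const _ => 1
  | read _ i => i.time + 1
  | add x y | sub x y | mul x y => x.time + y.time + 1

/-- The truth of a test. -/
def Test.holds (M : ℕ) (s : State) : Test → Prop
  | wordLE x y => x.eval M s ≤ y.eval M s
  | numLE x y => x.eval M s ≤ y.eval M s
  | not b => ¬ b.holds M s
  | and b c => b.holds M s ∧ c.holds M s

/-- The time needed to evaluate a test. -/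
def Test.time : Test → ℕ
  | wordLE x y => x.time + y.time + 1
  | numLE x y => x.time + y.time + 1
  | not b => b.time + 1
  | and b c => b.time + c.time + 1

/-- Write `x` into cell `i` of the word array `a`. -/
def State.setWord (s : State) (a i x : ℕ) : State :=
  { s with word := Function.update s.word a (Function.update (s.word a) i x) }

/-- Write `x` into cell `i` of the real array `a`. -/
def State.setNum (s : State) (a i : ℕ) (x : ℝ) : State :=
  { s with num := Function.update s.num a (Function.update (s.num a) i x) }

/-- Print the word `x`. -/
def State.print (s : State) (x : ℕ) : State := { s with out := s.out ++ [x] }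

/-- `Exec M P s t s'`: with word bound `M`, the program `P` started in the state `s` halts after
exactly `t` time units in the state `s'`. -/
inductive Exec (M : ℕ) : Program → State → ℕ → State → Prop
  | skip (s : State) : Exec M .skip s 1 s
  | setWord (s : State) (a : ℕ) (i x : WExp) :
      Exec M (.setWord a i x) s (i.time + x.time + 1) (s.setWord a (i.eval M s) (x.eval M s))
  | setNum (s : State) (a : ℕ) (i : WExp) (x : NExp) :
      Exec M (.setNum a i x) s (i.time + x.time + 1) (s.setNum a (i.eval M s) (x.eval M s))
  | print (s : State) (x : WExp) : Exec M (.print x) s (x.time + 1) (s.print (x.eval M s))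
  | seq {P Q : Program} {s s' s'' : State} {t t' : ℕ} :
      Exec M P s t s' → Exec M Q s' t' s'' → Exec M (.seq P Q) s (t + t') s''
  | iteTrue {b : Test} {P Q : Program} {s s' : State} {t : ℕ} :
      b.holds M s → Exec M P s t s' → Exec M (.ite b P Q) s (b.time + t + 1) s'
  | iteFalse {b : Test} {P Q : Program} {s s' : State} {t : ℕ} :
      ¬ b.holds M s → Exec M Q s t s' → Exec M (.ite b P Q) s (b.time + t + 1) s'
  | whileFalse {b : Test} {P : Program} {s : State} :
      ¬ b.holds M s → Exec M (.while b P) s (b.time + 1) s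
  | whileTrue {b : Test} {P : Program} {s s' s'' : State} {t t' : ℕ} :
      b.holds M s → Exec M P s t s' → Exec M (.while b P) s' t' s'' →
      Exec M (.while b P) s (b.time + t + t' + 1) s''

/-- `es` lists every edge of `G` exactly once, as an ordered pair of its ends. -/
def ListsEdges {n : ℕ} (G : SimpleGraph (Fin n)) (es : List (Fin n × Fin n)) : Prop :=
  (es.map fun p => s(p.1, p.2)).Nodup ∧
    ∀ e : Sym2 (Fin n), e ∈ es.map (fun p => s(p.1, p.2)) ↔ e ∈ G.edgeSet

/-- The initial state for a network with vertices `0, …, n - 1` and the list `es` of its edges: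
cell 0 of word array 0 holds `n`, cell `i` of the word arrays 1 and 2 and of the real array 0
hold the two ends and the length of edge number `i`, and cell `u * n + v` of the real array 1
holds the weight of the pair `{u, v}`. All the other cells hold zero. -/
noncomputable def input {n : ℕ} (N : Network (Fin n)) (es : List (Fin n × Fin n)) : State where
  word a i := match a with
    | 0 => if i = 0 then n else 0
    | 1 => (es.map fun p => (p.1 : ℕ)).getD i 0
    | 2 => (es.map fun p => (p.2 : ℕ)).getD i 0
    | _ => 0
  num a i := match a with
    | 0 => (es.map fun p => N.len s(p.1, p.2)).getD i 0
    | 1 => if h : i < n * n then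
        N.wt s((finProdFinEquiv.symm ⟨i, h⟩).1, (finProdFinEquiv.symm ⟨i, h⟩).2) else 0
    | _ => 0
  out := []

end RAM

/-!
Let `F A` be the total weight of the pairs that are connected by a set `A` of edges. A pair of
vertices of a tree is connected exactly when all the edges that separate it are present
(`Network.linked_iff`), so `F` is a nonnegative combination of functions `A ↦ [B ⊆ A]` and hence
supermodular. The objective value of a sequence is the constant `F(all) * total length` minus the
area under the step function that shows `F` of the edges constructed so far
(`Network.objective_eq`).

*Correctness.* Fix the last edge `e`. On the edges of the two sides of `e`, `F` is the sum of its
restrictions to the two sides. For a supermodular function, moving a set `X` of maximum density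
`F X / length X` to the front of a sequence does not decrease the area (`area_exchange`), and the
area increases if `X` is the largest such set and was not in front (`area_exchange_strict`). So an
optimal sequence of a side starts with its largest densest set, and induction over the number of
edges shows that some interleaving of *any* two optimal sequences of the sides is optimal for both
sides together (`exists_shuffle_area_le`). Along an interleaving every edge has the gain it has on
its own side; therefore the scheduling problem with two chains finds the best interleaving
(`Network.isOptimalWithLast_of_merge`), and `Network.DPRecord.IsExecution.correct` follows by
induction over the number of edges.

*Counting.* A subtree has at most as many leaves as the tree and is determined by them
(`card_leaves_le`, `eq_of_leaves_eq`). Writing the increasing list of its leaves as a number in base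
`n + 1` gives an injective code below `(n + 1) ^ l` (`code_lt`, `code_injective`). With one vertex
there are no vertices of degree one, but the vertex is counted as a leaf in the code; the bound
`codeBound_le` takes this into account.

*The program.* The codes also serve as addresses of tables with one cell or one row of length `n`
for each subtree. A breadth-first search, which extends the subtrees found so far by one edge, lists
all subtrees by size (`RAM.runs_queueProg`). For each of them, every last edge takes time `O(n)`:
the codes of the two sides are found with a table of the sides of the edges of `T`, and the stored
sequences are merged by *keys*. The keys of a chain are the running minima of the maximum densities
of the initial parts of its remainders; they are constant on blocks which are densest initial parts,
and by the same exchange argument, applied to a function that counts a job only if its predecessors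
in the chain are present, merging by nonincreasing keys is optimal (`area_le_keyMerge`). The machine
cannot divide, so a key is stored as a numerator and a positive denominator. Computing the keys of a
chosen sequence and the total weight in a subtree takes time `O(n²)`. Hence the time for a subtree
is `O(n²)`, and all addresses and values stay below a polynomial in `n`, as the word length demands
(`RAM.runs_mainProg`).
-/

set_option linter.unusedSectionVars false

/-! ### Sequences and supermodular set functions -/

section Area

variable {E : Type*} [DecidableEq E]

/-- The area under the step function which, while the element `j` of the sequence is processed
during `c j` time units, has the value `f` of the set of elements processed before (starting with
the set `A`). The total weighted completion time is a constant minus this area. -/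
def area (c : E → ℝ) (f : Finset E → ℝ) (A : Finset E) : List E → ℝ
  | [] => 0
  | j :: σ => c j * f A + area c f (insert j A) σ

/-- The total of `c` over a list. -/
def total (c : E → ℝ) (σ : List E) : ℝ := (σ.map c).sum

/-- A set function with increasing marginal values. -/
def Supermodular (f : Finset E → ℝ) : Prop :=
  ∀ A B, f A + f B ≤ f (A ∪ B) + f (A ∩ B)

/-- The function `f` after the set `X` has been processed. -/
def contract (f : Finset E → ℝ) (X : Finset E) (Y : Finset E) : ℝ := f (X ∪ Y) - f X

/-- `τ` interleaves the sequences `S₁` and `S₂`. -/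
structure IsShuffle (S₁ S₂ τ : List E) : Prop where
  nodup : τ.Nodup
  left : S₁.Sublist τ
  right : S₂.Sublist τ
  mem : ∀ j ∈ τ, j ∈ S₁ ∨ j ∈ S₂

variable {c : E → ℝ} {f : Finset E → ℝ}

@[simp] lemma total_nil : total c [] = 0 := rfl
@[simp] lemma total_cons (j : E) (σ : List E) : total c (j :: σ) = c j + total c σ := by
  simp [total]
@[simp] lemma total_append (σ τ : List E) : total c (σ ++ τ) = total c σ + total c τ := by
  simp [total]

lemma total_perm {σ τ : List E} (h : σ.Perm τ) : total c σ = total c τ := (h.map c).sum_eq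

lemma total_eq_sum {σ : List E} (h : σ.Nodup) : total c σ = ∑ j ∈ σ.toFinset, c j := by
  rw [List.sum_toFinset _ h, total]

lemma total_nonneg {σ : List E} (h : ∀ j ∈ σ, 0 ≤ c j) : 0 ≤ total c σ :=
  List.sum_nonneg (by simpa using h)

lemma total_pos {σ : List E} (h : ∀ j ∈ σ, 0 < c j) (hne : σ ≠ []) : 0 < total c σ := by
  cases σ with
  | nil => exact absurd rfl hne
  | cons a σ =>
    rw [total_cons]
    have := total_nonneg (c := c) (σ := σ) fun j hj => (h j (List.mem_cons_of_mem _ hj)).le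
    have := h a List.mem_cons_self
    linarith

lemma area_append (A : Finset E) (σ τ : List E) :
    area c f A (σ ++ τ) = area c f A σ + area c f (A ∪ σ.toFinset) τ := by
  induction σ generalizing A with
  | nil => simp [area]
  | cons j σ ih =>
    simp only [List.cons_append, area, ih, List.toFinset_cons, add_assoc]
    rw [show insert j A ∪ σ.toFinset = A ∪ insert j σ.toFinset by grind]

lemma area_congr {g : Finset E → ℝ} {A : Finset E} {σ : List E}
    (h : ∀ Y, A ⊆ Y → Y ⊆ A ∪ σ.toFinset → f Y = g Y) : area c f A σ = area c g A σ := by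
  induction σ generalizing A with
  | nil => rfl
  | cons j σ ih =>
    rw [area, area, h A subset_rfl (by grind), ih]
    intro Y h1 h2
    exact h Y (by grind) (by intro x hx; have := h2 hx; simp at this ⊢; tauto)

lemma area_contract (X A : Finset E) (σ : List E) :
    area c f (X ∪ A) σ = area c (contract f X) A σ + f X * total c σ := by
  induction σ generalizing A with
  | nil => simp [area]
  | cons j σ ih =>
    rw [area, area, total_cons, show insert j (X ∪ A) = X ∪ insert j A by grind, ih, contract]
    ring

lemma area_after (X : Finset E) (σ : List E) :
    area c f X σ = area c (contract f X) ∅ σ + f X * total c σ := by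
  rw [← area_contract, Finset.union_empty]

lemma supermodular_contract (hf : Supermodular f) (X : Finset E) :
    Supermodular (contract f X) := by
  intro A B
  have := hf (X ∪ A) (X ∪ B)
  rw [show (X ∪ A) ∪ (X ∪ B) = X ∪ (A ∪ B) by grind,
    show (X ∪ A) ∩ (X ∪ B) = X ∪ (A ∩ B) by grind] at this
  simp only [contract]; linarith

lemma sum_union_sdiff_add (c : E → ℝ) (P X : Finset E) :
    ∑ j ∈ P ∪ X, c j = ∑ j ∈ P \ X, c j + ∑ j ∈ X, c j := by
  rw [← Finset.sdiff_union_self_eq_union, Finset.sum_union Finset.sdiff_disjoint]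

lemma sum_eq_inter_add_total {c : E → ℝ} {P X : Finset E} {σ : List E} (hn : σ.Nodup)
    (hP : ∀ j ∈ σ, j ∉ P) (hX : ∀ j ∈ X, j ∈ P ∨ j ∈ σ) :
    ∑ j ∈ X, c j = ∑ j ∈ P ∩ X, c j + total c (σ.filter (· ∈ X)) := by
  rw [total_eq_sum (hn.filter _), ← Finset.sum_union]
  · congr 1
    ext x
    have := hX x
    simp only [Finset.mem_union, Finset.mem_inter, List.mem_toFinset, List.mem_filter,
      decide_eq_true_eq]
    tauto
  · rw [Finset.disjoint_left]
    intro x hx hx'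
    simp at hx hx'
    exact hP x hx'.1 hx.1

lemma toFinset_filter_mem {X : Finset E} {σ : List E} (h : X ⊆ σ.toFinset) :
    (σ.filter (· ∈ X)).toFinset = X := by
  ext x
  have := @h x
  simp at this ⊢; tauto

/-- The exchange argument: moving a set `X` of maximum density to the front does not decrease the
area. The statement compares the two sequences from the moment when the set `P` has been processed
by the first of them. -/
lemma area_exchange_aux (hf : Supermodular f) (hc : ∀ j, 0 ≤ c j)
    {X U : Finset E} {ρ : ℝ} (hXU : X ⊆ U) (hX : f X = ρ * ∑ j ∈ X, c j)
    (hU : ∀ Y ⊆ U, f Y ≤ ρ * ∑ j ∈ Y, c j)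
    (σ : List E) (P : Finset E) (hn : σ.Nodup) (hP : ∀ j ∈ σ, j ∉ P) (hU' : P ∪ σ.toFinset = U) :
    area c f P σ ≤ area c f (P ∩ X) (σ.filter (· ∈ X)) + area c f (P ∪ X) (σ.filter (· ∉ X))
      + ρ * (∑ j ∈ P \ X, c j) * total c (σ.filter (· ∈ X)) := by
  induction σ generalizing P with
  | nil => simp [area]
  | cons j σ ih =>
    have hn' := List.nodup_cons.1 hn
    have ih' := ih (insert j P) hn'.2 (by grind) (by rw [← hU']; ext x; simp)
    have hsm := hf P X
    have hsum := sum_union_sdiff_add c P X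
    have hPU : P ⊆ U := by rw [← hU']; exact Finset.subset_union_left
    have hXmem : ∀ i ∈ X, i ≠ j → i ∈ insert j P ∨ i ∈ σ := fun i hi hij => by
      have := hXU hi
      rw [← hU'] at this
      simp at this ⊢; tauto
    have hPX := hU (P ∪ X) (Finset.union_subset hPU hXU)
    -- For `j ∈ X` compare `f P` with `f (P ∩ X)`, which is in force when the rearranged sequence
    -- processes `j`; for `j ∉ X` compare it with `f (P ∪ X)`.
    by_cases hj : j ∈ X
    · have hj' := hj
      simp only [List.filter_cons, hj, decide_true, if_true, not_true, decide_false,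
        Bool.false_eq_true, if_false, area, total_cons]
      rw [Finset.insert_inter_of_mem hj',
        Finset.insert_union, Finset.insert_eq_of_mem (Finset.mem_union_right P hj'),
          Finset.insert_sdiff_of_mem _ hj'] at ih'
      have h1 : f P ≤ ρ * ∑ j ∈ P \ X, c j + f (P ∩ X) := by
        rw [hsum, mul_add] at hPX; linarith
      have h2 := mul_le_mul_of_nonneg_left h1 (hc j)
      linarith
    · have hj' := hj
      simp only [List.filter_cons, hj, decide_true, if_true, not_false_eq_true, decide_false,
        Bool.false_eq_true, if_false, area]
      have hjP : j ∉ P := hP j (by simp)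
      rw [Finset.insert_inter_of_notMem hj', Finset.insert_union,
        Finset.insert_sdiff_of_notMem _ hj',
        Finset.sum_insert (by simp [hjP])] at ih'
      have hPiX := hU (P ∩ X) (Finset.inter_subset_right.trans hXU)
      have hrest := sum_eq_inter_add_total (c := c) (X := X) hn'.2
        (fun i hi => hP i (List.mem_cons_of_mem _ hi)) fun i hi => by
          have hij : i ≠ j := by rintro rfl; exact hj' hi
          simpa [hij] using hXmem i hi hij
      have h1 : f P ≤ f (P ∪ X) - ρ * total c (σ.filter (· ∈ X)) := by
        rw [hrest, mul_add] at hX; linarith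
      have h2 := mul_le_mul_of_nonneg_left h1 (hc j)
      linarith

/-- If moreover no proper superset of `X` has maximum density, then the area increases unless the
sequence begins with `X`. -/
lemma area_exchange_strict_aux (hf : Supermodular f) (hc : ∀ j, 0 < c j)
    {X U : Finset E} {ρ : ℝ} (hXU : X ⊆ U) (hX : f X = ρ * ∑ j ∈ X, c j)
    (hU : ∀ Y ⊆ U, f Y ≤ ρ * ∑ j ∈ Y, c j)
    (hmax : ∀ Y ⊆ U, X ⊂ Y → f Y < ρ * ∑ j ∈ Y, c j)
    (σ : List E) (P : Finset E) (hn : σ.Nodup) (hP : ∀ j ∈ σ, j ∉ P) (hU' : P ∪ σ.toFinset = U) :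
    area c f P σ < area c f (P ∩ X) (σ.filter (· ∈ X)) + area c f (P ∪ X) (σ.filter (· ∉ X))
      + ρ * (∑ j ∈ P \ X, c j) * total c (σ.filter (· ∈ X)) ∨
    (σ = σ.filter (· ∈ X) ++ σ.filter (· ∉ X) ∧ (P ⊆ X ∨ σ.filter (· ∈ X) = [])) := by
  induction σ generalizing P with
  | nil => simp
  | cons j σ ih =>
    have hn' := List.nodup_cons.1 hn
    have hU2 : insert j P ∪ σ.toFinset = U := by rw [← hU']; ext x; simp
    have hP2 : ∀ i ∈ σ, i ∉ insert j P := by grind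
    have ih' := ih (insert j P) hn'.2 hP2 hU2
    have weak := area_exchange_aux hf (fun j => (hc j).le) hXU hX hU σ (insert j P) hn'.2 hP2 hU2
    have hsm := hf P X
    have hsum := sum_union_sdiff_add c P X
    have hPU : P ⊆ U := by rw [← hU']; exact Finset.subset_union_left
    have hXmem : ∀ i ∈ X, i ≠ j → i ∈ insert j P ∨ i ∈ σ := fun i hi hij => by
      have := hXU hi
      rw [← hU'] at this
      simp at this ⊢; tauto
    by_cases hj : j ∈ X
    · have hj' := hj
      have hPX := hU (P ∪ X) (Finset.union_subset hPU hXU)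
      simp only [List.filter_cons, hj, decide_true, if_true, not_true, decide_false,
        Bool.false_eq_true, if_false, area, total_cons]
      rw [Finset.insert_inter_of_mem hj',
        Finset.insert_union, Finset.insert_eq_of_mem (Finset.mem_union_right P hj'),
          Finset.insert_sdiff_of_mem _ hj'] at ih' weak
      have h1 : f P ≤ ρ * ∑ j ∈ P \ X, c j + f (P ∩ X) := by
        rw [hsum, mul_add] at hPX; linarith
      have h2 := mul_le_mul_of_nonneg_left h1 (hc j).le
      by_cases hPsub : P ⊆ X
      · rcases ih' with h | ⟨h, -⟩
        · left; linarith
        · right; exact ⟨by rw [List.cons_append, ← h], Or.inl hPsub⟩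
      · left
        have hlt := hmax (P ∪ X) (Finset.union_subset hPU hXU) (by
          rw [Finset.ssubset_iff_subset_ne]
          refine ⟨Finset.subset_union_right, fun h => hPsub ?_⟩
          rw [h]; exact Finset.subset_union_left)
        have h1 : f P < ρ * ∑ j ∈ P \ X, c j + f (P ∩ X) := by
          rw [hsum, mul_add] at hlt; linarith
        have h2 := mul_lt_mul_of_pos_left h1 (hc j)
        linarith
    · have key := area_exchange_aux hf (fun j => (hc j).le) hXU hX hU (j :: σ) P hn hP hU'
      rcases ih' with h | ⟨h, h'⟩
      · left
        have hj' := hj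
        have hjP : j ∉ P := hP j (by simp)
        have hPiX := hU (P ∩ X) (Finset.inter_subset_right.trans hXU)
        simp only [List.filter_cons, hj, decide_true, if_true, not_false_eq_true, decide_false,
          Bool.false_eq_true, if_false, area]
        rw [Finset.insert_inter_of_notMem hj', Finset.insert_union,
          Finset.insert_sdiff_of_notMem _ hj',
          Finset.sum_insert (by simp [hjP])] at h
        have hrest := sum_eq_inter_add_total (c := c) (X := X) hn'.2
          (fun i hi => hP i (List.mem_cons_of_mem _ hi)) fun i hi => by
            have hij : i ≠ j := by rintro rfl; exact hj' hi
            simpa [hij] using hXmem i hi hij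
        have h1 : f P ≤ f (P ∪ X) - ρ * total c (σ.filter (· ∈ X)) := by
          rw [hrest, mul_add] at hX; linarith
        have h2 := mul_le_mul_of_nonneg_left h1 (hc j).le
        linarith
      · right
        have he : σ.filter (· ∈ X) = [] := by
          rcases h' with h' | h'
          · exact absurd (h' (Finset.mem_insert_self _ _)) hj
          · exact h'
        rw [he, List.nil_append] at h
        simp only [List.filter_cons, hj, decide_false, Bool.false_eq_true, if_false,
          not_false_eq_true, decide_true, if_true, he, List.nil_append, ← h, or_true, and_self]

lemma area_exchange (hf : Supermodular f) (hc : ∀ j, 0 < c j)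
    {X : Finset E} {ρ : ℝ} {σ : List E} (hn : σ.Nodup) (hXσ : X ⊆ σ.toFinset)
    (hX : f X = ρ * ∑ j ∈ X, c j) (hU : ∀ Y ⊆ σ.toFinset, f Y ≤ ρ * ∑ j ∈ Y, c j) :
    area c f ∅ σ ≤ area c f ∅ (σ.filter (· ∈ X) ++ σ.filter (· ∉ X)) := by
  have h := area_exchange_aux hf (fun j => (hc j).le) hXσ hX hU σ ∅ hn (by simp) (by simp)
  rw [area_append, toFinset_filter_mem hXσ, Finset.empty_union]
  simpa using h

lemma area_exchange_strict (hf : Supermodular f) (hc : ∀ j, 0 < c j)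
    {X : Finset E} {ρ : ℝ} {σ : List E} (hn : σ.Nodup) (hXσ : X ⊆ σ.toFinset)
    (hX : f X = ρ * ∑ j ∈ X, c j) (hU : ∀ Y ⊆ σ.toFinset, f Y ≤ ρ * ∑ j ∈ Y, c j)
    (hmax : ∀ Y ⊆ σ.toFinset, X ⊂ Y → f Y < ρ * ∑ j ∈ Y, c j)
    (hne : σ ≠ σ.filter (· ∈ X) ++ σ.filter (· ∉ X)) :
    area c f ∅ σ < area c f ∅ (σ.filter (· ∈ X) ++ σ.filter (· ∉ X)) := by
  have h := area_exchange_strict_aux hf hc hXσ hX hU hmax σ ∅ hn (by simp) (by simp)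
  rcases h with h | ⟨h, -⟩
  · rw [area_append, toFinset_filter_mem hXσ, Finset.empty_union]
    simpa using h
  · exact absurd h hne

/-- The sequence maximizes the area among its permutations. -/
def IsAreaMax (c : E → ℝ) (f : Finset E → ℝ) (S : List E) : Prop :=
  ∀ S', S'.Perm S → area c f ∅ S' ≤ area c f ∅ S

/-- The largest set of maximum density. -/
lemma exists_max_density (hc : ∀ j, 0 < c j) (hf0 : f ∅ = 0) {U : Finset E} (hU : U.Nonempty) :
    ∃ (X : Finset E) (ρ : ℝ), X ⊆ U ∧ X.Nonempty ∧ f X = ρ * ∑ j ∈ X, c j ∧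
      (∀ Y ⊆ U, f Y ≤ ρ * ∑ j ∈ Y, c j) ∧ ∀ Y ⊆ U, X ⊂ Y → f Y < ρ * ∑ j ∈ Y, c j := by
  have hpos : ∀ Y : Finset E, Y.Nonempty → 0 < ∑ j ∈ Y, c j := fun Y hY =>
    Finset.sum_pos (fun j _ => hc j) hY
  obtain ⟨X₀, hX₀, hmax⟩ := Finset.exists_max_image (U.powerset.filter (·.Nonempty))
    (fun Y => f Y / ∑ j ∈ Y, c j) ⟨U, by simp [hU]⟩
  simp only [Finset.mem_filter, Finset.mem_powerset] at hX₀ hmax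
  set ρ := f X₀ / ∑ j ∈ X₀, c j with hρ
  have hle : ∀ Y ⊆ U, f Y ≤ ρ * ∑ j ∈ Y, c j := by
    intro Y hY
    rcases Y.eq_empty_or_nonempty with rfl | hne
    · simp [hf0]
    · exact (div_le_iff₀ (hpos Y hne)).1 (hmax Y ⟨hY, hne⟩)
  have hX₀e : f X₀ = ρ * ∑ j ∈ X₀, c j := by
    rw [hρ, div_mul_cancel₀ _ (hpos X₀ hX₀.2).ne']
  obtain ⟨X, hX, hcard⟩ := Finset.exists_max_image
    (U.powerset.filter fun Y => Y.Nonempty ∧ f Y = ρ * ∑ j ∈ Y, c j) Finset.card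
    ⟨X₀, by simp [hX₀, hX₀e]⟩
  simp only [Finset.mem_filter, Finset.mem_powerset] at hX hcard
  refine ⟨X, ρ, hX.1, hX.2.1, hX.2.2, hle, fun Y hY hXY => lt_of_le_of_ne (hle Y hY) fun h => ?_⟩
  exact absurd (hcard Y ⟨hY, hX.2.1.mono hXY.subset, h⟩) (not_le.2 (Finset.card_lt_card hXY))

lemma IsShuffle.symm {S₁ S₂ τ : List E} (h : IsShuffle S₁ S₂ τ) : IsShuffle S₂ S₁ τ :=
  ⟨h.nodup, h.right, h.left, fun j hj => (h.mem j hj).symm⟩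

lemma IsShuffle.append_left {A S₁ S₂ τ : List E} (h : IsShuffle S₁ S₂ τ) (hA : A.Nodup)
    (hd : ∀ j ∈ A, j ∉ τ) : IsShuffle (A ++ S₁) S₂ (A ++ τ) where
  nodup := List.nodup_append.2 ⟨hA, h.nodup, by grind⟩
  left := h.left.append_left A
  right := h.right.trans (List.sublist_append_right _ _)
  mem := by have := h.mem; grind

/-- The values of `f` on subsets of `S₁` and of `S₂` are independent of each other. -/
def Separable (f : Finset E → ℝ) (S₁ S₂ : List E) : Prop :=
  ∀ Y₁ ⊆ S₁.toFinset, ∀ Y₂ ⊆ S₂.toFinset, f (Y₁ ∪ Y₂) = f Y₁ + f Y₂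

lemma Separable.symm {S₁ S₂ : List E} (h : Separable f S₁ S₂) : Separable f S₂ S₁ :=
  fun Y₁ h₁ Y₂ h₂ => by rw [Finset.union_comm, h Y₂ h₂ Y₁ h₁, add_comm]

/-- Optimal sequences for the two parts of a separable problem can be interleaved to give an
optimal sequence for the whole problem. -/
theorem exists_shuffle_area_le (hc : ∀ j, 0 < c j) (n : ℕ) :
    ∀ (f : Finset E → ℝ) (S₁ S₂ : List E), S₁.length + S₂.length = n → Supermodular f → f ∅ = 0 →
      Separable f S₁ S₂ → (S₁ ++ S₂).Nodup → IsAreaMax c f S₁ → IsAreaMax c f S₂ →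
      ∀ σ : List E, σ.Perm (S₁ ++ S₂) →
        ∃ τ, IsShuffle S₁ S₂ τ ∧ area c f ∅ σ ≤ area c f ∅ τ := by
  induction n using Nat.strong_induction_on with
  | _ n ih =>
  -- the case in which a densest set of the whole problem lies in the first sequence
  have main : ∀ (f : Finset E → ℝ) (S₁ S₂ : List E), S₁.length + S₂.length = n → Supermodular f →
      f ∅ = 0 → Separable f S₁ S₂ → (S₁ ++ S₂).Nodup → IsAreaMax c f S₁ → IsAreaMax c f S₂ →
      ∀ (X : Finset E) (ρ : ℝ), X ⊆ S₁.toFinset → X.Nonempty → f X = ρ * ∑ j ∈ X, c j →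
      (∀ Y ⊆ S₁.toFinset, f Y ≤ ρ * ∑ j ∈ Y, c j) →
      (∀ Y ⊆ S₁.toFinset, X ⊂ Y → f Y < ρ * ∑ j ∈ Y, c j) →
      (∀ Y ⊆ S₂.toFinset, f Y ≤ ρ * ∑ j ∈ Y, c j) →
      ∀ σ : List E, σ.Perm (S₁ ++ S₂) →
        ∃ τ, IsShuffle S₁ S₂ τ ∧ area c f ∅ σ ≤ area c f ∅ τ := by
    intro f S₁ S₂ hlen hf hf0 hsep hnd h₁ h₂ X ρ hXS hXne hX hle hlt hle₂ σ hσ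
    obtain ⟨hn₁, hn₂, hd⟩ := List.nodup_append.1 hnd
    have hσn : σ.Nodup := hσ.nodup_iff.2 hnd
    have hσmem : ∀ x, x ∈ σ ↔ x ∈ S₁ ∨ x ∈ S₂ := fun x => by rw [hσ.mem_iff]; simp
    set A := S₁.filter (· ∈ X) with hA
    set R := S₁.filter (· ∉ X) with hR
    -- By the strict exchange argument, an optimal sequence starts with its largest densest set.
    have hS₁ : S₁ = A ++ R := by
      by_contra hne
      have h1 := area_exchange_strict hf hc hn₁ hXS hX hle hlt hne
      have h2 := h₁ _ (List.filter_append_perm (fun x => decide (x ∈ X)) S₁)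
      simp only [decide_not] at h1
      linarith
    have hAX : A.toFinset = X := by
      ext x; simp only [hA, List.toFinset_filter, Finset.mem_filter, List.mem_toFinset]
      have := @hXS x
      simp at this; simp; tauto
    set σA := σ.filter (· ∈ X) with hσA
    set σR := σ.filter (· ∉ X) with hσR
    have hleU : ∀ Y ⊆ σ.toFinset, f Y ≤ ρ * ∑ j ∈ Y, c j := by
      intro Y hY
      have hYe : Y = (Y ∩ S₁.toFinset) ∪ (Y ∩ S₂.toFinset) := by
        ext x
        have := @hY x
        simp only [List.mem_toFinset, hσmem] at this
        simp; tauto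
      have e := hsep (Y ∩ S₁.toFinset) (by grind) (Y ∩ S₂.toFinset) (by grind)
      rw [← hYe] at e
      have e2 : ∑ j ∈ Y, c j = ∑ j ∈ Y ∩ S₁.toFinset, c j + ∑ j ∈ Y ∩ S₂.toFinset, c j := by
        conv_lhs => rw [hYe]
        rw [Finset.sum_union]
        rw [Finset.disjoint_left]
        intro x hx hx'
        simp at hx hx'
        exact hd x hx.2 x hx'.2 rfl
      rw [e, e2, mul_add]
      exact add_le_add (hle _ (by grind)) (hle₂ _ (by grind))
    have hXσ : X ⊆ σ.toFinset := by
      intro x hx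
      have := hXS hx
      simp only [List.mem_toFinset, hσmem] at *; tauto
    -- `X` is densest in the whole problem, so it can be moved to the front of `σ`; the rest is the
    -- problem for the contracted function, to which the induction hypothesis applies.
    have hstep := area_exchange hf hc hσn hXσ hX hleU
    have hσAperm : σA.Perm A := by
      refine (List.perm_ext_iff_of_nodup (hσn.filter _) (hn₁.filter _)).2 fun x => ?_
      have := @hXS x
      simp only [List.mem_toFinset] at this
      simp [hσmem]; tauto
    have hσRperm : σR.Perm (R ++ S₂) := by
      have hndR : (R ++ S₂).Nodup := by
        rw [hS₁, List.append_assoc] at hnd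
        exact (List.nodup_append.1 hnd).2.1
      refine (List.perm_ext_iff_of_nodup (hσn.filter _) hndR).2 fun x => ?_
      have hx : x ∈ S₂ → x ∉ X := fun h h' => by
        have := hXS h'
        simp only [List.mem_toFinset] at this
        exact hd x this x h rfl
      simp only [hR, List.mem_filter, List.mem_append, hσmem, decide_eq_true_eq]
      tauto
    have hAne : A ≠ [] := by
      intro h
      rw [h] at hAX
      exact hXne.ne_empty (by simpa using hAX.symm)
    have hlenA : 0 < A.length := List.length_pos_iff.2 hAne
    have hlenS : S₁.length = A.length + R.length := by
      conv_lhs => rw [hS₁]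
      simp
    have hX2 : ∀ Y ⊆ S₂.toFinset, contract f X Y = f Y := by
      intro Y hY
      rw [contract, hsep X hXS Y hY]; ring
    have hRX : ∀ S : List E, S.Perm R → area c f ∅ (A ++ S) =
        area c f ∅ A + (area c (contract f X) ∅ S + f X * total c R) := by
      intro S hS
      rw [area_append, Finset.empty_union, hAX, area_after X, total_perm hS]
    obtain ⟨τ, hτ, hτle⟩ := ih (R.length + S₂.length) (by omega) (contract f X) R S₂ rfl
      (supermodular_contract hf X) (by simp [contract])
      (by
        intro Y₁ hY₁ Y₂ hY₂
        have hR1 : R.toFinset ⊆ S₁.toFinset := by intro x; simp [hR]; tauto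
        have e1 := hsep (X ∪ Y₁) (Finset.union_subset hXS (hY₁.trans hR1)) Y₂ hY₂
        rw [hX2 Y₂ hY₂, contract, contract, ← Finset.union_assoc, e1]; ring)
      (hσRperm.nodup_iff.1 (hσn.filter _))
      (by
        intro S' hS'
        have h := h₁ (A ++ S') (by
          conv_rhs => rw [hS₁]
          exact hS'.append_left A)
        conv_rhs at h => rw [hS₁]
        rw [hRX S' hS', hRX R (List.Perm.refl _)] at h
        linarith)
      (by
        intro S' hS'
        have e : ∀ S : List E, S.Perm S₂ → area c (contract f X) ∅ S = area c f ∅ S := by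
          intro S hS
          refine area_congr fun Y _ hY => hX2 Y ?_
          rw [Finset.empty_union] at hY
          intro x hx
          have := hY hx
          rw [List.mem_toFinset] at *
          exact hS.mem_iff.1 this
        rw [e S' hS', e S₂ (List.Perm.refl _)]
        exact h₂ S' hS') σR hσRperm
    have hτmem : ∀ x, x ∈ τ → x ∈ R ∨ x ∈ S₂ := hτ.mem
    refine ⟨A ++ τ, ?_, ?_⟩
    · have := hτ.append_left (A := A) (hn₁.filter _) (by
        intro x hx hx'
        have hx1 : x ∈ S₁ := by rw [hS₁]; simp [hx]
        rcases hτmem x hx' with h | h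
        · simp [hA] at hx; simp [hR] at h; tauto
        · exact hd x hx1 x h rfl)
      rwa [← hS₁] at this
    · have hτperm : τ.Perm σR := by
        refine (List.perm_ext_iff_of_nodup hτ.nodup (hσn.filter _)).2 fun x => ?_
        rw [hσRperm.mem_iff]
        constructor
        · intro h; simpa using hτmem x h
        · intro h
          rcases List.mem_append.1 h with h | h
          · exact hτ.left.subset h
          · exact hτ.right.subset h
      -- optimality of `S₁` also compares the order of `X` in `σ` with the order in `S₁`
      have hA2 := h₁ (σA ++ R) (by
        conv_rhs => rw [hS₁]
        exact hσAperm.append_right R)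
      conv_rhs at hA2 => rw [hS₁]
      have hσAX : σA.toFinset = X := by rw [← hAX]; exact List.toFinset_eq_of_perm _ _ hσAperm
      rw [area_append, area_append, hAX, hσAX] at hA2
      rw [area_append, hσAX, area_after (∅ ∪ X)] at hstep
      rw [area_append, hAX, area_after (∅ ∪ X), total_perm hτperm]
      rw [Finset.empty_union] at *
      linarith
  intro f S₁ S₂ hlen hf hf0 hsep hnd h₁ h₂ σ hσ
  have hnd' : (S₂ ++ S₁).Nodup := (List.perm_append_comm.nodup_iff).1 hnd
  have swap : (∃ τ, IsShuffle S₂ S₁ τ ∧ area c f ∅ σ ≤ area c f ∅ τ) →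
      ∃ τ, IsShuffle S₁ S₂ τ ∧ area c f ∅ σ ≤ area c f ∅ τ :=
    fun ⟨τ, h, h'⟩ => ⟨τ, h.symm, h'⟩
  have hempty : ∀ ρ : ℝ, ∀ Y ⊆ ([] : List E).toFinset, f Y ≤ ρ * ∑ j ∈ Y, c j := by
    intro ρ Y hY
    rw [List.toFinset_nil, Finset.subset_empty] at hY
    simp [hY, hf0]
  rcases eq_or_ne S₁ [] with rfl | hne₁
  · rcases eq_or_ne S₂ [] with rfl | hne₂
    · have : σ = [] := by simpa using hσ
      exact ⟨[], ⟨by simp, by simp, by simp, by simp⟩, by simp [this]⟩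
    · obtain ⟨X, ρ, h1, h2, h3, h4, h5⟩ := exists_max_density hc hf0
        (U := S₂.toFinset) (by simpa [List.toFinset_nonempty_iff] using hne₂)
      exact swap (main f S₂ [] (by omega) hf hf0 hsep.symm hnd' h₂ h₁ X ρ h1 h2 h3 h4 h5
        (hempty ρ) σ (hσ.trans List.perm_append_comm))
  · obtain ⟨X, ρ, h1, h2, h3, h4, h5⟩ := exists_max_density hc hf0
      (U := S₁.toFinset) (by simpa [List.toFinset_nonempty_iff] using hne₁)
    rcases eq_or_ne S₂ [] with rfl | hne₂
    · exact main f S₁ [] hlen hf hf0 hsep hnd h₁ h₂ X ρ h1 h2 h3 h4 h5 (hempty ρ) σ hσ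
    · obtain ⟨X', ρ', h1', h2', h3', h4', h5'⟩ := exists_max_density hc hf0
        (U := S₂.toFinset) (by simpa [List.toFinset_nonempty_iff] using hne₂)
      have hnn : ∀ Y : Finset E, 0 ≤ ∑ j ∈ Y, c j := fun Y =>
        Finset.sum_nonneg fun j _ => (hc j).le
      rcases le_total ρ' ρ with hρ | hρ
      · exact main f S₁ S₂ hlen hf hf0 hsep hnd h₁ h₂ X ρ h1 h2 h3 h4 h5
          (fun Y hY => (h4' Y hY).trans (mul_le_mul_of_nonneg_right hρ (hnn Y))) σ hσ
      · exact swap (main f S₂ S₁ (by omega) hf hf0 hsep.symm hnd' h₂ h₁ X' ρ' h1' h2' h3' h4' h5'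
          (fun Y hY => (h4 Y hY).trans (mul_le_mul_of_nonneg_right hρ (hnn Y))) σ
          (hσ.trans List.perm_append_comm))

end Area

/-! ### Merging two chains -/

section Chains

variable {E : Type*} [DecidableEq E] {c w : E → ℝ}

/-- The total weighted completion time of a sequence which starts at time `t`. -/
def costFrom (c w : E → ℝ) (t : ℝ) : List E → ℝ
  | [] => 0
  | j :: σ => w j * (t + c j) + costFrom c w (t + c j) σ

lemma costFrom_congr {c' w' : E → ℝ} {σ : List E} (hc : ∀ j ∈ σ, c j = c' j)
    (hw : ∀ j ∈ σ, w j = w' j) (t : ℝ) : costFrom c w t σ = costFrom c' w' t σ := by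
  induction σ generalizing t with
  | nil => rfl
  | cons j σ ih =>
    simp only [costFrom, hc j List.mem_cons_self, hw j List.mem_cons_self]
    rw [ih (fun i hi => hc i (List.mem_cons_of_mem _ hi))
      (fun i hi => hw i (List.mem_cons_of_mem _ hi))]

lemma cost_eq_costFrom_aux {σ : List E} (hn : σ.Nodup) (t : ℝ) :
    (σ.map fun j => w j * (t + Scheduling.completionTime c σ j)).sum = costFrom c w t σ := by
  induction σ generalizing t with
  | nil => rfl
  | cons j σ ih =>
    have hn' := List.nodup_cons.1 hn
    rw [List.map_cons, List.sum_cons, costFrom, ← ih hn'.2]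
    congr 1
    · simp [Scheduling.completionTime]
    · refine congrArg List.sum (List.map_congr_left fun k hk => ?_)
      have hkj : j ≠ k := fun h => hn'.1 (h ▸ hk)
      simp only [Scheduling.completionTime, List.idxOf_cons_ne _ hkj, List.take_succ_cons,
        List.map_cons, List.sum_cons]
      ring

lemma cost_eq_costFrom {σ : List E} (hn : σ.Nodup) :
    Scheduling.cost c w σ = costFrom c w 0 σ := by
  rw [← cost_eq_costFrom_aux hn 0]; simp [Scheduling.cost]

/-- The weights `w` are the increments of `f` along the sequence, starting from the set `A`. -/
def IsIncrement (w : E → ℝ) (f : Finset E → ℝ) (A : Finset E) (σ : List E) : Prop :=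
  ∀ π j ρ, σ = π ++ j :: ρ → w j = f (insert j (A ∪ π.toFinset)) - f (A ∪ π.toFinset)

/-- Summation by parts: when the weights are the increments of `f`, the total weighted completion
time and the area under `f` add up to a constant. -/
lemma costFrom_add_area {f : Finset E → ℝ} {A : Finset E} {σ : List E} (h : IsIncrement w f A σ)
    (t : ℝ) : costFrom c w t σ + area c f A σ =
      f (A ∪ σ.toFinset) * (t + total c σ) - f A * t := by
  induction σ generalizing A t with
  | nil => simp [costFrom, area]
  | cons j σ ih =>
    have hj := h [] j σ rfl
    have ih' := ih (A := insert j A) (fun π i ρ hσ => by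
      have := h (j :: π) i ρ (by simp [hσ])
      rw [this]; simp) (t + c j)
    simp only [List.toFinset_nil, Finset.union_empty] at hj
    rw [costFrom, area, total_cons, List.toFinset_cons,
      show A ∪ insert j σ.toFinset = insert j A ∪ σ.toFinset by simp, hj]
    linear_combination ih'

/-- The total weight of the longest initial part of a chain that is contained in a given set. -/
def chainWeight (w : E → ℝ) : List E → Finset E → ℝ
  | [], _ => 0
  | j :: S, A => if j ∈ A then w j + chainWeight w S A else 0

lemma chainWeight_nonneg (hw : ∀ j, 0 ≤ w j) (S : List E) (A : Finset E) :
    0 ≤ chainWeight w S A := by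
  induction S with
  | nil => simp [chainWeight]
  | cons j S ih => rw [chainWeight]; split_ifs; exacts [add_nonneg (hw j) ih, le_rfl]

lemma chainWeight_mono (hw : ∀ j, 0 ≤ w j) (S : List E) {A B : Finset E} (h : A ⊆ B) :
    chainWeight w S A ≤ chainWeight w S B := by
  induction S with
  | nil => simp [chainWeight]
  | cons j S ih =>
    rw [chainWeight, chainWeight]
    by_cases hj : j ∈ A
    · simp [hj, h hj, ih]
    · rw [if_neg hj]; split_ifs; exacts [add_nonneg (hw j) (chainWeight_nonneg hw S B), le_rfl]

lemma chainWeight_supermodular (hw : ∀ j, 0 ≤ w j) (S : List E) :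
    Supermodular (chainWeight w S) := by
  intro A B
  induction S with
  | nil => simp [chainWeight]
  | cons j S ih =>
    simp only [chainWeight, Finset.mem_union, Finset.mem_inter]
    have h1 := chainWeight_mono hw S (Finset.subset_union_left (s₁ := A) (s₂ := B))
    have h2 := chainWeight_mono hw S (Finset.subset_union_right (s₁ := A) (s₂ := B))
    by_cases hA : j ∈ A <;> by_cases hB : j ∈ B <;> simp [hA, hB] <;> linarith

lemma chainWeight_congr {S : List E} {A B : Finset E} (h : ∀ j ∈ S, j ∈ A ↔ j ∈ B) :
    chainWeight w S A = chainWeight w S B := by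
  induction S with
  | nil => rfl
  | cons j S ih =>
    rw [chainWeight, chainWeight, ih fun i hi => h i (List.mem_cons_of_mem _ hi)]
    simp [h j List.mem_cons_self]

lemma chainWeight_append {P R : List E} {A : Finset E} (hP : ∀ j ∈ P, j ∈ A) :
    chainWeight w (P ++ R) A = total w P + chainWeight w R A := by
  induction P with
  | nil => simp
  | cons j P ih =>
    rw [List.cons_append, chainWeight, if_pos (hP j List.mem_cons_self), total_cons,
      ih fun i hi => hP i (List.mem_cons_of_mem _ hi), add_assoc]

lemma chainWeight_disjoint {R : List E} {A : Finset E} (h : ∀ j ∈ R, j ∉ A) :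
    chainWeight w R A = 0 := by
  cases R with
  | nil => rfl
  | cons j R => rw [chainWeight, if_neg (h j List.mem_cons_self)]

/-- The chain weight of a set is attained by an initial part of the chain within this set. -/
lemma exists_prefix_chainWeight (S : List E) (A : Finset E) :
    ∃ p, p <+: S ∧ (∀ j ∈ p, j ∈ A) ∧ chainWeight w S A = total w p := by
  induction S with
  | nil => exact ⟨[], by simp, by simp, rfl⟩
  | cons j S ih =>
    obtain ⟨p, h1, h2, h3⟩ := ih
    by_cases hj : j ∈ A
    · refine ⟨j :: p, ?_, ?_, ?_⟩
      · exact List.cons_prefix_cons.2 ⟨rfl, h1⟩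
      · simpa [hj] using h2
      · rw [chainWeight, if_pos hj, h3, total_cons]
    · exact ⟨[], by simp, by simp, by rw [chainWeight, if_neg hj, total_nil]⟩

/-- The weights of the longest initial parts of two chains. -/
def twoChainWeight (w : E → ℝ) (S₁ S₂ : List E) (A : Finset E) : ℝ :=
  chainWeight w S₁ A + chainWeight w S₂ A

lemma twoChainWeight_supermodular (hw : ∀ j, 0 ≤ w j) (S₁ S₂ : List E) :
    Supermodular (twoChainWeight w S₁ S₂) := fun A B => by
  have := chainWeight_supermodular hw S₁ A B
  have := chainWeight_supermodular hw S₂ A B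
  simp only [twoChainWeight]; linarith

lemma twoChainWeight_comm (S₁ S₂ : List E) :
    twoChainWeight w S₁ S₂ = twoChainWeight w S₂ S₁ := by
  funext A; exact add_comm _ _

lemma List.Sublist.filter_eq_of_nodup {S σ : List E} (hn : σ.Nodup) (h : S.Sublist σ) :
    σ.filter (· ∈ S) = S := by
  induction h with
  | slnil => rfl
  | @cons S σ a h ih =>
    have hn' := List.nodup_cons.1 hn
    rw [List.filter_cons_of_neg, ih hn'.2]
    simpa using fun h' => hn'.1 (h.subset h')
  | @cons_cons S σ a h ih =>
    have hn' := List.nodup_cons.1 hn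
    rw [List.filter_cons_of_pos (by simp)]
    congr 1
    conv_rhs => rw [← ih hn'.2]
    refine List.filter_congr fun x hx => ?_
    have : x ≠ a := by rintro rfl; exact hn'.1 hx
    simp [this]

lemma chainWeight_step {S π ρ : List E} {j : E} (hn : (π ++ j :: ρ).Nodup)
    (h : S.Sublist (π ++ j :: ρ)) (hj : j ∈ S) :
    chainWeight w S (insert j π.toFinset) - chainWeight w S π.toFinset = w j := by
  have e := List.Sublist.filter_eq_of_nodup hn h
  rw [List.filter_append, List.filter_cons_of_pos (by simpa using hj)] at e
  obtain ⟨h1, h2, h3⟩ := List.nodup_append.1 hn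
  have h2' := List.nodup_cons.1 h2
  rw [← e, chainWeight_append (by simp; tauto), chainWeight_append (by simp; tauto), chainWeight,
    if_pos (by simp), chainWeight, if_neg, chainWeight_disjoint]
  · ring
  · intro x hx
    simp only [List.mem_filter] at hx
    simp only [Finset.mem_insert, List.mem_toFinset, not_or]
    exact ⟨fun h => h2'.1 (h ▸ hx.1), fun h => h3 x h x (by simp [hx.1]) rfl⟩
  · simpa using fun h => h3 j h j (by simp) rfl

/-- Along an interleaving of two chains, the weights are the increments of `twoChainWeight`. So the
scheduling problem also maximizes an area under a supermodular function. -/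
lemma IsShuffle.isIncrement {S₁ S₂ σ : List E} (h : IsShuffle S₁ S₂ σ)
    (hd : ∀ j ∈ S₁, j ∉ S₂) : IsIncrement w (twoChainWeight w S₁ S₂) ∅ σ := by
  rintro π j ρ rfl
  simp only [Finset.empty_union, twoChainWeight]
  have hcongr : ∀ S : List E, j ∉ S →
      chainWeight w S (insert j π.toFinset) = chainWeight w S π.toFinset := fun S hS =>
    chainWeight_congr fun i hi => by
      have : i ≠ j := by rintro rfl; exact hS hi
      simp [this]
  rcases h.mem j (by simp) with hj | hj
  · have := chainWeight_step (w := w) h.nodup h.left hj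
    rw [hcongr S₂ (hd j hj)]; linarith
  · have := chainWeight_step (w := w) h.nodup h.right hj
    rw [hcongr S₁ fun h' => hd j h' hj]; linarith

lemma IsShuffle.toFinset {S₁ S₂ σ : List E} (h : IsShuffle S₁ S₂ σ) :
    σ.toFinset = S₁.toFinset ∪ S₂.toFinset := by
  ext x
  have h1 := h.left.subset (a := x)
  have h2 := h.right.subset (a := x)
  have h3 := h.mem x
  simp; tauto

lemma IsShuffle.perm {S₁ S₂ σ τ : List E} (h : IsShuffle S₁ S₂ σ) (h' : IsShuffle S₁ S₂ τ) :
    σ.Perm τ :=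
  (List.perm_ext_iff_of_nodup h.nodup h'.nodup).2 fun x => by
    rw [← List.mem_toFinset, h.toFinset, ← h'.toFinset, List.mem_toFinset]

/-- A decomposition of a chain into blocks of constant key `κ`, such that each block is an initial
part of maximum density of the remaining chain, and the key is its density. -/
inductive IsBlocks (c w κ : E → ℝ) : List E → Prop
  | nil : IsBlocks c w κ []
  | append (b R : List E) (k : ℝ) : b ≠ [] → (∀ j ∈ b, κ j = k) → total w b = k * total c b →
      (∀ p, p <+: b ++ R → total w p ≤ k * total c p) → IsBlocks c w κ R → IsBlocks c w κ (b ++ R)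

/-- Merging two sequences by nonincreasing keys. -/
noncomputable def keyMerge (κ : E → ℝ) (S₁ S₂ : List E) : List E :=
  open Classical in S₁.merge S₂ fun a b => decide (κ b ≤ κ a)

variable {κ : E → ℝ}

@[simp] lemma keyMerge_nil_left (S : List E) : keyMerge κ [] S = S := by simp [keyMerge]
@[simp] lemma keyMerge_nil_right (S : List E) : keyMerge κ S [] = S := by simp [keyMerge]

lemma keyMerge_cons_left {a b : E} (h : κ b ≤ κ a) (S₁ S₂ : List E) :
    keyMerge κ (a :: S₁) (b :: S₂) = a :: keyMerge κ S₁ (b :: S₂) := by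
  rw [keyMerge, List.cons_merge_cons, if_pos (by simpa using h)]; rfl

lemma keyMerge_cons_right {a b : E} (h : κ a < κ b) (S₁ S₂ : List E) :
    keyMerge κ (a :: S₁) (b :: S₂) = b :: keyMerge κ (a :: S₁) S₂ := by
  rw [keyMerge, List.cons_merge_cons, if_neg (by simpa using h)]; rfl

lemma keyMerge_perm (S₁ S₂ : List E) : (keyMerge κ S₁ S₂).Perm (S₁ ++ S₂) :=
  List.merge_perm_append _

lemma keyMerge_isShuffle {S₁ S₂ : List E} (hn : (S₁ ++ S₂).Nodup) :
    IsShuffle S₁ S₂ (keyMerge κ S₁ S₂) where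
  nodup := (keyMerge_perm S₁ S₂).nodup_iff.2 hn
  mem j hj := by simpa using (keyMerge_perm S₁ S₂).mem_iff.1 hj
  left := by
    clear hn
    induction S₁ generalizing S₂ with
    | nil => simp
    | cons a S₁ ih₁ =>
      induction S₂ with
      | nil => simp
      | cons b S₂ ih₂ =>
        rcases le_or_gt (κ b) (κ a) with h | h
        · rw [keyMerge_cons_left h]; exact (ih₁).cons_cons a
        · rw [keyMerge_cons_right h]; exact ih₂.cons b
  right := by
    clear hn
    induction S₁ generalizing S₂ with
    | nil => simp
    | cons a S₁ ih₁ =>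
      induction S₂ with
      | nil => simp
      | cons b S₂ ih₂ =>
        rcases le_or_gt (κ b) (κ a) with h | h
        · rw [keyMerge_cons_left h]; exact (ih₁).cons a
        · rw [keyMerge_cons_right h]; exact ih₂.cons_cons b

/-- A block whose keys are not smaller than the first key of the other chain is merged first. -/
lemma keyMerge_append_left {b R S : List E} (h : ∀ x ∈ b, ∀ y ∈ S.head?, κ y ≤ κ x) :
    keyMerge κ (b ++ R) S = b ++ keyMerge κ R S := by
  cases S with
  | nil => simp
  | cons y S =>
    induction b with
    | nil => rfl
    | cons x b ih =>
      rw [List.cons_append, keyMerge_cons_left (h x List.mem_cons_self y rfl),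
        ih fun z hz => h z (List.mem_cons_of_mem _ hz), List.cons_append]

lemma keyMerge_append_right {b R S : List E} (h : ∀ x ∈ b, ∀ y ∈ S.head?, κ y < κ x) :
    keyMerge κ S (b ++ R) = b ++ keyMerge κ S R := by
  cases S with
  | nil => simp
  | cons y S =>
    induction b with
    | nil => rfl
    | cons x b ih =>
      rw [List.cons_append, keyMerge_cons_right (h x List.mem_cons_self y rfl),
        ih fun z hz => h z (List.mem_cons_of_mem _ hz), List.cons_append]

/-- A block of maximum density comes first in some optimal interleaving of two chains. -/
lemma exists_area_le_of_block (hc : ∀ j, 0 < c j) (hw : ∀ j, 0 ≤ w j) {b R S σ : List E} {k : ℝ}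
    (hne : b ≠ []) (hk : total w b = k * total c b)
    (h₁ : ∀ p, p <+: b ++ R → total w p ≤ k * total c p)
    (h₂ : ∀ p, p <+: S → total w p ≤ k * total c p)
    (hn : (b ++ R ++ S).Nodup) (hσ : IsShuffle (b ++ R) S σ) {μ : List E}
    (hμ : IsShuffle R S μ)
    (ih : ∀ τ, IsShuffle R S τ →
      area c (twoChainWeight w R S) ∅ τ ≤ area c (twoChainWeight w R S) ∅ μ) :
    area c (twoChainWeight w (b ++ R) S) ∅ σ ≤
      area c (twoChainWeight w (b ++ R) S) ∅ (b ++ μ) := by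
  set f := twoChainWeight w (b ++ R) S with hf
  obtain ⟨hbR, hSn, hdS⟩ := List.nodup_append.1 hn
  obtain ⟨hbn, hRn, hdR⟩ := List.nodup_append.1 hbR
  -- A set `Y` counts only through initial parts `p`, `q` of the two chains inside `Y`. The
  -- nonnegative key `k` bounds their densities, hence that of `Y`.
  have hk0 : 0 ≤ k := by
    have h1 := total_pos (c := c) (fun j _ => hc j) hne
    have h2 := total_nonneg (c := w) (σ := b) fun j _ => hw j
    rw [hk] at h2
    exact le_of_mul_le_mul_right (by simpa using h2) h1
  have hbσ : b.toFinset ⊆ σ.toFinset := by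
    rw [hσ.toFinset]; intro x hx; simp at hx ⊢; tauto
  have hfb : f b.toFinset = k * ∑ j ∈ b.toFinset, c j := by
    rw [← total_eq_sum hbn, ← hk, hf, twoChainWeight, chainWeight_append (by simp),
      chainWeight_disjoint, chainWeight_disjoint]
    · ring
    · intro j hj hj'
      exact hdS j (by simp at hj'; simp [hj']) j hj rfl
    · intro j hj hj'
      exact hdR j (by simpa using hj') j hj rfl
  have hfle : ∀ Y ⊆ σ.toFinset, f Y ≤ k * ∑ j ∈ Y, c j := by
    intro Y _
    obtain ⟨p, hp, hpY, hpw⟩ := exists_prefix_chainWeight (w := w) (b ++ R) Y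
    obtain ⟨q, hq, hqY, hqw⟩ := exists_prefix_chainWeight (w := w) S Y
    have hpn := hp.sublist.nodup hbR
    have hqn := hq.sublist.nodup hSn
    have hpq : (p ++ q).Nodup := List.nodup_append.2 ⟨hpn, hqn, fun x hx y hy =>
      hdS x (hp.subset hx) y (hq.subset hy)⟩
    have hle : total c (p ++ q) ≤ ∑ j ∈ Y, c j := by
      rw [total_eq_sum hpq]
      refine Finset.sum_le_sum_of_subset_of_nonneg ?_ fun j _ _ => (hc j).le
      intro x hx
      simp at hx
      rcases hx with hx | hx
      exacts [hpY x hx, hqY x hx]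
    rw [total_append] at hle
    have := h₁ p hp
    have := h₂ q hq
    have := mul_le_mul_of_nonneg_left hle hk0
    rw [hf, twoChainWeight, hpw, hqw]; linarith
  have hfilter : σ.filter (· ∈ b.toFinset) = b := by
    have := List.Sublist.filter_eq_of_nodup hσ.nodup
      ((List.sublist_append_left b R).trans hσ.left)
    rw [← this]
    refine List.filter_congr fun x _ => ?_
    simp [this]
  have hτ : IsShuffle R S (σ.filter (· ∉ b.toFinset)) := by
    refine ⟨hσ.nodup.filter _, ?_, ?_, ?_⟩
    · have h := hσ.left.filter (· ∉ b.toFinset)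
      rw [List.filter_append, List.filter_eq_nil_iff.2 (by simp), List.nil_append,
        List.filter_eq_self.2] at h
      · exact h
      · intro x hx
        simpa using fun h => hdR x h x hx rfl
    · have h := hσ.right.filter (· ∉ b.toFinset)
      rw [List.filter_eq_self.2] at h
      · exact h
      · intro x hx
        simpa using fun h => hdS x (by simp [h]) x hx rfl
    · intro j hj
      simp at hj
      have := hσ.mem j hj.1
      simp at this; tauto
  -- The block `b` keeps its order in `σ`, so it is moved to the front as a whole.
  have hex := area_exchange (twoChainWeight_supermodular hw _ _) hc hσ.nodup hbσ hfb hfle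
  rw [hfilter] at hex
  refine hex.trans ?_
  have key : ∀ τ, IsShuffle R S τ → area c f (∅ ∪ b.toFinset) τ =
      area c (twoChainWeight w R S) ∅ τ + f b.toFinset * total c τ := by
    intro τ hτ
    rw [Finset.empty_union, area_after]
    congr 1
    refine area_congr fun Y _ hY => ?_
    rw [contract, hfb, ← total_eq_sum hbn, ← hk, hf, twoChainWeight, twoChainWeight,
      chainWeight_append (by simp +contextual),
      chainWeight_congr (S := R) (A := b.toFinset ∪ Y) (B := Y),
      chainWeight_congr (S := S) (A := b.toFinset ∪ Y) (B := Y)]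
    · ring
    · intro j hj
      have : j ∉ b := fun h => hdS j (by simp [h]) j hj rfl
      simp [this]
    · intro j hj
      have : j ∉ b := fun h => hdR j h j hj rfl
      simp [this]
  rw [area_append, area_append, key _ hτ, key μ hμ, total_perm (hτ.perm hμ)]
  have := ih _ hτ
  linarith

/-- Merging by keys solves the scheduling problem with two chains. -/
theorem area_le_keyMerge (hc : ∀ j, 0 < c j) (hw : ∀ j, 0 ≤ w j) (n : ℕ) :
    ∀ S₁ S₂ : List E, S₁.length + S₂.length = n → (S₁ ++ S₂).Nodup → IsBlocks c w κ S₁ →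
      IsBlocks c w κ S₂ → ∀ σ, IsShuffle S₁ S₂ σ →
      area c (twoChainWeight w S₁ S₂) ∅ σ ≤
        area c (twoChainWeight w S₁ S₂) ∅ (keyMerge κ S₁ S₂) := by
  induction n using Nat.strong_induction_on with
  | _ n ih =>
  intro S₁ S₂ hlen hn h₁ h₂ σ hσ
  have left : ∀ (b R : List E) (k : ℝ), S₁ = b ++ R → b ≠ [] → (∀ j ∈ b, κ j = k) →
      total w b = k * total c b → (∀ p, p <+: b ++ R → total w p ≤ k * total c p) →
      IsBlocks c w κ R → (∀ y ∈ S₂.head?, κ y ≤ k) →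
      (∀ p, p <+: S₂ → total w p ≤ k * total c p) →
      area c (twoChainWeight w S₁ S₂) ∅ σ ≤
        area c (twoChainWeight w S₁ S₂) ∅ (keyMerge κ S₁ S₂) := by
    rintro b R k rfl hne hκ hk hp hR hhead hp₂
    rw [keyMerge_append_left fun x hx y hy => by rw [hκ x hx]; exact hhead y hy]
    have hlb := List.length_pos_iff.2 hne
    have hn' : (R ++ S₂).Nodup := by
      rw [List.append_assoc] at hn; exact (List.nodup_append.1 hn).2.1
    exact exists_area_le_of_block hc hw hne hk hp hp₂ hn hσ (keyMerge_isShuffle hn') fun τ hτ =>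
      ih _ (by simp at hlen; omega) R S₂ rfl hn' hR h₂ τ hτ
  have right : ∀ (b R : List E) (k : ℝ), S₂ = b ++ R → b ≠ [] → (∀ j ∈ b, κ j = k) →
      total w b = k * total c b → (∀ p, p <+: b ++ R → total w p ≤ k * total c p) →
      IsBlocks c w κ R → (∀ y ∈ S₁.head?, κ y < k) →
      (∀ p, p <+: S₁ → total w p ≤ k * total c p) →
      area c (twoChainWeight w S₁ S₂) ∅ σ ≤
        area c (twoChainWeight w S₁ S₂) ∅ (keyMerge κ S₁ S₂) := by
    rintro b R k rfl hne hκ hk hp hR hhead hp₁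
    rw [keyMerge_append_right fun x hx y hy => by rw [hκ x hx]; exact hhead y hy]
    have hlb := List.length_pos_iff.2 hne
    have hn2 : (b ++ R ++ S₁).Nodup := (List.perm_append_comm.nodup_iff).1 hn
    have hn' : (R ++ S₁).Nodup := by
      rw [List.append_assoc] at hn2; exact (List.nodup_append.1 hn2).2.1
    have hn3 : (S₁ ++ R).Nodup := (List.perm_append_comm.nodup_iff).1 hn'
    rw [twoChainWeight_comm]
    refine exists_area_le_of_block hc hw hne hk hp hp₁ hn2 hσ.symm (keyMerge_isShuffle hn3).symm
      fun τ hτ => ?_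
    rw [twoChainWeight_comm]
    exact ih _ (by simp at hlen; omega) S₁ R rfl hn3 h₁ hR τ hτ.symm
  have hhd : ∀ (b R : List E) (k : ℝ), b ≠ [] → (∀ j ∈ b, κ j = k) →
      ∀ y ∈ (b ++ R).head?, κ y = k := by
    intro b R k hne hκ y hy
    cases b with
    | nil => exact absurd rfl hne
    | cons x b => simp at hy; subst hy; exact hκ _ List.mem_cons_self
  have hnn : ∀ S : List E, 0 ≤ total c S := fun S => total_nonneg fun j _ => (hc j).le
  cases h₁ with
  | nil =>
    cases h₂ with
    | nil =>
      have : σ = [] := List.eq_nil_iff_forall_not_mem.2 fun x hx => by simpa using hσ.mem x hx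
      simp [this]
    | append b R k a1 a2 a3 a4 a5 =>
      refine right b R k rfl a1 a2 a3 a4 a5 (by simp) fun p hp => ?_
      rw [List.prefix_nil.1 hp]; simp
  | append b R k a1 a2 a3 a4 a5 =>
    cases h₂ with
    | nil =>
      refine left b R k rfl a1 a2 a3 a4 a5 (by simp) fun p hp => ?_
      rw [List.prefix_nil.1 hp]; simp
    | append b' R' k' b1 b2 b3 b4 b5 =>
      rcases le_or_gt k' k with h | h
      · exact left b R k rfl a1 a2 a3 a4 a5 (fun y hy => (hhd b' R' k' b1 b2 y hy).trans_le h)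
          fun p hp => (b4 p hp).trans (mul_le_mul_of_nonneg_right h (hnn p))
      · exact right b' R' k' rfl b1 b2 b3 b4 b5 (fun y hy => (hhd b R k a1 a2 y hy).trans_lt h)
          fun p hp => (a4 p hp).trans (mul_le_mul_of_nonneg_right h.le (hnn p))

/-- `r` is the maximum density of a nonempty initial part of the chain `S`. -/
def IsMaxDensity (c w : E → ℝ) (S : List E) (r : ℝ) : Prop :=
  (∃ p, p <+: S ∧ p ≠ [] ∧ total w p = r * total c p) ∧
    ∀ p, p <+: S → total w p ≤ r * total c p

/-- Every key is the minimum of the preceding key (at first `k`) and of the maximum density of an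
initial part of the chain from here on. -/
def IsKeysFrom (c w κ : E → ℝ) (k : ℝ) : List E → Prop
  | [] => True
  | j :: S => (∃ r, IsMaxDensity c w (j :: S) r ∧ κ j = min k r) ∧ IsKeysFrom c w κ (κ j) S

/-- The keys of a chain: running minima of the maximum densities. -/
def IsKeys (c w κ : E → ℝ) : List E → Prop
  | [] => True
  | j :: S => IsMaxDensity c w (j :: S) (κ j) ∧ IsKeysFrom c w κ (κ j) S

/-- Keys that start from the bound `k` keep the value `k` on an initial part `U`, all of whose final
parts have at least the density `k`, and after it no initial part is denser than `k`. -/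
lemma IsKeysFrom.exists_split (hc : ∀ j, 0 < c j) {k : ℝ} {S : List E}
    (h : IsKeysFrom c w κ k S) :
    ∃ U V, S = U ++ V ∧ (∀ j ∈ U, κ j = k) ∧ (∀ s, s <:+ U → k * total c s ≤ total w s) ∧
      IsKeys c w κ V ∧ ∀ p, p <+: V → total w p ≤ k * total c p := by
  induction S with
  | nil => exact ⟨[], [], rfl, by simp, by simp, trivial, by simp⟩
  | cons j S ih =>
    obtain ⟨⟨r, hr, hj⟩, h'⟩ := h
    rcases lt_or_ge r k with hrk | hrk
    · rw [min_eq_right hrk.le] at hj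
      refine ⟨[], j :: S, rfl, by simp, by simp, ⟨hj ▸ hr, h'⟩, fun p hp => ?_⟩
      exact (hr.2 p hp).trans (mul_le_mul_of_nonneg_right hrk.le
        (total_nonneg fun i _ => (hc i).le))
    · rw [min_eq_left hrk] at hj
      rw [hj] at h'
      obtain ⟨U, V, rfl, hU, hs, hV, hp⟩ := ih h'
      refine ⟨j :: U, V, rfl, by simpa [hj] using hU, fun s hsU => ?_, hV, hp⟩
      rcases List.suffix_cons_iff.1 hsU with rfl | hsU
      · obtain ⟨q, hq, hqne, hqw⟩ := hr.1
        have hqk : k * total c q ≤ total w q := by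
          rw [hqw]
          exact mul_le_mul_of_nonneg_right hrk (total_nonneg fun i _ => (hc i).le)
        rcases List.prefix_or_prefix_of_prefix hq
          (show j :: U <+: j :: (U ++ V) from ⟨V, rfl⟩) with ⟨t, ht⟩ | ⟨t, ht⟩
        · have : t <:+ U := by
            cases q with
            | nil => exact absurd rfl hqne
            | cons a q =>
              simp only [List.cons_append, List.cons.injEq] at ht
              exact ⟨q, ht.2⟩
          have := hs t this
          rw [← ht, total_append, total_append, mul_add]; linarith
        · have htV : t <+: V := by
            rw [← ht, ← List.cons_append] at hq
            exact (List.prefix_append_right_inj _).1 hq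
          have := hp t htV
          rw [← ht, total_append, total_append, mul_add] at hqk; linarith
      · exact hs s hsU

/-- The keys of a chain decompose it into blocks. -/
lemma IsKeys.isBlocks (hc : ∀ j, 0 < c j) (n : ℕ) :
    ∀ S : List E, S.length = n → IsKeys c w κ S → IsBlocks c w κ S := by
  induction n using Nat.strong_induction_on with
  | _ n ih =>
  intro S hn h
  cases S with
  | nil => exact .nil
  | cons j S =>
    obtain ⟨hj, h'⟩ := h
    obtain ⟨U, V, rfl, hU, hs, hV, hp⟩ := h'.exists_split hc
    refine IsBlocks.append (j :: U) V (κ j) (by simp) (by simpa using hU) ?_ hj.2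
      (ih V.length (by simp at hn; omega) V rfl hV)
    refine le_antisymm (hj.2 _ ⟨V, rfl⟩) ?_
    obtain ⟨q, hq, hqne, hqw⟩ := hj.1
    rcases List.prefix_or_prefix_of_prefix hq
      (show j :: U <+: j :: (U ++ V) from ⟨V, rfl⟩) with ⟨t, ht⟩ | ⟨t, ht⟩
    · have : t <:+ U := by
        cases q with
        | nil => exact absurd rfl hqne
        | cons a q =>
          simp only [List.cons_append, List.cons.injEq] at ht
          exact ⟨q, ht.2⟩
      have := hs t this
      rw [← ht, total_append, total_append, mul_add]; linarith
    · have htV : t <+: V := by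
        rw [← ht, ← List.cons_append] at hq
        exact (List.prefix_append_right_inj _).1 hq
      have := hp t htV
      rw [← ht, total_append, total_append, mul_add] at hqw; linarith

end Chains

/-! ### Connection and separation in trees -/

section Reach

variable {V : Type*}

/-- `u` and `v` are connected by edges of the set `A`. -/
def Rch (A : Set (Sym2 V)) (u v : V) : Prop := (SimpleGraph.fromEdgeSet A).Reachable u v

variable {A B : Set (Sym2 V)} {u v x : V}

lemma Rch.refl (A : Set (Sym2 V)) (u : V) : Rch A u u := SimpleGraph.Reachable.refl u

lemma Rch.symm (h : Rch A u v) : Rch A v u := SimpleGraph.Reachable.symm h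

lemma Rch.trans (h : Rch A u v) (h' : Rch A v x) : Rch A u x := SimpleGraph.Reachable.trans h h'

lemma Rch.mono (hAB : A ⊆ B) (h : Rch A u v) : Rch B u v :=
  SimpleGraph.Reachable.mono (SimpleGraph.fromEdgeSet_mono hAB) h

lemma Rch.of_mem (h : s(u, v) ∈ A) : Rch A u v := by
  rcases eq_or_ne u v with rfl | hne
  · exact Rch.refl A u
  · exact SimpleGraph.Adj.reachable ((SimpleGraph.fromEdgeSet_adj A).2 ⟨h, hne⟩)

lemma Rch.induction {P : V → Prop} (h : Rch A u v) (h0 : P u)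
    (hs : ∀ x y, P x → s(x, y) ∈ A → P y) : P v := by
  obtain ⟨p⟩ := h
  induction p with
  | nil => exact h0
  | cons hadj p ih => exact ih (hs _ _ h0 ((SimpleGraph.fromEdgeSet_adj A).1 hadj).1)

lemma Rch.exists_edge (h : Rch A u v) (hne : u ≠ v) : ∃ e ∈ A, u ∈ e := by
  by_contra hcon
  push Not at hcon
  refine hne (h.induction (P := fun x => u = x) rfl fun x y hx hxy => ?_)
  subst hx
  exact absurd (Sym2.mem_mk_left _ _) (hcon _ hxy)

variable (T : SimpleGraph V)

/-- The edges of `T` other than `e`. -/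
def cut (e : Sym2 V) : Set (Sym2 V) := T.edgeSet \ {e}

/-- The edges of `T` with both ends in `X`. -/
def innerEdges (X : Set V) : Set (Sym2 V) := {e | e ∈ T.edgeSet ∧ ∀ v ∈ e, v ∈ X}

/-- The set `X` of vertices is nonempty and connected in `T`. -/
def Conn (X : Set V) : Prop := X.Nonempty ∧ ∀ u ∈ X, ∀ v ∈ X, Rch (innerEdges T X) u v

/-- The part of `X` on the same side of the edge `e` as the vertex `a`. -/
def side (X : Set V) (e : Sym2 V) (a : V) : Set V := {v ∈ X | Rch (cut T e) a v}

variable {T} {X Y : Set V} {a b : V} {e : Sym2 V}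

lemma cut_eq (e : Sym2 V) : SimpleGraph.fromEdgeSet (cut T e) = T.deleteEdges {e} := by
  ext u v
  simp only [SimpleGraph.fromEdgeSet_adj, cut, Set.mem_sdiff, SimpleGraph.mem_edgeSet,
    Set.mem_singleton_iff, SimpleGraph.deleteEdges_adj]
  exact ⟨fun h => h.1, fun h => ⟨h, h.1.ne⟩⟩

lemma mem_innerEdges : s(a, b) ∈ innerEdges T X ↔ T.Adj a b ∧ a ∈ X ∧ b ∈ X := by simp [innerEdges]

lemma innerEdges_subset : innerEdges T X ⊆ T.edgeSet := fun _ h => h.1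

lemma innerEdges_mono (h : X ⊆ Y) : innerEdges T X ⊆ innerEdges T Y :=
  fun _ he => ⟨he.1, fun v hv => h (he.2 v hv)⟩

lemma subset_cut {A : Set (Sym2 V)} (hA : A ⊆ T.edgeSet) (he : e ∉ A) : A ⊆ cut T e :=
  fun x hx => ⟨hA hx, fun h => he (by rw [Set.mem_singleton_iff] at h; exact h ▸ hx)⟩

lemma not_rch_cut (hT : T.IsAcyclic) (h : s(a, b) ∈ T.edgeSet) : ¬ Rch (cut T s(a, b)) a b := by
  rw [Rch, cut_eq]
  exact SimpleGraph.isBridge_iff.1 (SimpleGraph.isAcyclic_iff_forall_isBridge.1 hT h)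

lemma not_rch_cut_both (hT : T.IsAcyclic) (h : s(a, b) ∈ T.edgeSet) (h1 : Rch (cut T s(a, b)) a v) :
    ¬ Rch (cut T s(a, b)) b v := fun h2 => not_rch_cut hT h (h1.trans h2.symm)

lemma rch_edgeSet (hT : T.Connected) (u v : V) : Rch T.edgeSet u v := by
  rw [Rch, SimpleGraph.fromEdgeSet_edgeSet]; exact hT.preconnected u v

lemma rch_cut_or (hT : T.Connected) (a b v : V) :
    Rch (cut T s(a, b)) a v ∨ Rch (cut T s(a, b)) b v := by
  refine (rch_edgeSet hT a v).induction
    (P := fun v => Rch (cut T s(a, b)) a v ∨ Rch (cut T s(a, b)) b v) (Or.inl (Rch.refl _ _)) ?_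
  intro x y hx hxy
  by_cases h : s(x, y) = s(a, b)
  · rcases Sym2.eq_iff.1 h with ⟨-, rfl⟩ | ⟨-, rfl⟩
    exacts [Or.inr (Rch.refl _ _), Or.inl (Rch.refl _ _)]
  · have hc : Rch (cut T s(a, b)) x y := Rch.of_mem ⟨hxy, h⟩
    exact hx.imp (·.trans hc) (·.trans hc)

lemma not_rch_cut_iff (hT : T.IsTree) (h : s(a, b) ∈ T.edgeSet) :
    ¬ Rch (cut T s(a, b)) a v ↔ Rch (cut T s(a, b)) b v :=
  ⟨fun h' => (rch_cut_or hT.connected a b v).resolve_left h',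
    fun h' h'' => not_rch_cut_both hT.isAcyclic h h'' h'⟩

/-- Two vertices of a tree are connected by a set of edges if it contains all the edges that
separate them. -/
lemma rch_of_cut (hT : T.IsTree) (h : ∀ e ∈ T.edgeSet, e ∉ A → Rch (cut T e) u v) :
    Rch A u v := by
  classical
  obtain ⟨p₀⟩ := hT.connected.preconnected u v
  set p := p₀.toPath
  have hp : ∀ e ∈ (p : T.Walk u v).edges, e ∈ A := by
    intro e he
    by_contra heA
    have heT := (p : T.Walk u v).edges_subset_edgeSet he
    have h' := h e heT heA
    rw [Rch, cut_eq] at h'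
    induction e with | h x y =>
    obtain ⟨q, hq⟩ := SimpleGraph.reachable_deleteEdges_iff_exists_walk.1 h'
    have hpq : p = q.toPath := (hT.isAcyclic.subsingleton_path u v).elim _ _
    rw [hpq] at he
    exact hq (q.edges_toPath_subset_edges he)
  refine ⟨(p : T.Walk u v).transfer _ fun e he => ?_⟩
  have heT := (p : T.Walk u v).edges_subset_edgeSet he
  rw [SimpleGraph.edgeSet_fromEdgeSet]
  exact ⟨hp e he, fun h => T.not_isDiag_of_mem_edgeSet heT h⟩

lemma Conn.rch_cut (hX : Conn T X) (he : e ∉ innerEdges T X) (hu : u ∈ X) (hv : v ∈ X) :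
    Rch (cut T e) u v := (hX.2 u hu v hv).mono (subset_cut innerEdges_subset he)

lemma side_subset : side T X e a ⊆ X := fun _ h => h.1

/-- Deleting an edge of a connected set of vertices leaves two connected sets of vertices. -/
lemma Conn.conn_side (hT : T.IsAcyclic) (hX : Conn T X) (h : s(a, b) ∈ innerEdges T X) :
    Conn T (side T X s(a, b) a) ∧ Conn T (side T X s(a, b) b) := by
  obtain ⟨hab, ha, hb⟩ := mem_innerEdges.1 h
  have key : ∀ v ∈ X,
      (v ∈ side T X s(a, b) a ∧ Rch (innerEdges T (side T X s(a, b) a)) a v) ∨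
      (v ∈ side T X s(a, b) b ∧ Rch (innerEdges T (side T X s(a, b) b)) b v) := by
    intro v hv
    refine (hX.2 a ha v hv).induction (P := fun v =>
      (v ∈ side T X s(a, b) a ∧ Rch (innerEdges T (side T X s(a, b) a)) a v) ∨
      (v ∈ side T X s(a, b) b ∧ Rch (innerEdges T (side T X s(a, b) b)) b v))
      (Or.inl ⟨⟨ha, Rch.refl _ _⟩, Rch.refl _ _⟩) ?_
    intro x y hx hxy
    obtain ⟨hadj, hxX, hyX⟩ := mem_innerEdges.1 hxy
    by_cases h : s(x, y) = s(a, b)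
    · rcases Sym2.eq_iff.1 h with ⟨-, rfl⟩ | ⟨-, rfl⟩
      · exact Or.inr ⟨⟨hb, Rch.refl _ _⟩, Rch.refl _ _⟩
      · exact Or.inl ⟨⟨ha, Rch.refl _ _⟩, Rch.refl _ _⟩
    · have hc : Rch (cut T s(a, b)) x y := Rch.of_mem ⟨hadj, h⟩
      refine hx.imp ?_ ?_
      · rintro ⟨h1, h2⟩
        have hy : y ∈ side T X s(a, b) a := ⟨hyX, h1.2.trans hc⟩
        exact ⟨hy, h2.trans (Rch.of_mem (mem_innerEdges.2 ⟨hadj, h1, hy⟩))⟩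
      · rintro ⟨h1, h2⟩
        have hy : y ∈ side T X s(a, b) b := ⟨hyX, h1.2.trans hc⟩
        exact ⟨hy, h2.trans (Rch.of_mem (mem_innerEdges.2 ⟨hadj, h1, hy⟩))⟩
  constructor
  · refine ⟨⟨a, ha, Rch.refl _ _⟩, fun u hu v hv => ?_⟩
    have hr : ∀ v ∈ side T X s(a, b) a, Rch (innerEdges T (side T X s(a, b) a)) a v := by
      intro v hv
      rcases key v hv.1 with h' | h'
      · exact h'.2
      · exact absurd h'.1.2 (not_rch_cut_both hT h.1 hv.2)
    exact (hr u hu).symm.trans (hr v hv)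
  · refine ⟨⟨b, hb, Rch.refl _ _⟩, fun u hu v hv => ?_⟩
    have hr : ∀ v ∈ side T X s(a, b) b, Rch (innerEdges T (side T X s(a, b) b)) b v := by
      intro v hv
      rcases key v hv.1 with h' | h'
      · exact absurd hv.2 (not_rch_cut_both hT h.1 h'.1.2)
      · exact h'.2
    exact (hr u hu).symm.trans (hr v hv)

lemma disjoint_side (hT : T.IsAcyclic) (h : s(a, b) ∈ T.edgeSet) :
    Disjoint (side T X s(a, b) a) (side T X s(a, b) b) :=
  Set.disjoint_left.2 fun _ h1 h2 => not_rch_cut_both hT h h1.2 h2.2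

lemma side_union (hT : T.Connected) : side T X s(a, b) a ∪ side T X s(a, b) b = X := by
  ext v
  constructor
  · rintro (h | h) <;> exact h.1
  · exact fun hv => (rch_cut_or hT a b v).imp (fun h => ⟨hv, h⟩) fun h => ⟨hv, h⟩

lemma inner_side_union (hT : T.IsTree) (h : s(a, b) ∈ innerEdges T X) :
    innerEdges T (side T X s(a, b) a) ∪ innerEdges T (side T X s(a, b) b) =
      innerEdges T X \ {s(a, b)} := by
  ext e
  induction e with | h x y =>
  have ha : s(a, b) ∉ innerEdges T (side T X s(a, b) a) := fun h' =>
    not_rch_cut hT.isAcyclic h.1 (mem_innerEdges.1 h').2.2.2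
  have hb : s(a, b) ∉ innerEdges T (side T X s(a, b) b) := fun h' =>
    not_rch_cut hT.isAcyclic h.1 (mem_innerEdges.1 h').2.1.2.symm
  constructor
  · rintro (h' | h')
    · exact ⟨innerEdges_mono side_subset h', fun he => ha (by
        rw [Set.mem_singleton_iff] at he; rwa [he] at h')⟩
    · exact ⟨innerEdges_mono side_subset h', fun he => hb (by
        rw [Set.mem_singleton_iff] at he; rwa [he] at h')⟩
  · rintro ⟨h', hne⟩
    obtain ⟨hadj, hx, hy⟩ := mem_innerEdges.1 h'
    have hc : Rch (cut T s(a, b)) x y := Rch.of_mem ⟨hadj, hne⟩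
    refine (rch_cut_or hT.connected a b x).imp ?_ ?_
    · exact fun h1 => mem_innerEdges.2 ⟨hadj, ⟨hx, h1⟩, ⟨hy, h1.trans hc⟩⟩
    · exact fun h1 => mem_innerEdges.2 ⟨hadj, ⟨hx, h1⟩, ⟨hy, h1.trans hc⟩⟩

/-- A connected set remains connected when a neighbour of one of its vertices is added. -/
lemma Conn.insert_adj (hX : Conn T X) (ha : a ∈ X) (hab : T.Adj a b) : Conn T (insert b X) := by
  have h1 : ∀ v ∈ insert b X, Rch (innerEdges T (insert b X)) a v := by
    rintro v (rfl | hv)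
    · exact Rch.of_mem (mem_innerEdges.2 ⟨hab, by simp [ha], by simp⟩)
    · exact (hX.2 a ha v hv).mono (innerEdges_mono (Set.subset_insert _ _))
  exact ⟨⟨a, by simp [ha]⟩, fun u hu v hv => (h1 u hu).symm.trans (h1 v hv)⟩

lemma conn_singleton (v : V) : Conn T {v} :=
  ⟨⟨v, rfl⟩, fun a ha b hb => by
    rw [Set.mem_singleton_iff] at ha hb; subst ha; subst hb; exact Rch.refl _ _⟩

lemma conn_univ (hT : T.Connected) : Conn T Set.univ := by
  obtain ⟨v⟩ := hT.nonempty
  refine ⟨⟨v, trivial⟩, fun a _ b _ => (rch_edgeSet hT a b).mono fun e he => ⟨he, by simp⟩⟩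

lemma Conn.exists_adj (hX : Conn T X) (hu : u ∈ X) (hv : v ∈ X) (hne : u ≠ v) :
    ∃ w ∈ X, T.Adj u w := by
  obtain ⟨e, he, hue⟩ := (hX.2 u hu v hv).exists_edge hne
  obtain ⟨w, rfl⟩ := hue
  exact ⟨w, (mem_innerEdges.1 he).2.2, (mem_innerEdges.1 he).1⟩

end Reach

/-! ### Subtrees and connected sets of vertices -/

section Subtree

variable {V : Type*} {T : SimpleGraph V}

lemma SimpleGraph.Subgraph.rch_of_reachable {H : T.Subgraph} {u v : H.verts}
    (h : H.coe.Reachable u v) : Rch H.edgeSet u v :=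
  h.map (G' := SimpleGraph.fromEdgeSet H.edgeSet)
    ⟨Subtype.val, fun {a b} hab => by
      have : H.Adj a b := hab
      rw [SimpleGraph.fromEdgeSet_adj]
      exact ⟨this, this.ne⟩⟩

lemma edgeSet_subset_inner (H : T.Subgraph) : H.edgeSet ⊆ innerEdges T H.verts := fun _ he =>
  ⟨H.edgeSet_subset he, fun _ hv => H.mem_verts_of_mem_edge he hv⟩

lemma conn_of_isTree (H : T.Subgraph) (h : H.coe.Connected) : Conn T H.verts := by
  obtain ⟨v⟩ := h.nonempty
  refine ⟨⟨v, v.2⟩, fun a ha b hb => ?_⟩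
  exact (H.rch_of_reachable (h.preconnected ⟨a, ha⟩ ⟨b, hb⟩)).mono (edgeSet_subset_inner H)

lemma edgeSet_eq_inner (hT : T.IsAcyclic) (H : T.Subgraph) (h : H.coe.Connected) :
    H.edgeSet = innerEdges T H.verts := by
  refine (edgeSet_subset_inner H).antisymm fun e he => ?_
  by_contra hne
  induction e with | h a b =>
  obtain ⟨hab, ha, hb⟩ := mem_innerEdges.1 he
  exact not_rch_cut hT hab ((H.rch_of_reachable (h.preconnected ⟨a, ha⟩ ⟨b, hb⟩)).mono
    (subset_cut H.edgeSet_subset hne))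

/-- The subgraph of `T` induced by a set of vertices. -/
def indSub (T : SimpleGraph V) (X : Set V) : T.Subgraph := (⊤ : T.Subgraph).induce X

@[simp] lemma indSub_verts (X : Set V) : (indSub T X).verts = X := rfl

@[simp] lemma indSub_edgeSet (X : Set V) : (indSub T X).edgeSet = innerEdges T X := by
  ext e
  induction e with | h a b =>
  rw [SimpleGraph.Subgraph.mem_edgeSet, mem_innerEdges]
  simp [indSub]; tauto

lemma subgraph_eq_of_edgeSet {H K : T.Subgraph} (h : H.verts = K.verts)
    (h' : H.edgeSet = K.edgeSet) : H = K := by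
  refine SimpleGraph.Subgraph.ext h ?_
  funext a b
  exact propext (show H.Adj a b ↔ K.Adj a b by
    rw [← SimpleGraph.Subgraph.mem_edgeSet, h', SimpleGraph.Subgraph.mem_edgeSet])

lemma eq_indSub (hT : T.IsAcyclic) (H : T.Subgraph) (h : H.coe.Connected) :
    H = indSub T H.verts :=
  subgraph_eq_of_edgeSet rfl (by rw [edgeSet_eq_inner hT H h, indSub_edgeSet])

lemma indSub_isTree (hT : T.IsAcyclic) {X : Set V} (h : Conn T X) : (indSub T X).coe.IsTree := by
  refine ⟨?_, hT.subgraph _⟩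
  obtain ⟨⟨v, hv⟩, h⟩ := h
  have : Nonempty (indSub T X).verts := ⟨⟨v, hv⟩⟩
  refine ⟨?_⟩
  rintro ⟨a, ha⟩ ⟨b, hb⟩
  have := (h a ha b hb).induction
    (P := fun x => ∃ hx : x ∈ X, (indSub T X).coe.Reachable ⟨a, ha⟩ ⟨x, hx⟩)
    ⟨ha, SimpleGraph.Reachable.refl _⟩ (by
      rintro x y ⟨hx, hr⟩ hxy
      have hy := (mem_innerEdges.1 hxy).2.2
      refine ⟨hy, hr.trans (SimpleGraph.Adj.reachable ?_)⟩
      rw [SimpleGraph.Subgraph.coe_adj, ← SimpleGraph.Subgraph.mem_edgeSet, indSub_edgeSet]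
      exact hxy)
  exact this.2

end Subtree

/-! ### The weight connected by a set of edges -/

namespace Network

variable {V : Type*} [Fintype V] [DecidableEq V] (N : Network V)

/-- The set `A` contains all the edges of the network that separate the vertices of the pair `q`.
In a tree, this means that `A` connects the pair. -/
def Linked (A : Finset (Sym2 V)) (q : Sym2 V) : Prop :=
  ∀ e ∈ N.graph.edgeSet, ¬ (∀ u ∈ q, ∀ v ∈ q, Rch (cut N.graph e) u v) → e ∈ A

/-- The total weight of the pairs that are connected by the set `A` of edges. -/
noncomputable def conWeight (A : Finset (Sym2 V)) : ℝ :=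
  open Classical in ∑ q, if N.Linked A q then N.wt q else 0

/-- The lengths of the edges, made positive outside the network. -/
noncomputable def posLen (e : Sym2 V) : ℝ :=
  open Classical in if e ∈ N.graph.edgeSet then N.len e else 1

variable {N}

lemma posLen_pos (e : Sym2 V) : 0 < N.posLen e := by
  rw [posLen]; split_ifs with h; exacts [N.len_pos e h, one_pos]

lemma posLen_eq {e : Sym2 V} (he : e ∈ N.graph.edgeSet) : N.posLen e = N.len e := if_pos he

lemma total_posLen {S : List (Sym2 V)} (hS : ∀ e ∈ S, e ∈ N.graph.edgeSet) :
    total N.posLen S = (S.map N.len).sum :=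
  congrArg List.sum (List.map_congr_left fun e he => posLen_eq (hS e he))

lemma Linked.mono {A B : Finset (Sym2 V)} {q : Sym2 V} (h : N.Linked A q) (hAB : A ⊆ B) :
    N.Linked B q := fun e he hq => hAB (h e he hq)

lemma linked_iff (hT : N.graph.IsTree) {A : Finset (Sym2 V)} (hA : ↑A ⊆ N.graph.edgeSet)
    {q : Sym2 V} : N.Linked A q ↔ ∀ u ∈ q, ∀ v ∈ q, Rch (A : Set (Sym2 V)) u v := by
  constructor
  · intro h u hu v hv
    refine rch_of_cut hT fun e he heA => ?_
    by_contra hcon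
    exact heA (h e he fun h' => hcon (h' u hu v hv))
  · intro h e he hq
    by_contra heA
    exact hq fun u hu v hv => (h u hu v hv).mono (subset_cut hA heA)

lemma linked_mk_iff (hT : N.graph.IsTree) {A : Finset (Sym2 V)} (hA : ↑A ⊆ N.graph.edgeSet)
    {u v : V} : N.Linked A s(u, v) ↔ Rch (A : Set (Sym2 V)) u v := by
  rw [linked_iff hT hA]
  constructor
  · exact fun h => h u (by simp) v (by simp)
  · intro h x hx y hy
    rcases Sym2.mem_iff.1 hx with rfl | rfl <;> rcases Sym2.mem_iff.1 hy with rfl | rfl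
    exacts [Rch.refl _ _, h, h.symm, Rch.refl _ _]

lemma connectedBy_iff (hT : N.graph.IsTree) {S : List (Sym2 V)}
    (hS : ∀ e ∈ S, e ∈ N.graph.edgeSet) {q : Sym2 V} :
    ConnectedBy S q ↔ N.Linked S.toFinset q := by
  rw [linked_iff hT (by simpa [Set.subset_def] using hS), List.coe_toFinset]; rfl

lemma conWeight_supermodular : Supermodular N.conWeight := by
  classical
  intro A B
  rw [conWeight, conWeight, conWeight, conWeight, ← Finset.sum_add_distrib,
    ← Finset.sum_add_distrib]
  refine Finset.sum_le_sum fun q _ => ?_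
  have hw := N.wt_nonneg q
  have hAB : N.Linked (A ∩ B) q ↔ N.Linked A q ∧ N.Linked B q := by
    simp only [Linked, Finset.mem_inter]
    exact ⟨fun h => ⟨fun e he hq => (h e he hq).1, fun e he hq => (h e he hq).2⟩,
      fun h e he hq => ⟨h.1 e he hq, h.2 e he hq⟩⟩
  have h1 : N.Linked A q → N.Linked (A ∪ B) q := fun h => h.mono Finset.subset_union_left
  have h2 : N.Linked B q → N.Linked (A ∪ B) q := fun h => h.mono Finset.subset_union_right
  by_cases hA : N.Linked A q <;> by_cases hB : N.Linked B q
  · simp [hAB, hA, hB, h1 hA]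
  · simp [hAB, hA, hB, h1 hA]
  · simp [hAB, hA, hB, h2 hB]
  · simp only [hAB, hA, hB, if_false, false_and, add_zero]
    split_ifs <;> linarith

/-- A pair of positive weight that is connected by edges has both its vertices on such edges. -/
lemma exists_edge_of_linked (hT : N.graph.IsTree) {A : Finset (Sym2 V)}
    (hA : ↑A ⊆ N.graph.edgeSet) {q : Sym2 V} (hq : N.Linked A q) (hw : N.wt q ≠ 0) :
    ∀ v ∈ q, ∃ e ∈ A, v ∈ e := by
  induction q with | h a b =>
  have hab : a ≠ b := by rintro rfl; exact hw (N.wt_diag a)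
  rw [linked_mk_iff hT hA] at hq
  intro v hv
  rcases Sym2.mem_iff.1 hv with rfl | rfl
  exacts [hq.exists_edge hab, hq.symm.exists_edge hab.symm]

lemma conWeight_empty (hT : N.graph.IsTree) : N.conWeight ∅ = 0 := by
  classical
  refine Finset.sum_eq_zero fun q _ => ?_
  split_ifs with h
  · by_contra hw
    obtain ⟨e, he, -⟩ := exists_edge_of_linked hT (by simp) h hw q.out.1 (Sym2.out_fst_mem q)
    simp at he
  · rfl

/-- Connected sets of edges on disjoint sets of vertices do not interact. -/
lemma conWeight_union (hT : N.graph.IsTree) {H₁ H₂ : N.graph.Subgraph}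
    (hd : Disjoint H₁.verts H₂.verts) {Y₁ Y₂ : Finset (Sym2 V)} (h₁ : ↑Y₁ ⊆ H₁.edgeSet)
    (h₂ : ↑Y₂ ⊆ H₂.edgeSet) : N.conWeight (Y₁ ∪ Y₂) = N.conWeight Y₁ + N.conWeight Y₂ := by
  classical
  have h₁T := h₁.trans H₁.edgeSet_subset
  have h₂T := h₂.trans H₂.edgeSet_subset
  have h₁₂T : ((Y₁ ∪ Y₂ : Finset (Sym2 V)) : Set (Sym2 V)) ⊆ N.graph.edgeSet := by
    rw [Finset.coe_union]; exact Set.union_subset h₁T h₂T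
  have aux : ∀ (K₁ K₂ : N.graph.Subgraph) (Z₁ Z₂ : Finset (Sym2 V)), Disjoint K₁.verts K₂.verts →
      ↑Z₁ ⊆ K₁.edgeSet → ↑Z₂ ⊆ K₂.edgeSet → ∀ u v, u ∈ K₁.verts →
      Rch ((Z₁ ∪ Z₂ : Finset (Sym2 V)) : Set (Sym2 V)) u v → Rch (Z₁ : Set (Sym2 V)) u v := by
    intro K₁ K₂ Z₁ Z₂ hd h₁ h₂ u v hu h
    refine (h.induction (P := fun x => x ∈ K₁.verts ∧ Rch (Z₁ : Set (Sym2 V)) u x)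
      ⟨hu, Rch.refl _ _⟩ ?_).2
    rintro x y ⟨hx, hr⟩ hxy
    rw [Finset.coe_union] at hxy
    rcases hxy with hxy | hxy
    · exact ⟨K₁.mem_verts_of_mem_edge (h₁ hxy) (Sym2.mem_mk_right x y), hr.trans (Rch.of_mem hxy)⟩
    · exact absurd (K₂.mem_verts_of_mem_edge (h₂ hxy) (Sym2.mem_mk_left x y))
        (Set.disjoint_left.1 hd hx)
  rw [conWeight, conWeight, conWeight, ← Finset.sum_add_distrib]
  refine Finset.sum_congr rfl fun q _ => ?_
  by_cases hw : N.wt q = 0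
  · simp [hw]
  induction q with | h u v =>
  have hnot : ¬ (N.Linked Y₁ s(u, v) ∧ N.Linked Y₂ s(u, v)) := by
    rintro ⟨ha, hb⟩
    obtain ⟨e, he, hue⟩ := exists_edge_of_linked hT h₁T ha hw u (by simp)
    obtain ⟨f, hf, huf⟩ := exists_edge_of_linked hT h₂T hb hw u (by simp)
    exact Set.disjoint_left.1 hd (H₁.mem_verts_of_mem_edge (h₁ he) hue)
      (H₂.mem_verts_of_mem_edge (h₂ hf) huf)
  have hor : N.Linked (Y₁ ∪ Y₂) s(u, v) ↔ N.Linked Y₁ s(u, v) ∨ N.Linked Y₂ s(u, v) := by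
    constructor
    · intro h
      obtain ⟨e, he, hue⟩ := exists_edge_of_linked hT h₁₂T h hw u (by simp)
      rw [linked_mk_iff hT h₁₂T] at h
      rw [linked_mk_iff hT h₁T, linked_mk_iff hT h₂T]
      rcases Finset.mem_union.1 he with he | he
      · exact Or.inl (aux H₁ H₂ Y₁ Y₂ hd h₁ h₂ u v (H₁.mem_verts_of_mem_edge (h₁ he) hue) h)
      · rw [Finset.union_comm] at h
        exact Or.inr (aux H₂ H₁ Y₂ Y₁ hd.symm h₂ h₁ u v (H₂.mem_verts_of_mem_edge (h₂ he) hue) h)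
    · rintro (h | h)
      exacts [h.mono Finset.subset_union_left, h.mono Finset.subset_union_right]
  by_cases ha : N.Linked Y₁ s(u, v) <;> by_cases hb : N.Linked Y₂ s(u, v)
  · exact absurd ⟨ha, hb⟩ hnot
  · simp [hor, ha, hb]
  · simp [hor, ha, hb]
  · simp [hor, ha, hb]

/-! ### Sequences of a subtree, their gains and their objective values -/

/-- The sequence `S` lists the edges of `H`. -/
def Lists (H : N.graph.Subgraph) (S : List (Sym2 V)) : Prop :=
  S.Nodup ∧ ∀ e, e ∈ S ↔ e ∈ H.edgeSet

lemma isSSequence_iff (hT : N.graph.IsTree) {H : N.graph.Subgraph} (hH : N.IsSubtree H)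
    {S : List (Sym2 V)} : N.IsSSequence H S ↔ Lists H S := by
  constructor
  · rintro ⟨hS, F, -, hv, hF, hFS⟩
    refine ⟨hS, fun e => ?_⟩
    rw [edgeSet_eq_inner hT.isAcyclic H hH.connected, ← hv,
      ← edgeSet_eq_inner hT.isAcyclic F hF.connected, hFS]
    rfl
  · rintro ⟨hS, h⟩
    exact ⟨hS, H, le_rfl, rfl, hH, by ext e; exact (h e).symm⟩

lemma Lists.mem_edgeSet {H : N.graph.Subgraph} {S : List (Sym2 V)} (h : Lists H S) :
    ∀ e ∈ S, e ∈ N.graph.edgeSet := fun e he => H.edgeSet_subset ((h.2 e).1 he)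

lemma Lists.perm {H : N.graph.Subgraph} {S S' : List (Sym2 V)} (h : Lists H S)
    (h' : Lists H S') : S.Perm S' :=
  (List.perm_ext_iff_of_nodup h.1 h'.1).2 fun e => (h.2 e).trans (h'.2 e).symm

lemma mem_relevantPairs_of_linked (hT : N.graph.IsTree) {H : N.graph.Subgraph}
    {A : Finset (Sym2 V)} (hA : ↑A ⊆ H.edgeSet) {q : Sym2 V} (hq : N.Linked A q)
    (hw : N.wt q ≠ 0) : q ∈ N.relevantPairs H := by
  simp only [relevantPairs, Finset.mem_filter, Finset.mem_univ, true_and]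
  refine ⟨lt_of_le_of_ne (N.wt_nonneg q) hw.symm, fun v hv => ?_⟩
  obtain ⟨e, he, hve⟩ := exists_edge_of_linked hT (hA.trans H.edgeSet_subset) hq hw v hv
  exact H.mem_verts_of_mem_edge (hA he) hve

lemma linked_of_mem_relevantPairs (hT : N.graph.IsTree) {H : N.graph.Subgraph}
    (hH : N.IsSubtree H) {S : List (Sym2 V)} (hS : Lists H S) {q : Sym2 V}
    (hq : q ∈ N.relevantPairs H) : N.Linked S.toFinset q := by
  simp only [relevantPairs, Finset.mem_filter, Finset.mem_univ, true_and] at hq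
  have e : ((S.toFinset : Finset (Sym2 V)) : Set (Sym2 V)) = H.edgeSet := by
    ext e; simp [hS.2]
  rw [linked_iff hT (by rw [e]; exact H.edgeSet_subset), e]
  intro u hu v hv
  rw [edgeSet_eq_inner hT.isAcyclic H hH.connected]
  exact (conn_of_isTree H hH.connected).2 u (hq.2 u hu) v (hq.2 v hv)

lemma sum_relevantPairs (hT : N.graph.IsTree) {H : N.graph.Subgraph} {A : Finset (Sym2 V)}
    (hA : ↑A ⊆ H.edgeSet) : open Classical in
    ∑ q ∈ N.relevantPairs H, (if N.Linked A q then N.wt q else 0) = N.conWeight A := by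
  classical
  refine Finset.sum_subset (Finset.subset_univ _) fun q _ hq => ?_
  split_ifs with h
  · by_contra hw
    exact hq (mem_relevantPairs_of_linked hT hA h hw)
  · rfl

/-- The gain of an edge is the increment of the connected weight. -/
lemma gain_eq (hT : N.graph.IsTree) {H : N.graph.Subgraph} {S : List (Sym2 V)}
    (hS : ∀ e ∈ S, e ∈ H.edgeSet) (e : Sym2 V) :
    N.gain H S e = N.conWeight (S.take (S.idxOf e + 1)).toFinset
      - N.conWeight (S.take (S.idxOf e)).toFinset := by
  classical
  have hsub : ∀ k, (((S.take k).toFinset : Finset (Sym2 V)) : Set (Sym2 V)) ⊆ H.edgeSet := by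
    intro k x hx
    simp only [List.coe_toFinset, Set.mem_ofPred_eq] at hx
    exact hS x (List.mem_of_mem_take hx)
  have hcon : ∀ k q, ConnectedBy (S.take k) q ↔ N.Linked (S.take k).toFinset q := fun k q =>
    connectedBy_iff hT fun x hx => H.edgeSet_subset (hS x (List.mem_of_mem_take hx))
  rw [gain, ← sum_relevantPairs hT (hsub _), ← sum_relevantPairs hT (hsub _),
    ← Finset.sum_sub_distrib, Finset.sum_filter]
  refine Finset.sum_congr rfl fun q _ => ?_
  rw [hcon, hcon]
  have hmono : N.Linked (S.take (S.idxOf e)).toFinset q →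
      N.Linked (S.take (S.idxOf e + 1)).toFinset q := fun h => h.mono fun x hx => by
    rw [List.mem_toFinset] at *
    exact (List.take_subset_take_left S (Nat.le_succ _)) hx
  by_cases h1 : N.Linked (S.take (S.idxOf e)).toFinset q
  · simp [h1, hmono h1]
  · by_cases h2 : N.Linked (S.take (S.idxOf e + 1)).toFinset q <;> simp [h1, h2]

end Network

/-- The time until a monotone property of the set of processed elements holds is the total time
minus the time during which it holds. -/
lemma total_take_sInf {E : Type*} [DecidableEq E] (c : E → ℝ) (p : Finset E → Prop)
    [DecidablePred p] (hp : ∀ A B, A ⊆ B → p A → p B) (S : List E) (A : Finset E)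
    (hS : p (A ∪ S.toFinset)) :
    total c (S.take (sInf {k | p (A ∪ (S.take k).toFinset)})) =
      total c S - area c (fun B => if p B then 1 else 0) A S := by
  induction S generalizing A with
  | nil => simp [area]
  | cons j S ih =>
    by_cases hA : p A
    · have h0 : sInf {k | p (A ∪ ((j :: S).take k).toFinset)} = 0 :=
        Nat.sInf_eq_zero.2 (Or.inl (by simpa using hA))
      have hall : ∀ (S : List E) (B : Finset E), p B →
          area c (fun B => if p B then 1 else 0) B S = total c S := by
        intro S
        induction S with
        | nil => simp [area]
        | cons i S ih =>
          intro B hB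
          rw [area, ih _ (hp _ _ (Finset.subset_insert _ _) hB), if_pos hB, total_cons, mul_one]
      rw [h0, hall _ _ hA]; simp
    · have hset : ∀ k, p (A ∪ ((j :: S).take (k + 1)).toFinset) ↔
          p (insert j A ∪ (S.take k).toFinset) := by
        intro k; simp
      have hS' : p (insert j A ∪ S.toFinset) := by simpa using hS
      have hne : {k | p (insert j A ∪ (S.take k).toFinset)}.Nonempty :=
        ⟨S.length, by simpa using hS'⟩
      have h1 : sInf {k | p (A ∪ ((j :: S).take k).toFinset)} =
          sInf {k | p (insert j A ∪ (S.take k).toFinset)} + 1 := by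
        refine le_antisymm (Nat.sInf_le ((hset _).2 (Nat.sInf_mem hne))) ?_
        have hmem := Nat.sInf_mem (s := {k | p (A ∪ ((j :: S).take k).toFinset)})
          ⟨_, (hset _).2 (Nat.sInf_mem hne)⟩
        rcases h : sInf {k | p (A ∪ ((j :: S).take k).toFinset)} with _ | k
        · rw [h] at hmem
          exact absurd (by simpa using hmem) hA
        · rw [h] at hmem
          exact Nat.succ_le_succ (Nat.sInf_le ((hset k).1 hmem))
      rw [h1, List.take_succ_cons, total_cons, ih _ hS', area, if_neg hA, total_cons]
      ring

lemma area_sum {E ι : Type*} [DecidableEq E] (c : E → ℝ) (s : Finset ι) (a : ι → ℝ)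
    (g : ι → Finset E → ℝ) (A : Finset E) (S : List E) :
    area c (fun B => ∑ i ∈ s, a i * g i B) A S = ∑ i ∈ s, a i * area c (g i) A S := by
  induction S generalizing A with
  | nil => simp [area]
  | cons j S ih =>
    rw [area, ih, Finset.mul_sum, ← Finset.sum_add_distrib]
    exact Finset.sum_congr rfl fun i _ => by rw [area]; ring

namespace Network

variable {V : Type*} [Fintype V] [DecidableEq V] {N : Network V}

/-- The objective value of a sequence is a constant minus the area under the connected weight. -/
lemma objective_eq (hT : N.graph.IsTree) {H : N.graph.Subgraph} (hH : N.IsSubtree H)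
    {S : List (Sym2 V)} (hS : Lists H S) :
    N.objective H S = N.conWeight S.toFinset * total N.posLen S
      - area N.posLen N.conWeight ∅ S := by
  classical
  have htime : ∀ q ∈ N.relevantPairs H, N.connectionTime S q =
      total N.posLen S - area N.posLen (fun B => if N.Linked B q then 1 else 0) ∅ S := by
    intro q hq
    rw [← total_take_sInf N.posLen (fun B => N.Linked B q) (fun A B hAB h => h.mono hAB) S ∅
      (by simpa using linked_of_mem_relevantPairs hT hH hS hq), connectionTime,
      total_posLen fun e he => hS.mem_edgeSet e (List.mem_of_mem_take he)]
    congr 4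
    ext k
    rw [Set.mem_ofPred_eq, Set.mem_ofPred_eq, Finset.empty_union]
    exact connectedBy_iff hT fun e he => hS.mem_edgeSet e (List.mem_of_mem_take he)
  have hsub : ((S.toFinset : Finset (Sym2 V)) : Set (Sym2 V)) ⊆ H.edgeSet := by
    intro x hx
    simp only [List.coe_toFinset, Set.mem_ofPred_eq] at hx
    exact (hS.2 x).1 hx
  rw [objective, Finset.sum_congr rfl fun q hq => by rw [htime q hq]]
  have harea : area N.posLen N.conWeight ∅ S = ∑ q ∈ N.relevantPairs H,
      N.wt q * area N.posLen (fun B => if N.Linked B q then 1 else 0) ∅ S := by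
    rw [← area_sum]
    refine area_congr fun Y _ hY => ?_
    rw [Finset.empty_union] at hY
    rw [← sum_relevantPairs hT ((Finset.coe_subset.2 hY).trans hsub)]
    exact Finset.sum_congr rfl fun q _ => by split_ifs <;> simp
  rw [harea, ← sum_relevantPairs hT hsub, Finset.sum_mul, ← Finset.sum_sub_distrib]
  refine Finset.sum_congr rfl fun q hq => ?_
  rw [if_pos (linked_of_mem_relevantPairs hT hH hS hq)]; ring

end Network

/-! ### Feasible schedules of two chains -/

lemma List.Sublist.idxOf_lt {E : Type*} [DecidableEq E] {i j : E} {σ : List E} (hn : σ.Nodup)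
    (h : [i, j].Sublist σ) : σ.idxOf i < σ.idxOf j := by
  induction σ with
  | nil => simp at h
  | cons a σ ih =>
    have hn' := List.nodup_cons.1 hn
    cases h with
    | cons _ h =>
      have hi : a ≠ i := by rintro rfl; exact hn'.1 (h.subset (by simp))
      have hj : a ≠ j := by rintro rfl; exact hn'.1 (h.subset (by simp))
      rw [List.idxOf_cons_ne _ hi, List.idxOf_cons_ne _ hj]
      exact Nat.succ_lt_succ (ih hn'.2 h)
    | cons_cons _ h =>
      have hj : i ≠ j := by rintro rfl; exact hn'.1 (h.subset (by simp))
      rw [List.idxOf_cons_ne _ hj]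
      simp

lemma sublist_of_idxOf_lt {E : Type*} [DecidableEq E] {S σ : List E} (hS : S.Nodup) (hσ : σ.Nodup)
    (hsub : ∀ j ∈ S, j ∈ σ) (h : ∀ i j, [i, j].Sublist S → σ.idxOf i < σ.idxOf j) :
    S.Sublist σ := by
  have hperm : (σ.filter (· ∈ S)).Perm S :=
    (List.perm_ext_iff_of_nodup (hσ.filter _) hS).2 fun x => by
      simpa using hsub x
  have h1 : (σ.filter (· ∈ S)).Pairwise fun i j => σ.idxOf i < σ.idxOf j :=
    List.pairwise_iff_forall_sublist.2 fun hab =>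
      (hab.trans List.filter_sublist).idxOf_lt hσ
  have h2 : S.Pairwise fun i j => σ.idxOf i < σ.idxOf j :=
    List.pairwise_iff_forall_sublist.2 fun hab => h _ _ hab
  have : σ.filter (· ∈ S) = S :=
    hperm.eq_of_pairwise (fun a b _ _ hab hba => absurd hab hba.asymm) h1 h2
  rw [← this]
  exact List.filter_sublist

/-- The feasible sequences for the precedence constraints given by two disjoint chains are the
interleavings of the chains. -/
lemma isFeasible_iff {E : Type*} [DecidableEq E] {S₁ S₂ σ : List E} {J : Set E} (h₁ : S₁.Nodup)
    (h₂ : S₂.Nodup) (hJ : ∀ j, j ∈ J ↔ j ∈ S₁ ∨ j ∈ S₂) :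
    Scheduling.IsFeasible J (Scheduling.twoChains S₁ S₂) σ ↔ IsShuffle S₁ S₂ σ := by
  constructor
  · rintro ⟨hn, hmem, hprec⟩
    refine ⟨hn, ?_, ?_, fun j hj => (hJ j).1 ((hmem j).1 hj)⟩
    · refine sublist_of_idxOf_lt h₁ hn (fun j hj => (hmem j).2 ((hJ j).2 (Or.inl hj)))
        fun i j hij => hprec i ?_ j ?_ (Or.inl hij)
      · exact (hJ i).2 (Or.inl (hij.subset (by simp)))
      · exact (hJ j).2 (Or.inl (hij.subset (by simp)))
    · refine sublist_of_idxOf_lt h₂ hn (fun j hj => (hmem j).2 ((hJ j).2 (Or.inr hj)))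
        fun i j hij => hprec i ?_ j ?_ (Or.inr hij)
      · exact (hJ i).2 (Or.inr (hij.subset (by simp)))
      · exact (hJ j).2 (Or.inr (hij.subset (by simp)))
  · intro h
    refine ⟨h.nodup, fun j => ⟨fun hj => (hJ j).2 (h.mem j hj), fun hj => ?_⟩, ?_⟩
    · rcases (hJ j).1 hj with hj | hj
      exacts [h.left.subset hj, h.right.subset hj]
    · rintro i - j - (hij | hij)
      exacts [(hij.trans h.left).idxOf_lt h.nodup, (hij.trans h.right).idxOf_lt h.nodup]

/-! ### Correctness of the dynamic program -/

namespace Network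

variable {V : Type*} [Fintype V] [DecidableEq V] {N : Network V}

/-- What the argument uses about the two subtrees left by the deletion of an edge. -/
structure SplitLists (H : N.graph.Subgraph) (e : Sym2 V) (H₁ H₂ : N.graph.Subgraph)
    (S₁ S₂ : List (Sym2 V)) : Prop where
  disj : Disjoint H₁.verts H₂.verts
  left : Lists H₁ S₁
  right : Lists H₂ S₂
  edges : H₁.edgeSet ∪ H₂.edgeSet = H.edgeSet \ {e}

lemma IsSplit.edgeSet_union {H H₁ H₂ : N.graph.Subgraph} {e : Sym2 V} (h : N.IsSplit H e H₁ H₂) :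
    H₁.edgeSet ∪ H₂.edgeSet = H.edgeSet \ {e} := by
  rw [← SimpleGraph.Subgraph.edgeSet_sup, h.2.2.2]
  ext x
  induction x with | h a b =>
  rw [SimpleGraph.Subgraph.mem_edgeSet, SimpleGraph.Subgraph.deleteEdges_adj]
  rfl

namespace SplitLists

variable {H H₁ H₂ : N.graph.Subgraph} {e : Sym2 V} {S₁ S₂ : List (Sym2 V)}

lemma edge_disjoint (h : SplitLists H e H₁ H₂ S₁ S₂) : ∀ j ∈ S₁, j ∉ S₂ := by
  intro j h1 h2
  have h1' := (h.left.2 j).1 h1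
  have h2' := (h.right.2 j).1 h2
  exact Set.disjoint_left.1 h.disj (H₁.mem_verts_of_mem_edge h1' (Sym2.out_fst_mem j))
    (H₂.mem_verts_of_mem_edge h2' (Sym2.out_fst_mem j))

lemma nodup (h : SplitLists H e H₁ H₂ S₁ S₂) : (S₁ ++ S₂).Nodup :=
  List.nodup_append.2 ⟨h.left.1, h.right.1, fun x hx _ hy hxy =>
    h.edge_disjoint x hx (hxy ▸ hy)⟩

lemma mem_iff (h : SplitLists H e H₁ H₂ S₁ S₂) (x : Sym2 V) :
    x ∈ S₁ ∨ x ∈ S₂ ↔ x ∈ H.edgeSet ∧ x ≠ e := by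
  rw [h.left.2, h.right.2, ← Set.mem_union, h.edges]; rfl

lemma lists_append (h : SplitLists H e H₁ H₂ S₁ S₂) (he : e ∈ H.edgeSet) {σ : List (Sym2 V)}
    (hσ : σ.Perm (S₁ ++ S₂)) : Lists H (σ ++ [e]) := by
  have hmem : ∀ x, x ∈ σ ↔ x ∈ H.edgeSet ∧ x ≠ e := fun x => by
    rw [hσ.mem_iff, List.mem_append, h.mem_iff]
  refine ⟨List.nodup_append.2 ⟨hσ.nodup_iff.2 h.nodup, by simp, ?_⟩, fun x => ?_⟩
  · intro x hx y hy
    simp only [List.mem_singleton] at hy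
    rw [hy]; exact ((hmem x).1 hx).2
  · rw [List.mem_append, hmem, List.mem_singleton]
    constructor
    · rintro (h | rfl); exacts [h.1, he]
    · intro hx
      by_cases hxe : x = e
      exacts [Or.inr hxe, Or.inl ⟨hx, hxe⟩]

lemma separable (hT : N.graph.IsTree) (h : SplitLists H e H₁ H₂ S₁ S₂) :
    Separable N.conWeight S₁ S₂ := by
  intro Y₁ h₁ Y₂ h₂
  refine conWeight_union hT h.disj (fun x hx => ?_) fun x hx => ?_
  · exact (h.left.2 x).1 (by simpa using h₁ hx)
  · exact (h.right.2 x).1 (by simpa using h₂ hx)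

/-- The weight of a job of the merging problem. -/
noncomputable def jobWeight (H₁ H₂ : N.graph.Subgraph) (S₁ S₂ : List (Sym2 V)) (e : Sym2 V) : ℝ :=
  open Classical in if e ∈ H₁.edgeSet then N.gain H₁ S₁ e else N.gain H₂ S₂ e

lemma jobWeight_left (h : SplitLists H e H₁ H₂ S₁ S₂) {j : Sym2 V} (hj : j ∈ S₁) :
    jobWeight H₁ H₂ S₁ S₂ j = N.gain H₁ S₁ j := if_pos ((h.left.2 j).1 hj)

lemma jobWeight_right (h : SplitLists H e H₁ H₂ S₁ S₂) {j : Sym2 V} (hj : j ∈ S₂) :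
    jobWeight H₁ H₂ S₁ S₂ j = N.gain H₂ S₂ j :=
  if_neg fun h' => h.edge_disjoint j ((h.left.2 j).2 h') hj

end SplitLists

/-- The gain of an edge in terms of a longer sequence without repetitions. -/
lemma gain_eq_of_sublist (hT : N.graph.IsTree) {H : N.graph.Subgraph} {S : List (Sym2 V)}
    (hS : ∀ e ∈ S, e ∈ H.edgeSet) {π ρ : List (Sym2 V)} {j : Sym2 V}
    (hn : (π ++ j :: ρ).Nodup) (hsub : S.Sublist (π ++ j :: ρ)) (hj : j ∈ S) :
    N.gain H S j = N.conWeight (insert j (π.filter (· ∈ S)).toFinset)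
      - N.conWeight (π.filter (· ∈ S)).toFinset := by
  have e := List.Sublist.filter_eq_of_nodup hn hsub
  rw [List.filter_append, List.filter_cons_of_pos (by simpa using hj)] at e
  set P := π.filter (· ∈ S) with hP
  set R := ρ.filter (· ∈ S) with hR
  have hjP : j ∉ P := fun h => by
    obtain ⟨-, -, h3⟩ := List.nodup_append.1 hn
    exact h3 j (List.mem_of_mem_filter h) j (by simp) rfl
  have hidx : S.idxOf j = P.length := by
    rw [← e, List.idxOf_append_of_notMem hjP]; simp
  rw [gain_eq hT hS, hidx]
  have e1 : S.take P.length = P := by rw [← e]; simp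
  have e2 : S.take (P.length + 1) = P ++ [j] := by
    rw [← e, List.take_append]; simp
  rw [e1, e2]
  congr 2
  ext x; simp

/-- The two sides do not interact: in an interleaving, the gain of an edge on its own side is the
increment of the connected weight of the whole subtree. -/
lemma SplitLists.isIncrement (hT : N.graph.IsTree) {H H₁ H₂ : N.graph.Subgraph} {e : Sym2 V}
    {S₁ S₂ σ : List (Sym2 V)} (h : SplitLists H e H₁ H₂ S₁ S₂) (hσ : IsShuffle S₁ S₂ σ) :
    IsIncrement (jobWeight H₁ H₂ S₁ S₂) N.conWeight ∅ σ := by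
  rintro π j ρ rfl
  rw [Finset.empty_union]
  have hπ : π.toFinset = (π.filter (· ∈ S₁)).toFinset ∪ (π.filter (· ∈ S₂)).toFinset := by
    ext x
    have := hσ.mem x
    simp at this ⊢; tauto
  have hF₁ : (π.filter (· ∈ S₁)).toFinset ⊆ S₁.toFinset := by intro x; simp
  have hF₂ : (π.filter (· ∈ S₂)).toFinset ⊆ S₂.toFinset := by intro x; simp
  have hsep := h.separable hT
  rcases hσ.mem j (by simp) with hj | hj
  · rw [h.jobWeight_left hj, gain_eq_of_sublist hT (fun e he => (h.left.2 e).1 he) hσ.nodup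
      hσ.left hj, hπ, ← Finset.insert_union, hsep _ hF₁ _ hF₂, hsep _ ?_ _ hF₂]
    · ring
    · exact Finset.insert_subset (by simpa using hj) hF₁
  · rw [h.jobWeight_right hj, gain_eq_of_sublist hT (fun e he => (h.right.2 e).1 he) hσ.nodup
      hσ.right hj, hπ, ← Finset.union_insert, hsep _ hF₁ _ hF₂, hsep _ hF₁]
    · ring
    · exact Finset.insert_subset (by simpa using hj) hF₂

lemma SplitLists.cost_eq (hT : N.graph.IsTree) {H H₁ H₂ : N.graph.Subgraph} {e : Sym2 V}
    {S₁ S₂ σ : List (Sym2 V)} (h : SplitLists H e H₁ H₂ S₁ S₂) (hσ : IsShuffle S₁ S₂ σ) :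
    Scheduling.cost N.len (jobWeight H₁ H₂ S₁ S₂) σ = N.conWeight σ.toFinset * total N.posLen σ
      - area N.posLen N.conWeight ∅ σ := by
  have hmem : ∀ j ∈ σ, N.len j = N.posLen j := fun j hj => by
    refine (posLen_eq ?_).symm
    rcases hσ.mem j hj with hj | hj
    exacts [h.left.mem_edgeSet j hj, h.right.mem_edgeSet j hj]
  have := costFrom_add_area (c := N.posLen) (h.isIncrement hT hσ) 0
  rw [cost_eq_costFrom hσ.nodup, costFrom_congr hmem fun _ _ => rfl]
  rw [Finset.empty_union, zero_add, mul_zero, sub_zero] at this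
  linarith

lemma IsOptimal.isAreaMax (hT : N.graph.IsTree) {H : N.graph.Subgraph} (hH : N.IsSubtree H)
    {S : List (Sym2 V)} (h : N.IsOptimal H S) : IsAreaMax N.posLen N.conWeight S := by
  intro S' hS'
  have hS := (isSSequence_iff hT hH).1 h.1
  have hS'l : Lists H S' := ⟨hS'.nodup_iff.2 hS.1, fun e => by rw [hS'.mem_iff, hS.2]⟩
  have := h.2 S' ((isSSequence_iff hT hH).2 hS'l)
  rw [objective_eq hT hH hS, objective_eq hT hH hS'l, List.toFinset_eq_of_perm _ _ hS',
    total_perm hS'] at this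
  linarith

/-- Merging optimal sequences of the two sides of an edge optimally and appending the edge gives
an optimal sequence among those which end with this edge. -/
theorem isOptimalWithLast_of_merge (hT : N.graph.IsTree) {H H₁ H₂ : N.graph.Subgraph}
    {e : Sym2 V} {S₁ S₂ L : List (Sym2 V)} (hH : N.IsSubtree H) (he : e ∈ H.edgeSet)
    (hsplit : N.IsSplit H e H₁ H₂) (h₁ : N.IsOptimal H₁ S₁) (h₂ : N.IsOptimal H₂ S₂)
    (hL : N.IsOptimalMerge H₁ H₂ S₁ S₂ L) : N.IsOptimalWithLast H e (L ++ [e]) := by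
  have hs : SplitLists H e H₁ H₂ S₁ S₂ := ⟨hsplit.2.2.1, (isSSequence_iff hT hsplit.1).1 h₁.1,
    (isSSequence_iff hT hsplit.2.1).1 h₂.1, hsplit.edgeSet_union⟩
  have hfeas : ∀ σ, Scheduling.IsFeasible (H₁.edgeSet ∪ H₂.edgeSet)
      (Scheduling.twoChains S₁ S₂) σ ↔ IsShuffle S₁ S₂ σ := fun σ =>
    isFeasible_iff hs.left.1 hs.right.1 fun j => by rw [hs.left.2, hs.right.2]; rfl
  have hLs : IsShuffle S₁ S₂ L := (hfeas L).1 hL.1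
  have hshperm : ∀ σ, IsShuffle S₁ S₂ σ → σ.Perm (S₁ ++ S₂) := fun σ hσ =>
    (List.perm_ext_iff_of_nodup hσ.nodup hs.nodup).2 fun x => by
      rw [← List.mem_toFinset, hσ.toFinset]; simp
  have hLl := hs.lists_append he (hshperm L hLs)
  refine ⟨(isSSequence_iff hT hH).2 hLl, by simp, fun S' hS' hlast => ?_⟩
  obtain ⟨σ, rfl⟩ := List.getLast?_eq_some_iff.1 hlast
  have hσl := (isSSequence_iff hT hH).1 hS'
  have hσ : σ.Perm (S₁ ++ S₂) :=
    ((List.perm_append_right_iff [e]).1 (hσl.perm hLl)).trans (hshperm L hLs)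
  -- `σ` is not better than some interleaving `τ`, which is not better than the optimal one.
  obtain ⟨τ, hτ, hle⟩ := exists_shuffle_area_le posLen_pos _ N.conWeight S₁ S₂ rfl
    conWeight_supermodular (conWeight_empty hT) (hs.separable hT) hs.nodup
    (h₁.isAreaMax hT hsplit.1) (h₂.isAreaMax hT hsplit.2.1) σ hσ
  have hcost := hL.2 τ ((hfeas τ).2 hτ)
  change Scheduling.cost N.len (SplitLists.jobWeight H₁ H₂ S₁ S₂) L ≤
    Scheduling.cost N.len (SplitLists.jobWeight H₁ H₂ S₁ S₂) τ at hcost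
  rw [hs.cost_eq hT hLs, hs.cost_eq hT hτ, List.toFinset_eq_of_perm _ _ (hLs.perm hτ),
    total_perm (hLs.perm hτ)] at hcost
  rw [objective_eq hT hH hLl, objective_eq hT hH hσl, area_append, area_append,
    List.toFinset_eq_of_perm _ _ (hLl.perm hσl), total_perm (hLl.perm hσl),
    List.toFinset_eq_of_perm _ _ ((hshperm L hLs).trans hσ.symm)]
  simp only [area]
  linarith

lemma edgeSet_finite (H : N.graph.Subgraph) : H.edgeSet.Finite := Set.toFinite _

lemma IsSplit.ncard_lt {H H₁ H₂ : N.graph.Subgraph} {e : Sym2 V} (h : N.IsSplit H e H₁ H₂)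
    (he : e ∈ H.edgeSet) : H₁.edgeSet.ncard < H.edgeSet.ncard ∧
      H₂.edgeSet.ncard < H.edgeSet.ncard := by
  have hu := h.edgeSet_union
  have hlt : (H.edgeSet \ {e}).ncard < H.edgeSet.ncard :=
    Set.ncard_sdiff_singleton_lt_of_mem he (edgeSet_finite H)
  constructor
  · refine (Set.ncard_le_ncard ?_ ((edgeSet_finite H).subset Set.sdiff_subset)).trans_lt hlt
    rw [← hu]; exact Set.subset_union_left
  · refine (Set.ncard_le_ncard ?_ ((edgeSet_finite H).subset Set.sdiff_subset)).trans_lt hlt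
    rw [← hu]; exact Set.subset_union_right

/-- The dynamic program is correct however ties are broken. -/
theorem DPRecord.IsExecution.correct (hT : N.graph.IsTree) {R : N.DPRecord}
    (hR : R.IsExecution) : ∀ H : N.graph.Subgraph, N.IsSubtree H →
      N.IsOptimal H (R.best H) ∧ ∀ e ∈ H.edgeSet, N.IsOptimalWithLast H e (R.merged H e) := by
  suffices h : ∀ n, ∀ H : N.graph.Subgraph, H.edgeSet.ncard = n → N.IsSubtree H →
      N.IsOptimal H (R.best H) ∧ ∀ e ∈ H.edgeSet, N.IsOptimalWithLast H e (R.merged H e) from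
    fun H => h _ H rfl
  intro n
  induction n using Nat.strong_induction_on with
  | _ n ih =>
  rintro H rfl hH
  have hlast : ∀ e ∈ H.edgeSet, N.IsOptimalWithLast H e (R.merged H e) := by
    intro e he
    obtain ⟨H₁, H₂, L, hs, hL, hm⟩ := hR.merge H ((hR.mem_order H).2 ⟨hH, e, he⟩) e he
    obtain ⟨hlt₁, hlt₂⟩ := hs.ncard_lt he
    rw [hm]
    exact isOptimalWithLast_of_merge hT hH he hs (ih _ hlt₁ H₁ rfl hs.1).1
      (ih _ hlt₂ H₂ rfl hs.2.1).1 hL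
  refine ⟨?_, hlast⟩
  rcases H.edgeSet.eq_empty_or_nonempty with hemp | hne
  · rw [hR.best_vertex H hH hemp]
    have hnil : Lists H [] := ⟨by simp, by simp [hemp]⟩
    refine ⟨(isSSequence_iff hT hH).2 hnil, fun S' hS' => ?_⟩
    have := (isSSequence_iff hT hH).1 hS'
    have : S' = [] := List.eq_nil_iff_forall_not_mem.2 fun x hx => by
      have := (this.2 x).1 hx
      rw [hemp] at this; exact this
    rw [this]
  · obtain ⟨e, he, hbest, hle⟩ := hR.choose_best H ((hR.mem_order H).2 ⟨hH, hne⟩)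
    rw [hbest]
    refine ⟨(hlast e he).1, fun S' hS' => ?_⟩
    have hS'l := (isSSequence_iff hT hH).1 hS'
    rcases hl : S'.getLast? with _ | e'
    · rw [List.getLast?_eq_none_iff] at hl
      obtain ⟨x, hx⟩ := hne
      have := (hS'l.2 x).2 hx
      rw [hl] at this; simp at this
    · have he' : e' ∈ H.edgeSet := (hS'l.2 e').1 (List.mem_of_getLast? hl)
      exact (hle e' he').trans ((hlast e' he').2.2 S' hS' hl)

end Network

/-! ### Counting leaves -/

section Leaves

variable {V : Type*} [Fintype V] [DecidableEq V] (T : SimpleGraph V)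

/-- The edges of `T` with both ends in the finite set `X`. -/
noncomputable def edgesIn (X : Finset V) : Finset (Sym2 V) :=
  open Classical in Finset.univ.filter (· ∈ innerEdges T (X : Set V))

/-- The number of edges at `v` with both ends in `X`. -/
noncomputable def edgeDeg (X : Finset V) (v : V) : ℕ := ((edgesIn T X).filter (v ∈ ·)).card

/-- The leaves of the subtree with vertex set `X`; the vertex of a trivial subtree counts. -/
noncomputable def leaves (X : Finset V) : Finset V := X.filter (edgeDeg T X · ≤ 1)

/-- The part of `X` on the same side of `e` as `a`. -/
noncomputable def sideFin (X : Finset V) (e : Sym2 V) (a : V) : Finset V :=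
  open Classical in X.filter (Rch (cut T e) a)

variable {T} {X Y : Finset V} {a b v : V}

@[simp] lemma mem_edgesIn {e : Sym2 V} : e ∈ edgesIn T X ↔ e ∈ innerEdges T (X : Set V) := by
  simp [edgesIn]

lemma mem_edgesIn_mk : s(a, b) ∈ edgesIn T X ↔ T.Adj a b ∧ a ∈ X ∧ b ∈ X := by
  rw [mem_edgesIn, mem_innerEdges]; simp

lemma mem_sideFin {e : Sym2 V} : v ∈ sideFin T X e a ↔ v ∈ X ∧ Rch (cut T e) a v := by
  simp [sideFin]

lemma coe_sideFin (e : Sym2 V) : (sideFin T X e a : Set V) = side T (X : Set V) e a := by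
  ext v; simp [mem_sideFin, side]

lemma sideFin_card (hT : T.IsTree) (h : s(a, b) ∈ edgesIn T X) :
    X.card = (sideFin T X s(a, b) a).card + (sideFin T X s(a, b) b).card := by
  rw [← Finset.card_union_of_disjoint]
  · congr 1
    rw [← Finset.coe_inj, Finset.coe_union, coe_sideFin, coe_sideFin, side_union hT.connected]
  · rw [← Finset.disjoint_coe, coe_sideFin, coe_sideFin]
    exact disjoint_side hT.isAcyclic (mem_edgesIn.1 h).1

lemma edgesIn_eq (hT : T.IsTree) (h : s(a, b) ∈ edgesIn T X) :
    edgesIn T X = insert s(a, b)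
      (edgesIn T (sideFin T X s(a, b) a) ∪ edgesIn T (sideFin T X s(a, b) b)) := by
  have hi := inner_side_union hT (mem_edgesIn.1 h)
  ext e
  have he : e ∈ innerEdges T (side T (X : Set V) s(a, b) a) ∪
      innerEdges T (side T (X : Set V) s(a, b) b) ↔ e ∈ innerEdges T (X : Set V) \ {s(a, b)} := by
    rw [hi]
  rw [Finset.mem_insert, Finset.mem_union, mem_edgesIn, mem_edgesIn, mem_edgesIn, coe_sideFin,
    coe_sideFin, ← Set.mem_union, he]
  by_cases hab : e = s(a, b)
  · subst hab; simpa using mem_edgesIn.1 h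
  · simp [hab]

lemma mem_edgesIn_mem {e : Sym2 V} (he : e ∈ edgesIn T X) (hv : v ∈ e) : v ∈ X := by
  simpa using (mem_edgesIn.1 he).2 v hv

lemma disjoint_edgesIn (h : Disjoint X Y) : Disjoint (edgesIn T X) (edgesIn T Y) :=
  Finset.disjoint_left.2 fun e h1 h2 => Finset.disjoint_left.1 h
    (mem_edgesIn_mem h1 (Sym2.out_fst_mem e)) (mem_edgesIn_mem h2 (Sym2.out_fst_mem e))

lemma disjoint_sideFin (hT : T.IsTree) (h : s(a, b) ∈ edgesIn T X) :
    Disjoint (sideFin T X s(a, b) a) (sideFin T X s(a, b) b) := by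
  rw [← Finset.disjoint_coe, coe_sideFin, coe_sideFin]
  exact disjoint_side hT.isAcyclic (mem_edgesIn.1 h).1

lemma conn_sideFin (hT : T.IsTree) (hX : Conn T (X : Set V)) (h : s(a, b) ∈ edgesIn T X) :
    Conn T (sideFin T X s(a, b) a : Set V) ∧ Conn T (sideFin T X s(a, b) b : Set V) := by
  rw [coe_sideFin, coe_sideFin]
  exact hX.conn_side hT.isAcyclic (mem_edgesIn.1 h)

lemma notMem_edgesIn_side (hT : T.IsTree) (h : s(a, b) ∈ edgesIn T X) :
    s(a, b) ∉ edgesIn T (sideFin T X s(a, b) a) ∧ s(a, b) ∉ edgesIn T (sideFin T X s(a, b) b) := by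
  have hne := not_rch_cut hT.isAcyclic (mem_edgesIn.1 h).1
  constructor
  · intro h'
    exact hne (mem_sideFin.1 (mem_edgesIn_mk.1 h').2.2).2
  · intro h'
    exact hne (mem_sideFin.1 (mem_edgesIn_mk.1 h').2.1).2.symm

lemma Conn.exists_edge (hX : Conn T (X : Set V)) (hv : v ∈ X) (h : 2 ≤ X.card) :
    ∃ w, s(v, w) ∈ edgesIn T X := by
  obtain ⟨u, hu, hne⟩ := Finset.exists_mem_ne (by omega : 1 < X.card) v
  obtain ⟨w, hw, hadj⟩ := hX.exists_adj (u := v) (v := u) hv hu hne.symm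
  exact ⟨w, mem_edgesIn_mk.2 ⟨hadj, hv, by simpa using hw⟩⟩

lemma Conn.card_pos (hX : Conn T (X : Set V)) : 0 < X.card := by
  obtain ⟨v, hv⟩ := hX.1
  exact Finset.card_pos.2 ⟨v, hv⟩

/-- A subtree has one vertex more than edges. -/
lemma card_edgesIn (hT : T.IsTree) (n : ℕ) : ∀ X : Finset V, X.card = n → Conn T (X : Set V) →
    (edgesIn T X).card + 1 = X.card := by
  induction n using Nat.strong_induction_on with
  | _ n ih =>
  intro X hn hX
  rcases Nat.lt_or_ge X.card 2 with h | h
  · have h1 : X.card = 1 := by have := hX.card_pos; omega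
    obtain ⟨v, rfl⟩ := Finset.card_eq_one.1 h1
    rw [h1, Nat.add_eq_right, Finset.card_eq_zero, Finset.eq_empty_iff_forall_notMem]
    intro e he
    induction e with | h a b =>
    obtain ⟨hadj, ha, hb⟩ := mem_edgesIn_mk.1 he
    rw [Finset.mem_singleton] at ha hb
    exact hadj.ne (ha.trans hb.symm)
  · obtain ⟨a, ha⟩ := hX.1
    obtain ⟨b, hab⟩ := hX.exists_edge ha h
    obtain ⟨ca, cb⟩ := conn_sideFin hT hX hab
    have hcard := sideFin_card hT hab
    have h1 := ih _ (by have := cb.card_pos; omega) _ rfl ca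
    have h2 := ih _ (by have := ca.card_pos; omega) _ rfl cb
    obtain ⟨n1, n2⟩ := notMem_edgesIn_side hT hab
    rw [edgesIn_eq hT hab, Finset.card_insert_of_notMem (by simp only [Finset.mem_union]; tauto),
      Finset.card_union_of_disjoint (disjoint_edgesIn (disjoint_sideFin hT hab))]
    omega

lemma sum_edgeDeg (X : Finset V) : ∑ v ∈ X, edgeDeg T X v = 2 * (edgesIn T X).card := by
  simp only [edgeDeg, Finset.card_filter]
  rw [Finset.sum_comm, mul_comm, ← smul_eq_mul, ← Finset.sum_const]
  refine Finset.sum_congr rfl fun e he => ?_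
  induction e with | h a b =>
  obtain ⟨hadj, ha, hb⟩ := mem_edgesIn_mk.1 he
  rw [← Finset.card_filter]
  have : X.filter (fun v => v ∈ s(a, b)) = {a, b} := by
    ext v
    simp only [Finset.mem_filter, Sym2.mem_iff, Finset.mem_insert, Finset.mem_singleton]
    constructor
    · exact fun h => h.2
    · rintro (rfl | rfl) <;> simp [ha, hb]
  rw [this, Finset.card_pair hadj.ne]

lemma sum_edgeDeg_add_two (hT : T.IsTree) (hX : Conn T (X : Set V)) :
    ∑ v ∈ X, edgeDeg T X v + 2 = 2 * X.card := by
  rw [sum_edgeDeg, ← card_edgesIn hT _ X rfl hX]; ring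

lemma edgeDeg_mono (h : X ⊆ Y) (v : V) : edgeDeg T X v ≤ edgeDeg T Y v :=
  Finset.card_le_card (Finset.filter_subset_filter _ fun e he =>
    mem_edgesIn.2 (innerEdges_mono (by exact_mod_cast h) (mem_edgesIn.1 he)))

/-- Each side of an edge of a subtree contains a leaf of the subtree. -/
lemma exists_leaf_side (hT : T.IsTree) (hX : Conn T (X : Set V)) (h : s(a, b) ∈ edgesIn T X) :
    ∃ v ∈ leaves T X, v ∈ sideFin T X s(a, b) a := by
  by_contra hcon
  push Not at hcon
  obtain ⟨ca, cb⟩ := conn_sideFin hT hX h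
  have hdeg : ∀ v ∈ sideFin T X s(a, b) a,
      2 ≤ edgeDeg T (sideFin T X s(a, b) a) v + if v = a then 1 else 0 := by
    intro v hv
    have h2 : 2 ≤ edgeDeg T X v := by
      by_contra hlt
      exact hcon v (Finset.mem_filter.2 ⟨(mem_sideFin.1 hv).1, by omega⟩) hv
    refine h2.trans ?_
    have hsub : (edgesIn T X).filter (v ∈ ·) ⊆
        (edgesIn T (sideFin T X s(a, b) a)).filter (v ∈ ·) ∪
          if v = a then {s(a, b)} else ∅ := by
      intro e he
      rw [Finset.mem_filter, edgesIn_eq hT h, Finset.mem_insert, Finset.mem_union] at he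
      obtain ⟨he | he | he, hve⟩ := he
      · subst he
        have hva : v = a := by
          rcases Sym2.mem_iff.1 hve with rfl | rfl
          · rfl
          · exact absurd (mem_sideFin.1 hv).2 (not_rch_cut hT.isAcyclic (mem_edgesIn.1 h).1)
        simp [hva]
      · exact Finset.mem_union_left _ (Finset.mem_filter.2 ⟨he, hve⟩)
      · exact absurd (mem_edgesIn_mem he hve)
          (Finset.disjoint_left.1 (disjoint_sideFin hT h) hv)
    refine (Finset.card_le_card hsub).trans ((Finset.card_union_le _ _).trans ?_)
    rw [edgeDeg]
    split_ifs <;> simp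
  have hs := Finset.sum_le_sum hdeg
  rw [Finset.sum_add_distrib, Finset.sum_const, smul_eq_mul, Finset.sum_ite_eq' ] at hs
  have := sum_edgeDeg_add_two hT ca
  split_ifs at hs <;> omega

lemma one_le_edgeDeg (hX : Conn T (X : Set V)) (h : 2 ≤ X.card) (hv : v ∈ X) :
    1 ≤ edgeDeg T X v := by
  obtain ⟨w, hw⟩ := hX.exists_edge hv h
  exact Finset.card_pos.2 ⟨_, Finset.mem_filter.2 ⟨hw, by simp⟩⟩

/-- By the handshake lemma, branchings determine the number of leaves. All the summands are monotone
in the subtree, which is why a subtree does not have more leaves than the tree. -/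
lemma card_leaves_eq (hT : T.IsTree) (hX : Conn T (X : Set V)) (h : 2 ≤ X.card) :
    (leaves T X).card = 2 + ∑ v ∈ X, (edgeDeg T X v - 2) := by
  have h1 : (leaves T X).card = ∑ v ∈ X, (2 - edgeDeg T X v) := by
    rw [leaves, Finset.card_filter]
    refine Finset.sum_congr rfl fun v hv => ?_
    have := one_le_edgeDeg hX h hv
    split_ifs <;> omega
  have h2 : ∑ v ∈ X, (2 - edgeDeg T X v) + ∑ v ∈ X, edgeDeg T X v =
      X.card * 2 + ∑ v ∈ X, (edgeDeg T X v - 2) := by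
    rw [← smul_eq_mul, ← Finset.sum_const, ← Finset.sum_add_distrib, ← Finset.sum_add_distrib]
    exact Finset.sum_congr rfl fun v _ => by omega
  have := sum_edgeDeg_add_two hT hX
  omega

lemma conn_coe_univ (hT : T.IsTree) : Conn T ((Finset.univ : Finset V) : Set V) := by
  rw [Finset.coe_univ]; exact conn_univ hT.connected

lemma leaves_univ_nonempty (hT : T.IsTree) : (leaves T Finset.univ).Nonempty := by
  by_contra hne
  rw [Finset.not_nonempty_iff_eq_empty] at hne
  have h : ∀ v ∈ Finset.univ, 2 ≤ edgeDeg T Finset.univ v := by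
    intro v hv
    by_contra hlt
    have : v ∈ leaves T Finset.univ := Finset.mem_filter.2 ⟨hv, by omega⟩
    rw [hne] at this; simp at this
  have hs := Finset.sum_le_sum h
  have := sum_edgeDeg_add_two hT (conn_coe_univ hT)
  rw [Finset.sum_const, smul_eq_mul] at hs
  omega

/-- A subtree of a tree does not have more leaves than the tree. -/
lemma card_leaves_le (hT : T.IsTree) (hX : Conn T (X : Set V)) :
    (leaves T X).card ≤ (leaves T Finset.univ).card := by
  rcases Nat.lt_or_ge X.card 2 with h | h
  · have h1 := Finset.card_le_card (Finset.filter_subset (edgeDeg T X · ≤ 1) X)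
    have h2 := Finset.card_pos.2 (leaves_univ_nonempty hT)
    rw [leaves]; omega
  · rw [card_leaves_eq hT hX h, card_leaves_eq hT (conn_coe_univ hT)
      (h.trans (Finset.card_le_card (Finset.subset_univ X)))]
    refine Nat.add_le_add_left ?_ 2
    refine (Finset.sum_le_sum fun v _ =>
      Nat.sub_le_sub_right (edgeDeg_mono (Finset.subset_univ X) v) 2).trans ?_
    exact Finset.sum_le_sum_of_subset (Finset.subset_univ X)

/-- An edge of the subtree `X` separates two leaves of `X`, so it belongs to every subtree that
contains the leaves of `X`. -/
lemma edgesIn_subset_of_leaves (hT : T.IsTree) (hX : Conn T (X : Set V))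
    (hY : Conn T (Y : Set V)) (h : leaves T X ⊆ Y) : edgesIn T X ⊆ edgesIn T Y := by
  intro e he
  by_contra hcon
  induction e with | h a b =>
  obtain ⟨u, hu, hua⟩ := exists_leaf_side hT hX he
  have hba : s(b, a) ∈ edgesIn T X := by rwa [Sym2.eq_swap]
  obtain ⟨v, hv, hvb⟩ := exists_leaf_side hT hX hba
  rw [Sym2.eq_swap] at hvb
  have huv : Rch (cut T s(a, b)) u v := hY.rch_cut (fun h' => hcon (mem_edgesIn.2 h')) (h hu) (h hv)
  exact not_rch_cut_both hT.isAcyclic (mem_edgesIn.1 he).1 ((mem_sideFin.1 hua).2.trans huv)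
    (mem_sideFin.1 hvb).2

/-- A subtree is determined by its leaves. -/
lemma eq_of_leaves_eq (hT : T.IsTree) (hX : Conn T (X : Set V)) (hY : Conn T (Y : Set V))
    (h : leaves T X = leaves T Y) : X = Y := by
  have hXY := edgesIn_subset_of_leaves hT hX hY (h ▸ Finset.filter_subset _ _)
  have hYX := edgesIn_subset_of_leaves hT hY hX (h ▸ Finset.filter_subset _ _)
  have hE := hXY.antisymm hYX
  have hcX := card_edgesIn hT _ X rfl hX
  have hcY := card_edgesIn hT _ Y rfl hY
  have key : ∀ Z W : Finset V, Conn T (Z : Set V) → edgesIn T Z = edgesIn T W → 2 ≤ Z.card →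
      Z ⊆ W := by
    intro Z W hZ hE h2 v hv
    obtain ⟨w, hw⟩ := hZ.exists_edge hv h2
    rw [hE] at hw
    exact (mem_edgesIn_mk.1 hw).2.1
  rw [hE] at hcX
  rcases Nat.lt_or_ge X.card 2 with h2 | h2
  · have e1 : ∀ Z : Finset V, Conn T (Z : Set V) → Z.card < 2 → leaves T Z = Z := by
      intro Z hZ hlt
      have hc := card_edgesIn hT _ Z rfl hZ
      have h0 : edgesIn T Z = ∅ := Finset.card_eq_zero.1 (by omega)
      refine Finset.filter_true_of_mem fun v _ => ?_
      simp [edgeDeg, h0]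
    rw [← e1 X hX h2, ← e1 Y hY (by omega), h]
  · exact (key X Y hX hE h2).antisymm (key Y X hY hE.symm (by omega))

lemma edgeDeg_univ (v : V) : edgeDeg T Finset.univ v = (T.neighborSet v).ncard := by
  have h : (T.neighborSet v).ncard = ((fun w => s(v, w)) '' T.neighborSet v).ncard :=
    (Set.ncard_image_of_injective _ fun w w' h => Sym2.congr_right.1 h).symm
  rw [h, edgeDeg, ← Set.ncard_coe_finset]
  congr 1
  ext e
  simp only [Finset.coe_filter, mem_edgesIn, Set.mem_ofPred_eq, Set.mem_image]
  constructor
  · rintro ⟨he, w, rfl⟩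
    exact ⟨w, he.1, rfl⟩
  · rintro ⟨w, hw, rfl⟩
    exact ⟨⟨hw, by simp⟩, by simp⟩

lemma card_leaves_univ (hT : T.IsTree) (h : 2 ≤ Fintype.card V) :
    (leaves T Finset.univ).card = leafCount T := by
  rw [leafCount, ← Set.ncard_coe_finset]
  congr 1
  ext v
  have := one_le_edgeDeg (conn_coe_univ hT) (by simpa using h) (Finset.mem_univ v)
  rw [edgeDeg_univ] at this
  simp only [leaves, Finset.coe_filter, Finset.mem_univ, true_and, Set.mem_ofPred_eq, edgeDeg_univ]
  omega

end Leaves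

/-! ### Codes of subtrees -/

section Codes

variable {n : ℕ} (T : SimpleGraph (Fin n))

/-- The number with the given digits, in base `n + 1`; the vertex `v` serves as the digit
`v + 1`, so that no digit is zero. -/
def horner {n : ℕ} (l : List (Fin n)) : ℕ := l.foldl (fun c v => c * (n + 1) + (v + 1)) 0

/-- The leaves of a subtree in increasing order. -/
noncomputable def leafList (X : Finset (Fin n)) : List (Fin n) :=
  (List.finRange n).filter (· ∈ leaves T X)

/-- The code of a subtree: its leaves as the digits of a number in base `n + 1`. -/
noncomputable def code (X : Finset (Fin n)) : ℕ := horner (leafList T X)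

/-- A strict upper bound for the codes of subtrees. -/
noncomputable def codeBound : ℕ := (n + 1) ^ (leaves T Finset.univ).card

variable {T}

lemma horner_concat (l : List (Fin n)) (v : Fin n) :
    horner (l ++ [v]) = horner l * (n + 1) + (v + 1) := by
  simp [horner]

lemma horner_lt (l : List (Fin n)) : horner l < (n + 1) ^ l.length := by
  induction l using List.reverseRecOn with
  | nil => simp [horner]
  | append_singleton l v ih =>
    rw [horner_concat, List.length_append, List.length_singleton, pow_succ]
    have hv := v.2
    have : (horner l + 1) * (n + 1) ≤ (n + 1) ^ l.length * (n + 1) := Nat.mul_le_mul_right _ ih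
    nlinarith

lemma horner_injective : Function.Injective (horner (n := n)) := by
  intro l
  induction l using List.reverseRecOn with
  | nil =>
    intro l' h
    induction l' using List.reverseRecOn with
    | nil => rfl
    | append_singleton l' v _ => rw [horner_concat] at h; simp [horner] at h
  | append_singleton l v ih =>
    intro l' h
    induction l' using List.reverseRecOn with
    | nil => rw [horner_concat] at h; simp [horner] at h
    | append_singleton l' w _ =>
      rw [horner_concat, horner_concat] at h
      have hm := congrArg (· % (n + 1)) h
      have hv := v.2
      have hw := w.2
      simp only [Nat.mul_add_mod_self_right] at hm
      rw [Nat.mod_eq_of_lt (by omega), Nat.mod_eq_of_lt (by omega)] at hm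
      have hvw : v = w := Fin.ext (by omega)
      subst hvw
      have : horner l = horner l' :=
        Nat.eq_of_mul_eq_mul_right (show 0 < n + 1 by omega) (by omega)
      rw [ih this]

lemma length_leafList (X : Finset (Fin n)) : (leafList T X).length = (leaves T X).card := by
  have hn : (leafList T X).Nodup := (List.nodup_finRange n).filter _
  rw [← List.toFinset_card_of_nodup hn]
  congr 1
  ext v; simp [leafList]

lemma code_lt (hT : T.IsTree) {X : Finset (Fin n)} (hX : Conn T (X : Set (Fin n))) :
    code T X < codeBound T := by
  refine (horner_lt _).trans_le (Nat.pow_le_pow_right (Nat.succ_pos n) ?_)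
  rw [length_leafList]; exact card_leaves_le hT hX

lemma code_injective (hT : T.IsTree) {X Y : Finset (Fin n)} (hX : Conn T (X : Set (Fin n)))
    (hY : Conn T (Y : Set (Fin n))) (h : code T X = code T Y) : X = Y := by
  have hl := horner_injective h
  refine eq_of_leaves_eq hT hX hY ?_
  ext v
  have : v ∈ leafList T X ↔ v ∈ leafList T Y := by rw [hl]
  simpa [leafList] using this

lemma codeBound_le (hT : T.IsTree) : codeBound T ≤ 2 ^ (leafCount T + 1) * n ^ leafCount T := by
  have hn : 0 < n := by
    obtain ⟨v⟩ := hT.connected.nonempty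
    exact v.pos
  rcases Nat.lt_or_ge n 2 with h | h
  · obtain rfl : n = 1 := by omega
    have h1 := Finset.card_le_card (Finset.subset_univ (leaves T Finset.univ))
    rw [Finset.card_univ, Fintype.card_fin] at h1
    rw [one_pow, mul_one, codeBound]
    exact Nat.pow_le_pow_right (by norm_num) (by omega)
  · rw [codeBound, card_leaves_univ hT (by simpa using h), pow_succ, mul_right_comm, ← mul_pow]
    refine (Nat.pow_le_pow_left (by omega : n + 1 ≤ 2 * n) _).trans ?_
    exact Nat.le_mul_of_pos_right _ (by norm_num)

lemma ncard_subtrees_le (N : Network (Fin n)) (hT : N.graph.IsTree) :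
    {H : N.graph.Subgraph | N.IsSubtree H}.ncard ≤ codeBound N.graph := by
  classical
  have hconn : ∀ H : N.graph.Subgraph, N.IsSubtree H →
      Conn N.graph ((H.verts.toFinset : Finset (Fin n)) : Set (Fin n)) := fun H hH => by
    rw [Set.coe_toFinset]; exact conn_of_isTree H hH.connected
  have h := Set.ncard_le_ncard_of_injOn (s := {H : N.graph.Subgraph | N.IsSubtree H})
    (t := ((Finset.range (codeBound N.graph) : Finset ℕ) : Set ℕ))
    (fun H => code N.graph H.verts.toFinset)
    (fun H hH => by simpa using code_lt hT (hconn H hH))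
    (fun H hH K hK h => by
      have hv := code_injective hT (hconn H hH) (hconn K hK) h
      rw [Set.toFinset_inj] at hv
      rw [eq_indSub hT.isAcyclic H hH.connected, eq_indSub hT.isAcyclic K hK.connected, hv])
    (Finset.finite_toSet _)
  rwa [Set.ncard_coe_finset, Finset.card_range] at h

end Codes

/-! ### Reasoning about programs -/

namespace RAM

variable {M : ℕ}

attribute [simp] WExp.eval NExp.eval Test.holds

@[simp] lemma State.word_setWord (s : State) (a i x b j : ℕ) :
    (s.setWord a i x).word b j = if b = a ∧ j = i then x else s.word b j := by
  simp only [State.setWord, Function.update_apply]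
  split_ifs <;> simp_all

@[simp] lemma State.num_setWord (s : State) (a i x : ℕ) : (s.setWord a i x).num = s.num := rfl
@[simp] lemma State.out_setWord (s : State) (a i x : ℕ) : (s.setWord a i x).out = s.out := rfl

@[simp] lemma State.num_setNum (s : State) (a i : ℕ) (x : ℝ) (b j : ℕ) :
    (s.setNum a i x).num b j = if b = a ∧ j = i then x else s.num b j := by
  simp only [State.setNum, Function.update_apply]
  split_ifs <;> simp_all

@[simp] lemma State.word_setNum (s : State) (a i : ℕ) (x : ℝ) :
    (s.setNum a i x).word = s.word := rfl
@[simp] lemma State.out_setNum (s : State) (a i : ℕ) (x : ℝ) :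
    (s.setNum a i x).out = s.out := rfl
@[simp] lemma State.word_print (s : State) (x : ℕ) : (s.print x).word = s.word := rfl
@[simp] lemma State.num_print (s : State) (x : ℕ) : (s.print x).num = s.num := rfl
@[simp] lemma State.out_print (s : State) (x : ℕ) : (s.print x).out = s.out ++ [x] := rfl

namespace Program

/-- The word arrays that a program may change. -/
def wmods : Program → List ℕ
  | skip | setNum _ _ _ | print _ => []
  | setWord a _ _ => [a]
  | seq P Q | ite _ P Q => P.wmods ++ Q.wmods
  | .while _ P => P.wmods

/-- The real arrays that a program may change. -/
def nmods : Program → List ℕ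
  | skip | setWord _ _ _ | print _ => []
  | setNum a _ _ => [a]
  | seq P Q | ite _ P Q => P.nmods ++ Q.nmods
  | .while _ P => P.nmods

/-- The program contains no print statement. -/
def silent : Program → Bool
  | skip | setWord _ _ _ | setNum _ _ _ => true
  | print _ => false
  | seq P Q | ite _ P Q => P.silent && Q.silent
  | .while _ P => P.silent

/-- The program contains no loop. -/
def loopFree : Program → Bool
  | skip | setWord _ _ _ | setNum _ _ _ | print _ => true
  | seq P Q | ite _ P Q => P.loopFree && Q.loopFree
  | .while _ _ => false

/-- A bound for the running time of a program without loops. -/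
def maxTime : Program → ℕ
  | skip => 1
  | setWord _ i x => i.time + x.time + 1
  | setNum _ i x => i.time + x.time + 1
  | print x => x.time + 1
  | seq P Q => P.maxTime + Q.maxTime
  | ite b P Q => b.time + (P.maxTime + Q.maxTime) + 1
  | .while _ _ => 0

/-- The state reached by a program without loops. -/
@[simp] noncomputable def den (M : ℕ) : Program → State → State
  | skip, s => s
  | setWord a i x, s => s.setWord a (i.eval M s) (x.eval M s)
  | setNum a i x, s => s.setNum a (i.eval M s) (x.eval M s)
  | print x, s => s.print (x.eval M s)
  | seq P Q, s => Q.den M (P.den M s)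
  | ite b P Q, s => open Classical in if b.holds M s then P.den M s else Q.den M s
  | .while _ _, s => s

end Program

/-- The program `P` changes only the arrays which occur as targets of its assignments. -/
structure Frame (P : Program) (s s' : State) : Prop where
  word : ∀ a, a ∉ P.wmods → s'.word a = s.word a
  num : ∀ a, a ∉ P.nmods → s'.num a = s.num a
  out : P.silent = true → s'.out = s.out

lemma Frame.refl (P : Program) (s : State) : Frame P s s :=
  ⟨fun _ _ => rfl, fun _ _ => rfl, fun _ => rfl⟩

lemma Frame.trans {P : Program} {s s' s'' : State} (h : Frame P s s') (h' : Frame P s' s'') :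
    Frame P s s'' :=
  ⟨fun a ha => (h'.word a ha).trans (h.word a ha), fun a ha => (h'.num a ha).trans (h.num a ha),
    fun hs => (h'.out hs).trans (h.out hs)⟩

lemma Frame.mono {P Q : Program} {s s' : State} (h : Frame P s s')
    (hw : ∀ a ∈ P.wmods, a ∈ Q.wmods) (hn : ∀ a ∈ P.nmods, a ∈ Q.nmods)
    (hs : Q.silent = true → P.silent = true) : Frame Q s s' :=
  ⟨fun a ha => h.word a fun h' => ha (hw a h'), fun a ha => h.num a fun h' => ha (hn a h'),
    fun h' => h.out (hs h')⟩

lemma Frame.seq_left {P : Program} (Q : Program) {s s' : State} (h : Frame P s s') :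
    Frame (.seq P Q) s s' :=
  h.mono (by simp [Program.wmods]; tauto) (by simp [Program.nmods]; tauto)
    (by simp [Program.silent]; tauto)

lemma Frame.seq_right (P : Program) {Q : Program} {s s' : State} (h : Frame Q s s') :
    Frame (.seq P Q) s s' :=
  h.mono (by simp [Program.wmods]; tauto) (by simp [Program.nmods]; tauto)
    (by simp [Program.silent])

lemma Exec.frame {P : Program} {s s' : State} {t : ℕ} (h : Exec M P s t s') : Frame P s s' := by
  induction h with
  | skip s => exact Frame.refl _ _
  | setWord s a i x =>
    refine ⟨fun b hb => ?_, fun _ _ => rfl, fun _ => rfl⟩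
    funext j
    simp only [Program.wmods, List.mem_singleton] at hb
    simp [hb]
  | setNum s a i x =>
    refine ⟨fun _ _ => rfl, fun b hb => ?_, fun _ => rfl⟩
    funext j
    simp only [Program.nmods, List.mem_singleton] at hb
    simp [hb]
  | print s x => exact ⟨fun _ _ => rfl, fun _ _ => rfl, fun h => by simp [Program.silent] at h⟩
  | seq _ _ ih₁ ih₂ => exact (ih₁.seq_left _).trans (ih₂.seq_right _)
  | @iteTrue b P Q s s' t _ _ ih =>
    have h := ih.seq_left Q
    exact ⟨h.word, h.num, h.out⟩
  | @iteFalse b P Q s s' t _ _ ih =>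
    have h := ih.seq_right P
    exact ⟨h.word, h.num, h.out⟩
  | whileFalse _ => exact Frame.refl _ _
  | whileTrue _ _ _ ih₁ ih₂ => exact Frame.trans ⟨ih₁.word, ih₁.num, ih₁.out⟩ ih₂

/-- Started in the state `s`, the program halts within `T` time units, in a state with the
property `Q`. -/
def Runs (M : ℕ) (P : Program) (s : State) (T : ℕ) (Q : State → Prop) : Prop :=
  ∃ t s', Exec M P s t s' ∧ t ≤ T ∧ Q s'

lemma Runs.imp {P : Program} {s : State} {T T' : ℕ} {Q Q' : State → Prop} (h : Runs M P s T Q)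
    (hT : T ≤ T') (hQ : ∀ s', Frame P s s' → Q s' → Q' s') : Runs M P s T' Q' := by
  obtain ⟨t, s', he, ht, hq⟩ := h
  exact ⟨t, s', he, ht.trans hT, hQ s' he.frame hq⟩

lemma Runs.seq {P P' : Program} {s : State} {T T₁ T₂ : ℕ} {R Q : State → Prop}
    (h : Runs M P s T₁ R) (h' : ∀ s', Frame P s s' → R s' → Runs M P' s' T₂ Q)
    (hT : T₁ + T₂ ≤ T) : Runs M (.seq P P') s T Q := by
  obtain ⟨t, s', he, ht, hr⟩ := h
  obtain ⟨t', s'', he', ht', hq⟩ := h' s' he.frame hr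
  exact ⟨t + t', s'', he.seq he', by omega, hq⟩

lemma Runs.ite {b : Test} {P P' : Program} {s : State} {T T' : ℕ} {Q : State → Prop}
    (h₁ : b.holds M s → Runs M P s T Q) (h₂ : ¬ b.holds M s → Runs M P' s T Q)
    (hT : b.time + T + 1 ≤ T') : Runs M (.ite b P P') s T' Q := by
  by_cases hb : b.holds M s
  · obtain ⟨t, s', he, ht, hq⟩ := h₁ hb
    exact ⟨_, s', .iteTrue hb he, by omega, hq⟩
  · obtain ⟨t, s', he, ht, hq⟩ := h₂ hb
    exact ⟨_, s', .iteFalse hb he, by omega, hq⟩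

lemma exec_den (P : Program) (h : P.loopFree = true) (s : State) :
    ∃ t, Exec M P s t (P.den M s) ∧ t ≤ P.maxTime := by
  induction P generalizing s with
  | skip => exact ⟨_, .skip s, le_rfl⟩
  | setWord a i x => exact ⟨_, .setWord s a i x, le_rfl⟩
  | setNum a i x => exact ⟨_, .setNum s a i x, le_rfl⟩
  | print x => exact ⟨_, .print s x, le_rfl⟩
  | seq P Q ihP ihQ =>
    simp only [Program.loopFree, Bool.and_eq_true] at h
    obtain ⟨t, he, ht⟩ := ihP h.1 s
    obtain ⟨t', he', ht'⟩ := ihQ h.2 (P.den M s)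
    exact ⟨_, he.seq he', by simp only [Program.maxTime]; omega⟩
  | ite b P Q ihP ihQ =>
    simp only [Program.loopFree, Bool.and_eq_true] at h
    rw [Program.den]
    split_ifs with hb
    · obtain ⟨t, he, ht⟩ := ihP h.1 s
      exact ⟨_, .iteTrue hb he, by simp only [Program.maxTime]; omega⟩
    · obtain ⟨t, he, ht⟩ := ihQ h.2 s
      exact ⟨_, .iteFalse hb he, by simp only [Program.maxTime]; omega⟩
  | _ => simp [Program.loopFree] at h

lemma Runs.basic {P : Program} {s : State} {T : ℕ} {Q : State → Prop}
    (h : P.loopFree = true) (hT : P.maxTime ≤ T) (hQ : Q (P.den M s)) : Runs M P s T Q := by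
  obtain ⟨t, he, ht⟩ := exec_den (M := M) P h s
  exact ⟨t, _, he, ht.trans hT, hQ⟩

/-- The rule for a loop: the invariant `I k` holds after `k` iterations, of which there are at most
`N`, each of time at most `T`. -/
lemma Runs.loop {b : Test} {P : Program} {s : State} {T N : ℕ} {Q : State → Prop}
    (I : ℕ → State → Prop) (h0 : I 0 s)
    (hcap : ∀ k s', Frame P s s' → I k s' → b.holds M s' → k < N)
    (hstep : ∀ k s', Frame P s s' → I k s' → b.holds M s' → Runs M P s' T (I (k + 1)))
    (hQ : ∀ k s', Frame P s s' → I k s' → ¬ b.holds M s' → Q s') :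
    Runs M (.while b P) s (N * (T + b.time + 1) + (b.time + 1)) Q := by
  suffices h : ∀ j k s', k + j = N → Frame P s s' → I k s' →
      Runs M (.while b P) s' (j * (T + b.time + 1) + (b.time + 1)) Q from
    h N 0 s (by omega) (Frame.refl _ _) h0
  intro j
  induction j with
  | zero =>
    intro k s' hk hF hI
    by_cases hb : b.holds M s'
    · exact absurd (hcap k s' hF hI hb) (by omega)
    · exact ⟨_, s', .whileFalse hb, by omega, hQ k s' hF hI hb⟩
  | succ j ih =>
    intro k s' hk hF hI
    by_cases hb : b.holds M s'
    · obtain ⟨t, s₁, he, ht, hI₁⟩ := hstep k s' hF hI hb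
      obtain ⟨t', s₂, he', ht', hq⟩ := ih (k + 1) s₁ (by omega) (hF.trans he.frame) hI₁
      refine ⟨_, s₂, .whileTrue hb he he', ?_, hq⟩
      rw [Nat.add_mul]; omega
    · exact ⟨_, s', .whileFalse hb, by nlinarith, hQ k s' hF hI hb⟩

/-- The variable `a`: cell 0 of the word array `a`. -/
abbrev wvar (a : ℕ) : WExp := .read a (.const 0)

/-- The real variable `a`: cell 0 of the real array `a`. -/
abbrev nvar (a : ℕ) : NExp := .read a (.const 0)

/-- `for i := 0 to b - 1 do P`. -/
def forLoop (i : ℕ) (b : WExp) (P : Program) : Program :=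
  .seq (.setWord i (.const 0) (.const 0))
    (.while (.not (.wordLE b (wvar i)))
      (.seq P (.setWord i (.const 0) (.add (wvar i) (.const 1)))))

/-- The rule for a counting loop. The body has to establish the invariant for the state in which the
counter has been incremented. -/
lemma Runs.forLoop {i : ℕ} {b : WExp} {P : Program} {s : State} {T N T' : ℕ} {Q : State → Prop}
    (I : ℕ → State → Prop) (hi : i ∉ P.wmods) (hN : N < M)
    (hb : ∀ s', Frame (forLoop i b P) s s' → b.eval M s' = N)
    (h0 : I 0 (s.setWord i 0 0))
    (hstep : ∀ k s', k < N → Frame (RAM.forLoop i b P) s s' → s'.word i 0 = k → I k s' →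
      Runs M P s' T fun s'' => I (k + 1) (s''.setWord i 0 (k + 1)))
    (hQ : ∀ s', Frame (RAM.forLoop i b P) s s' → I N s' → Q s')
    (hT : N * (T + b.time + 11) + b.time + 8 ≤ T') :
    Runs M (RAM.forLoop i b P) s T' Q := by
  have hF0 : Frame (RAM.forLoop i b P) s (s.setWord i 0 0) := by
    have := (Exec.setWord (M := M) s i (.const 0) (.const 0)).frame.seq_left
      (.while (.not (.wordLE b (wvar i)))
        (.seq P (.setWord i (.const 0) (.add (wvar i) (.const 1)))))
    simpa [RAM.forLoop] using this
  have hFs : ∀ s', Frame (.seq P (.setWord i (.const 0) (.add (wvar i) (.const 1))))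
      (s.setWord i 0 0) s' → Frame (RAM.forLoop i b P) s s' := fun s' h =>
    hF0.trans (Frame.seq_right (.setWord i (.const 0) (.const 0)) ⟨h.word, h.num, h.out⟩)
  have hloop : Runs M (.while (.not (.wordLE b (wvar i)))
      (.seq P (.setWord i (.const 0) (.add (wvar i) (.const 1))))) (s.setWord i 0 0)
      (N * (T + 6 + (Test.not (.wordLE b (wvar i))).time + 1) +
        ((Test.not (.wordLE b (wvar i))).time + 1)) Q := by
    refine Runs.loop (fun k s' => k ≤ N ∧ s'.word i 0 = k ∧ I k s')
      ⟨Nat.zero_le _, by simp, h0⟩ ?_ ?_ ?_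
    · rintro k s' hF ⟨hk, hw, hI⟩ hh
      simp only [Test.holds, WExp.eval, Nat.zero_mod, hb s' (hFs s' hF), hw] at hh
      omega
    · rintro k s' hF ⟨hk, hw, hI⟩ hh
      simp only [Test.holds, WExp.eval, Nat.zero_mod, hb s' (hFs s' hF), hw] at hh
      refine Runs.seq (hstep k s' (by omega) (hFs s' hF) hw hI) (T₂ := 6) ?_ (by omega)
      intro s'' hF'' hI''
      have hw'' : s''.word i 0 = k := by rw [hF''.word i hi, hw]
      refine Runs.basic rfl (by simp [Program.maxTime, WExp.time]) ?_
      have h1 : (k + 1 % M) % M = k + 1 := by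
        rw [Nat.mod_eq_of_lt (a := 1) (by omega), Nat.mod_eq_of_lt (by omega)]
      simp only [Program.den, WExp.eval, Nat.zero_mod, hw'', h1]
      exact ⟨by omega, by simp, hI''⟩
    · rintro k s' hF ⟨hk, hw, hI⟩ hh
      simp only [Test.holds, WExp.eval, Nat.zero_mod, hb s' (hFs s' hF), hw] at hh
      obtain rfl : k = N := by omega
      exact hQ s' (hFs s' hF) hI
  obtain ⟨t, s', he, ht, hq⟩ := hloop
  have h0e := Exec.setWord (M := M) s i (.const 0) (.const 0)
  simp only [WExp.eval, Nat.zero_mod, WExp.time] at h0e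
  refine ⟨_, s', h0e.seq he, ?_, hq⟩
  simp only [Test.time, WExp.time] at ht
  have : N * (T + 6 + (b.time + (1 + 1) + 1 + 1) + 1) = N * (T + b.time + 11) := by ring
  omega

end RAM

/-! ### The program -/

namespace RAM

/-! The word arrays: the number of vertices and the ends of the edges (input); the sides of the
edges; marks and degrees of vertices and the code of the marked set; for each code, the number of
vertices, the vertex set and the chosen sequence of the subtree; the queue of codes and its length;
the merged sequence; and variables. -/

notation "wN" => (0 : ℕ)
notation "wEA" => (1 : ℕ)
notation "wEB" => (2 : ℕ)
notation "wSide" => (3 : ℕ)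
notation "wMark" => (4 : ℕ)
notation "wDeg" => (5 : ℕ)
notation "wCode" => (6 : ℕ)
notation "wSize" => (7 : ℕ)
notation "wMem" => (8 : ℕ)
notation "wQueue" => (9 : ℕ)
notation "wCount" => (10 : ℕ)
notation "wSeq" => (11 : ℕ)
notation "wBuf" => (12 : ℕ)
notation "wI" => (13 : ℕ)
notation "wE" => (14 : ℕ)
notation "wV" => (15 : ℕ)
notation "wU" => (16 : ℕ)
notation "wT" => (17 : ℕ)
notation "wX" => (18 : ℕ)
notation "wY" => (19 : ℕ)
notation "wZ" => (20 : ℕ)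
notation "wA" => (21 : ℕ)
notation "wB" => (22 : ℕ)
notation "wFlag" => (23 : ℕ)

/-! The real arrays: lengths and weights (input); for each code, the total weight in the subtree,
the gains of its chosen sequence, and numerators and denominators of the keys; the gains of the
merged sequence; and variables. -/

notation "rLen" => (0 : ℕ)
notation "rWt" => (1 : ℕ)
notation "rTot" => (2 : ℕ)
notation "rGain" => (3 : ℕ)
notation "rKeyW" => (4 : ℕ)
notation "rKeyP" => (5 : ℕ)
notation "rBuf" => (6 : ℕ)
notation "rObj" => (7 : ℕ)
notation "rTime" => (8 : ℕ)
notation "rBest" => (9 : ℕ)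
notation "rSW" => (10 : ℕ)
notation "rSP" => (11 : ℕ)
notation "rBW" => (12 : ℕ)
notation "rBP" => (13 : ℕ)
notation "rCW" => (14 : ℕ)
notation "rCP" => (15 : ℕ)

/-- The address of cell `v` of row `x` in a table with rows of length `n`. -/
abbrev row (x v : WExp) : WExp := .add (.mul x (wvar wN)) v

/-- The number of edges of the whole tree. -/
abbrev mExp : WExp := .sub (wvar wN) (.const 1)

/-- The test `x < y` on words. -/
abbrev wlt (x y : WExp) : Test := .not (.wordLE y x)

/-- The test whether a word is not zero; the words in question are 0 or 1, or positions. -/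
abbrev isOne (x : WExp) : Test := .wordLE (.const 1) x

/-- Increment the variable `a`. -/
abbrev incr (a : ℕ) : Program := .setWord a (.const 0) (.add (wvar a) (.const 1))

/-- Assign a word to the variable `a`. -/
abbrev setVar (a : ℕ) (x : WExp) : Program := .setWord a (.const 0) x

/-- Assign a real number to the real variable `a`. -/
abbrev setReal (a : ℕ) (x : NExp) : Program := .setNum a (.const 0) x

/-- One step of the search on one side of the edge `wE`: inspect the edge `wV`. -/
def sideStep : Program :=
  .ite (.and (.wordLE (wvar wV) (wvar wE)) (.wordLE (wvar wE) (wvar wV))) .skip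
    (.seq
      (.ite (isOne (.read wSide (row (wvar wE) (.read wEA (wvar wV)))))
        (.setWord wSide (row (wvar wE) (.read wEB (wvar wV))) (.const 1)) .skip)
      (.ite (isOne (.read wSide (row (wvar wE) (.read wEB (wvar wV)))))
        (.setWord wSide (row (wvar wE) (.read wEA (wvar wV))) (.const 1)) .skip))

/-- For every edge, mark the vertices on the side of its first end. Each of `n` rounds inspects all
edges, so that the marks spread by one edge at least in each round. -/
def sideProg : Program :=
  forLoop wE mExp
    (.seq (.setWord wSide (row (wvar wE) (.read wEA (wvar wE))) (.const 1))
      (forLoop wU (wvar wN) (forLoop wV mExp sideStep)))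

/-- Compute the code of the set of marked vertices. -/
def codeProg : Program :=
  .seq (forLoop wV (wvar wN) (.setWord wDeg (wvar wV) (.const 0)))
  (.seq (forLoop wV mExp
    (.ite (.and (isOne (.read wMark (.read wEA (wvar wV))))
        (isOne (.read wMark (.read wEB (wvar wV)))))
      (.seq (.setWord wDeg (.read wEA (wvar wV))
          (.add (.read wDeg (.read wEA (wvar wV))) (.const 1)))
        (.setWord wDeg (.read wEB (wvar wV))
          (.add (.read wDeg (.read wEB (wvar wV))) (.const 1)))) .skip))
  (.seq (setVar wCode (.const 0))
  (forLoop wV (wvar wN)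
    (.ite (.and (isOne (.read wMark (wvar wV))) (.wordLE (.read wDeg (wvar wV)) (.const 1)))
      (setVar wCode (.add (.mul (wvar wCode) (.add (wvar wN) (.const 1)))
        (.add (wvar wV) (.const 1)))) .skip))))

/-- Enter the subtrees with one vertex into the queue. -/
def initProg : Program :=
  .seq (forLoop wV (wvar wN)
    (.seq (.setWord wMem (row (.add (wvar wV) (.const 1)) (wvar wV)) (.const 1))
    (.seq (.setWord wSize (.add (wvar wV) (.const 1)) (.const 1))
      (.setWord wQueue (wvar wV) (.add (wvar wV) (.const 1))))))
  (setVar wCount (wvar wN))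

/-- Extend the subtree `wX` by the edge `wE` and enter the result into the queue if it is new, that
is, if the size stored for its code is still zero. -/
def extendProg : Program :=
  .seq (forLoop wV (wvar wN) (.setWord wMark (wvar wV) (.read wMem (row (wvar wX) (wvar wV)))))
  (.seq (.setWord wMark (.read wEA (wvar wE)) (.const 1))
  (.seq (.setWord wMark (.read wEB (wvar wE)) (.const 1))
  (.seq codeProg
  (.ite (.wordLE (.read wSize (wvar wCode)) (.const 0))
    (.seq (.setWord wSize (wvar wCode) (.add (.read wSize (wvar wX)) (.const 1)))
    (.seq (.setWord wQueue (wvar wCount) (wvar wCode))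
    (.seq (incr wCount)
    (forLoop wV (wvar wN)
      (.setWord wMem (row (wvar wCode) (wvar wV)) (.read wMark (wvar wV))))))) .skip))))

/-- Enumerate all subtrees, in the order of their numbers of edges. -/
def queueProg : Program :=
  .seq initProg
  (.seq (setVar wI (.const 0))
  (.while (wlt (wvar wI) (wvar wCount))
    (.seq (setVar wX (.read wQueue (wvar wI)))
    (.seq (forLoop wE mExp
      (.ite (.and (.wordLE (.read wMem (row (wvar wX) (.read wEA (wvar wE))))
            (.read wMem (row (wvar wX) (.read wEB (wvar wE)))))
          (.wordLE (.read wMem (row (wvar wX) (.read wEB (wvar wE))))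
            (.read wMem (row (wvar wX) (.read wEA (wvar wE))))))
        .skip extendProg))
    (incr wI)))))

/-- The number of edges of the subtree with code `x`. -/
abbrev edgesExp (x : WExp) : WExp := .sub (.read wSize x) (.const 1)

/-- The total weight of the pairs of vertices of the subtree `wX`. -/
def totalProg : Program :=
  .seq (setReal rSW (.const 0))
  (.seq (forLoop wU (wvar wN) (forLoop wV (wvar wN)
    (.ite (.and (wlt (wvar wU) (wvar wV)) (.and (isOne (.read wMem (row (wvar wX) (wvar wU))))
        (isOne (.read wMem (row (wvar wX) (wvar wV))))))
      (setReal rSW (.add (nvar rSW) (.read rWt (row (wvar wU) (wvar wV))))) .skip)))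
  (.setNum rTot (wvar wX) (nvar rSW)))

/-- Compute the codes of the two sides of the edge `wE` in the subtree `wX`. -/
def splitProg : Program :=
  .seq (forLoop wV (wvar wN)
    (.ite (.and (isOne (.read wMem (row (wvar wX) (wvar wV))))
        (isOne (.read wSide (row (wvar wE) (wvar wV)))))
      (.setWord wMark (wvar wV) (.const 1)) (.setWord wMark (wvar wV) (.const 0))))
  (.seq codeProg
  (.seq (setVar wY (wvar wCode))
  (.seq (forLoop wV (wvar wN)
    (.ite (.and (isOne (.read wMem (row (wvar wX) (wvar wV))))
        (.not (isOne (.read wSide (row (wvar wE) (wvar wV))))))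
      (.setWord wMark (wvar wV) (.const 1)) (.setWord wMark (wvar wV) (.const 0))))
  (.seq codeProg
  (setVar wZ (wvar wCode))))))

/-- Append the next edge of the sequence of the subtree `z` to the merged sequence. -/
def takeProg (z a : ℕ) : Program :=
  .seq (.setWord wBuf (wvar wT) (.read wSeq (row (wvar z) (wvar a))))
  (.seq (.setNum rBuf (wvar wT) (.read rGain (row (wvar z) (wvar a)))) (incr a))

/-- Merge the sequences of the subtrees `wY` and `wZ` by their keys. Keys are compared by
cross-multiplication. -/
def mergeProg : Program :=
  .seq (setVar wA (.const 0))
  (.seq (setVar wB (.const 0))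
  (forLoop wT (.sub (edgesExp (wvar wX)) (.const 1))
    (.ite (wlt (wvar wB) (edgesExp (wvar wZ)))
      (.ite (.and (wlt (wvar wA) (edgesExp (wvar wY)))
          (.numLE
            (.mul (.read rKeyW (row (wvar wZ) (wvar wB))) (.read rKeyP (row (wvar wY) (wvar wA))))
            (.mul (.read rKeyW (row (wvar wY) (wvar wA))) (.read rKeyP (row (wvar wZ) (wvar wB))))))
        (takeProg wY wA) (takeProg wZ wB))
      (takeProg wY wA))))

/-- Append the edge `wE` to the merged sequence. Its gain is the total weight in the subtree minus
the total weights in its two sides. -/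
def appendProg : Program :=
  .seq (.setWord wBuf (.sub (edgesExp (wvar wX)) (.const 1)) (wvar wE))
  (.setNum rBuf (.sub (edgesExp (wvar wX)) (.const 1))
    (.sub (.sub (.read rTot (wvar wX)) (.read rTot (wvar wY))) (.read rTot (wvar wZ))))

/-- Compute the objective value of the merged sequence, as the sum of gains times completion
times. -/
def objProg : Program :=
  .seq (setReal rObj (.const 0))
  (.seq (setReal rTime (.const 0))
  (forLoop wT (edgesExp (wvar wX))
    (.seq (setReal rTime (.add (nvar rTime) (.read rLen (.read wBuf (wvar wT)))))
      (setReal rObj (.add (nvar rObj) (.mul (.read rBuf (wvar wT)) (nvar rTime)))))))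

/-- Print the merged sequence. -/
def printBuf : Program :=
  .seq (.print (edgesExp (wvar wX)))
  (forLoop wT (edgesExp (wvar wX)) (.print (.read wBuf (wvar wT))))

/-- Choose the merged sequence for the subtree `wX`. -/
def storeProg : Program :=
  .seq (setVar wFlag (.const 1))
  (.seq (setReal rBest (nvar rObj))
  (forLoop wT (edgesExp (wvar wX))
    (.seq (.setWord wSeq (row (wvar wX) (wvar wT)) (.read wBuf (wvar wT)))
      (.setNum rGain (row (wvar wX) (wvar wT)) (.read rBuf (wvar wT))))))

/-- Choose the merged sequence if it is the first one or better than the earlier ones. -/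
def chooseProg : Program :=
  .ite (.and (isOne (wvar wFlag)) (.numLE (nvar rBest) (nvar rObj))) .skip storeProg

/-- Treat the last edge `wE` for the subtree `wX`. -/
def edgeProg : Program :=
  .seq splitProg (.seq mergeProg (.seq appendProg (.seq objProg (.seq printBuf chooseProg))))

/-- Print the sequence of the subtree `wX`. -/
def printSeq : Program :=
  .seq (.print (edgesExp (wvar wX)))
  (forLoop wT (edgesExp (wvar wX)) (.print (.read wSeq (row (wvar wX) (wvar wT)))))

/-- Extend the initial part which begins at `wU` by one edge, and update its best density. -/
def densStep : Program :=
  .seq (setReal rSW (.add (nvar rSW) (.read rGain (row (wvar wX) (.add (wvar wU) (wvar wV))))))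
  (.seq (setReal rSP (.add (nvar rSP)
      (.read rLen (.read wSeq (row (wvar wX) (.add (wvar wU) (wvar wV)))))))
    (.ite (.and (isOne (wvar wV))
        (.numLE (.mul (nvar rSW) (nvar rBP)) (.mul (nvar rBW) (nvar rSP)))) .skip
      (.seq (setReal rBW (nvar rSW)) (setReal rBP (nvar rSP)))))

/-- Compute the keys of the sequence of the subtree `wX`. -/
def keysProg : Program :=
  forLoop wU (edgesExp (wvar wX))
    (.seq (setReal rSW (.const 0))
    (.seq (setReal rSP (.const 0))
    (.seq (forLoop wV (.sub (edgesExp (wvar wX)) (wvar wU)) densStep)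
    (.seq (.ite (.and (isOne (wvar wU))
        (.numLE (.mul (nvar rCW) (nvar rBP)) (.mul (nvar rBW) (nvar rCP)))) .skip
      (.seq (setReal rCW (nvar rBW)) (setReal rCP (nvar rBP))))
    (.seq (.setNum rKeyW (row (wvar wX) (wvar wU)) (nvar rCW))
      (.setNum rKeyP (row (wvar wX) (wvar wU)) (nvar rCP)))))))

/-- Treat the subtree `wX`: try all last edges and choose the best one. -/
def treeProg : Program :=
  .seq totalProg
  (.seq (setVar wFlag (.const 0))
  (.seq (forLoop wE mExp
    (.ite (.and (isOne (.read wMem (row (wvar wX) (.read wEA (wvar wE)))))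
        (isOne (.read wMem (row (wvar wX) (.read wEB (wvar wE)))))) edgeProg .skip))
  (.seq printSeq keysProg)))

/-- The dynamic program over the queue of subtrees, without the subtrees with one vertex. -/
def dpProg : Program :=
  forLoop wI (.sub (wvar wCount) (wvar wN))
    (.seq (setVar wX (.read wQueue (.add (wvar wN) (wvar wI)))) treeProg)

/-- The whole program. -/
def mainProg : Program :=
  .seq sideProg (.seq queueProg (.seq dpProg
    (.seq (setVar wX (.read wQueue (.sub (wvar wCount) (.const 1)))) printSeq)))

/-! ### The input and the edge list -/

variable {n M : ℕ} {N : Network (Fin n)} {es : List (Fin n × Fin n)} {s s' : State}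

/-- The pair number `i` of the edge list as an edge. -/
abbrev toEdge (p : Fin n × Fin n) : Sym2 (Fin n) := s(p.1, p.2)

/-- The input arrays contain the network. -/
structure Env (N : Network (Fin n)) (es : List (Fin n × Fin n)) (s : State) : Prop where
  n_eq : s.word wN 0 = n
  ea : ∀ (i : ℕ) (h : i < es.length), s.word wEA i = es[i].1
  eb : ∀ (i : ℕ) (h : i < es.length), s.word wEB i = es[i].2
  len : ∀ (i : ℕ) (h : i < es.length), s.num rLen i = N.len (toEdge es[i])
  wt : ∀ u v : Fin n, s.num rWt (u * n + v) = N.wt s(u, v)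

lemma Env.of_eq (h : Env N es s) (h0 : s'.word wN = s.word wN) (h1 : s'.word wEA = s.word wEA)
    (h2 : s'.word wEB = s.word wEB) (h3 : s'.num rLen = s.num rLen)
    (h4 : s'.num rWt = s.num rWt) : Env N es s' :=
  ⟨by rw [h0, h.n_eq], by rw [h1]; exact h.ea, by rw [h2]; exact h.eb, by rw [h3]; exact h.len,
    by rw [h4]; exact h.wt⟩

/-- A program which does not write into the input arrays. -/
def keepsInput (P : Program) : Bool :=
  !P.wmods.contains wN && !P.wmods.contains wEA && !P.wmods.contains wEB &&
    !P.nmods.contains rLen && !P.nmods.contains rWt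

lemma Env.frame (h : Env N es s) {P : Program} (hF : Frame P s s')
    (hP : keepsInput P = true) : Env N es s' := by
  simp only [keepsInput, Bool.and_eq_true, Bool.not_eq_true', List.contains_eq_mem,
    decide_eq_false_iff_not] at hP
  exact h.of_eq (hF.word _ hP.1.1.1.1) (hF.word _ hP.1.1.1.2) (hF.word _ hP.1.1.2)
    (hF.num _ hP.1.2) (hF.num _ hP.2)

lemma env_input (N : Network (Fin n)) (es : List (Fin n × Fin n)) : Env N es (input N es) where
  n_eq := rfl
  ea i h := by simp [input, h]
  eb i h := by simp [input, h]
  len i h := by simp [input, h]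
  wt u v := by
    have h : (u : ℕ) * n + v < n * n := by
      have := u.2; have := v.2; nlinarith
    have hs : finProdFinEquiv.symm ⟨u * n + v, h⟩ = (u, v) := by
      rw [Equiv.symm_apply_eq]
      ext
      simp [finProdFinEquiv]; ring
    simp only [input, h, dif_pos, hs]

lemma ListsEdges.mem_edgeSet {G : SimpleGraph (Fin n)} (h : ListsEdges G es) {i : ℕ}
    (hi : i < es.length) : toEdge es[i] ∈ G.edgeSet :=
  (h.2 _).1 (List.mem_map.2 ⟨es[i], List.getElem_mem hi, rfl⟩)

lemma ListsEdges.exists_index {G : SimpleGraph (Fin n)} (h : ListsEdges G es) {e : Sym2 (Fin n)}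
    (he : e ∈ G.edgeSet) : ∃ (i : ℕ) (hi : i < es.length), toEdge es[i] = e := by
  obtain ⟨p, hp, rfl⟩ := List.mem_map.1 ((h.2 e).2 he)
  obtain ⟨i, hi, rfl⟩ := List.mem_iff_getElem.1 hp
  exact ⟨i, hi, rfl⟩

lemma ListsEdges.index_inj {G : SimpleGraph (Fin n)} (h : ListsEdges G es) {i j : ℕ}
    (hi : i < es.length) (hj : j < es.length) (hij : toEdge es[i] = toEdge es[j]) : i = j := by
  refine (h.1.getElem_inj_iff (i := i) (hi := by simpa using hi) (j := j)
    (hj := by simpa using hj)).1 ?_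
  simpa using hij

lemma ListsEdges.countP_eq {G : SimpleGraph (Fin n)} (h : ListsEdges G es)
    (X : Finset (Fin n)) (v : Fin n) :
    es.countP (fun p => p.1 ∈ X ∧ p.2 ∈ X ∧ (v = p.1 ∨ v = p.2)) = edgeDeg G X v := by
  classical
  have h1 : es.countP (fun p => p.1 ∈ X ∧ p.2 ∈ X ∧ (v = p.1 ∨ v = p.2)) =
      (es.map toEdge).countP fun e => decide (e ∈ edgesIn G X ∧ v ∈ e) := by
    rw [List.countP_map]
    refine List.countP_congr fun p hp => ?_
    have hadj : G.Adj p.1 p.2 := (h.2 _).1 (List.mem_map.2 ⟨p, hp, rfl⟩)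
    simp [toEdge, mem_innerEdges, hadj, and_assoc]
  rw [h1, edgeDeg, List.countP_eq_length_filter, ← List.toFinset_card_of_nodup (h.1.filter _)]
  congr 1
  ext e
  have := h.2 e
  simp only [List.mem_toFinset, List.mem_filter, decide_eq_true_eq, Finset.mem_filter]
  constructor
  · exact fun h => h.2
  · exact fun h' => ⟨this.2 (mem_edgesIn.1 h'.1).1, h'⟩

lemma ListsEdges.length (hT : N.graph.IsTree) (h : ListsEdges N.graph es) : es.length + 1 = n := by
  classical
  have h1 := card_edgesIn hT _ Finset.univ rfl (conn_coe_univ hT)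
  rw [Finset.card_univ, Fintype.card_fin] at h1
  have h2 : (edgesIn N.graph Finset.univ).card = es.length := by
    rw [← List.length_map (f := toEdge), ← List.toFinset_card_of_nodup h.1]
    congr 1
    ext e
    rw [List.mem_toFinset, h.2, mem_edgesIn]
    simp [innerEdges]
  omega

/-- The word bound suffices for all addresses and values that the program computes. -/
structure Bounds (N : Network (Fin n)) (M : ℕ) : Prop where
  le : (codeBound N.graph + n + 2) * (n + 2) ≤ M

lemma Bounds.row_lt (h : Bounds N M) {x v : ℕ} (hx : x ≤ codeBound N.graph + n) (hv : v < n) :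
    x * n + v < M := by
  have := h.le; nlinarith

lemma Bounds.lt (h : Bounds N M) {x : ℕ} (hx : x ≤ codeBound N.graph + n + 1) : x < M := by
  have := h.le; nlinarith

lemma row_inj {x y u v : ℕ} (hu : u < n) (hv : v < n) : x * n + u = y * n + v ↔ x = y ∧ u = v := by
  constructor
  · intro h
    have hn : 0 < n := by omega
    have h1 := congrArg (· / n) h
    have h2 := congrArg (· % n) h
    simp only [Nat.mul_comm _ n, Nat.mul_add_div hn, Nat.mul_add_mod, Nat.div_eq_of_lt hu,
      Nat.div_eq_of_lt hv, Nat.mod_eq_of_lt hu, Nat.mod_eq_of_lt hv, add_zero] at h1 h2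
    exact ⟨h1, h2⟩
  · rintro ⟨rfl, rfl⟩; rfl

end RAM

/-! ### Codes of marked sets -/

namespace RAM

variable {n M : ℕ} {N : Network (Fin n)} {es : List (Fin n × Fin n)} {s s' : State}

/-- The cells `f 0, …, f (n - 1)` of the word array `a` are the indicator function of `X`. -/
def Marks (s : State) (a : ℕ) (f : ℕ → ℕ) (X : Finset (Fin n)) : Prop :=
  ∀ v : Fin n, s.word a (f v) = if v ∈ X then 1 else 0

lemma Marks.congr {a : ℕ} {f : ℕ → ℕ} {X : Finset (Fin n)} (h : Marks s a f X)
    (h' : s'.word a = s.word a) : Marks s' a f X := fun v => by rw [h']; exact h v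

lemma Marks.one_le {a : ℕ} {f : ℕ → ℕ} {X : Finset (Fin n)} (h : Marks s a f X) (v : Fin n) :
    1 ≤ s.word a (f v) ↔ v ∈ X := by rw [h v]; split_ifs <;> simp_all

lemma Bounds.one_mod (hB : Bounds N M) : 1 % M = 1 :=
  Nat.mod_eq_of_lt (by have := hB.le; nlinarith [Nat.zero_le (codeBound N.graph)])

lemma Bounds.mod_eq (hB : Bounds N M) {x : ℕ} (hx : x ≤ codeBound N.graph + n + 1) :
    x % M = x := Nat.mod_eq_of_lt (hB.lt hx)

/-- The degrees in the marked set are counted along the edge list. -/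
lemma runs_degrees (hL : ListsEdges N.graph es) (hlen : es.length + 1 = n) (hB : Bounds N M)
    (hE : Env N es s) {X : Finset (Fin n)} (hm : Marks s wMark id X)
    (h0 : ∀ v : Fin n, s.word wDeg v = 0) :
    Runs M (forLoop wV mExp
    (.ite (.and (isOne (.read wMark (.read wEA (wvar wV))))
        (isOne (.read wMark (.read wEB (wvar wV)))))
      (.seq (.setWord wDeg (.read wEA (wvar wV))
          (.add (.read wDeg (.read wEA (wvar wV))) (.const 1)))
        (.setWord wDeg (.read wEB (wvar wV))
          (.add (.read wDeg (.read wEB (wvar wV))) (.const 1)))) .skip)) s (100 * n)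
      fun s' => ∀ v : Fin n, s'.word wDeg v = edgeDeg N.graph X v := by
  have h1 := hB.one_mod
  refine Runs.forLoop (N := es.length) (T := 60)
    (fun k s' => ∀ v : Fin n, s'.word wDeg v =
      (es.take k).countP (fun p => p.1 ∈ X ∧ p.2 ∈ X ∧ (v = p.1 ∨ v = p.2)))
    (by decide) (hB.lt (by omega)) ?_ ?_ ?_ ?_ ?_
  · intro s' hF
    have := (hE.frame hF rfl).n_eq
    simp [this, h1]; omega
  · intro v; simp [h0]
  · intro k s' hk hF hw hI
    have hE' := hE.frame hF rfl
    have hm' := hm.congr (hF.word wMark (by decide))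
    refine Runs.basic rfl (by decide) ?_
    have hadj : N.graph.Adj es[k].1 es[k].2 := hL.mem_edgeSet hk
    have hne := hadj.ne
    have m1 := hm'.one_le es[k].1
    have m2 := hm'.one_le es[k].2
    simp only [id] at m1 m2
    intro v
    have hc := hI v
    have hcle : (es.take k).countP (fun p => p.1 ∈ X ∧ p.2 ∈ X ∧ (v = p.1 ∨ v = p.2)) ≤ k :=
      List.countP_le_length.trans (by simp)
    rw [List.take_succ_eq_append_getElem hk, List.countP_append, List.countP_singleton, ← hc]
    rw [← hc] at hcle
    have hmod := hB.mod_eq (x := s'.word wDeg v + 1) (by omega)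
    simp only [Program.den, Test.holds, WExp.eval, Nat.zero_mod, h1, hw, hE'.ea k hk,
      hE'.eb k hk, m1, m2]
    by_cases hX : es[k].1 ∈ X ∧ es[k].2 ∈ X
    · rw [if_pos hX]
      by_cases hv1 : v = es[k].1
      · subst hv1; simp [hX, hmod, hw, hE'.eb k hk, Fin.val_inj, hne]
      · by_cases hv2 : v = es[k].2
        · subst hv2; simp [hX, hmod, hw, hE'.eb k hk, Fin.val_inj, hne.symm]
        · simp [hX, hw, hE'.eb k hk, Fin.val_inj, hv1, hv2]
    · rw [if_neg hX]
      have : ¬ (es[k].1 ∈ X ∧ es[k].2 ∈ X ∧ (v = es[k].1 ∨ v = es[k].2)) := by tauto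
      simp [this]
  · intro s' hF hI v
    rw [hI v, List.take_length, hL.countP_eq]
  · simp only [WExp.time]; omega

/-- The leaves of the marked set are its vertices of degree at most one; in the case of a single
vertex, its degree is zero. -/
lemma runs_horner (hT : N.graph.IsTree) (hB : Bounds N M)
    (hE : Env N es s) {X : Finset (Fin n)} (hX : Conn N.graph (X : Set (Fin n)))
    (hm : Marks s wMark id X)
    (hd : ∀ v : Fin n, s.word wDeg v = edgeDeg N.graph X v) (h0 : s.word wCode 0 = 0) :
    Runs M (forLoop wV (wvar wN)
    (.ite (.and (isOne (.read wMark (wvar wV))) (.wordLE (.read wDeg (wvar wV)) (.const 1)))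
      (setVar wCode (.add (.mul (wvar wCode) (.add (wvar wN) (.const 1)))
        (.add (wvar wV) (.const 1)))) .skip)) s (100 * n + 20)
      fun s' => s'.word wCode 0 = code N.graph X := by
  have h1 := hB.one_mod
  refine Runs.forLoop (N := n) (T := 60)
    (fun k s' => s'.word wCode 0 =
      horner (((List.finRange n).take k).filter (· ∈ leaves N.graph X)))
    (by decide) (hB.lt (by omega)) ?_ ?_ ?_ ?_ ?_
  · intro s' hF
    have := (hE.frame hF rfl).n_eq
    simp [this]
  · simp [h0, horner]
  · intro k s' hk hF hw hI
    have hE' := hE.frame hF rfl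
    have hm' := hm.congr (hF.word wMark (by decide))
    have hd' : s'.word wDeg k = edgeDeg N.graph X ⟨k, hk⟩ := by
      rw [hF.word wDeg (by decide)]; exact hd ⟨k, hk⟩
    refine Runs.basic rfl (by decide) ?_
    have m1 := hm'.one_le ⟨k, hk⟩
    simp only [id] at m1
    have hk' : k < (List.finRange n).length := by simpa using hk
    have hlt : horner (((List.finRange n).take (k + 1)).filter (· ∈ leaves N.graph X)) <
        codeBound N.graph := by
      refine (horner_lt _).trans_le (Nat.pow_le_pow_right (Nat.succ_pos n) ?_)
      have hs : (((List.finRange n).take (k + 1)).filter (· ∈ leaves N.graph X)).Sublist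
          (leafList N.graph X) := (List.take_sublist _ _).filter _
      exact hs.length_le.trans (by rw [length_leafList]; exact card_leaves_le hT hX)
    rw [List.take_succ_eq_append_getElem hk', List.filter_append] at hlt ⊢
    simp only [List.getElem_finRange] at hlt ⊢
    simp only [Program.den, Test.holds, WExp.eval, Nat.zero_mod, h1, hw, hE'.n_eq, m1, hd', hI]
    by_cases hv : (⟨k, hk⟩ : Fin n) ∈ leaves N.graph X
    · have hv' := hv
      rw [leaves, Finset.mem_filter] at hv'
      rw [if_pos hv']
      have hf : [(⟨k, hk⟩ : Fin n)].filter (· ∈ leaves N.graph X) = [⟨k, hk⟩] := by simp [hv]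
      rw [show Fin.cast (List.length_finRange (n := n)) ⟨k, hk'⟩ = ⟨k, hk⟩ from rfl, hf,
        horner_concat] at hlt ⊢
      simp only [State.word_setWord]
      simp only [Nat.mod_add_mod, Nat.add_mod_mod, Nat.mul_mod_mod]
      simp
      exact hB.mod_eq (by simpa using hlt.le.trans (by omega))
    · have hv' := hv
      rw [leaves, Finset.mem_filter] at hv'
      rw [if_neg hv']
      have hf : [(⟨k, hk⟩ : Fin n)].filter (· ∈ leaves N.graph X) = [] := by simp [hv]
      rw [show Fin.cast (List.length_finRange (n := n)) ⟨k, hk'⟩ = ⟨k, hk⟩ from rfl, hf]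
      simp [hI]
  · intro s' hF hI
    rw [hI, code, leafList, List.take_of_length_le (by simp)]
  · simp only [WExp.time]; omega

lemma runs_codeProg (hT : N.graph.IsTree) (hL : ListsEdges N.graph es) (hB : Bounds N M)
    (hE : Env N es s) {X : Finset (Fin n)} (hX : Conn N.graph (X : Set (Fin n)))
    (hm : Marks s wMark id X) :
    Runs M codeProg s (300 * n) fun s' => s'.word wCode 0 = code N.graph X := by
  have hlen := hL.length hT
  have hn : 1 ≤ n := by omega
  have hclear : Runs M (forLoop wV (wvar wN) (.setWord wDeg (wvar wV) (.const 0))) s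
      (20 * n + 20) fun s' => ∀ v : Fin n, s'.word wDeg v = 0 := by
    refine Runs.forLoop (N := n) (T := 6) (fun k s' => ∀ v < k, s'.word wDeg v = 0)
      (by decide) (hB.lt (by omega)) ?_ ?_ ?_ ?_ ?_
    · intro s' hF
      have := (hE.frame hF rfl).n_eq
      simp [this]
    · simp
    · intro k s' hk hF hw hI
      refine Runs.basic rfl (by decide) ?_
      intro v hv
      simp only [Program.den, WExp.eval, Nat.zero_mod, hw, State.word_setWord]
      have := hI v
      simp
      intro; exact this (by omega)
    · intro s' hF hI v; exact hI v v.2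
    · simp only [WExp.time]; omega
  refine Runs.seq hclear (T₂ := 300 * n - (20 * n + 20)) ?_ (by omega)
  intro s₁ hF₁ hd₁
  refine Runs.seq (runs_degrees hL hlen hB (hE.frame hF₁ rfl)
    (hm.congr (hF₁.word _ (by decide))) hd₁) (T₂ := 100 * n + 24) ?_ (by omega)
  intro s₂ hF₂ hd₂
  refine Runs.seq (T₁ := 4) (R := fun s' => s'.word wCode 0 = 0 )
    (Runs.basic rfl (by decide) (by simp)) (T₂ := 100 * n + 20) ?_ (by omega)
  intro s₃ hF₃ h0
  exact runs_horner hT hB (((hE.frame hF₁ rfl).frame hF₂ rfl).frame hF₃ rfl) hX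
    (((hm.congr (hF₁.word _ (by decide))).congr (hF₂.word _ (by decide))).congr
      (hF₃.word _ (by decide)))
    (by rw [hF₃.word wDeg (by decide)]; exact hd₂) h0

end RAM

/-! ### Sides of edges -/

namespace RAM

variable {n M : ℕ} {N : Network (Fin n)} {es : List (Fin n × Fin n)} {s s' : State}

/-- The table of the sides of the edges: row `e` marks the side of the first end of edge `e`. -/
def SideTable (N : Network (Fin n)) (es : List (Fin n × Fin n)) (s : State) : Prop :=
  ∀ (e : ℕ) (h : e < es.length), Marks s wSide (e * n + ·)
    (sideFin N.graph Finset.univ (toEdge es[e]) es[e].1)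

lemma mul_add_lt_bound (hB : Bounds N M) {e v : ℕ} (he : e < n) (hv : v < n) :
    e * n + v < M := hB.row_lt (by omega) hv

/-- One round of the search: the marked set `R` grows within the side of `a`, and the result has
all neighbours of `R` across edges other than the edge `k`. -/
lemma runs_sideStep_loop (hL : ListsEdges N.graph es) (hlen : es.length + 1 = n) (hB : Bounds N M)
    (hE : Env N es s) {k : ℕ} (hk : k < es.length) (hw : s.word wE 0 = k)
    {R : Finset (Fin n)} (hR : Marks s wSide (k * n + ·) R) {a : Fin n}
    (hRa : ∀ v ∈ R, Rch (cut N.graph (toEdge es[k])) a v) :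
    Runs M (forLoop wV mExp sideStep) s (200 * n) fun s' =>
      (∀ e, e ≠ k → ∀ v : Fin n, s'.word wSide (e * n + v) = s.word wSide (e * n + v)) ∧
      ∃ R' : Finset (Fin n), Marks s' wSide (k * n + ·) R' ∧ R ⊆ R' ∧
        (∀ v ∈ R', Rch (cut N.graph (toEdge es[k])) a v) ∧
        ∀ x y, x ∈ R → s(x, y) ∈ cut N.graph (toEdge es[k]) → y ∈ R' := by
  have h1 := hB.one_mod
  have hM0 : 0 % M = 0 := Nat.zero_mod M
  refine Runs.forLoop (N := es.length) (T := 120)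
    (fun j s' => (∀ e, e ≠ k → ∀ v : Fin n, s'.word wSide (e * n + v) = s.word wSide (e * n + v)) ∧
      ∃ R' : Finset (Fin n), Marks s' wSide (k * n + ·) R' ∧ R ⊆ R' ∧
        (∀ v ∈ R', Rch (cut N.graph (toEdge es[k])) a v) ∧
        ∀ x y, x ∈ R → ∀ i, i < j → ∀ hi : i < es.length, i ≠ k →
          toEdge es[i] = s(x, y) → y ∈ R')
    (by decide) (hB.lt (by omega)) ?_ ?_ ?_ ?_ ?_
  · intro s' hF
    have := (hE.frame hF rfl).n_eq
    simp [this, h1]; omega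
  · refine ⟨by simp, R, fun v => by simpa using hR v, subset_rfl, hRa, by simp⟩
  · rintro j s' hj hF hwj ⟨hI1, R', hR', hsub, hRch, hcl⟩
    have hE' := hE.frame hF rfl
    have hwk : s'.word wE 0 = k := by rw [hF.word _ (by decide), hw]
    refine Runs.basic rfl (by decide) ?_
    by_cases hjk : j = k
    · subst hjk
      refine ⟨?_, R', ?_, hsub, hRch, ?_⟩
      · intro e he v
        simpa [sideStep, Program.den, hwj, hwk] using hI1 e he v
      · intro v
        simpa [sideStep, Program.den, hwj, hwk] using hR' v
      · intro x y hx i hi hi' hij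
        exact hcl x y hx i (by omega) hi' hij
    · have hcond : ¬ (j ≤ k ∧ k ≤ j) := by omega
      set p := (es[j]).1 with hp
      set q := (es[j]).2 with hq
      have hpq : s(p, q) ∈ cut N.graph (toEdge es[k]) :=
        ⟨hL.mem_edgeSet hj, fun h => hjk (hL.index_inj hj hk h)⟩
      have haddr : ∀ v : Fin n, (k * n % M + v) % M = k * n + v := fun v => by
        rw [Nat.mod_add_mod, Nat.mod_eq_of_lt (mul_add_lt_bound hB (by omega) v.2)]
      have mp := hR'.one_le p
      have mq := hR'.one_le q
      have hrow : ∀ (e : ℕ) (u v : Fin n), e * n + u = k * n + v ↔ e = k ∧ u = v := fun e u v => by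
        rw [row_inj u.2 v.2, Fin.val_inj]
      -- the set of marked vertices after the step
      refine ⟨?_, R' ∪ (if p ∈ R' ∨ q ∈ R' then {p, q} else ∅), ?_, ?_, ?_, ?_⟩
      · intro e he v
        rw [← hI1 e he v]
        simp only [sideStep, Program.den, Test.holds, WExp.eval, hM0, hwj, hwk, hE'.ea j hj,
          hE'.eb j hj, hE'.n_eq, ← hp, ← hq, haddr, h1, if_neg hcond]
        by_cases hp' : p ∈ R' <;>
          simp [mp, hp', hwj, hwk, hE'.ea j hj, hE'.eb j hj, hE'.n_eq, ← hp, ← hq, haddr, hrow, he]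
        by_cases hq' : q ∈ R' <;>
          simp [mq, hq', hrow, he]
      · intro v
        have hv := hR' v
        have hqq : (q : ℕ) = q := rfl
        simp only at hv ⊢
        simp only [sideStep, Program.den, Test.holds, WExp.eval, hM0, hwj, hwk, hE'.ea j hj,
          hE'.eb j hj, hE'.n_eq, ← hp, ← hq, haddr, h1, if_neg hcond]
        by_cases hp' : p ∈ R'
        · simp [mp, hp', hwj, hwk, hE'.ea j hj, hE'.eb j hj, hE'.n_eq, ← hp, ← hq, haddr, hv,
            Fin.val_inj]
          by_cases hv1 : v = p
          · simp [hv1, hp']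
          · by_cases hv2 : v = q <;> simp [hv1, hv2]
        · by_cases hq' : q ∈ R'
          · simp [mp, mq, hp', hq', hwj, hwk, hE'.ea j hj, hE'.eb j hj, hE'.n_eq, ← hp, ← hq, haddr,
              hv, Fin.val_inj]
            by_cases hv1 : v = p
            · simp [hv1]
            · by_cases hv2 : v = q
              · simp [hv2, hq']
              · simp [hv1]
          · simp [mp, mq, hp', hq', hwj, hwk, hE'.eb j hj, hE'.n_eq, ← hq, haddr, hv]
      · exact hsub.trans Finset.subset_union_left
      · intro v hv
        rcases Finset.mem_union.1 hv with hv | hv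
        · exact hRch v hv
        · split_ifs at hv with hpq'
          · have hap : Rch (cut N.graph (toEdge es[k])) a p ∧
                Rch (cut N.graph (toEdge es[k])) a q := by
              rcases hpq' with h | h
              · exact ⟨hRch p h, (hRch p h).trans (Rch.of_mem hpq)⟩
              · exact ⟨(hRch q h).trans (Rch.of_mem hpq).symm, hRch q h⟩
            rcases Finset.mem_insert.1 hv with rfl | hv
            · exact hap.1
            · rw [Finset.mem_singleton.1 hv]; exact hap.2
          · simp at hv
      · intro x y hx i hi hi' hik hxy
        rcases Nat.lt_succ_iff_lt_or_eq.1 hi with hi | rfl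
        · exact Finset.mem_union_left _ (hcl x y hx i hi hi' hik hxy)
        · have hxR := hsub hx
          have hxy' : s(p, q) = s(x, y) := hxy
          rcases Sym2.eq_iff.1 hxy' with ⟨h, h'⟩ | ⟨h, h'⟩
          · have : p ∈ R' := h ▸ hxR
            simp [this, ← h']
          · have : q ∈ R' := h' ▸ hxR
            simp [this, ← h]
  · rintro s' hF ⟨h, R', hR', hsub, hRch, hcl⟩
    refine ⟨h, R', hR', hsub, hRch, fun x y hx hxy => ?_⟩
    obtain ⟨i, hi, hie⟩ := hL.exists_index hxy.1
    refine hcl x y hx i hi hi ?_ hie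
    rintro rfl
    exact hxy.2 hie.symm
  · simp only [WExp.time]; omega

lemma runs_sideProg (hT : N.graph.IsTree) (hL : ListsEdges N.graph es) (hB : Bounds N M)
    (hE : Env N es s) (h0 : ∀ i, s.word wSide i = 0) :
    Runs M sideProg s (1000 * n * n * n) (SideTable N es) := by
  have hlen := hL.length hT
  have h1 := hB.one_mod
  have hM0 : 0 % M = 0 := Nat.zero_mod M
  have hnn : n ≤ n * n := Nat.le_mul_self n
  have hnnn : n * n ≤ n * n * n := Nat.le_mul_of_pos_right _ (by omega)
  refine Runs.forLoop (N := es.length) (T := 250 * (n * n))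
    (fun k s' => (∀ (e : ℕ) (h : e < es.length), e < k → Marks s' wSide (e * n + ·)
      (sideFin N.graph Finset.univ (toEdge es[e]) es[e].1)) ∧
      ∀ e, k ≤ e → ∀ v : Fin n, s'.word wSide (e * n + v) = 0)
    (by decide) (hB.lt (by omega)) ?_ ?_ ?_ ?_ ?_
  · intro s' hF
    have := (hE.frame hF rfl).n_eq
    simp [this, h1]; omega
  · exact ⟨by simp, by simp [h0]⟩
  · rintro k s₁ hk hF hwk ⟨hI1, hI2⟩
    have hE₁ := hE.frame hF rfl
    set a := es[k].1 with ha
    have hrow : ∀ (e : ℕ) (u v : Fin n), e * n + u = k * n + v ↔ e = k ∧ u = v := fun e u v => by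
      rw [row_inj u.2 v.2, Fin.val_inj]
    refine Runs.seq (T₁ := 20) (T₂ := 250 * (n * n) - 20)
      (R := fun s₂ => (∀ e, e ≠ k → ∀ v : Fin n,
        s₂.word wSide (e * n + v) = s₁.word wSide (e * n + v)) ∧ Marks s₂ wSide (k * n + ·) {a})
      (Runs.basic rfl (by decide) ?_) ?_
      (by have : 1 ≤ n * n := Nat.mul_pos (by omega) (by omega)
          omega)
    · have hk' := mul_add_lt_bound hB (show k < n by omega) a.2
      constructor
      · intro e he v
        simp [Program.den, hwk, hE₁.ea k hk, hE₁.n_eq, ← ha, Nat.mod_eq_of_lt hk', hrow, he]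
      · intro v
        have := hI2 k le_rfl v
        simp [Program.den, hwk, hE₁.ea k hk, hE₁.n_eq, ← ha, Nat.mod_eq_of_lt hk', h1, this,
          Fin.val_inj]
    · rintro s₂ hF₂ ⟨ho₂, hm₂⟩
      have hE₂ := hE₁.frame hF₂ rfl
      refine Runs.forLoop (N := n) (T := 200 * n)
        (fun r s₃ => (∀ e, e ≠ k → ∀ v : Fin n,
          s₃.word wSide (e * n + v) = s₁.word wSide (e * n + v)) ∧
          ∃ R' : Finset (Fin n), Marks s₃ wSide (k * n + ·) R' ∧
            (∀ v ∈ R', Rch (cut N.graph (toEdge es[k])) a v) ∧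
            ∀ v (p : (SimpleGraph.fromEdgeSet (cut N.graph (toEdge es[k]))).Walk v a),
              p.length ≤ r → v ∈ R')
        (by decide) (hB.lt (by omega)) ?_ ?_ ?_ ?_ ?_
      · intro s₃ hF₃
        have := (hE₂.frame hF₃ rfl).n_eq
        simp [this]
      · refine ⟨by simpa using ho₂, {a}, fun v => by simpa using hm₂ v, ?_, ?_⟩
        · intro v hv
          rw [Finset.mem_singleton.1 hv]; exact Rch.refl _ _
        · intro v p hp
          rw [SimpleGraph.Walk.eq_of_length_eq_zero (Nat.le_zero.1 hp)]
          simp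
      · rintro r s₃ hr hF₃ hwr ⟨ho₃, R', hR', hRch, hwalk⟩
        have hwk₃ : s₃.word wE 0 = k := by
          rw [hF₃.word _ (by decide), hF₂.word _ (by decide), hwk]
        refine (runs_sideStep_loop hL hlen hB (hE₂.frame hF₃ rfl) hk hwk₃ hR' hRch).imp le_rfl ?_
        rintro s₄ hF₄ ⟨ho₄, R'', hR'', hsub, hRch', hcl⟩
        refine ⟨fun e he v => ?_, R'', fun v => by simpa using hR'' v, hRch', ?_⟩
        · simpa using (ho₄ e he v).trans (ho₃ e he v)
        · intro v p hp
          cases p with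
          | nil => exact hsub (hwalk _ .nil (by simp))
          | @cons _ w _ hadj p =>
            refine hcl w v (hwalk w p (by simpa using hp)) ?_
            rw [Sym2.eq_swap]
            exact ((SimpleGraph.fromEdgeSet_adj _).1 hadj).1
      · rintro s₃ hF₃ ⟨ho₃, R', hR', hRch, hwalk⟩
        have hR'eq : R' = sideFin N.graph Finset.univ (toEdge es[k]) a := by
          ext v
          rw [mem_sideFin]
          refine ⟨fun h => ⟨Finset.mem_univ _, hRch v h⟩, fun h => ?_⟩
          obtain ⟨p, hp⟩ := h.2.symm.exists_isPath
          exact hwalk v p (by simpa using hp.length_lt.le)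
        constructor
        · intro e he hek v
          rcases Nat.lt_succ_iff_lt_or_eq.1 hek with hek | rfl
          · rw [← hI1 e he hek v, ← ho₃ e (by omega) v]
            simp
          · rw [hR'eq] at hR'
            simpa using hR' v
        · intro e hek v
          rw [← hI2 e (by omega) v, ← ho₃ e (by omega) v]
          simp
      · simp only [WExp.time]
        have : n * (200 * n + (1 + 1) + 11) = 200 * (n * n) + 13 * n := by ring
        rcases Nat.lt_or_ge n 3 with hn3 | hn3
        · have : n = 2 := by omega
          subst this; omega
        · have : 3 * n ≤ n * n := Nat.mul_le_mul_right n hn3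
          omega
  · intro s' hF hI
    exact fun e he => hI.1 e he he
  · simp only [WExp.time]
    have h : es.length * (250 * (n * n) + (1 + 1 + 1 + 1) + 11) ≤ n * (250 * (n * n) + 15) :=
      Nat.mul_le_mul (by omega) (by omega)
    have : n * (250 * (n * n) + 15) = 250 * (n * n * n) + 15 * n := by ring
    have : 1000 * n * n * n = 1000 * (n * n * n) := by ring
    omega

end RAM

/-! ### Enumeration of the subtrees -/

section Singleton

variable {n : ℕ} {T : SimpleGraph (Fin n)}

lemma conn_coe_singleton (v : Fin n) : Conn T (({v} : Finset (Fin n)) : Set (Fin n)) := by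
  rw [Finset.coe_singleton]; exact conn_singleton v

lemma code_singleton (hT : T.IsTree) (v : Fin n) : code T {v} = v + 1 := by
  have h := card_edgesIn hT _ {v} rfl (conn_coe_singleton v)
  rw [Finset.card_singleton] at h
  have h0 : edgesIn T {v} = ∅ := Finset.card_eq_zero.1 (by omega)
  have hl : leaves T {v} = {v} := by
    ext u; simp [leaves, edgeDeg, h0]
  have : leafList T {v} = [v] := by
    rw [leafList, hl]
    refine List.perm_singleton.1 ((List.perm_ext_iff_of_nodup
      ((List.nodup_finRange n).filter _) (List.nodup_singleton v)).2 fun u => ?_)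
    simp
  simp [code, this, horner]

/-- A family of vertex sets which contains the singletons and is closed under extensions by an
edge contains all subtrees. -/
lemma mem_of_closed {F : Finset (Fin n) → Prop} (h1 : ∀ v, F {v})
    (hc : ∀ X x y, F X → x ∈ X → y ∉ X → T.Adj x y → F (insert y X)) {Y : Finset (Fin n)}
    (hY : Conn T (Y : Set (Fin n))) : F Y := by
  classical
  obtain ⟨v, hv⟩ := hY.1
  have hne : (Y.powerset.filter fun X => F X ∧ X.Nonempty).Nonempty :=
    ⟨{v}, by simp [h1, Finset.mem_coe.1 hv]⟩
  obtain ⟨X, hX, hmax⟩ := Finset.exists_max_image _ Finset.card hne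
  simp only [Finset.mem_filter, Finset.mem_powerset] at hX hmax
  obtain ⟨hXY, hFX, x₀, hx₀⟩ := hX
  by_contra hcon
  obtain ⟨w, hwY, hwX⟩ : ∃ w ∈ Y, w ∉ X := by
    by_contra h
    push Not at h
    exact hcon ((hXY.antisymm h) ▸ hFX)
  refine hwX ((hY.2 x₀ (hXY hx₀) w hwY).induction (P := (· ∈ X)) hx₀ fun x y hx hxy => ?_)
  by_contra hy
  obtain ⟨hadj, -, hyY⟩ := mem_innerEdges.1 hxy
  have h := hmax (insert y X) ⟨Finset.insert_subset hyY hXY, hc X x y hFX hx hy hadj,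
    Finset.insert_nonempty _ _⟩
  rw [Finset.card_insert_of_notMem hy] at h
  omega

end Singleton

namespace RAM

variable {n M : ℕ} {N : Network (Fin n)} {es : List (Fin n × Fin n)} {s s' : State}

/-- A loop which fills the cells `f 0, …, f (K - 1)` of the word array `a`. -/
lemma runs_fill {i a : ℕ} {b addr val : WExp} {K T : ℕ} {f g : ℕ → ℕ} (hia : i ≠ a) (hK : K < M)
    (hb : ∀ s', Frame (forLoop i b (.setWord a addr val)) s s' → b.eval M s' = K)
    (hf : ∀ u < K, ∀ v < K, f u = f v → u = v)
    (haddr : ∀ s', Frame (forLoop i b (.setWord a addr val)) s s' → ∀ v < K, s'.word i 0 = v →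
      addr.eval M s' = f v ∧ val.eval M s' = g v)
    (hT : K * (addr.time + val.time + b.time + 12) + b.time + 8 ≤ T) :
    Runs M (forLoop i b (.setWord a addr val)) s T fun s' =>
      (∀ v < K, s'.word a (f v) = g v) ∧
        ∀ j, (∀ v < K, j ≠ f v) → s'.word a j = s.word a j := by
  refine Runs.forLoop (N := K) (T := addr.time + val.time + 1)
    (fun k s' => (∀ v < k, s'.word a (f v) = g v) ∧
        ∀ j, (∀ v < K, j ≠ f v) → s'.word a j = s.word a j) (by simpa [Program.wmods] using hia)
        hK hb ?_ ?_ ?_ ?_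
  · simp [hia.symm]
  · rintro k s' hk hF hw ⟨hI1, hI2⟩
    obtain ⟨h1, h2⟩ := haddr s' hF k hk hw
    refine Runs.basic rfl le_rfl ⟨fun v hv => ?_, fun j hj => ?_⟩
    · rcases Nat.lt_succ_iff_lt_or_eq.1 hv with hv | rfl
      · have : f v ≠ f k := fun h => by have := hf v (by omega) k hk h; omega
        simp [Program.den, h1, h2, hia.symm, this, hI1 v hv]
      · simp [Program.den, h1, h2, hia.symm]
    · simp [Program.den, h1, h2, hia.symm, hj k hk, hI2 j hj]
  · exact fun s' hF hI => hI
  · have : addr.time + val.time + 1 + b.time + 11 = addr.time + val.time + b.time + 12 := by ring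
    rw [this]; exact hT

/-- The tables describe the list `qs` of subtrees, sorted by size. A subtree that is not in the list
has the size zero at its code, which is how the program recognizes new subtrees. -/
structure Enum (N : Network (Fin n)) (s : State) (qs : List (Finset (Fin n))) : Prop where
  nodup : qs.Nodup
  conn : ∀ X ∈ qs, Conn N.graph (X : Set (Fin n))
  sorted : qs.Pairwise fun X Y => X.card ≤ Y.card
  count : s.word wCount 0 = qs.length
  queue : ∀ (i : ℕ) (h : i < qs.length), s.word wQueue i = code N.graph qs[i]
  size : ∀ X ∈ qs, s.word wSize (code N.graph X) = X.card
  size_zero : ∀ X : Finset (Fin n), Conn N.graph (X : Set (Fin n)) → X ∉ qs →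
    s.word wSize (code N.graph X) = 0
  mem : ∀ X ∈ qs, Marks s wMem (code N.graph X * n + ·) X
  initial : (List.finRange n).map (fun v => {v}) <+: qs
  card_of_le : ∀ (i : ℕ) (h : i < qs.length), n ≤ i → 2 ≤ qs[i].card

lemma Enum.of_eq {qs : List (Finset (Fin n))} (h : Enum N s qs)
    (h1 : s'.word wCount = s.word wCount) (h2 : s'.word wQueue = s.word wQueue)
    (h3 : s'.word wSize = s.word wSize) (h4 : s'.word wMem = s.word wMem) : Enum N s' qs :=
  ⟨h.nodup, h.conn, h.sorted, by rw [h1, h.count], by rw [h2]; exact h.queue,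
    by rw [h3]; exact h.size, by rw [h3]; exact h.size_zero,
    fun X hX => (h.mem X hX).congr h4, h.initial, h.card_of_le⟩

/-- A program which does not write into the tables that describe the list of subtrees. -/
def keepsEnum (P : Program) : Bool :=
  !P.wmods.contains wCount && !P.wmods.contains wQueue && !P.wmods.contains wSize &&
    !P.wmods.contains wMem

lemma Enum.frame {qs : List (Finset (Fin n))} (h : Enum N s qs) {P : Program} (hF : Frame P s s')
    (hP : keepsEnum P = true) : Enum N s' qs := by
  simp only [keepsEnum, Bool.and_eq_true, Bool.not_eq_true', List.contains_eq_mem,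
    decide_eq_false_iff_not] at hP
  exact h.of_eq (hF.word _ hP.1.1.1) (hF.word _ hP.1.1.2) (hF.word _ hP.1.2) (hF.word _ hP.2)

lemma Enum.length_le {qs : List (Finset (Fin n))} (hT : N.graph.IsTree) (h : Enum N s qs) :
    qs.length ≤ codeBound N.graph := by
  have h1 : (qs.map (code N.graph)).Nodup :=
    (List.nodup_map_iff_inj_on h.nodup).2 fun X hX Y hY hXY =>
      code_injective hT (h.conn X hX) (h.conn Y hY) hXY
  have h2 := List.toFinset_card_of_nodup h1
  rw [List.length_map] at h2
  rw [← h2, ← Finset.card_range (codeBound N.graph)]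
  refine Finset.card_le_card fun c hc => ?_
  obtain ⟨X, hX, rfl⟩ := List.mem_map.1 (List.mem_toFinset.1 hc)
  exact Finset.mem_range.2 (code_lt hT (h.conn X hX))

lemma Enum.singleton_mem {qs : List (Finset (Fin n))} (h : Enum N s qs) (v : Fin n) : {v} ∈ qs :=
  h.initial.subset (List.mem_map.2 ⟨v, List.mem_finRange v, rfl⟩)

/-- The queue remains sorted because the new subtree, if any, has one vertex more than `X`, and no
entry of the queue has more vertices than that. -/
lemma runs_extendProg (hT : N.graph.IsTree) (hL : ListsEdges N.graph es) (hB : Bounds N M)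
    (hE : Env N es s) {qs : List (Finset (Fin n))} (hq : Enum N s qs) {X : Finset (Fin n)}
    (hX : X ∈ qs) (hwX : s.word wX 0 = code N.graph X) {j : ℕ} (hj : j < es.length)
    (hwE : s.word wE 0 = j) {Y : Finset (Fin n)} (hY : Y = insert es[j].1 (insert es[j].2 X))
    (hYc : Conn N.graph (Y : Set (Fin n))) (hcard : Y.card = X.card + 1)
    (hle : ∀ Z ∈ qs, Z.card ≤ X.card + 1) :
    Runs M extendProg s (400 * n + 100) fun s' =>
      ∃ qs', Enum N s' qs' ∧ qs <+: qs' ∧ Y ∈ qs' ∧ ∀ Z ∈ qs', Z.card ≤ X.card + 1 := by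
  have hlen := hL.length hT
  have h1 := hB.one_mod
  have hM0 : 0 % M = 0 := Nat.zero_mod M
  have hcX := code_lt hT (hq.conn X hX)
  have hcY := code_lt hT hYc
  have hrowX : ∀ v < n, (code N.graph X * n % M + v) % M = code N.graph X * n + v := fun v hv => by
    rw [Nat.mod_add_mod, Nat.mod_eq_of_lt (hB.row_lt (by omega) hv)]
  have hrowY : ∀ v < n, (code N.graph Y * n % M + v) % M = code N.graph Y * n + v := fun v hv => by
    rw [Nat.mod_add_mod, Nat.mod_eq_of_lt (hB.row_lt (by omega) hv)]
  refine Runs.seq (T₁ := 26 * n + 10) (T₂ := 374 * n + 90)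
    (runs_fill (K := n) (f := id) (g := fun v => s.word wMem (code N.graph X * n + v))
      (by decide) (hB.lt (by omega)) (fun s' hF => ?_)
      (fun u _ v _ h => h) (fun s' hF v hv hwv => ?_) (by simp only [WExp.time]; omega)) ?_
    (by omega)
  · simp [(hE.frame hF rfl).n_eq]
  · have e1 := hF.word wX (by decide)
    have e2 := hF.word wMem (by decide)
    simp [hwv, (hE.frame hF rfl).n_eq, e1, e2, hwX, hrowX v hv]
  rintro s₁ hF₁ ⟨hm₁, -⟩
  have hE₁ := hE.frame hF₁ rfl
  have hq₁ := hq.frame hF₁ rfl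
  have hm₁' : Marks s₁ wMark id X := fun v => (hm₁ v v.2).trans (hq.mem X hX v)
  have hwE₁ : s₁.word wE 0 = j := by rw [hF₁.word _ (by decide), hwE]
  have hwX₁ : s₁.word wX 0 = code N.graph X := by rw [hF₁.word _ (by decide), hwX]
  refine Runs.seq (T₁ := 10) (T₂ := 374 * n + 80) (R := fun s' => s'.word wE 0 = j ∧
      Marks s' wMark id (insert es[j].1 X))
    (Runs.basic rfl (by decide) ⟨by simp [hwE₁], fun v => ?_⟩) ?_ (by omega)
  · have := hm₁' v
    by_cases hv : v = es[j].1 <;>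
      simp_all [Program.den, hE₁.ea j hj, Fin.val_inj]
  rintro s₂ hF₂ ⟨hwE₂, hm₂⟩
  have hE₂ := hE₁.frame hF₂ rfl
  have hq₂ := hq₁.frame hF₂ rfl
  have hwX₂ : s₂.word wX 0 = code N.graph X := by rw [hF₂.word _ (by decide), hwX₁]
  refine Runs.seq (T₁ := 10) (T₂ := 374 * n + 70) (R := fun s' => Marks s' wMark id Y)
    (Runs.basic rfl (by decide) fun v => ?_) ?_ (by omega)
  · have := hm₂ v
    rw [hY]
    by_cases hv : v = es[j].2 <;>
      simp_all [Program.den, hE₂.eb j hj, Fin.val_inj]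
  intro s₃ hF₃ hm₃
  have hE₃ := hE₂.frame hF₃ rfl
  have hq₃ := hq₂.frame hF₃ rfl
  have hwX₃ : s₃.word wX 0 = code N.graph X := by rw [hF₃.word _ (by decide), hwX₂]
  refine Runs.seq (runs_codeProg hT hL hB hE₃ hYc hm₃) (T₂ := 74 * n + 70) ?_ (by omega)
  intro s₄ hF₄ hc₄
  have hE₄ := hE₃.frame hF₄ rfl
  have hq₄ := hq₃.frame hF₄ rfl
  have hm₄ := hm₃.congr (hF₄.word _ (by decide))
  have hwX₄ : s₄.word wX 0 = code N.graph X := by rw [hF₄.word _ (by decide), hwX₃]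
  refine Runs.ite (T := 74 * n + 60) (fun hb => ?_) (fun hb => ?_)
    (by simp only [Test.time, WExp.time]; omega)
  swap
  · have hYq : Y ∈ qs := by
      by_contra hYq
      simp [hc₄, hq₄.size_zero Y hYc hYq] at hb
    exact Runs.basic rfl (by simp [Program.maxTime]) ⟨qs, hq₄, List.prefix_rfl, hYq, hle⟩
  have hYq : Y ∉ qs := by
    intro hYq
    have h2 := hq₄.size Y hYq
    have h3 := hYc.card_pos
    simp only [Test.holds, WExp.eval, hM0, hc₄, h2] at hb
    omega
  have hne : ∀ Z ∈ qs, code N.graph Z ≠ code N.graph Y := fun Z hZ h =>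
    hYq (code_injective hT (hq.conn Z hZ) hYc h ▸ hZ)
  have hlenq := hq₄.length_le hT
  have hcn : Y.card ≤ n := (Finset.card_le_univ Y).trans (by simp)
  refine Runs.seq (T₁ := 20) (T₂ := 74 * n + 40)
    (R := fun s' => s'.word wSize = Function.update (s₄.word wSize) (code N.graph Y) Y.card)
    (Runs.basic rfl (by decide) ?_) ?_ (by omega)
  · funext c
    have : (X.card + 1) % M = X.card + 1 := hB.mod_eq (by omega)
    simp [Program.den, hc₄, hwX₄, hq₄.size X hX, h1, this, hcard, Function.update_apply]
  intro s₅ hF₅ hs₅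
  have hwC₅ : s₅.word wCode 0 = code N.graph Y := by rw [hF₅.word _ (by decide), hc₄]
  have hcnt₅ : s₅.word wCount 0 = qs.length := by rw [hF₅.word _ (by decide), hq₄.count]
  refine Runs.seq (T₁ := 10) (T₂ := 74 * n + 30)
    (R := fun s' => s'.word wQueue = Function.update (s₅.word wQueue) qs.length (code N.graph Y))
    (Runs.basic rfl (by decide) ?_) ?_ (by omega)
  · funext c
    simp [Program.den, hwC₅, hcnt₅, Function.update_apply]
  intro s₆ hF₆ hs₆
  have hcnt₆ : s₆.word wCount 0 = qs.length := by rw [hF₆.word _ (by decide), hcnt₅]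
  refine Runs.seq (T₁ := 10) (T₂ := 74 * n + 20)
    (R := fun s' => s'.word wCount 0 = qs.length + 1)
    (Runs.basic rfl (by decide) ?_) ?_ (by omega)
  · have : (qs.length + 1) % M = qs.length + 1 := hB.mod_eq (by omega)
    simp [Program.den, hcnt₆, h1, this]
  intro s₇ hF₇ hcnt₇
  have hE₇ := ((hE₄.frame hF₅ rfl).frame hF₆ rfl).frame hF₇ rfl
  have hm₇ : Marks s₇ wMark id Y :=
    ((hm₄.congr (hF₅.word _ (by decide))).congr (hF₆.word _ (by decide))).congr
      (hF₇.word _ (by decide))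
  have hwC₇ : s₇.word wCode 0 = code N.graph Y := by
    rw [hF₇.word _ (by decide), hF₆.word _ (by decide), hwC₅]
  have hQ₇ : s₇.word wQueue = Function.update (s₄.word wQueue) qs.length (code N.graph Y) := by
    rw [hF₇.word _ (by decide), hs₆, hF₅.word _ (by decide)]
  have hS₇ : s₇.word wSize = Function.update (s₄.word wSize) (code N.graph Y) Y.card := by
    rw [hF₇.word _ (by decide), hF₆.word _ (by decide), hs₅]
  have hM₇ : s₇.word wMem = s₄.word wMem := by
    rw [hF₇.word _ (by decide), hF₆.word _ (by decide), hF₅.word _ (by decide)]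
  refine (runs_fill (K := n) (T := 74 * n + 20) (f := fun v => code N.graph Y * n + v)
    (g := fun v => s₇.word wMark v)
    (by decide) (hB.lt (by omega)) (fun s' hF => ?_)
      (fun u _ v _ h => by simpa using h) (fun s' hF v hv hwv => ?_)
      (by simp only [WExp.time]; omega)).imp le_rfl ?_
  · simp [(hE₇.frame hF rfl).n_eq]
  · have e1 := hF.word wCode (by decide)
    have e2 := hF.word wMark (by decide)
    simp [hwv, (hE₇.frame hF rfl).n_eq, e1, e2, hwC₇, hrowY v hv]
  rintro s₈ hF₈ ⟨hr₈, ho₈⟩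
  have hcnt₈ : s₈.word wCount 0 = qs.length + 1 := by rw [hF₈.word _ (by decide), hcnt₇]
  have hQ₈ : s₈.word wQueue = Function.update (s₄.word wQueue) qs.length (code N.graph Y) := by
    rw [hF₈.word _ (by decide), hQ₇]
  have hS₈ : s₈.word wSize = Function.update (s₄.word wSize) (code N.graph Y) Y.card := by
    rw [hF₈.word _ (by decide), hS₇]
  have hdis : ∀ Z ∈ qs ++ [Y], Z ∈ qs ∨ Z = Y := by simp
  refine ⟨qs ++ [Y], ⟨?_, ?_, ?_, ?_, ?_, ?_, ?_, ?_, ?_, ?_⟩, List.prefix_append _ _, by simp, ?_⟩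
  · exact List.nodup_append.2 ⟨hq.nodup, by simp, by rintro a ha b hb rfl; simp_all⟩
  · intro Z hZ
    rcases hdis Z hZ with h | rfl
    exacts [hq.conn Z h, hYc]
  · rw [List.pairwise_append]
    refine ⟨hq.sorted, by simp, fun Z hZ W hW => ?_⟩
    rw [List.mem_singleton.1 hW, hcard]
    exact hle Z hZ
  · rw [hcnt₈]; simp
  · intro i hi
    rw [hQ₈]
    rw [List.length_append, List.length_singleton] at hi
    rcases Nat.lt_succ_iff_lt_or_eq.1 hi with hi | rfl
    · rw [Function.update_of_ne (by omega), List.getElem_append_left hi, hq₄.queue i hi]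
    · simp
  · intro Z hZ
    rw [hS₈]
    rcases hdis Z hZ with h | rfl
    · rw [Function.update_of_ne (hne Z h), hq₄.size Z h]
    · simp
  · intro Z hZc hZ
    rw [hS₈, Function.update_of_ne, hq₄.size_zero Z hZc (fun h => hZ (by simp [h]))]
    intro h
    exact hZ (by simp [code_injective hT hZc hYc h])
  · intro Z hZ v
    rcases hdis Z hZ with h | rfl
    · have hh := hq₄.mem Z h v
      simp only at hh ⊢
      rw [ho₈ _ (fun u hu h' => hne Z h ((row_inj v.2 hu).1 h').1), hM₇, hh]
    · have := hm₇ v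
      simp only at hr₈ ⊢
      rw [hr₈ v v.2]; exact this
  · exact hq.initial.trans (List.prefix_append _ _)
  · intro i hi hni
    rw [List.length_append, List.length_singleton] at hi
    rcases Nat.lt_succ_iff_lt_or_eq.1 hi with hi | rfl
    · rw [List.getElem_append_left hi]; exact hq.card_of_le i hi hni
    · have := (hq.conn X hX).card_pos
      simp; omega
  · intro Z hZ
    rcases hdis Z hZ with h | rfl
    exacts [hle Z h, hcard.le]

end RAM

namespace RAM

variable {n M : ℕ} {N : Network (Fin n)} {es : List (Fin n × Fin n)} {s s' : State}

lemma runs_initProg (hT : N.graph.IsTree) (hB : Bounds N M) (hE : Env N es s)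
    (hs0 : ∀ i, s.word wSize i = 0) (hm0 : ∀ i, s.word wMem i = 0) :
    Runs M initProg s (60 * n + 20) fun s' => Enum N s' ((List.finRange n).map fun v => {v}) := by
  have h1 := hB.one_mod
  refine Runs.seq (T₁ := 60 * n + 10) (T₂ := 10) (R := fun s' =>
      (∀ u v : Fin n, s'.word wMem ((v + 1) * n + u) = if u = v then 1 else 0) ∧
      (∀ c, s'.word wSize c = if 1 ≤ c ∧ c ≤ n then 1 else 0) ∧
      ∀ v < n, s'.word wQueue v = v + 1) ?_ ?_ (by omega)
  · refine Runs.forLoop (N := n) (T := 45) (fun k s' =>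
        (∀ u v : Fin n, s'.word wMem ((v + 1) * n + u) = if u = v ∧ v < k then 1 else 0) ∧
        (∀ c, s'.word wSize c = if 1 ≤ c ∧ c ≤ k then 1 else 0) ∧
        ∀ v < k, s'.word wQueue v = v + 1)
      (by decide) (hB.lt (by omega)) ?_ ?_ ?_ ?_ ?_
    · intro s' hF
      simp [(hE.frame hF rfl).n_eq]
    · refine ⟨by simp [hm0], fun c => ?_, by simp⟩
      have : ¬ (1 ≤ c ∧ c ≤ 0) := by omega
      rw [if_neg this]; simp [hs0]
    · rintro k s' hk hF hw ⟨hI1, hI2, hI3⟩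
      have hE' := hE.frame hF rfl
      have e1 : (k + 1) % M = k + 1 := hB.mod_eq (by omega)
      have e2 : ((k + 1) * n % M + k) % M = (k + 1) * n + k := by
        rw [Nat.mod_add_mod, Nat.mod_eq_of_lt (hB.row_lt (by omega) hk)]
      refine Runs.basic rfl (by decide) ⟨fun u v => ?_, fun c => ?_, fun v hv => ?_⟩
      · have hr : (v + 1 : ℕ) * n + u = (k + 1) * n + k ↔ v = (⟨k, hk⟩ : Fin n) ∧ u = ⟨k, hk⟩ := by
          rw [row_inj u.2 hk, Fin.ext_iff, Fin.ext_iff]; simp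
        have hI := hI1 u v
        by_cases h : v = (⟨k, hk⟩ : Fin n) ∧ u = ⟨k, hk⟩
        · obtain ⟨rfl, rfl⟩ := h
          simp [Program.den, hw, hE'.n_eq, h1, e1, e2]
        · simp only [Program.den, WExp.eval, Nat.zero_mod, hw, hE'.n_eq, h1, e1, e2]
          simp [hr, h, hI]
          by_cases huv : u = v
          · subst huv
            have : (u : ℕ) ≠ k := fun hh => h ⟨Fin.ext hh, Fin.ext hh⟩
            have : (u : ℕ) < k ↔ (u : ℕ) < k + 1 := by omega
            simp [this]
          · simp [huv]
      · have hI := hI2 c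
        simp only [Program.den, WExp.eval, Nat.zero_mod, hw, hE'.n_eq, h1, e1, e2]
        simp [hw, e1, hI]
        split_ifs <;> omega
      · simp only [Program.den, WExp.eval, Nat.zero_mod, hw, hE'.n_eq, h1, e1, e2]
        simp [hw, e1]
        split_ifs with hvk
        · omega
        · exact hI3 v (by omega)
    · rintro s' hF ⟨hI1, hI2, hI3⟩
      exact ⟨fun u v => by simpa using hI1 u v, hI2, hI3⟩
    · simp only [WExp.time]; omega
  · rintro s₁ hF ⟨hI1, hI2, hI3⟩
    refine Runs.basic rfl (by decide) ?_
    have hE₁ := hE.frame hF rfl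
    refine ⟨?_, ?_, ?_, ?_, ?_, ?_, ?_, ?_, List.prefix_rfl, ?_⟩
    · exact (List.nodup_finRange n).map fun u v h => by simpa using h
    · intro X hX
      obtain ⟨v, -, rfl⟩ := List.mem_map.1 hX
      exact conn_coe_singleton v
    · rw [List.pairwise_map]
      exact List.pairwise_of_forall (by simp)
    · simp [Program.den, hE₁.n_eq]
    · intro i hi
      have hi' : i < n := by simpa using hi
      simp [Program.den, code_singleton hT, hI3 i hi']
    · intro X hX
      obtain ⟨v, -, rfl⟩ := List.mem_map.1 hX
      have := v.2
      simp [Program.den, code_singleton hT, hI2]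
    · intro X hX hX'
      simp only [Program.den, State.word_setWord]
      rw [if_neg (by simp), hI2]
      rw [if_neg]
      rintro ⟨h2, h3⟩
      refine hX' (List.mem_map.2 ⟨⟨code N.graph X - 1, by omega⟩, List.mem_finRange _, ?_⟩)
      refine code_injective hT (conn_coe_singleton _) hX ?_
      rw [code_singleton hT]; simp; omega
    · intro X hX u
      obtain ⟨v, -, rfl⟩ := List.mem_map.1 hX
      simp [Program.den, code_singleton hT, hI1]
    · intro i hi hni
      simp at hi; omega

/-- The list `qs` consists of all subtrees. -/
def Complete (N : Network (Fin n)) (qs : List (Finset (Fin n))) : Prop :=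
  ∀ Y : Finset (Fin n), Conn N.graph (Y : Set (Fin n)) → Y ∈ qs

/-- The search over the queue: after `k` rounds, the queue is sorted by size, its entries exceed the
size of the entry `k` by at most one, and it contains all extensions of its first `k` entries. -/
lemma runs_queueProg (hT : N.graph.IsTree) (hL : ListsEdges N.graph es) (hB : Bounds N M)
    (hE : Env N es s) (hs0 : ∀ i, s.word wSize i = 0) (hm0 : ∀ i, s.word wMem i = 0) :
    Runs M queueProg s (2000 * (codeBound N.graph * (n * n))) fun s' =>
      ∃ qs, Enum N s' qs ∧ Complete N qs := by
  have hlen := hL.length hT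
  have h1 := hB.one_mod
  have hcb : 1 ≤ codeBound N.graph := Nat.one_le_pow _ _ (by omega)
  have hnn : n ≤ n * n := Nat.le_mul_self n
  have hcnn : n * n ≤ codeBound N.graph * (n * n) := Nat.le_mul_of_pos_left _ hcb
  refine Runs.seq (runs_initProg hT hB hE hs0 hm0) (T₂ := 1900 * (codeBound N.graph * (n * n)))
    ?_ (by omega)
  intro s₁ hF₁ hq₁
  have hE₁ := hE.frame hF₁ rfl
  refine Runs.seq (T₁ := 5) (T₂ := 1800 * (codeBound N.graph * (n * n)))
    (R := fun s' => s'.word wI 0 = 0) (Runs.basic rfl (by decide) (by simp [Program.den])) ?_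
    (by omega)
  intro s₂ hF₂ hi₂
  have hE₂ := hE₁.frame hF₂ rfl
  have hq₂ := hq₁.frame hF₂ rfl
  refine (Runs.loop (N := codeBound N.graph) (T := 700 * (n * n)) (fun k s' =>
    s'.word wI 0 = k ∧ ∃ qs, Enum N s' qs ∧ k ≤ qs.length ∧
      (∀ X ∈ qs, ∀ h : k < qs.length, X.card ≤ qs[k].card + 1) ∧
      ∀ (i : ℕ) (h : i < qs.length), i < k → ∀ x y, x ∈ qs[i] → y ∉ qs[i] → N.graph.Adj x y →
        insert y qs[i] ∈ qs) ⟨hi₂, _, hq₂, Nat.zero_le _, ?_, by simp⟩ ?_ ?_ ?_).imp ?_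
      fun _ _ h => h
  · intro X hX h
    obtain ⟨v, -, rfl⟩ := List.mem_map.1 hX
    simp
  · rintro k s' hF ⟨hw, qs, hq, hk, -⟩ hb
    have := hq.length_le hT
    simp only [Test.holds, WExp.eval, Nat.zero_mod, hq.count, hw] at hb
    omega
  · rintro k s₃ hF₃ ⟨hw, qs, hq, hk, hbd, hcl⟩ hb
    have hlq := hq.length_le hT
    simp only [Test.holds, WExp.eval, Nat.zero_mod, hq.count, hw] at hb
    have hk' : k < qs.length := by omega
    set X := qs[k] with hXdef
    have hXq : X ∈ qs := List.getElem_mem hk'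
    have hE₃ := hE₂.frame hF₃ rfl
    refine Runs.seq (T₁ := 10) (T₂ := 700 * (n * n) - 10)
      (R := fun s' => s'.word wX 0 = code N.graph X)
      (Runs.basic rfl (by decide) ?_) ?_ (by omega)
    · simp [Program.den, hw, hq.queue k hk', hXdef]
    intro s₄ hF₄ hwX₄
    have hE₄ := hE₃.frame hF₄ rfl
    have hq₄ := hq.frame hF₄ rfl
    have hwI₄ : s₄.word wI 0 = k := by rw [hF₄.word _ (by decide), hw]
    refine Runs.seq (T₁ := 700 * (n * n) - 20) (T₂ := 10)
      (R := fun s' => ∃ qs', Enum N s' qs' ∧ qs <+: qs' ∧ (∀ Z ∈ qs', Z.card ≤ X.card + 1) ∧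
        ∀ x y, x ∈ X → y ∉ X → N.graph.Adj x y → insert y X ∈ qs') ?_ ?_ (by omega)
    · refine Runs.forLoop (N := es.length) (T := 400 * n + 200) (fun j s' =>
        ∃ qs', Enum N s' qs' ∧ qs <+: qs' ∧ (∀ Z ∈ qs', Z.card ≤ X.card + 1) ∧
        ∀ x y, x ∈ X → y ∉ X → ∀ i (hi : i < es.length), i < j → toEdge es[i] = s(x, y) →
          insert y X ∈ qs') (by decide) (hB.lt (by omega)) ?_ ?_ ?_ ?_ ?_
      · intro s' hF
        simp [(hE₄.frame hF rfl).n_eq, h1]; omega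
      · refine ⟨qs, hq₄.of_eq ?_ ?_ ?_ ?_, List.prefix_rfl, fun Z hZ => hbd Z hZ hk', by simp⟩ <;>
          (funext i; simp)
      · rintro j s₅ hj hF₅ hwE₅ ⟨qs', hq', hpre, hcd, hcl'⟩
        have hE₅ := hE₄.frame hF₅ rfl
        have hwX₅ : s₅.word wX 0 = code N.graph X := by rw [hF₅.word _ (by decide), hwX₄]
        have hXq' := hpre.subset hXq
        have hm := hq'.mem X hXq'
        have hcX := code_lt hT (hq.conn X hXq)
        have hrow : ∀ v : Fin n, (code N.graph X * n % M + v) % M = code N.graph X * n + v :=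
          fun v => by rw [Nat.mod_add_mod, Nat.mod_eq_of_lt (hB.row_lt (by omega) v.2)]
        set p := (es[j]).1 with hp
        set q := (es[j]).2 with hqd
        have hadj : N.graph.Adj p q := hL.mem_edgeSet hj
        have mp := hm p
        have mq := hm q
        simp only at mp mq
        refine Runs.ite (T := 400 * n + 100) (fun hb => ?_) (fun hb => ?_)
          (by simp only [Test.time, WExp.time]; omega)
        · refine Runs.basic rfl (by simp [Program.maxTime]) ⟨qs', hq'.of_eq ?_ ?_ ?_ ?_, hpre, hcd,
            fun x y hx hy i hi hij hxy => ?_⟩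
          iterate 4 · funext i; simp
          rcases Nat.lt_succ_iff_lt_or_eq.1 hij with hij | rfl
          · exact hcl' x y hx hy i hi hij hxy
          · exfalso
            simp only [Test.holds, WExp.eval, Nat.zero_mod, hwE₅, hE₅.ea i hj, hE₅.eb i hj,
              hE₅.n_eq, hwX₅, ← hp, ← hqd, hrow, mp, mq] at hb
            have hiff : p ∈ X ↔ q ∈ X := by
              by_cases h1 : p ∈ X <;> by_cases h2 : q ∈ X <;> simp [h1, h2] at hb ⊢
            have hxy' : s(p, q) = s(x, y) := hxy
            rcases Sym2.eq_iff.1 hxy' with ⟨h, h'⟩ | ⟨h, h'⟩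
            · rw [h, h'] at hiff; exact hy (hiff.1 hx)
            · rw [h, h'] at hiff; exact hy (hiff.2 hx)
        · simp only [Test.holds, WExp.eval, Nat.zero_mod, hwE₅, hE₅.ea j hj, hE₅.eb j hj,
            hE₅.n_eq, hwX₅, ← hp, ← hqd, hrow, mp, mq] at hb
          have hXc := hq.conn X hXq
          have hcase : (p ∈ X ∧ q ∉ X) ∨ (q ∈ X ∧ p ∉ X) := by
            by_cases h1 : p ∈ X <;> by_cases h2 : q ∈ X <;> simp [h1, h2] at hb ⊢
          obtain ⟨Y, hY, hYc, hcardY⟩ : ∃ Y : Finset (Fin n), Y = insert p (insert q X) ∧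
              Conn N.graph (Y : Set (Fin n)) ∧ Y.card = X.card + 1 := by
            rcases hcase with ⟨h1, h2⟩ | ⟨h1, h2⟩
            · have : insert p (insert q X) = insert q X := Finset.insert_eq_of_mem (by simp [h1])
              refine ⟨_, rfl, ?_, ?_⟩
              · rw [this, Finset.coe_insert]; exact hXc.insert_adj h1 hadj
              · rw [this, Finset.card_insert_of_notMem h2]
            · have : insert p (insert q X) = insert p X := by rw [Finset.insert_eq_of_mem h1]
              refine ⟨_, rfl, ?_, ?_⟩
              · rw [this, Finset.coe_insert]; exact hXc.insert_adj h1 hadj.symm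
              · rw [this, Finset.card_insert_of_notMem h2]
          refine (runs_extendProg hT hL hB hE₅ hq' hXq' hwX₅ hj hwE₅ hY hYc hcardY hcd).imp
            (by omega) ?_
          rintro s₆ hF₆ ⟨qs'', hq'', hpre', hYq, hcd'⟩
          refine ⟨qs'', hq''.of_eq ?_ ?_ ?_ ?_, hpre.trans hpre', hcd',
            fun x y hx hy i hi hij hxy => ?_⟩
          iterate 4 · funext i; simp
          rcases Nat.lt_succ_iff_lt_or_eq.1 hij with hij | rfl
          · exact hpre'.subset (hcl' x y hx hy i hi hij hxy)
          · have hxy' : s(p, q) = s(x, y) := hxy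
            have : insert y X = Y := by
              rw [hY]
              rcases Sym2.eq_iff.1 hxy' with ⟨h, h'⟩ | ⟨h, h'⟩
              · rw [h, h']; exact (Finset.insert_eq_of_mem (by simp [hx])).symm
              · rw [h, h', Finset.insert_eq_of_mem hx]
            rw [this]; exact hYq
      · rintro s₅ hF₅ ⟨qs', hq', hpre, hcd, hcl'⟩
        refine ⟨qs', hq', hpre, hcd, fun x y hx hy hadj => ?_⟩
        obtain ⟨i, hi, hie⟩ := hL.exists_index (e := s(x, y)) hadj
        exact hcl' x y hx hy i hi hi hie
      · simp only [WExp.time]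
        have h2 : es.length * (400 * n + 200 + (1 + 1 + 1 + 1) + 11) ≤ (n - 1) * (400 * n + 215) :=
          Nat.mul_le_mul (by omega) (by omega)
        have h3 : (n - 1) * (400 * n + 215) = 400 * ((n - 1) * n) + 215 * (n - 1) := by ring
        have h4 : (n - 1) * n + n = n * n := by
          rw [← Nat.succ_mul]; congr 1; omega
        omega
    · rintro s₅ hF₅ ⟨qs', hq', hpre, hcd, hcl'⟩
      have hwI₅ : s₅.word wI 0 = k := by rw [hF₅.word _ (by decide), hwI₄]
      have hlq' := hq'.length_le hT
      have hk'' : k < qs'.length := hk'.trans_le hpre.length_le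
      have hget : ∀ i (hi : i < qs.length) (hi' : i < qs'.length), qs'[i] = qs[i] :=
        fun i hi hi' => (hpre.getElem hi).symm
      have hmod : (k + 1) % M = k + 1 := hB.mod_eq (by omega)
      refine Runs.basic rfl (by decide) ⟨by simp [Program.den, hwI₅, h1, hmod], qs',
        hq'.of_eq ?_ ?_ ?_ ?_, hk'', ?_, ?_⟩
      iterate 4 · funext i; simp [Program.den]
      · intro Z hZ h
        have h2 := hcd Z hZ
        have h3 := List.pairwise_iff_getElem.1 hq'.sorted k (k + 1) hk'' h (by omega)
        rw [hget k hk' hk'', ← hXdef] at h3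
        omega
      · intro i hi hik x y
        rcases Nat.lt_succ_iff_lt_or_eq.1 hik with hik | rfl
        · rw [hget i (by omega) hi]
          exact fun hx hy hadj => hpre.subset (hcl i (by omega) hik x y hx hy hadj)
        · rw [hget i hk' hi]
          exact hcl' x y
  · rintro k s₃ hF₃ ⟨hw, qs, hq, hk, hbd, hcl⟩ hb
    simp only [Test.holds, WExp.eval, Nat.zero_mod, hq.count, hw] at hb
    refine ⟨qs, hq, fun Y hY => mem_of_closed (F := (· ∈ qs)) hq.singleton_mem ?_ hY⟩
    intro X x y hX hx hy hadj
    obtain ⟨i, hi, rfl⟩ := List.mem_iff_getElem.1 hX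
    exact hcl i hi (by omega) x y hx hy hadj
  · simp only [Test.time, WExp.time]
    have h2 : codeBound N.graph * (700 * (n * n) + (1 + 1 + (1 + 1) + 1 + 1) + 1) ≤
        codeBound N.graph * (708 * (n * n)) := Nat.mul_le_mul_left _ (by omega)
    have h3 : codeBound N.graph * (708 * (n * n)) = 708 * (codeBound N.graph * (n * n)) := by ring
    omega

end RAM

/-! ### Gains along a sequence -/

lemma IsMaxDensity.congr {E : Type*} {c w w' : E → ℝ} {S : List E} {r : ℝ}
    (h : IsMaxDensity c w S r) (hw : ∀ j ∈ S, w j = w' j) : IsMaxDensity c w' S r := by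
  have e : ∀ p, p <+: S → total w p = total w' p := fun p hp =>
    congrArg List.sum (List.map_congr_left fun j hj => hw j (hp.subset hj))
  obtain ⟨⟨p, h1, h2, h3⟩, h4⟩ := h
  exact ⟨⟨p, h1, h2, by rw [← e p h1, h3]⟩, fun q hq => by rw [← e q hq]; exact h4 q hq⟩

lemma IsKeysFrom.congr {E : Type*} {c w w' κ : E → ℝ} {k : ℝ} {S : List E}
    (h : IsKeysFrom c w κ k S) (hw : ∀ j ∈ S, w j = w' j) : IsKeysFrom c w' κ k S := by
  induction S generalizing k with
  | nil => trivial
  | cons j S ih =>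
    obtain ⟨⟨r, hr, hk⟩, h'⟩ := h
    exact ⟨⟨r, hr.congr hw, hk⟩, ih h' fun i hi => hw i (List.mem_cons_of_mem _ hi)⟩

lemma IsKeys.congr {E : Type*} {c w w' κ : E → ℝ} {S : List E}
    (h : IsKeys c w κ S) (hw : ∀ j ∈ S, w j = w' j) : IsKeys c w' κ S := by
  cases S with
  | nil => trivial
  | cons j S => exact ⟨h.1.congr hw, h.2.congr fun i hi => hw i (List.mem_cons_of_mem _ hi)⟩

lemma isKeysFrom_of_getElem {E : Type*} {c w κ : E → ℝ} {S : List E} {k : ℝ}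
    (h : ∀ (i : ℕ) (hi : i < S.length), ∃ r, IsMaxDensity c w (S.drop i) r ∧
      κ S[i] = min (if _ : i = 0 then k else κ (S[i - 1])) r) : IsKeysFrom c w κ k S := by
  induction S generalizing k with
  | nil => trivial
  | cons j S ih =>
    refine ⟨?_, ih fun i hi => ?_⟩
    · obtain ⟨r, hr, hk⟩ := h 0 (by simp)
      exact ⟨r, hr, hk⟩
    · have := h (i + 1) (by simpa using hi)
      cases i with
      | zero => simpa using this
      | succ i => simpa using this

lemma isKeys_of_getElem {E : Type*} {c w κ : E → ℝ} {S : List E}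
    (h : ∀ (i : ℕ) (hi : i < S.length), ∃ r, IsMaxDensity c w (S.drop i) r ∧
      κ S[i] = if _ : i = 0 then r else min (κ (S[i - 1])) r) : IsKeys c w κ S := by
  cases S with
  | nil => trivial
  | cons j S =>
    constructor
    · obtain ⟨r, hr, hk⟩ := h 0 (by simp)
      simp at hk
      rw [hk]; simpa using hr
    · refine isKeysFrom_of_getElem fun i hi => ?_
      have := h (i + 1) (by simpa using hi)
      cases i with
      | zero => simpa using this
      | succ i => simpa using this

namespace Network

section Gain

variable {V : Type*} [Fintype V] [DecidableEq V] (N : Network V)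

/-- The weight of the pairs that the edge `e` connects in the sequence `S`. -/
noncomputable def seqGain (S : List (Sym2 V)) (e : Sym2 V) : ℝ :=
  N.conWeight (S.take (S.idxOf e + 1)).toFinset - N.conWeight (S.take (S.idxOf e)).toFinset

variable {N} {S : List (Sym2 V)} {W : Sym2 V → ℝ}

lemma isIncrement_seqGain (hn : S.Nodup) : IsIncrement (N.seqGain S) N.conWeight ∅ S := by
  rintro π j ρ rfl
  have hj : j ∉ π := fun h => by
    obtain ⟨-, -, h3⟩ := List.nodup_append.1 hn
    exact h3 j h j (by simp) rfl
  have hidx : (π ++ j :: ρ).idxOf j = π.length := by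
    rw [List.idxOf_append_of_notMem hj]; simp
  have e1 : (π ++ j :: ρ).take π.length = π := by simp
  have e2 : (π ++ j :: ρ).take (π.length + 1) = π ++ [j] := by rw [List.take_append]; simp
  rw [seqGain, hidx, e1, e2, Finset.empty_union]
  congr 2
  ext x; simp

lemma seqGain_eq_of_isIncrement (hn : S.Nodup) (h : IsIncrement W N.conWeight ∅ S) {j : Sym2 V}
    (hj : j ∈ S) : N.seqGain S j = W j := by
  obtain ⟨π, ρ, rfl⟩ := List.append_of_mem hj
  rw [h π j ρ rfl, isIncrement_seqGain hn π j ρ rfl]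

lemma gain_eq_seqGain (hT : N.graph.IsTree) {H : N.graph.Subgraph} (hS : Lists H S)
    (e : Sym2 V) : N.gain H S e = N.seqGain S e := gain_eq hT (fun e he => (hS.2 e).1 he) e

lemma gain_nonneg (H : N.graph.Subgraph) (S : List (Sym2 V)) (e : Sym2 V) :
    0 ≤ N.gain H S e := Finset.sum_nonneg fun q _ => N.wt_nonneg q

/-- The objective value as the total weighted completion time with the gains as weights. -/
lemma objective_eq_costFrom (hT : N.graph.IsTree) {H : N.graph.Subgraph} (hH : N.IsSubtree H)
    (hS : Lists H S) : N.objective H S = costFrom N.len (N.seqGain S) 0 S := by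
  have h := costFrom_add_area (c := N.posLen) (isIncrement_seqGain (N := N) hS.1) 0
  rw [Finset.empty_union, zero_add, mul_zero, sub_zero] at h
  rw [objective_eq hT hH hS, costFrom_congr (c' := N.posLen) (w' := N.seqGain S)
    (fun j hj => (posLen_eq (hS.mem_edgeSet j hj)).symm) fun _ _ => rfl]
  linarith

/-- Merging by keys gives an optimal solution of the merging problem. -/
lemma isOptimalMerge_keyMerge (hT : N.graph.IsTree) {H H₁ H₂ : N.graph.Subgraph} {e : Sym2 V}
    {S₁ S₂ : List (Sym2 V)} {κ : Sym2 V → ℝ} (hs : SplitLists H e H₁ H₂ S₁ S₂)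
    (h₁ : IsKeys N.posLen (N.seqGain S₁) κ S₁) (h₂ : IsKeys N.posLen (N.seqGain S₂) κ S₂) :
    N.IsOptimalMerge H₁ H₂ S₁ S₂ (keyMerge κ S₁ S₂) := by
  have hfeas : ∀ σ, Scheduling.IsFeasible (H₁.edgeSet ∪ H₂.edgeSet)
      (Scheduling.twoChains S₁ S₂) σ ↔ IsShuffle S₁ S₂ σ := fun σ =>
    isFeasible_iff hs.left.1 hs.right.1 fun j => by rw [hs.left.2, hs.right.2]; rfl
  have hL := keyMerge_isShuffle (κ := κ) hs.nodup
  refine ⟨(hfeas _).2 hL, fun τ hτ => ?_⟩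
  have hτ' := (hfeas τ).1 hτ
  set W := SplitLists.jobWeight H₁ H₂ S₁ S₂ with hW
  change Scheduling.cost N.len W _ ≤ Scheduling.cost N.len W _
  have hWn : ∀ j, 0 ≤ W j := fun j => by
    rw [hW, SplitLists.jobWeight]; split_ifs <;> exact gain_nonneg _ _ _
  have k₁ : IsKeys N.posLen W κ S₁ := h₁.congr fun j hj => by
    rw [hW, hs.jobWeight_left hj, gain_eq_seqGain hT hs.left]
  have k₂ : IsKeys N.posLen W κ S₂ := h₂.congr fun j hj => by
    rw [hW, hs.jobWeight_right hj, gain_eq_seqGain hT hs.right]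
  have harea := area_le_keyMerge posLen_pos hWn _ S₁ S₂ rfl hs.nodup
    (k₁.isBlocks posLen_pos _ _ rfl) (k₂.isBlocks posLen_pos _ _ rfl) τ hτ'
  have hcost : ∀ σ, IsShuffle S₁ S₂ σ → Scheduling.cost N.len W σ =
      twoChainWeight W S₁ S₂ σ.toFinset * total N.posLen σ
        - area N.posLen (twoChainWeight W S₁ S₂) ∅ σ := by
    intro σ hσ
    have h := costFrom_add_area (c := N.posLen)
      (hσ.isIncrement (w := W) fun j h1 h2 => hs.edge_disjoint j h1 h2) 0
    rw [Finset.empty_union, zero_add, mul_zero, sub_zero] at h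
    rw [cost_eq_costFrom hσ.nodup, costFrom_congr (c' := N.posLen) (w' := W)
      (fun j hj => ?_) fun _ _ => rfl]
    · linarith
    · refine (posLen_eq ?_).symm
      rcases hσ.mem j hj with hj | hj
      exacts [hs.left.mem_edgeSet j hj, hs.right.mem_edgeSet j hj]
  rw [hcost _ hL, hcost _ hτ', List.toFinset_eq_of_perm _ _ (hL.perm hτ'),
    total_perm (hL.perm hτ')]
  linarith

/-- The gains along a merged sequence followed by the last edge: every edge keeps the gain from its
own side, and the last edge gains what is left of the total. -/
lemma SplitLists.seqGain_append (hT : N.graph.IsTree) {H H₁ H₂ : N.graph.Subgraph} {e : Sym2 V}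
    {S₁ S₂ L : List (Sym2 V)} (hs : SplitLists H e H₁ H₂ S₁ S₂) (he : e ∈ H.edgeSet)
    (hL : IsShuffle S₁ S₂ L) :
    (∀ j ∈ S₁, N.seqGain (L ++ [e]) j = N.seqGain S₁ j) ∧
    (∀ j ∈ S₂, N.seqGain (L ++ [e]) j = N.seqGain S₂ j) ∧
    N.seqGain (L ++ [e]) e = N.conWeight (L ++ [e]).toFinset - N.conWeight S₁.toFinset
      - N.conWeight S₂.toFinset := by
  have hperm : L.Perm (S₁ ++ S₂) :=
    (List.perm_ext_iff_of_nodup hL.nodup hs.nodup).2 fun x => by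
      rw [← List.mem_toFinset, hL.toFinset]; simp
  have hlist := hs.lists_append he hperm
  have hinc := isIncrement_seqGain (N := N) hlist.1
  have hincL : IsIncrement (N.seqGain (L ++ [e])) N.conWeight ∅ L := by
    rintro π j ρ rfl
    exact hinc π j (ρ ++ [e]) (by simp)
  have hjob := hs.isIncrement hT hL
  have key : ∀ j ∈ L, N.seqGain (L ++ [e]) j = jobWeight H₁ H₂ S₁ S₂ j := fun j hj => by
    rw [← seqGain_eq_of_isIncrement hL.nodup hincL hj,
      seqGain_eq_of_isIncrement hL.nodup hjob hj]
  refine ⟨fun j hj => ?_, fun j hj => ?_, ?_⟩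
  · rw [key j (hL.left.subset hj), hs.jobWeight_left hj, gain_eq_seqGain hT hs.left]
  · rw [key j (hL.right.subset hj), hs.jobWeight_right hj, gain_eq_seqGain hT hs.right]
  · have h1 := hinc L e [] rfl
    have h2 := hs.separable hT S₁.toFinset subset_rfl S₂.toFinset subset_rfl
    rw [Finset.empty_union, hL.toFinset, h2] at h1
    have h3 : insert e (S₁.toFinset ∪ S₂.toFinset) = (L ++ [e]).toFinset := by
      rw [← hL.toFinset]; ext x; simp
    rw [h1, h3]; ring

/-- The weight connected by all the edges of a subtree is the total weight of its pairs. -/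
lemma conWeight_edgesIn {n : ℕ} {N : Network (Fin n)} (hT : N.graph.IsTree)
    {X : Finset (Fin n)} (hX : Conn N.graph (X : Set (Fin n))) : N.conWeight (edgesIn N.graph X) =
      ∑ u, ∑ v, if u < v ∧ u ∈ X ∧ v ∈ X then N.wt s(u, v) else 0 := by
  classical
  have hsub : ((edgesIn N.graph X : Finset (Sym2 (Fin n))) : Set (Sym2 (Fin n))) =
      innerEdges N.graph (X : Set (Fin n)) := by ext e; simp
  have hsub' : ((edgesIn N.graph X : Finset (Sym2 (Fin n))) : Set (Sym2 (Fin n))) ⊆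
      N.graph.edgeSet := by
    rw [hsub]; exact innerEdges_subset
  have h1 : N.conWeight (edgesIn N.graph X) = ∑ q ∈ X.sym2 with ¬ q.IsDiag, N.wt q := by
    rw [conWeight, Finset.sum_filter, ← Finset.sum_subset (Finset.subset_univ X.sym2)]
    · refine Finset.sum_congr rfl fun q hq => ?_
      induction q with | h u v =>
      rw [Finset.mk_mem_sym2_iff] at hq
      rw [if_pos ((linked_mk_iff hT hsub').2 (hsub ▸ hX.2 u hq.1 v hq.2))]
      split_ifs with hd
      · have : u = v := by simpa using hd
        rw [this, N.wt_diag]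
      · rfl
    · intro q _ hq
      split_ifs with hl
      · by_contra hw
        refine hq (Finset.mem_sym2_iff.2 fun v hv => ?_)
        obtain ⟨e, he, hve⟩ := exists_edge_of_linked hT hsub' hl hw v hv
        exact mem_edgesIn_mem he hve
      · rfl
  have h2 := Finset.sum_sym2_filter_not_isDiag X N.wt
  have h3 : ∑ q ∈ X.sym2 with ¬ q.IsDiag, N.wt q =
      ∑ p ∈ X.offDiag with p.1 < p.2, N.wt s(p.1, p.2) := by convert h2
  rw [h1, h3, Finset.sum_filter, ← Finset.sum_product',
    Finset.univ_product_univ, ← Finset.sum_subset (Finset.subset_univ X.offDiag)]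
  · refine Finset.sum_congr rfl fun p hp => ?_
    rw [Finset.mem_offDiag] at hp
    simp [hp.1, hp.2.1]
  · intro p _ hp
    rw [if_neg]
    rintro ⟨h2, h3, h4⟩
    exact hp (Finset.mem_offDiag.2 ⟨h3, h4, h2.ne⟩)

lemma lists_indSub_iff {X : Finset V} :
    Lists (indSub N.graph (X : Set V)) S ↔ S.Nodup ∧ S.toFinset = edgesIn N.graph X := by
  rw [Lists, indSub_edgeSet, Finset.ext_iff]
  simp

lemma Lists.length_add_one (hT : N.graph.IsTree) {X : Finset V} (hX : Conn N.graph (X : Set V))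
    (h : Lists (indSub N.graph (X : Set V)) S) : S.length + 1 = X.card := by
  obtain ⟨h1, h2⟩ := lists_indSub_iff.1 h
  rw [← card_edgesIn hT _ X rfl hX, ← h2, List.toFinset_card_of_nodup h1]

lemma isSplit_sideFin (hT : N.graph.IsTree) {X : Finset V} (hX : Conn N.graph (X : Set V))
    {a b : V} (h : s(a, b) ∈ edgesIn N.graph X) :
    N.IsSplit (indSub N.graph (X : Set V)) s(a, b)
      (indSub N.graph (sideFin N.graph X s(a, b) a : Set V))
      (indSub N.graph (sideFin N.graph X s(a, b) b : Set V)) := by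
  obtain ⟨ca, cb⟩ := conn_sideFin hT hX h
  refine ⟨indSub_isTree hT.isAcyclic ca, indSub_isTree hT.isAcyclic cb, ?_, ?_⟩
  · exact Finset.disjoint_coe.2 (disjoint_sideFin hT h)
  · refine subgraph_eq_of_edgeSet ?_ ?_
    · simp only [SimpleGraph.Subgraph.verts_sup, indSub_verts, coe_sideFin]
      rw [side_union hT.connected]
      rfl
    · rw [SimpleGraph.Subgraph.edgeSet_sup, indSub_edgeSet, indSub_edgeSet, coe_sideFin,
        coe_sideFin, inner_side_union hT (mem_edgesIn.1 h), ← indSub_edgeSet]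
      ext e
      induction e with | h x y =>
      rw [SimpleGraph.Subgraph.mem_edgeSet, SimpleGraph.Subgraph.deleteEdges_adj]
      rfl

end Gain

end Network

/-! ### Totals and splits -/

namespace RAM

variable {n M : ℕ} {N : Network (Fin n)} {es : List (Fin n × Fin n)} {s s' : State}
  {qs : List (Finset (Fin n))} {X : Finset (Fin n)}

/-- The variable `wX` contains the code of the subtree `X`, and the input and the tables of the
subtrees and of the sides are available. -/
structure Ctx (N : Network (Fin n)) (es : List (Fin n × Fin n)) (qs : List (Finset (Fin n)))
    (X : Finset (Fin n)) (s : State) : Prop where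
  env : Env N es s
  enum : Enum N s qs
  side : SideTable N es s
  mem : X ∈ qs
  wx : s.word wX 0 = code N.graph X

lemma Ctx.frame (h : Ctx N es qs X s) {P : Program} (hF : Frame P s s')
    (h1 : keepsInput P = true) (h2 : keepsEnum P = true) (h3 : wX ∉ P.wmods)
    (h4 : wSide ∉ P.wmods) : Ctx N es qs X s' :=
  ⟨h.env.frame hF h1, h.enum.frame hF h2, fun e he => (h.side e he).congr (hF.word _ h4), h.mem,
    by rw [hF.word _ h3, h.wx]⟩

lemma Ctx.conn (h : Ctx N es qs X s) : Conn N.graph (X : Set (Fin n)) := h.enum.conn X h.mem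

lemma Ctx.size (h : Ctx N es qs X s) : s.word wSize (code N.graph X) = X.card :=
  h.enum.size X h.mem

lemma Ctx.marks (h : Ctx N es qs X s) : Marks s wMem (code N.graph X * n + ·) X :=
  h.enum.mem X h.mem

lemma Bounds.row_mod (hB : Bounds N M) {c v : ℕ} (hc : c < codeBound N.graph) (hv : v < n) :
    (c * n % M + v) % M = c * n + v := by
  rw [Nat.mod_add_mod, Nat.mod_eq_of_lt (hB.row_lt (by omega) hv)]

lemma Ctx.row_mod (h : Ctx N es qs X s) (hT : N.graph.IsTree) (hB : Bounds N M) {v : ℕ}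
    (hv : v < n) : (code N.graph X * n % M + v) % M = code N.graph X * n + v :=
  hB.row_mod (code_lt hT h.conn) hv

lemma Ctx.card_le (_ : Ctx N es qs X s) : X.card ≤ n := (Finset.card_le_univ X).trans (by simp)

lemma runs_totalProg (hT : N.graph.IsTree) (hB : Bounds N M) (hC : Ctx N es qs X s) :
    Runs M totalProg s (200 * (n * n)) fun s' => s'.num rTot =
      Function.update (s.num rTot) (code N.graph X) (N.conWeight (edgesIn N.graph X)) := by
  have hn : 1 ≤ n := by
    obtain ⟨v, -⟩ := hC.conn.1
    have := v.2; omega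
  have hnn : n ≤ n * n := Nat.le_mul_self n
  have h1 := hB.one_mod
  set f : ℕ → ℕ → ℝ := fun u v => if u < v ∧ 1 ≤ s.word wMem (code N.graph X * n + u) ∧
    1 ≤ s.word wMem (code N.graph X * n + v) then s.num rWt (u * n + v) else 0 with hf
  have hsum : N.conWeight (edgesIn N.graph X) =
      ∑ u ∈ Finset.range n, ∑ v ∈ Finset.range n, f u v := by
    rw [Network.conWeight_edgesIn hT hC.conn, Finset.sum_range]
    refine Finset.sum_congr rfl fun u _ => ?_
    rw [Finset.sum_range]
    refine Finset.sum_congr rfl fun v _ => ?_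
    have e1 := hC.marks.one_le u
    have e2 := hC.marks.one_le v
    simp only [hf, e1, e2, hC.env.wt, Fin.lt_def]
  refine Runs.seq (T₁ := 5) (T₂ := 199 * (n * n) - 5) (R := fun s' => s'.num rSW 0 = 0)
    (Runs.basic rfl (by decide) (by simp [Program.den])) ?_ (by omega)
  intro s₁ hF₁ h0
  have hC₁ := hC.frame hF₁ rfl rfl (by decide) (by decide)
  refine Runs.seq (T₁ := 180 * (n * n)) (T₂ := 7) (R := fun s' => s'.num rSW 0 =
    ∑ u ∈ Finset.range n, ∑ v ∈ Finset.range n, f u v) ?_ ?_ (by omega)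
  · refine Runs.forLoop (N := n) (T := 120 * n) (fun k s' => s'.num rSW 0 =
      ∑ u ∈ Finset.range k, ∑ v ∈ Finset.range n, f u v) (by decide) (hB.lt (by omega))
      ?_ ?_ ?_ ?_ ?_
    · intro s' hF
      simp [(hC₁.env.frame hF rfl).n_eq]
    · simp [h0]
    · intro k s₂ hk hF₂ hwk hI
      have hC₂ := hC₁.frame hF₂ rfl rfl (by decide) (by decide)
      have e1 : s₂.word wMem = s.word wMem := by
        rw [hF₂.word _ (by decide), hF₁.word _ (by decide)]
      have e2 : s₂.num rWt = s.num rWt := by rw [hF₂.num _ (by decide), hF₁.num _ (by decide)]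
      refine Runs.forLoop (N := n) (T := 90) (fun j s' => s'.num rSW 0 =
        ∑ u ∈ Finset.range k, ∑ v ∈ Finset.range n, f u v + ∑ v ∈ Finset.range j, f k v)
        (by decide) (hB.lt (by omega)) ?_ ?_ ?_ ?_ ?_
      · intro s' hF
        simp [(hC₂.env.frame hF rfl).n_eq]
      · simp [hI]
      · intro j s₃ hj hF₃ hwj hI'
        have hC₃ := hC₂.frame hF₃ rfl rfl (by decide) (by decide)
        have e1' : s₃.word wMem = s.word wMem := by rw [hF₃.word _ (by decide), e1]
        have e2' : s₃.num rWt = s.num rWt := by rw [hF₃.num _ (by decide), e2]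
        have hwk' : s₃.word wU 0 = k := by rw [hF₃.word _ (by decide), hwk]
        refine Runs.basic rfl (by decide) ?_
        have hkj : (k * n % M + j) % M = k * n + j := by
          rw [Nat.mod_add_mod, Nat.mod_eq_of_lt (hB.row_lt (by omega) hj)]
        rw [Finset.sum_range_succ, ← add_assoc, ← hI']
        simp only [Program.den, Test.holds, WExp.eval, Nat.zero_mod, h1, hwk', hwj, hC₃.wx,
          hC₃.env.n_eq, hC₃.row_mod hT hB hj, hC₃.row_mod hT hB hk, e1', not_le]
        by_cases hc : k < j ∧ 1 ≤ s.word wMem (code N.graph X * n + k) ∧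
            1 ≤ s.word wMem (code N.graph X * n + j)
        · rw [if_pos hc]
          simp [hf, hc, hwk', hwj, hC₃.env.n_eq, hkj, e2']
        · rw [if_neg hc]
          simp [hf, hc]
      · intro s' hF hI'
        rw [State.num_setWord, hI', Finset.sum_range_succ]
      · simp only [WExp.time]; omega
    · intro s' hF hI; exact hI
    · simp only [WExp.time]
      have : n * (120 * n + (1 + 1) + 11) = 120 * (n * n) + 13 * n := by ring
      omega
  · intro s₂ hF₂ hS
    have hC₂ := hC₁.frame hF₂ rfl rfl (by decide) (by decide)
    refine Runs.basic rfl (by decide) ?_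
    have e1 : s₂.num rTot = s.num rTot := by rw [hF₂.num _ (by decide), hF₁.num _ (by decide)]
    funext c
    simp [Program.den, hC₂.wx, hS, e1, hsum, Function.update_apply]

/-- A loop which marks the vertices of the set `Y`. -/
lemma runs_mark (hB : Bounds N M) (hE : Env N es s) {b : Test} {Y : Finset (Fin n)} {T : ℕ}
    (hb : ∀ s' (v : Fin n), Frame (forLoop wV (wvar wN)
      (.ite b (.setWord wMark (wvar wV) (.const 1)) (.setWord wMark (wvar wV) (.const 0)))) s s' →
      s'.word wV 0 = v → (b.holds M s' ↔ v ∈ Y))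
    (hT : n * (b.time + 24) + 10 ≤ T) :
    Runs M (forLoop wV (wvar wN)
      (.ite b (.setWord wMark (wvar wV) (.const 1)) (.setWord wMark (wvar wV) (.const 0)))) s T
      fun s' => Marks s' wMark id Y := by
  have h1 := hB.one_mod
  refine Runs.forLoop (N := n) (T := b.time + 9) (fun k s' => ∀ v : Fin n, (v : ℕ) < k →
    s'.word wMark v = if v ∈ Y then 1 else 0) (by simp [Program.wmods]) (hB.lt (by omega))
    ?_ ?_ ?_ ?_ ?_
  · intro s' hF
    have : s'.word wN 0 = s.word wN 0 := by
      rw [hF.word _ (by simp [forLoop, Program.wmods])]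
    simp [this, hE.n_eq]
  · simp
  · intro k s' hk hF hw hI
    have hb' := hb s' ⟨k, hk⟩ hF hw
    refine Runs.ite (T := 4) (fun h => ?_) (fun h => ?_) (by omega)
    · refine Runs.basic rfl (by decide) fun v hv => ?_
      have := hI v
      by_cases hvk : (v : ℕ) = k
      · have hv' : v = ⟨k, hk⟩ := Fin.ext hvk
        subst hv'
        simp [Program.den, hw, h1, hb'.1 h]
      · simp only [Program.den, WExp.eval, Nat.zero_mod, hw, State.word_setWord, hvk, and_false,
          if_false]
        exact this (by omega)
    · refine Runs.basic rfl (by decide) fun v hv => ?_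
      have := hI v
      by_cases hvk : (v : ℕ) = k
      · have hv' : v = ⟨k, hk⟩ := Fin.ext hvk
        subst hv'
        have hnot : (⟨k, hk⟩ : Fin n) ∉ Y := fun h' => h (hb'.2 h')
        simp [Program.den, hw, hnot]
      · simp only [Program.den, WExp.eval, Nat.zero_mod, hw, State.word_setWord, hvk, and_false,
          if_false]
        exact this (by omega)
  · intro s' hF hI v
    exact hI v v.2
  · have : n * (b.time + 9 + (wvar 0).time + 11) + (wvar 0).time + 8 = n * (b.time + 22) + 10 := by
      simp only [WExp.time]
    have : n * (b.time + 22) ≤ n * (b.time + 24) := Nat.mul_le_mul_left _ (by omega)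
    omega

lemma mem_sideFin_right (hT : N.graph.IsTree) {a b v : Fin n} (h : s(a, b) ∈ N.graph.edgeSet) :
    v ∈ sideFin N.graph X s(a, b) b ↔ v ∈ X ∧ v ∉ sideFin N.graph Finset.univ s(a, b) a := by
  rw [mem_sideFin, mem_sideFin, ← not_rch_cut_iff hT h]
  simp

lemma mem_sideFin_left {a v : Fin n} {e : Sym2 (Fin n)} :
    v ∈ sideFin N.graph X e a ↔ v ∈ X ∧ v ∈ sideFin N.graph Finset.univ e a := by
  simp [mem_sideFin]

lemma runs_splitProg (hT : N.graph.IsTree) (hL : ListsEdges N.graph es) (hB : Bounds N M)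
    (hC : Ctx N es qs X s) {k : ℕ} (hk : k < es.length) (hw : s.word wE 0 = k)
    (hkX : toEdge es[k] ∈ edgesIn N.graph X) :
    Runs M splitProg s (800 * n) fun s' =>
      s'.word wY 0 = code N.graph (sideFin N.graph X (toEdge es[k]) es[k].1) ∧
      s'.word wZ 0 = code N.graph (sideFin N.graph X (toEdge es[k]) es[k].2) := by
  have hlen := hL.length hT
  have h1 := hB.one_mod
  obtain ⟨cA, cB⟩ := conn_sideFin hT hC.conn hkX
  have hkn : k < n := by omega
  have hke : ∀ v : Fin n, (k * n % M + v) % M = k * n + v := fun v => by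
    rw [Nat.mod_add_mod, Nat.mod_eq_of_lt (hB.row_lt (by omega) v.2)]
  refine Runs.seq (T₁ := 52 * n + 10) (T₂ := 748 * n - 10)
    (runs_mark hB hC.env (Y := sideFin N.graph X (toEdge es[k]) es[k].1) ?_ ?_) ?_ (by omega)
  · intro s' v hF hv
    have hC' := hC.frame hF rfl rfl (by decide) (by decide)
    have hw' : s'.word wE 0 = k := by rw [hF.word _ (by decide), hw]
    have e1 := hC'.marks.one_le v
    have e2 := (hC'.side k hk).one_le v
    rw [mem_sideFin_left, ← e1, ← e2]
    simp only [Test.holds, WExp.eval, Nat.zero_mod, h1, hv, hw', hC'.wx, hC'.env.n_eq,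
      hC'.row_mod hT hB v.2, hke]
  · simp only [Test.time, WExp.time]; omega
  intro s₁ hF₁ hm₁
  have hC₁ := hC.frame hF₁ rfl rfl (by decide) (by decide)
  refine Runs.seq (runs_codeProg hT hL hB hC₁.env cA hm₁) (T₂ := 448 * n - 10) ?_ (by omega)
  intro s₂ hF₂ hc₂
  have hC₂ := hC₁.frame hF₂ rfl rfl (by decide) (by decide)
  refine Runs.seq (T₁ := 5) (T₂ := 446 * n - 15) (R := fun s' => s'.word wY 0 =
    code N.graph (sideFin N.graph X (toEdge es[k]) es[k].1))
    (Runs.basic rfl (by decide) (by simp [Program.den, hc₂])) ?_ (by omega)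
  intro s₃ hF₃ hy₃
  have hC₃ := hC₂.frame hF₃ rfl rfl (by decide) (by decide)
  have hw₃ : s₃.word wE 0 = k := by
    rw [hF₃.word _ (by decide), hF₂.word _ (by decide), hF₁.word _ (by decide), hw]
  refine Runs.seq (T₁ := 53 * n + 10) (T₂ := 393 * n - 25)
    (runs_mark hB hC₃.env (Y := sideFin N.graph X (toEdge es[k]) es[k].2) ?_ ?_) ?_ (by omega)
  · intro s' v hF hv
    have hC' := hC₃.frame hF rfl rfl (by decide) (by decide)
    have hw' : s'.word wE 0 = k := by rw [hF.word _ (by decide), hw₃]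
    have e1 := hC'.marks.one_le v
    have e2 := (hC'.side k hk).one_le v
    rw [mem_sideFin_right hT (mem_edgesIn.1 hkX).1, ← e1, ← e2]
    simp only [Test.holds, WExp.eval, Nat.zero_mod, h1, hv, hw', hC'.wx, hC'.env.n_eq,
      hC'.row_mod hT hB v.2, hke]
  · simp only [Test.time, WExp.time]; omega
  intro s₄ hF₄ hm₄
  have hC₄ := hC₃.frame hF₄ rfl rfl (by decide) (by decide)
  refine Runs.seq (runs_codeProg hT hL hB hC₄.env cB hm₄) (T₂ := 5) ?_ (by omega)
  intro s₅ hF₅ hc₅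
  refine Runs.basic rfl (by decide) ?_
  have hy₅ : s₅.word wY 0 = code N.graph (sideFin N.graph X (toEdge es[k]) es[k].1) := by
    rw [hF₅.word _ (by decide), hF₄.word _ (by decide), hy₃]
  simp only [Program.den, WExp.eval, Nat.zero_mod, hc₅, State.word_setWord]
  simp [hy₅]

end RAM

/-! ### Merging -/

namespace RAM

variable {n M : ℕ} {N : Network (Fin n)} {es : List (Fin n × Fin n)} {s s' : State}
  {qs : List (Finset (Fin n))} {X Y : Finset (Fin n)} {S S₁ S₂ : List (Sym2 (Fin n))}

/-- The tables contain the sequence `S` of the subtree `X`, with its gains and its keys. The tables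
contain keys by position, and `κ` is any function with these values on the edges of `S`. -/
structure Row (N : Network (Fin n)) (es : List (Fin n × Fin n)) (s : State) (X : Finset (Fin n))
    (S : List (Sym2 (Fin n))) : Prop where
  lists : Network.Lists (indSub N.graph (X : Set (Fin n))) S
  tot : s.num rTot (code N.graph X) = N.conWeight (edgesIn N.graph X)
  seq : ∀ (i : ℕ) (h : i < S.length),
    s.word wSeq (code N.graph X * n + i) = (es.map toEdge).idxOf S[i]
  gain : ∀ (i : ℕ) (h : i < S.length), s.num rGain (code N.graph X * n + i) = N.seqGain S S[i]
  pos : ∀ i < S.length, 0 < s.num rKeyP (code N.graph X * n + i)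
  keys : ∀ κ : Sym2 (Fin n) → ℝ, (∀ (i : ℕ) (h : i < S.length), κ S[i] =
      s.num rKeyW (code N.graph X * n + i) / s.num rKeyP (code N.graph X * n + i)) →
    IsKeys N.posLen (N.seqGain S) κ S

/-- The first `t` cells of the buffer contain the first `t` edges of `S` and their gains. -/
def Buf (es : List (Fin n × Fin n)) (s : State)
    (S : List (Sym2 (Fin n))) (g : Sym2 (Fin n) → ℝ) (t : ℕ) : Prop :=
  ∀ (i : ℕ) (h : i < S.length), i < t →
    s.word wBuf i = (es.map toEdge).idxOf S[i] ∧ s.num rBuf i = g S[i]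

lemma Row.of_eq (h : Row N es s X S) (h1 : s'.num rTot = s.num rTot)
    (h2 : s'.word wSeq = s.word wSeq) (h3 : s'.num rGain = s.num rGain)
    (h4 : s'.num rKeyW = s.num rKeyW) (h5 : s'.num rKeyP = s.num rKeyP) : Row N es s' X S :=
  ⟨h.lists, by rw [h1, h.tot], by rw [h2]; exact h.seq, by rw [h3]; exact h.gain,
    by rw [h5]; exact h.pos, by rw [h4, h5]; exact h.keys⟩

/-- A program which does not write into the tables of the chosen sequences. -/
def keepsRows (P : Program) : Bool :=
  !P.wmods.contains wSeq && !P.nmods.contains rTot && !P.nmods.contains rGain &&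
    !P.nmods.contains rKeyW && !P.nmods.contains rKeyP

lemma Row.frame (h : Row N es s X S) {P : Program} (hF : Frame P s s')
    (hP : keepsRows P = true) : Row N es s' X S := by
  simp only [keepsRows, Bool.and_eq_true, Bool.not_eq_true', List.contains_eq_mem,
    decide_eq_false_iff_not] at hP
  exact h.of_eq (hF.num _ hP.1.1.1.2) (hF.word _ hP.1.1.1.1) (hF.num _ hP.1.1.2) (hF.num _ hP.1.2)
    (hF.num _ hP.2)

lemma Row.length (h : Row N es s X S) (hT : N.graph.IsTree)
    (hX : Conn N.graph (X : Set (Fin n))) : S.length + 1 = X.card :=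
  h.lists.length_add_one hT hX

/-- Taking the next edge `S[a]` of the subtree `Y` into cell `t` of the buffer. -/
lemma runs_takeProg (hT : N.graph.IsTree) (hB : Bounds N M) (hC : Ctx N es qs X s)
    (hY : Conn N.graph (Y : Set (Fin n))) (hR : Row N es s Y S) {z c a t : ℕ}
    (hz : s.word z 0 = code N.graph Y) (hc : s.word c 0 = a) (ht : s.word wT 0 = t)
    (ha : a < S.length) {L : List (Sym2 (Fin n))} {g : Sym2 (Fin n) → ℝ} (hb : Buf es s L g t)
    (htL : t < L.length) (hLt : L[t] = S[a]) (hg : g S[a] = N.seqGain S S[a])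
    (hz' : z = wY ∨ z = wZ) (hc' : c = wA ∨ c = wB) :
    Runs M (takeProg z c) s 40 fun s' => Buf es s' L g (t + 1) ∧ s'.word c 0 = a + 1 := by
  have h1 := hB.one_mod
  have hlen := hR.length hT hY
  have hYn : Y.card ≤ n := (Finset.card_le_univ Y).trans (by simp)
  have ha1 : (a + 1) % M = a + 1 := hB.mod_eq (by omega)
  have hrow := hB.row_mod (v := a) (code_lt hT hY) (by omega)
  have e1 := hR.seq a ha
  have e2 := hR.gain a ha
  have hn := hC.env.n_eq
  refine Runs.basic rfl (by rcases hz' with rfl | rfl <;> rcases hc' with rfl | rfl <;> decide) ?_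
  rcases hz' with rfl | rfl <;> rcases hc' with rfl | rfl
  all_goals
    refine ⟨fun i hi hit => ?_, by simp [takeProg, Program.den, hc, h1, ha1]⟩
    by_cases hit' : i = t
    · subst hit'
      simp [takeProg, Program.den, hz, hc, ht, hn, hrow, e1, e2, hLt, hg]
    · have := hb i hi (by omega)
      simp [takeProg, Program.den, hz, hc, ht, hn, hrow, hit', this]

/-- A function on the edges with given values along two disjoint sequences. -/
lemma exists_key {E : Type*} [DecidableEq E] {S₁ S₂ : List E} (hn : (S₁ ++ S₂).Nodup)
    (f₁ f₂ : ℕ → ℝ) : ∃ κ : E → ℝ, (∀ (i : ℕ) (h : i < S₁.length), κ S₁[i] = f₁ i) ∧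
      ∀ (i : ℕ) (h : i < S₂.length), κ S₂[i] = f₂ i := by
  obtain ⟨h1, h2, h3⟩ := List.nodup_append.1 hn
  refine ⟨fun x => if x ∈ S₁ then f₁ (S₁.idxOf x) else f₂ (S₂.idxOf x), fun i h => ?_,
    fun i h => ?_⟩
  · simp [List.Nodup.idxOf_getElem h1]
  · have : S₂[i] ∉ S₁ := fun h' => h3 _ h' _ (List.getElem_mem h) rfl
    simp [this, List.Nodup.idxOf_getElem h2]

lemma eq_take_succ {E : Type*} {L R : List E} {x : E} {t : ℕ} (h : L = L.take t ++ x :: R)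
    (ht : t ≤ L.length) : ∃ h' : t < L.length, L[t] = x ∧ L = L.take (t + 1) ++ R := by
  have hl : (L.take t).length = t := by simp [ht]
  have ht' : t < L.length := by
    have := congrArg List.length h
    rw [List.length_append, hl, List.length_cons] at this
    omega
  have hx : L[t] = x := by
    have h2 : L[t]? = some x := by
      rw [h, List.getElem?_append_right (by rw [hl]), hl]; simp
    rw [List.getElem?_eq_getElem ht'] at h2
    simpa using h2
  refine ⟨ht', hx, ?_⟩
  rw [List.take_succ_eq_append_getElem ht', hx, List.append_assoc]
  exact h

/-- The invariant of the merging loop: what has been written, followed by the merge of the remaining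
parts of the two chains, is the merge of the chains. -/
lemma runs_mergeProg (hT : N.graph.IsTree) (hB : Bounds N M) (hC : Ctx N es qs X s)
    {A B : Finset (Fin n)} (hA : A ∈ qs) (hBq : B ∈ qs)
    (hy : s.word wY 0 = code N.graph A) (hz : s.word wZ 0 = code N.graph B)
    (hR₁ : Row N es s A S₁) (hR₂ : Row N es s B S₂)
    (hlen : S₁.length + S₂.length + 2 = X.card) {κ : Sym2 (Fin n) → ℝ}
    (hκ₁ : ∀ (i : ℕ) (h : i < S₁.length), κ S₁[i] =
      s.num rKeyW (code N.graph A * n + i) / s.num rKeyP (code N.graph A * n + i))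
    (hκ₂ : ∀ (i : ℕ) (h : i < S₂.length), κ S₂[i] =
      s.num rKeyW (code N.graph B * n + i) / s.num rKeyP (code N.graph B * n + i))
    {g : Sym2 (Fin n) → ℝ} (hg₁ : ∀ j ∈ S₁, g j = N.seqGain S₁ j)
    (hg₂ : ∀ j ∈ S₂, g j = N.seqGain S₂ j) :
    Runs M mergeProg s (200 * n + 50) fun s' =>
      Buf es s' (keyMerge κ S₁ S₂) g (keyMerge κ S₁ S₂).length := by
  have h1 := hB.one_mod
  set L := keyMerge κ S₁ S₂ with hL
  have hLlen : L.length = S₁.length + S₂.length := by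
    rw [hL, (keyMerge_perm S₁ S₂).length_eq, List.length_append]
  have hXn := hC.card_le
  have hAc := hC.enum.conn A hA
  have hBc := hC.enum.conn B hBq
  have hlA := hR₁.length hT hAc
  have hlB := hR₂.length hT hBc
  refine Runs.seq (T₁ := 5) (T₂ := 200 * n + 40) (R := fun s' => s'.word wA 0 = 0)
    (Runs.basic rfl (by decide) (by simp [Program.den])) ?_ (by omega)
  intro s₁ hF₁ ha₁
  refine Runs.seq (T₁ := 5) (T₂ := 200 * n + 30) (R := fun s' => s'.word wA 0 = 0 ∧
    s'.word wB 0 = 0) (Runs.basic rfl (by decide) (by simp [Program.den, ha₁])) ?_ (by omega)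
  rintro s₂ hF₂ ⟨ha₂, hb₂⟩
  have hC₂ := (hC.frame hF₁ rfl rfl (by decide) (by decide)).frame hF₂ rfl rfl (by decide)
    (by decide)
  have hR₁₂ := (hR₁.frame hF₁ rfl).frame hF₂ rfl
  have hR₂₂ := (hR₂.frame hF₁ rfl).frame hF₂ rfl
  have hy₂ : s₂.word wY 0 = code N.graph A := by
    rw [hF₂.word _ (by decide), hF₁.word _ (by decide), hy]
  have hz₂ : s₂.word wZ 0 = code N.graph B := by
    rw [hF₂.word _ (by decide), hF₁.word _ (by decide), hz]
  have hKW₂ : s₂.num rKeyW = s.num rKeyW := by rw [hF₂.num _ (by decide), hF₁.num _ (by decide)]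
  have hKP₂ : s₂.num rKeyP = s.num rKeyP := by rw [hF₂.num _ (by decide), hF₁.num _ (by decide)]
  refine Runs.forLoop (N := L.length) (T := 160) (fun t s' => t ≤ L.length ∧ Buf es s' L g t ∧
    ∃ a b, a ≤ S₁.length ∧ b ≤ S₂.length ∧ a + b = t ∧ s'.word wA 0 = a ∧ s'.word wB 0 = b ∧
      L = L.take t ++ keyMerge κ (S₁.drop a) (S₂.drop b)) (by decide) (hB.lt (by omega))
    ?_ ?_ ?_ ?_ ?_
  · intro s' hF
    have hC' := hC₂.frame hF rfl rfl (by decide) (by decide)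
    simp only [WExp.eval, Nat.zero_mod, hC'.wx, hC'.size, h1]
    omega
  · refine ⟨Nat.zero_le _, fun i _ hi => absurd hi (by omega), 0, 0, Nat.zero_le _, Nat.zero_le _,
      rfl, by simp [ha₂], by simp [hb₂], by simp [hL]⟩
  · rintro t s₃ ht hF₃ hwt ⟨-, hbuf, a, b, ha, hb, hab, hwa, hwb, hLab⟩
    have hC₃ := hC₂.frame hF₃ rfl rfl (by decide) (by decide)
    have hR₁₃ := hR₁₂.frame hF₃ rfl
    have hR₂₃ := hR₂₂.frame hF₃ rfl
    have hy₃ : s₃.word wY 0 = code N.graph A := by rw [hF₃.word _ (by decide), hy₂]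
    have hz₃ : s₃.word wZ 0 = code N.graph B := by rw [hF₃.word _ (by decide), hz₂]
    have hKW₃ : s₃.num rKeyW = s.num rKeyW := by rw [hF₃.num _ (by decide), hKW₂]
    have hKP₃ : s₃.num rKeyP = s.num rKeyP := by rw [hF₃.num _ (by decide), hKP₂]
    -- the two ways to continue
    have takeA : ∀ (ha' : a < S₁.length), keyMerge κ (S₁.drop a) (S₂.drop b) =
        S₁[a] :: keyMerge κ (S₁.drop (a + 1)) (S₂.drop b) →
        Runs M (takeProg wY wA) s₃ 40 fun s'' => t + 1 ≤ L.length ∧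
          Buf es (s''.setWord wT 0 (t + 1)) L g (t + 1) ∧
          ∃ a b, a ≤ S₁.length ∧ b ≤ S₂.length ∧ a + b = t + 1 ∧
            (s''.setWord wT 0 (t + 1)).word wA 0 = a ∧ (s''.setWord wT 0 (t + 1)).word wB 0 = b ∧
            L = L.take (t + 1) ++ keyMerge κ (S₁.drop a) (S₂.drop b) := by
      intro ha' hm
      rw [hm] at hLab
      obtain ⟨htL, hLt, hL'⟩ := eq_take_succ hLab ht.le
      refine (runs_takeProg hT hB hC₃ hAc hR₁₃ hy₃ hwa hwt ha' hbuf htL hLt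
        (hg₁ _ (List.getElem_mem _)) (Or.inl rfl) (Or.inl rfl)).imp le_rfl ?_
      rintro s₄ hF₄ ⟨hbuf', ha''⟩
      refine ⟨htL, fun i hi hit => ?_, a + 1, b, ha', hb, by omega, by simp [ha''], ?_, hL'⟩
      · simpa using hbuf' i hi hit
      · have : s₄.word wB 0 = b := by rw [hF₄.word _ (by decide), hwb]
        simp [this]
    have takeB : ∀ (hb' : b < S₂.length), keyMerge κ (S₁.drop a) (S₂.drop b) =
        S₂[b] :: keyMerge κ (S₁.drop a) (S₂.drop (b + 1)) →
        Runs M (takeProg wZ wB) s₃ 40 fun s'' => t + 1 ≤ L.length ∧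
          Buf es (s''.setWord wT 0 (t + 1)) L g (t + 1) ∧
          ∃ a b, a ≤ S₁.length ∧ b ≤ S₂.length ∧ a + b = t + 1 ∧
            (s''.setWord wT 0 (t + 1)).word wA 0 = a ∧ (s''.setWord wT 0 (t + 1)).word wB 0 = b ∧
            L = L.take (t + 1) ++ keyMerge κ (S₁.drop a) (S₂.drop b) := by
      intro hb' hm
      rw [hm] at hLab
      obtain ⟨htL, hLt, hL'⟩ := eq_take_succ hLab ht.le
      refine (runs_takeProg hT hB hC₃ hBc hR₂₃ hz₃ hwb hwt hb' hbuf htL hLt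
        (hg₂ _ (List.getElem_mem _)) (Or.inr rfl) (Or.inr rfl)).imp le_rfl ?_
      rintro s₄ hF₄ ⟨hbuf', hb''⟩
      refine ⟨htL, fun i hi hit => ?_, a, b + 1, ha, hb', by omega, ?_, by simp [hb''], hL'⟩
      · simpa using hbuf' i hi hit
      · have : s₄.word wA 0 = a := by rw [hF₄.word _ (by decide), hwa]
        simp [this]
    have hdropA : ∀ ha' : a < S₁.length, S₁.drop a = S₁[a] :: S₁.drop (a + 1) := fun ha' =>
      List.drop_eq_getElem_cons ha'
    have hdropB : ∀ hb' : b < S₂.length, S₂.drop b = S₂[b] :: S₂.drop (b + 1) := fun hb' =>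
      List.drop_eq_getElem_cons hb'
    have hsA : s₃.word wSize (code N.graph A) = A.card := hC₃.enum.size A hA
    have hsB : s₃.word wSize (code N.graph B) = B.card := hC₃.enum.size B hBq
    refine Runs.ite (T := 120) (fun hc => ?_) (fun hc => ?_)
      (by simp only [Test.time, WExp.time]; omega)
    · simp only [Test.holds, WExp.eval, Nat.zero_mod, h1, hwb, hz₃, hsB] at hc
      have hb' : b < S₂.length := by omega
      have hrowB := hB.row_mod (v := b) (code_lt hT hBc) (by omega)
      refine Runs.ite (T := 40) (fun hd => ?_) (fun hd => ?_)
        (by simp only [Test.time, NExp.time, WExp.time]; omega)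
      · simp only [Test.holds, WExp.eval, NExp.eval, Nat.zero_mod, h1, hwa, hwb, hy₃, hz₃, hsA,
          hC₃.env.n_eq, hrowB] at hd
        have ha' : a < S₁.length := by omega
        rw [hB.row_mod (v := a) (code_lt hT hAc) (by omega), hKW₃, hKP₃] at hd
        refine takeA ha' ?_
        rw [hdropA ha', hdropB hb', keyMerge_cons_left]
        have p1 := hR₁₃.pos a ha'
        have p2 := hR₂₃.pos b hb'
        rw [hKP₃] at p1 p2
        rw [hκ₁ a ha', hκ₂ b hb', div_le_div_iff₀ p2 p1]
        exact hd.2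
      · refine takeB hb' ?_
        rcases Nat.lt_or_ge a S₁.length with ha' | ha'
        · rw [hdropA ha', hdropB hb', keyMerge_cons_right]
          have p1 := hR₁₃.pos a ha'
          have p2 := hR₂₃.pos b hb'
          rw [hKP₃] at p1 p2
          rw [hκ₁ a ha', hκ₂ b hb', div_lt_div_iff₀ p1 p2]
          by_contra hcon
          refine hd ?_
          simp only [Test.holds, WExp.eval, NExp.eval, Nat.zero_mod, h1, hwa, hwb, hy₃, hz₃, hsA,
            hC₃.env.n_eq, hrowB, hKW₃, hKP₃, hB.row_mod (v := a) (code_lt hT hAc) (by omega)]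
          exact ⟨by omega, not_lt.1 hcon⟩
        · rw [List.drop_of_length_le ha', keyMerge_nil_left, keyMerge_nil_left, hdropB hb']
    · simp only [Test.holds, WExp.eval, Nat.zero_mod, h1, hwb, hz₃, hsB] at hc
      have hb' : S₂.length ≤ b := by omega
      have ha' : a < S₁.length := by omega
      refine (takeA ha' ?_).imp (by omega) fun _ _ h => h
      rw [List.drop_of_length_le hb', keyMerge_nil_right, keyMerge_nil_right, hdropA ha']
  · rintro s₃ hF₃ ⟨-, hbuf, -⟩
    exact hbuf
  · simp only [WExp.time]; omega

lemma runs_appendProg (hL : ListsEdges N.graph es) (hB : Bounds N M)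
    (hC : Ctx N es qs X s) {A B : Finset (Fin n)}
    (hy : s.word wY 0 = code N.graph A) (hz : s.word wZ 0 = code N.graph B)
    (htX : s.num rTot (code N.graph X) = N.conWeight (edgesIn N.graph X))
    (hR₁ : Row N es s A S₁) (hR₂ : Row N es s B S₂)
    {k : ℕ} (hk : k < es.length) (hw : s.word wE 0 = k) {L : List (Sym2 (Fin n))}
    (hlen : L.length + 2 = X.card) {g : Sym2 (Fin n) → ℝ} (hb : Buf es s L g L.length)
    (hg : g (toEdge es[k]) = N.conWeight (edgesIn N.graph X) - N.conWeight (edgesIn N.graph A)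
      - N.conWeight (edgesIn N.graph B)) :
    Runs M appendProg s 50 fun s' => Buf es s' (L ++ [toEdge es[k]]) g (L.length + 1) := by
  have h1 := hB.one_mod
  refine Runs.basic rfl (by decide) fun i hi hit => ?_
  have hidx : (es.map toEdge).idxOf (toEdge es[k]) = k := by
    have h2 := List.Nodup.idxOf_getElem hL.1 k (by simpa using hk)
    rw [List.getElem_map] at h2
    exact h2
  have e1 : X.card - 1 - 1 = L.length := by omega
  have e2 := hR₁.tot
  have e3 := hR₂.tot
  rcases Nat.lt_succ_iff_lt_or_eq.1 hit with hit | rfl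
  · have := hb i hit hit
    rw [List.getElem_append_left hit]
    simp [appendProg, Program.den, hC.wx, hC.size, h1, e1, hit.ne, this]
  · simp [appendProg, Program.den, hC.wx, hC.size, h1, e1, hw, hidx, hy, hz, htX, hg, e2, e3]

end RAM

/-! ### Objective values, output and storage -/

namespace RAM

variable {n M : ℕ} {N : Network (Fin n)} {es : List (Fin n × Fin n)} {s s' : State}
  {qs : List (Finset (Fin n))} {X : Finset (Fin n)} {S : List (Sym2 (Fin n))}
  {g : Sym2 (Fin n) → ℝ}

lemma Buf.congr {t : ℕ} (h : Buf es s S g t) (h1 : s'.word wBuf = s.word wBuf)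
    (h2 : s'.num rBuf = s.num rBuf) : Buf es s' S g t := fun i hi hit => by
  rw [h1, h2]; exact h i hi hit

lemma Env.len_idxOf (hE : Env N es s) (hL : ListsEdges N.graph es) {e : Sym2 (Fin n)}
    (he : e ∈ N.graph.edgeSet) : s.num rLen ((es.map toEdge).idxOf e) = N.len e := by
  have hlt : (es.map toEdge).idxOf e < (es.map toEdge).length :=
    List.idxOf_lt_length_of_mem ((hL.2 e).2 he)
  have hlt' : (es.map toEdge).idxOf e < es.length := by simpa using hlt
  have h := List.getElem_idxOf hlt
  rw [hE.len _ hlt']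
  rw [List.getElem_map] at h
  rw [h]

lemma runs_objProg (hL : ListsEdges N.graph es) (hB : Bounds N M)
    (hC : Ctx N es qs X s) (hS : ∀ e ∈ S, e ∈ N.graph.edgeSet) (hlen : S.length + 1 = X.card)
    (hb : Buf es s S g S.length) :
    Runs M objProg s (100 * n + 50) fun s' => s'.num rObj 0 = costFrom N.len g 0 S := by
  have h1 := hB.one_mod
  have hXn := hC.card_le
  refine Runs.seq (T₁ := 5) (T₂ := 100 * n + 40) (R := fun s' => s'.num rObj 0 = 0)
    (Runs.basic rfl (by decide) (by simp [Program.den])) ?_ (by omega)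
  intro s₁ hF₁ ho₁
  refine Runs.seq (T₁ := 5) (T₂ := 100 * n + 30) (R := fun s' => s'.num rObj 0 = 0 ∧
    s'.num rTime 0 = 0) (Runs.basic rfl (by decide) (by simp [Program.den, ho₁])) ?_ (by omega)
  rintro s₂ hF₂ ⟨ho₂, ht₂⟩
  have hC₂ := (hC.frame hF₁ rfl rfl (by decide) (by decide)).frame hF₂ rfl rfl (by decide)
    (by decide)
  have hb₂ := (hb.congr (hF₁.word _ (by decide)) (hF₁.num _ (by decide))).congr
    (hF₂.word _ (by decide)) (hF₂.num _ (by decide))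
  refine Runs.forLoop (N := S.length) (T := 60) (fun t s' => s'.num rObj 0 +
    costFrom N.len g (s'.num rTime 0) (S.drop t) = costFrom N.len g 0 S) (by decide)
    (hB.lt (by omega)) ?_ ?_ ?_ ?_ ?_
  · intro s' hF
    have hC' := hC₂.frame hF rfl rfl (by decide) (by decide)
    simp only [WExp.eval, Nat.zero_mod, hC'.wx, hC'.size, h1]
    omega
  · simp [ho₂, ht₂]
  · intro t s₃ ht hF₃ hwt hI
    have hC₃ := hC₂.frame hF₃ rfl rfl (by decide) (by decide)
    obtain ⟨e1, e2⟩ := (hb₂.congr (hF₃.word _ (by decide)) (hF₃.num _ (by decide))) t ht ht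
    have e3 := hC₃.env.len_idxOf hL (hS _ (List.getElem_mem ht))
    refine Runs.basic rfl (by decide) ?_
    rw [List.drop_eq_getElem_cons ht, costFrom] at hI
    simp only [Program.den, WExp.eval, NExp.eval, Nat.zero_mod, hwt, e1, e3]
    simp [hwt, e2]
    linarith
  · intro s' hF hI
    simpa [costFrom] using hI
  · simp only [WExp.time]; omega

lemma runs_printBuf (hB : Bounds N M)
    (hC : Ctx N es qs X s) (hlen : S.length + 1 = X.card) (hb : Buf es s S g S.length) :
    Runs M printBuf s (50 * n + 50) fun s' =>
      s'.out = s.out ++ Network.encodeSeq (es.map toEdge) S := by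
  have h1 := hB.one_mod
  have hXn := hC.card_le
  refine Runs.seq (T₁ := 10) (T₂ := 50 * n + 30) (R := fun s' => s'.out = s.out ++ [S.length])
    (Runs.basic rfl (by decide) ?_) ?_ (by omega)
  · have : X.card - 1 = S.length := by omega
    simp [Program.den, hC.wx, hC.size, h1, this]
  intro s₁ hF₁ ho₁
  have hC₁ := hC.frame hF₁ rfl rfl (by decide) (by decide)
  have hb₁ := hb.congr (hF₁.word _ (by decide)) (hF₁.num _ (by decide))
  refine Runs.forLoop (N := S.length) (T := 10) (fun t s' => s'.out = s.out ++ [S.length] ++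
    (S.take t).map fun e => (es.map toEdge).idxOf e) (by decide)
    (hB.lt (by omega)) ?_ ?_ ?_ ?_ ?_
  · intro s' hF
    have hC' := hC₁.frame hF rfl rfl (by decide) (by decide)
    simp only [WExp.eval, Nat.zero_mod, hC'.wx, hC'.size, h1]
    omega
  · simp [ho₁]
  · intro t s₂ ht hF₂ hwt hI
    obtain ⟨e1, -⟩ := (hb₁.congr (hF₂.word _ (by decide)) (hF₂.num _ (by decide))) t ht ht
    refine Runs.basic rfl (by decide) ?_
    simp only [Program.den, WExp.eval, Nat.zero_mod, hwt, e1, State.out_setWord, State.out_print,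
      hI]
    rw [List.take_succ_eq_append_getElem ht, List.map_append, List.map_singleton,
      ← List.append_assoc]
  · intro s' hF hI
    rw [hI, List.take_length]
    simp [Network.encodeSeq]
  · simp only [WExp.time]; omega

/-- The row of `X` in the tables contains the sequence `S` and the values of `g`. -/
def SeqRow (N : Network (Fin n)) (es : List (Fin n × Fin n)) (s : State) (X : Finset (Fin n))
    (S : List (Sym2 (Fin n))) (g : Sym2 (Fin n) → ℝ) : Prop :=
  ∀ (i : ℕ) (h : i < S.length),
    s.word wSeq (code N.graph X * n + i) = (es.map toEdge).idxOf S[i] ∧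
    s.num rGain (code N.graph X * n + i) = g S[i]

lemma SeqRow.congr (h : SeqRow N es s X S g) (h1 : s'.word wSeq = s.word wSeq)
    (h2 : s'.num rGain = s.num rGain) : SeqRow N es s' X S g := fun i hi => by
  rw [h1, h2]; exact h i hi

/-- The cell `j` does not belong to row `x` of a table. -/
def OffRow (n x j : ℕ) : Prop := ∀ i < n, j ≠ x * n + i

lemma runs_printSeq (hT : N.graph.IsTree) (hB : Bounds N M)
    (hC : Ctx N es qs X s) (hlen : S.length + 1 = X.card) (hb : SeqRow N es s X S g) :
    Runs M printSeq s (50 * n + 50) fun s' =>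
      s'.out = s.out ++ Network.encodeSeq (es.map toEdge) S := by
  have h1 := hB.one_mod
  have hXn := hC.card_le
  refine Runs.seq (T₁ := 10) (T₂ := 50 * n + 30) (R := fun s' => s'.out = s.out ++ [S.length])
    (Runs.basic rfl (by decide) ?_) ?_ (by omega)
  · have : X.card - 1 = S.length := by omega
    simp [Program.den, hC.wx, hC.size, h1, this]
  intro s₁ hF₁ ho₁
  have hC₁ := hC.frame hF₁ rfl rfl (by decide) (by decide)
  have hb₁ := hb.congr (hF₁.word _ (by decide)) (hF₁.num _ (by decide))
  refine Runs.forLoop (N := S.length) (T := 20) (fun t s' => s'.out = s.out ++ [S.length] ++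
    (S.take t).map fun e => (es.map toEdge).idxOf e) (by decide)
    (hB.lt (by omega)) ?_ ?_ ?_ ?_ ?_
  · intro s' hF
    have hC' := hC₁.frame hF rfl rfl (by decide) (by decide)
    simp only [WExp.eval, Nat.zero_mod, hC'.wx, hC'.size, h1]
    omega
  · simp [ho₁]
  · intro t s₂ ht hF₂ hwt hI
    have hC₂ := hC₁.frame hF₂ rfl rfl (by decide) (by decide)
    obtain ⟨e1, -⟩ := (hb₁.congr (hF₂.word _ (by decide)) (hF₂.num _ (by decide))) t ht
    refine Runs.basic rfl (by decide) ?_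
    simp only [Program.den, WExp.eval, Nat.zero_mod, hwt, hC₂.wx, hC₂.env.n_eq,
      hC₂.row_mod hT hB (show t < n by omega), e1, State.out_setWord, State.out_print, hI]
    rw [List.take_succ_eq_append_getElem ht, List.map_append, List.map_singleton,
      ← List.append_assoc]
  · intro s' hF hI
    rw [hI, List.take_length]
    simp [Network.encodeSeq]
  · simp only [WExp.time]; omega

lemma runs_storeProg (hT : N.graph.IsTree) (hB : Bounds N M)
    (hC : Ctx N es qs X s) (hlen : S.length + 1 = X.card) (hb : Buf es s S g S.length) :
    Runs M storeProg s (60 * n + 50) fun s' => SeqRow N es s' X S g ∧ s'.word wFlag 0 = 1 ∧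
      s'.num rBest 0 = s.num rObj 0 ∧ ∀ j, OffRow n (code N.graph X) j →
        s'.word wSeq j = s.word wSeq j ∧ s'.num rGain j = s.num rGain j := by
  have h1 := hB.one_mod
  have hXn := hC.card_le
  refine Runs.seq (T₁ := 5) (T₂ := 60 * n + 40) (R := fun s' => s'.word wFlag 0 = 1)
    (Runs.basic rfl (by decide) (by simp [Program.den, h1])) ?_ (by omega)
  intro s₁ hF₁ hf₁
  refine Runs.seq (T₁ := 5) (T₂ := 60 * n + 30) (R := fun s' => s'.num rBest 0 = s.num rObj 0)
    (Runs.basic rfl (by decide) (by simp [Program.den, hF₁.num rObj (by decide)])) ?_ (by omega)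
  intro s₂ hF₂ hbest₂
  have hf₂ : s₂.word wFlag 0 = 1 := by rw [hF₂.word _ (by decide), hf₁]
  have hC₂ := (hC.frame hF₁ rfl rfl (by decide) (by decide)).frame hF₂ rfl rfl (by decide)
    (by decide)
  have hb₂ := (hb.congr (hF₁.word _ (by decide)) (hF₁.num _ (by decide))).congr
    (hF₂.word _ (by decide)) (hF₂.num _ (by decide))
  have e1 : s₂.word wSeq = s.word wSeq := by rw [hF₂.word _ (by decide), hF₁.word _ (by decide)]
  have e2 : s₂.num rGain = s.num rGain := by rw [hF₂.num _ (by decide), hF₁.num _ (by decide)]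
  refine Runs.forLoop (N := S.length) (T := 40) (fun t s' =>
    (∀ (i : ℕ) (h : i < S.length), i < t →
      s'.word wSeq (code N.graph X * n + i) = (es.map toEdge).idxOf S[i] ∧
      s'.num rGain (code N.graph X * n + i) = g S[i]) ∧
    ∀ j, OffRow n (code N.graph X) j →
        s'.word wSeq j = s.word wSeq j ∧ s'.num rGain j = s.num rGain j) (by decide)
    (hB.lt (by omega)) ?_ ?_ ?_ ?_ ?_
  · intro s' hF
    have hC' := hC₂.frame hF rfl rfl (by decide) (by decide)
    simp only [WExp.eval, Nat.zero_mod, hC'.wx, hC'.size, h1]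
    omega
  · exact ⟨fun i _ hi => absurd hi (by omega), fun j _ => by simp [e1, e2]⟩
  · rintro t s₃ ht hF₃ hwt ⟨hI1, hI2⟩
    have hC₃ := hC₂.frame hF₃ rfl rfl (by decide) (by decide)
    obtain ⟨b1, b2⟩ := (hb₂.congr (hF₃.word _ (by decide)) (hF₃.num _ (by decide))) t ht ht
    have hrow := hC₃.row_mod hT hB (show t < n by omega)
    refine Runs.basic rfl (by decide) ⟨fun i hi hit => ?_, fun j hj => ?_⟩
    · rcases Nat.lt_succ_iff_lt_or_eq.1 hit with hit | rfl
      · have := hI1 i hi hit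
        simp [Program.den, hwt, hC₃.wx, hC₃.env.n_eq, hrow, hit.ne, this]
      · simp [Program.den, hwt, hC₃.wx, hC₃.env.n_eq, hrow, b1, b2]
    · have h2 := hj t (by omega)
      have := hI2 j hj
      simp [Program.den, hwt, hC₃.wx, hC₃.env.n_eq, hrow, h2, this]
  · rintro s₃ hF₃ ⟨hI1, hI2⟩
    refine ⟨fun i hi => hI1 i hi hi, ?_, ?_, hI2⟩
    · rw [hF₃.word _ (by decide), hf₂]
    · rw [hF₃.num _ (by decide), hbest₂]
  · simp only [WExp.time]; omega

end RAM

/-! ### Keys -/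

namespace RAM

variable {n M : ℕ} {N : Network (Fin n)} {es : List (Fin n × Fin n)} {s s' : State}
  {qs : List (Finset (Fin n))} {X : Finset (Fin n)} {S : List (Sym2 (Fin n))}
  {g : Sym2 (Fin n) → ℝ}

/-- The fraction `W / P` is the largest density of the initial parts of `D` of length at most
`v`. -/
structure BestPrefix {E : Type*} (c w : E → ℝ) (D : List E) (v : ℕ) (W P : ℝ) : Prop where
  pos : 0 < P
  attained : ∃ k, 0 < k ∧ k ≤ v ∧ W = total w (D.take k) ∧ P = total c (D.take k)
  le : ∀ k ≤ v, total w (D.take k) * P ≤ W * total c (D.take k)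

lemma BestPrefix.succ_keep {E : Type*} {c w : E → ℝ} {D : List E} {v : ℕ} {W P : ℝ}
    (h : BestPrefix c w D v W P)
    (hle : total w (D.take (v + 1)) * P ≤ W * total c (D.take (v + 1))) :
    BestPrefix c w D (v + 1) W P := by
  obtain ⟨k, h1, h2, h3⟩ := h.attained
  refine ⟨h.pos, ⟨k, h1, by omega, h3⟩, fun k hk => ?_⟩
  rcases Nat.le_succ_iff.1 hk with hk | rfl
  exacts [h.le k hk, hle]

lemma BestPrefix.succ_change {E : Type*} [DecidableEq E] {c w : E → ℝ} (hc : ∀ j, 0 < c j)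
    {D : List E} {v : ℕ}
    (hv : v < D.length)
    (h : v ≠ 0 → ∃ W P, BestPrefix c w D v W P ∧
      W * total c (D.take (v + 1)) ≤ total w (D.take (v + 1)) * P) :
    BestPrefix c w D (v + 1) (total w (D.take (v + 1))) (total c (D.take (v + 1))) := by
  have hpos : 0 < total c (D.take (v + 1)) :=
    total_pos (fun j _ => hc j) (by
      intro h'
      have := congrArg List.length h'
      rw [List.length_take, List.length_nil] at this
      omega)
  refine ⟨hpos, ⟨v + 1, by omega, le_rfl, rfl, rfl⟩, fun k hk => ?_⟩
  rcases Nat.le_succ_iff.1 hk with hk | rfl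
  · rcases Nat.eq_zero_or_pos v with rfl | hv0
    · obtain rfl : k = 0 := by omega
      simp
    · obtain ⟨W, P, hb, hle⟩ := h (by omega)
      have h1 := hb.le k hk
      have h2 : 0 ≤ total c (D.take k) := total_nonneg fun j _ => (hc j).le
      refine le_of_mul_le_mul_right ?_ hb.pos
      calc total w (D.take k) * total c (D.take (v + 1)) * P
          = total w (D.take k) * P * total c (D.take (v + 1)) := by ring
        _ ≤ W * total c (D.take k) * total c (D.take (v + 1)) :=
            mul_le_mul_of_nonneg_right h1 hpos.le
        _ = W * total c (D.take (v + 1)) * total c (D.take k) := by ring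
        _ ≤ total w (D.take (v + 1)) * P * total c (D.take k) :=
            mul_le_mul_of_nonneg_right hle h2
        _ = total w (D.take (v + 1)) * total c (D.take k) * P := by ring
  · exact le_rfl

lemma BestPrefix.isMaxDensity {E : Type*} {c w : E → ℝ} {D : List E} {W P : ℝ}
    (h : BestPrefix c w D D.length W P) : IsMaxDensity c w D (W / P) := by
  obtain ⟨k, h1, h2, h3, h4⟩ := h.attained
  refine ⟨⟨D.take k, List.take_prefix k D, ?_, ?_⟩, fun q hq => ?_⟩
  · intro h'
    have := congrArg List.length h'
    rw [List.length_take, List.length_nil] at this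
    omega
  · rw [← h3, ← h4, div_mul_cancel₀ _ h.pos.ne']
  · have := h.le q.length hq.length_le
    rw [← List.prefix_iff_eq_take.1 hq] at this
    rw [div_mul_eq_mul_div, le_div_iff₀ h.pos]
    exact this

/-- The densest initial part of the remainder of the sequence from position `u`. -/
lemma runs_dens (hT : N.graph.IsTree) (hL : ListsEdges N.graph es) (hB : Bounds N M)
    (hC : Ctx N es qs X s) (hS : ∀ e ∈ S, e ∈ N.graph.edgeSet) (hlen : S.length + 1 = X.card)
    (hb : SeqRow N es s X S g) {u : ℕ} (hu : u < S.length) (hwu : s.word wU 0 = u)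
    (h0 : s.num rSW 0 = 0) (h0' : s.num rSP 0 = 0) :
    Runs M (forLoop wV (.sub (edgesExp (wvar wX)) (wvar wU)) densStep) s (200 * n) fun s' =>
      BestPrefix N.posLen g (S.drop u) (S.drop u).length (s'.num rBW 0) (s'.num rBP 0) := by
  have h1 := hB.one_mod
  have hXn := hC.card_le
  set D := S.drop u with hD
  have hDl : D.length = S.length - u := by rw [hD, List.length_drop]
  refine Runs.forLoop (N := D.length) (T := 100) (fun v s' =>
    s'.num rSW 0 = total g (D.take v) ∧ s'.num rSP 0 = total N.posLen (D.take v) ∧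
    (v ≠ 0 → BestPrefix N.posLen g D v (s'.num rBW 0) (s'.num rBP 0))) (by decide)
    (hB.lt (by omega)) ?_ ?_ ?_ ?_ ?_
  · intro s' hF
    have hC' := hC.frame hF rfl rfl (by decide) (by decide)
    have hwu' : s'.word wU 0 = u := by rw [hF.word _ (by decide), hwu]
    simp only [WExp.eval, Nat.zero_mod, hC'.wx, hC'.size, h1, hwu']
    omega
  · simp [h0, h0']
  · rintro v s₁ hv hF hwv ⟨hI1, hI2, hI3⟩
    have hC₁ := hC.frame hF rfl rfl (by decide) (by decide)
    have hwu₁ : s₁.word wU 0 = u := by rw [hF.word _ (by decide), hwu]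
    have huv : u + v < S.length := by omega
    obtain ⟨b1, b2⟩ := (hb.congr (hF.word _ (by decide)) (hF.num _ (by decide))) (u + v) huv
    have hrow := hC₁.row_mod hT hB (show u + v < n by omega)
    have hmod : (u + v) % M = u + v := hB.mod_eq (by omega)
    have hSe := hS _ (List.getElem_mem huv)
    have b3 := hC₁.env.len_idxOf hL hSe
    rw [← Network.posLen_eq hSe] at b3
    have hDv : D[v] = S[u + v] := by simp [hD]
    have t1 : total g (D.take (v + 1)) = total g (D.take v) + g S[u + v] := by
      rw [List.take_succ_eq_append_getElem hv, total_append, hDv]; simp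
    have t2 : total N.posLen (D.take (v + 1)) = total N.posLen (D.take v) + N.posLen S[u + v] := by
      rw [List.take_succ_eq_append_getElem hv, total_append, hDv]; simp
    refine Runs.seq (T₁ := 20) (T₂ := 75) (R := fun s' => s'.num rSW 0 = total g (D.take (v + 1)))
      (Runs.basic rfl (by decide) ?_) ?_ (by omega)
    · simp [Program.den, hwu₁, hwv, hC₁.wx, hC₁.env.n_eq, hmod, hrow, hI1, b2, t1]
    intro s₂ hF₂ hs₂
    have hC₂ := hC₁.frame hF₂ rfl rfl (by decide) (by decide)
    have hwu₂ : s₂.word wU 0 = u := by rw [hF₂.word _ (by decide), hwu₁]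
    have hwv₂ : s₂.word wV 0 = v := by rw [hF₂.word _ (by decide), hwv]
    have b1' : s₂.word wSeq = s₁.word wSeq := hF₂.word _ (by decide)
    have b3' : s₂.num rLen = s₁.num rLen := hF₂.num _ (by decide)
    have hI2' : s₂.num rSP 0 = total N.posLen (D.take v) := by rw [hF₂.num _ (by decide), hI2]
    refine Runs.seq (T₁ := 25) (T₂ := 50) (R := fun s' =>
      s'.num rSP 0 = total N.posLen (D.take (v + 1)))
      (Runs.basic rfl (by decide) ?_) ?_ (by omega)
    · simp [Program.den, hwu₂, hwv₂, hC₂.wx, hC₂.env.n_eq, hmod, hrow, hI2', b1', b3', b1, b3, t2]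
    intro s₃ hF₃ hp₃
    have hs₃ : s₃.num rSW 0 = total g (D.take (v + 1)) := by rw [hF₃.num _ (by decide), hs₂]
    have hwv₃ : s₃.word wV 0 = v := by rw [hF₃.word _ (by decide), hwv₂]
    have hI3' : v ≠ 0 → BestPrefix N.posLen g D v (s₃.num rBW 0) (s₃.num rBP 0) := by
      rw [hF₃.num rBW (by decide), hF₃.num rBP (by decide), hF₂.num rBW (by decide),
        hF₂.num rBP (by decide)]
      exact hI3
    refine Runs.ite (T := 10) (fun hc => ?_) (fun hc => ?_)
      (by simp only [Test.time, NExp.time, WExp.time]; omega)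
    · simp only [Test.holds, WExp.eval, NExp.eval, Nat.zero_mod, h1, hwv₃, hs₃, hp₃] at hc
      refine Runs.basic rfl (by decide) ⟨hs₃, hp₃, fun _ => ?_⟩
      exact (hI3' (by omega)).succ_keep hc.2
    · simp only [Test.holds, WExp.eval, NExp.eval, Nat.zero_mod, h1, hwv₃, hs₃, hp₃] at hc
      have hb := BestPrefix.succ_change (w := g) (c := N.posLen) Network.posLen_pos hv fun hv0 =>
        ⟨_, _, hI3' hv0, (not_le.1 fun h => hc ⟨by omega, h⟩).le⟩
      refine Runs.basic rfl (by decide) ⟨by simpa [Program.den] using hs₃,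
        by simpa [Program.den] using hp₃, fun _ => ?_⟩
      simpa [Program.den, hs₃, hp₃] using hb
  · rintro s₁ hF ⟨-, -, hI3⟩
    exact hI3 (by omega)
  · simp only [WExp.time]; omega

/-- The keys of the sequence are computed from front to back; `rCW / rCP` is the current key. -/
lemma runs_keysProg (hT : N.graph.IsTree) (hL : ListsEdges N.graph es) (hB : Bounds N M)
    (hC : Ctx N es qs X s) (hS : ∀ e ∈ S, e ∈ N.graph.edgeSet) (hlen : S.length + 1 = X.card)
    (hb : SeqRow N es s X S g) :
    Runs M keysProg s (400 * (n * n)) fun s' =>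
      (∀ i < S.length, 0 < s'.num rKeyP (code N.graph X * n + i)) ∧
      (∀ κ : Sym2 (Fin n) → ℝ, (∀ (i : ℕ) (h : i < S.length), κ S[i] =
        s'.num rKeyW (code N.graph X * n + i) / s'.num rKeyP (code N.graph X * n + i)) →
        IsKeys N.posLen g κ S) ∧
      ∀ j, OffRow n (code N.graph X) j →
        s'.num rKeyW j = s.num rKeyW j ∧ s'.num rKeyP j = s.num rKeyP j := by
  have h1 := hB.one_mod
  have hXn := hC.card_le
  set x := code N.graph X with hx
  refine Runs.forLoop (N := S.length) (T := 300 * n) (fun u s' =>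
    (∀ i < S.length, i < u → 0 < s'.num rKeyP (x * n + i)) ∧
    (∀ i < S.length, i < u → ∃ r, IsMaxDensity N.posLen g (S.drop i) r ∧
      s'.num rKeyW (x * n + i) / s'.num rKeyP (x * n + i) = if i = 0 then r else
        min (s'.num rKeyW (x * n + (i - 1)) / s'.num rKeyP (x * n + (i - 1))) r) ∧
    (u ≠ 0 → s'.num rCW 0 = s'.num rKeyW (x * n + (u - 1)) ∧
      s'.num rCP 0 = s'.num rKeyP (x * n + (u - 1))) ∧
    ∀ j, OffRow n x j →
        s'.num rKeyW j = s.num rKeyW j ∧ s'.num rKeyP j = s.num rKeyP j) (by decide)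
    (hB.lt (by omega)) ?_ ?_ ?_ ?_ ?_
  · intro s' hF
    have hC' := hC.frame hF rfl rfl (by decide) (by decide)
    simp only [WExp.eval, Nat.zero_mod, hC'.wx, hC'.size, h1]
    omega
  · exact ⟨fun i _ hi => absurd hi (by omega), fun i _ hi => absurd hi (by omega), by simp,
      by simp⟩
  · rintro u s₁ hu hF hwu ⟨hI1, hI2, hI3, hI4⟩
    have hC₁ := hC.frame hF rfl rfl (by decide) (by decide)
    have hb₁ := hb.congr (hF.word _ (by decide)) (hF.num _ (by decide))
    refine Runs.seq (T₁ := 5) (T₂ := 300 * n - 10) (R := fun s' => s'.num rSW 0 = 0)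
      (Runs.basic rfl (by decide) (by simp [Program.den])) ?_ (by omega)
    intro s₂ hF₂ h0₂
    refine Runs.seq (T₁ := 5) (T₂ := 300 * n - 20) (R := fun s' => s'.num rSW 0 = 0 ∧
      s'.num rSP 0 = 0) (Runs.basic rfl (by decide) (by simp [Program.den, h0₂])) ?_ (by omega)
    rintro s₃ hF₃ ⟨h0₃, h0₃'⟩
    have hC₃ := (hC₁.frame hF₂ rfl rfl (by decide) (by decide)).frame hF₃ rfl rfl (by decide)
      (by decide)
    have hb₃ := (hb₁.congr (hF₂.word _ (by decide)) (hF₂.num _ (by decide))).congr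
      (hF₃.word _ (by decide)) (hF₃.num _ (by decide))
    have hwu₃ : s₃.word wU 0 = u := by
      rw [hF₃.word _ (by decide), hF₂.word _ (by decide), hwu]
    refine Runs.seq (runs_dens hT hL hB hC₃ hS hlen hb₃ hu hwu₃ h0₃ h0₃') (T₂ := 90) ?_
      (by omega)
    intro s₄ hF₄ hbest
    have hC₄ := hC₃.frame hF₄ rfl rfl (by decide) (by decide)
    have hwu₄ : s₄.word wU 0 = u := by rw [hF₄.word _ (by decide), hwu₃]
    have hkw₄ : s₄.num rKeyW = s₁.num rKeyW := by
      rw [hF₄.num _ (by decide), hF₃.num _ (by decide), hF₂.num _ (by decide)]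
    have hkp₄ : s₄.num rKeyP = s₁.num rKeyP := by
      rw [hF₄.num _ (by decide), hF₃.num _ (by decide), hF₂.num _ (by decide)]
    have hcw₄ : s₄.num rCW = s₁.num rCW := by
      rw [hF₄.num _ (by decide), hF₃.num _ (by decide), hF₂.num _ (by decide)]
    have hcp₄ : s₄.num rCP = s₁.num rCP := by
      rw [hF₄.num _ (by decide), hF₃.num _ (by decide), hF₂.num _ (by decide)]
    set r := s₄.num rBW 0 / s₄.num rBP 0 with hr
    have hmax : IsMaxDensity N.posLen g (S.drop u) r := hbest.isMaxDensity
    have hprev : u ≠ 0 → 0 < s₁.num rKeyP (x * n + (u - 1)) := fun h0 =>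
      hI1 (u - 1) (by omega) (by omega)
    refine Runs.seq (T₁ := 40) (T₂ := 50) (R := fun s' => 0 < s'.num rCP 0 ∧
      s'.num rCW 0 / s'.num rCP 0 = if u = 0 then r else
        min (s₁.num rKeyW (x * n + (u - 1)) / s₁.num rKeyP (x * n + (u - 1))) r) ?_ ?_ (by omega)
    · refine Runs.ite (T := 10) (fun hc => ?_) (fun hc => ?_)
        (by simp only [Test.time, NExp.time, WExp.time]; omega)
      · simp only [Test.holds, WExp.eval, NExp.eval, Nat.zero_mod, h1, hwu₄, hcw₄, hcp₄] at hc
        have hu0 : u ≠ 0 := by omega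
        obtain ⟨c1, c2⟩ := hI3 hu0
        rw [c1, c2] at hc
        refine Runs.basic rfl (by decide) ?_
        simp only [Program.den, hcw₄, hcp₄, c1, c2, if_neg hu0]
        refine ⟨hprev hu0, (min_eq_left ?_).symm⟩
        rw [hr, div_le_div_iff₀ (hprev hu0) hbest.pos]
        exact hc.2
      · simp only [Test.holds, WExp.eval, NExp.eval, Nat.zero_mod, h1, hwu₄, hcw₄, hcp₄] at hc
        refine Runs.basic rfl (by decide) ?_
        have hval : (0 < s₄.num rBP 0 ∧ r = if u = 0 then r else
            min (s₁.num rKeyW (x * n + (u - 1)) / s₁.num rKeyP (x * n + (u - 1))) r) := by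
          refine ⟨hbest.pos, ?_⟩
          split_ifs with hu0
          · rfl
          obtain ⟨c1, c2⟩ := hI3 hu0
          rw [c1, c2] at hc
          refine (min_eq_right ?_).symm
          rw [hr, div_le_div_iff₀ hbest.pos (hprev hu0)]
          exact (not_le.1 fun h => hc ⟨by omega, h⟩).le
        simpa [Program.den, ← hr] using hval
    rintro s₅ hF₅ ⟨hpos₅, hval₅⟩
    have hC₅ := hC₄.frame hF₅ rfl rfl (by decide) (by decide)
    have hwu₅ : s₅.word wU 0 = u := by rw [hF₅.word _ (by decide), hwu₄]
    have hkw₅ : s₅.num rKeyW = s₁.num rKeyW := by rw [hF₅.num _ (by decide), hkw₄]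
    have hkp₅ : s₅.num rKeyP = s₁.num rKeyP := by rw [hF₅.num _ (by decide), hkp₄]
    have hrow := hC₅.row_mod hT hB (show u < n by omega)
    rw [← hx] at hrow
    -- the tables after both assignments
    refine Runs.imp (Runs.basic (T := 50) (Q := fun s' =>
      s'.num rKeyW = Function.update (s₁.num rKeyW) (x * n + u) (s₅.num rCW 0) ∧
      s'.num rKeyP = Function.update (s₁.num rKeyP) (x * n + u) (s₅.num rCP 0) ∧
      s'.num rCW = s₅.num rCW ∧ s'.num rCP = s₅.num rCP) rfl (by decide) ?_) le_rfl ?_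
    · refine ⟨?_, ?_, ?_, ?_⟩ <;> funext j <;>
        simp [Program.den, hwu₅, hC₅.wx, hC₅.env.n_eq, ← hx, hrow, hkw₅, hkp₅,
          Function.update_apply]
    rintro s₆ - ⟨k1, k2, k3, k4⟩
    simp only [State.num_setWord, k1, k2, k3, k4]
    have hne : ∀ i, i < u → x * n + i ≠ x * n + u := fun i hi => by omega
    refine ⟨fun i hi hiu => ?_, fun i hi hiu => ?_, fun _ => ?_, fun j hj => ?_⟩
    · rcases Nat.lt_succ_iff_lt_or_eq.1 hiu with hiu | rfl
      · rw [Function.update_of_ne (hne i hiu)]; exact hI1 i hi hiu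
      · simpa using hpos₅
    · rcases Nat.lt_succ_iff_lt_or_eq.1 hiu with hiu | rfl
      · rw [Function.update_of_ne (hne i hiu), Function.update_of_ne (hne i hiu),
          Function.update_of_ne (hne (i - 1) (by omega)),
          Function.update_of_ne (hne (i - 1) (by omega))]
        exact hI2 i hi hiu
      · refine ⟨r, hmax, ?_⟩
        rw [Function.update_self, Function.update_self, hval₅]
        split_ifs with hi0
        · rfl
        · rw [Function.update_of_ne (hne (i - 1) (by omega)),
            Function.update_of_ne (hne (i - 1) (by omega))]
    · simp
    · have := hj u (by omega)
      rw [Function.update_of_ne this, Function.update_of_ne this]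
      exact hI4 j hj
  · rintro s₁ hF ⟨hI1, hI2, -, hI4⟩
    refine ⟨fun i hi => hI1 i hi hi, fun κ hκ => isKeys_of_getElem fun i hi => ?_, hI4⟩
    obtain ⟨r, hr, hv⟩ := hI2 i hi hi
    refine ⟨r, hr, ?_⟩
    rw [hκ i hi, hv]
    split_ifs with h0
    · rfl
    · rw [hκ (i - 1) (by omega)]
  · simp only [WExp.time]
    have h2 : S.length * (300 * n + (1 + 1 + 1 + 1 + 1) + 11) ≤ (n - 1) * (300 * n + 16) :=
      Nat.mul_le_mul (by omega) (by omega)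
    have h3 : (n - 1) * (300 * n + 16) = 300 * ((n - 1) * n) + 16 * (n - 1) := by ring
    have h4 : (n - 1) * n + n = n * n := by
      rw [← Nat.succ_mul]; congr 1; omega
    omega

end RAM

/-! ### Treatment of one subtree -/

namespace RAM

variable {n M : ℕ} {N : Network (Fin n)} {es : List (Fin n × Fin n)} {s s' : State}
  {qs : List (Finset (Fin n))} {X Y : Finset (Fin n)} {S : List (Sym2 (Fin n))}

/-- Outside the row of `X`, the tables of sequences and gains are the same in both states. -/
def SameOff (n x : ℕ) (s s' : State) : Prop :=
  ∀ j, OffRow n x j → s'.word wSeq j = s.word wSeq j ∧ s'.num rGain j = s.num rGain j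

lemma Row.of_off (hT : N.graph.IsTree) (h : Row N es s Y S)
    (hX : Conn N.graph (X : Set (Fin n))) (hY : Conn N.graph (Y : Set (Fin n))) (hne : Y ≠ X)
    (h1 : s'.num rTot (code N.graph Y) = s.num rTot (code N.graph Y))
    (h2 : SameOff n (code N.graph X) s s')
    (h3 : ∀ j, OffRow n (code N.graph X) j →
      s'.num rKeyW j = s.num rKeyW j ∧ s'.num rKeyP j = s.num rKeyP j) : Row N es s' Y S := by
  have hlen := h.length hT hY
  have hYn : Y.card ≤ n := (Finset.card_le_univ Y).trans (by simp)
  have hoff : ∀ i, i < S.length → OffRow n (code N.graph X) (code N.graph Y * n + i) := by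
    intro i hi u hu he
    exact hne (code_injective hT hY hX ((row_inj (by omega) hu).1 he).1)
  refine ⟨h.lists, h1.trans h.tot, fun i hi => ?_, fun i hi => ?_, fun i hi => ?_,
    fun κ hκ => h.keys κ fun i hi => ?_⟩
  · rw [(h2 _ (hoff i hi)).1, h.seq i hi]
  · rw [(h2 _ (hoff i hi)).2, h.gain i hi]
  · rw [(h3 _ (hoff i hi)).2]; exact h.pos i hi
  · rw [hκ i hi, (h3 _ (hoff i hi)).1, (h3 _ (hoff i hi)).2]

/-- `K` is a possible merged sequence for the subtree `X` and the last edge `p`. -/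
def IsMerged (N : Network (Fin n)) (best : Finset (Fin n) → List (Sym2 (Fin n)))
    (X : Finset (Fin n)) (p : Fin n × Fin n) (K : List (Sym2 (Fin n))) : Prop :=
  ∃ L, N.IsOptimalMerge
      (indSub N.graph (sideFin N.graph X (toEdge p) p.1 : Set (Fin n)))
      (indSub N.graph (sideFin N.graph X (toEdge p) p.2 : Set (Fin n)))
      (best (sideFin N.graph X (toEdge p) p.1)) (best (sideFin N.graph X (toEdge p) p.2)) L ∧
    K = L ++ [toEdge p]

/-- The rows of the two sides of the edge `p` of `X` contain the chosen sequences. -/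
def HasSides (N : Network (Fin n)) (es : List (Fin n × Fin n)) (s : State)
    (best : Finset (Fin n) → List (Sym2 (Fin n))) (X : Finset (Fin n)) (p : Fin n × Fin n) :
    Prop :=
  Row N es s (sideFin N.graph X (toEdge p) p.1) (best (sideFin N.graph X (toEdge p) p.1)) ∧
  Row N es s (sideFin N.graph X (toEdge p) p.2) (best (sideFin N.graph X (toEdge p) p.2))

/-- The objective value of a sequence for the subtree `X`. -/
noncomputable abbrev objOn (N : Network (Fin n)) (X : Finset (Fin n)) (K : List (Sym2 (Fin n))) :
    ℝ := N.objective (indSub N.graph (X : Set (Fin n))) K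

/-- The best value so far is compared with the value of the new sequence `K`: either the stored
sequence remains, or `K` is stored. -/
lemma runs_edgeProg (hT : N.graph.IsTree) (hL : ListsEdges N.graph es) (hB : Bounds N M)
    (hq : Complete N qs) (hC : Ctx N es qs X s)
    (htX : s.num rTot (code N.graph X) = N.conWeight (edgesIn N.graph X))
    {best : Finset (Fin n) → List (Sym2 (Fin n))} {k : ℕ} (hk : k < es.length)
    (hw : s.word wE 0 = k) (hkX : toEdge es[k] ∈ edgesIn N.graph X)
    (hrows : HasSides N es s best X es[k]) (hfl : s.word wFlag 0 ≤ 1) :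
    Runs M edgeProg s (1600 * n) fun s' => ∃ K, IsMerged N best X es[k] K ∧
      Network.Lists (indSub N.graph (X : Set (Fin n))) K ∧
      s'.out = s.out ++ Network.encodeSeq (es.map toEdge) K ∧
      SameOff n (code N.graph X) s s' ∧
      ((s.word wFlag 0 = 1 ∧ s.num rBest 0 ≤ objOn N X K ∧ s'.word wFlag = s.word wFlag ∧
          s'.num rBest = s.num rBest ∧ s'.word wSeq = s.word wSeq ∧ s'.num rGain = s.num rGain) ∨
        (¬ (s.word wFlag 0 = 1 ∧ s.num rBest 0 ≤ objOn N X K) ∧ s'.word wFlag 0 = 1 ∧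
          s'.num rBest 0 = objOn N X K ∧ SeqRow N es s' X K (N.seqGain K))) := by
  have h1 := hB.one_mod
  have hlen := hL.length hT
  obtain ⟨hR₁, hR₂⟩ := hrows
  obtain ⟨cA, cB⟩ := conn_sideFin hT hC.conn hkX
  have hsplit := Network.isSplit_sideFin hT hC.conn hkX
  have hcard := sideFin_card hT hkX
  have hdis := disjoint_sideFin hT hkX
  set e := toEdge es[k] with he
  set A := sideFin N.graph X e es[k].1 with hA
  set B := sideFin N.graph X e es[k].2 with hBd
  have hlA := hR₁.length hT cA
  have hlB := hR₂.length hT cB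
  have hs : Network.SplitLists (indSub N.graph (X : Set (Fin n))) e
      (indSub N.graph (A : Set (Fin n))) (indSub N.graph (B : Set (Fin n))) (best A) (best B) :=
    ⟨Finset.disjoint_coe.2 hdis, hR₁.lists, hR₂.lists, hsplit.edgeSet_union⟩
  have heX : e ∈ (indSub N.graph (X : Set (Fin n))).edgeSet := by
    rw [indSub_edgeSet]; exact mem_edgesIn.1 hkX
  obtain ⟨κ, hκ₁, hκ₂⟩ := exists_key hs.nodup
    (fun i => s.num rKeyW (code N.graph A * n + i) / s.num rKeyP (code N.graph A * n + i))
    (fun i => s.num rKeyW (code N.graph B * n + i) / s.num rKeyP (code N.graph B * n + i))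
  have hopt := Network.isOptimalMerge_keyMerge hT hs (hR₁.keys κ hκ₁) (hR₂.keys κ hκ₂)
  have hshuf := keyMerge_isShuffle (κ := κ) hs.nodup
  have hperm := keyMerge_perm (κ := κ) (best A) (best B)
  set L := keyMerge κ (best A) (best B) with hLd
  have hlists := hs.lists_append heX hperm
  obtain ⟨g1, g2, g3⟩ := hs.seqGain_append hT heX hshuf
  have hLl : L.length + 2 = X.card := by
    rw [hperm.length_eq, List.length_append]; omega
  set K := L ++ [e] with hK
  have hKl : K.length + 1 = X.card := by rw [hK, List.length_append, List.length_singleton]; omega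
  rw [(Network.lists_indSub_iff.1 hlists).2, (Network.lists_indSub_iff.1 hR₁.lists).2,
    (Network.lists_indSub_iff.1 hR₂.lists).2] at g3
  have hobj := Network.objective_eq_costFrom hT (indSub_isTree hT.isAcyclic hC.conn) hlists
  refine Runs.seq (runs_splitProg hT hL hB hC hk hw hkX) (T₂ := 800 * n) ?_ (by omega)
  rintro s₁ hF₁ ⟨hy₁, hz₁⟩
  have hC₁ := hC.frame hF₁ rfl rfl (by decide) (by decide)
  have hR₁₁ := hR₁.frame hF₁ rfl
  have hR₂₁ := hR₂.frame hF₁ rfl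
  have hw₁ : s₁.word wE 0 = k := by rw [hF₁.word _ (by decide), hw]
  refine Runs.seq (runs_mergeProg hT hB hC₁ (hq A cA) (hq B cB) hy₁ hz₁ hR₁₁ hR₂₁
    (by omega) (κ := κ) (by rw [hF₁.num _ (by decide), hF₁.num _ (by decide)]; exact hκ₁)
    (by rw [hF₁.num _ (by decide), hF₁.num _ (by decide)]; exact hκ₂) g1 g2)
    (T₂ := 600 * n - 50) ?_ (by omega)
  intro s₂ hF₂ hb₂
  have hC₂ := hC₁.frame hF₂ rfl rfl (by decide) (by decide)
  refine Runs.seq (runs_appendProg hL hB hC₂ (by rw [hF₂.word _ (by decide), hy₁])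
    (by rw [hF₂.word _ (by decide), hz₁])
    (by rw [hF₂.num _ (by decide), hF₁.num _ (by decide), htX]) (hR₁₁.frame hF₂ rfl)
    (hR₂₁.frame hF₂ rfl) hk (by rw [hF₂.word _ (by decide), hw₁]) hLl hb₂ g3)
    (T₂ := 600 * n - 100) ?_ (by omega)
  intro s₃ hF₃ hb₃
  have hC₃ := hC₂.frame hF₃ rfl rfl (by decide) (by decide)
  have hb₃' : Buf es s₃ K (N.seqGain K) K.length := by
    have : K.length = L.length + 1 := by simp [hK]
    rw [this]; exact hb₃
  refine Runs.seq (runs_objProg hL hB hC₃ hlists.mem_edgeSet hKl hb₃') (T₂ := 500 * n - 150) ?_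
    (by omega)
  intro s₄ hF₄ ho₄
  rw [← hobj] at ho₄
  have hC₄ := hC₃.frame hF₄ rfl rfl (by decide) (by decide)
  have hb₄ := hb₃'.congr (hF₄.word _ (by decide)) (hF₄.num _ (by decide))
  refine Runs.seq (runs_printBuf hB hC₄ hKl hb₄) (T₂ := 450 * n - 200) ?_ (by omega)
  intro s₅ hF₅ hout₅
  have hC₅ := hC₄.frame hF₅ rfl rfl (by decide) (by decide)
  have hb₅ := hb₄.congr (hF₅.word _ (by decide)) (hF₅.num _ (by decide))
  have hout : s₅.out = s.out ++ Network.encodeSeq (es.map toEdge) K := by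
    rw [hout₅, hF₄.out rfl, hF₃.out rfl, hF₂.out rfl, hF₁.out rfl]
  have ho₅ : s₅.num rObj 0 = objOn N X K := by rw [hF₅.num _ (by decide), ho₄]
  have hflag : s₅.word wFlag = s.word wFlag := by
    rw [hF₅.word _ (by decide), hF₄.word _ (by decide), hF₃.word _ (by decide),
      hF₂.word _ (by decide), hF₁.word _ (by decide)]
  have hbest : s₅.num rBest = s.num rBest := by
    rw [hF₅.num _ (by decide), hF₄.num _ (by decide), hF₃.num _ (by decide),
      hF₂.num _ (by decide), hF₁.num _ (by decide)]
  have hseq : s₅.word wSeq = s.word wSeq := by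
    rw [hF₅.word _ (by decide), hF₄.word _ (by decide), hF₃.word _ (by decide),
      hF₂.word _ (by decide), hF₁.word _ (by decide)]
  have hgain : s₅.num rGain = s.num rGain := by
    rw [hF₅.num _ (by decide), hF₄.num _ (by decide), hF₃.num _ (by decide),
      hF₂.num _ (by decide), hF₁.num _ (by decide)]
  refine Runs.ite (T := 60 * n + 50) (fun hc => ?_) (fun hc => ?_)
    (by simp only [Test.time, NExp.time, WExp.time]; omega)
  · simp only [Test.holds, WExp.eval, NExp.eval, Nat.zero_mod, h1, hflag, hbest, ho₅] at hc
    refine Runs.basic rfl (by simp [Program.maxTime]) ⟨K, ⟨L, hopt, rfl⟩, hlists, hout,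
      fun j _ => by simp [hseq, hgain],
      Or.inl ⟨by omega, hc.2, hflag, hbest, hseq, hgain⟩⟩
  · simp only [Test.holds, WExp.eval, NExp.eval, Nat.zero_mod, h1, hflag, hbest, ho₅] at hc
    refine (runs_storeProg hT hB hC₅ hKl hb₅).imp (by omega) ?_
    rintro s₆ hF₆ ⟨hrow, hf, hbe, hoff⟩
    refine ⟨K, ⟨L, hopt, rfl⟩, hlists, by rw [hF₆.out rfl, hout], fun j hj => ?_, Or.inr
      ⟨fun h => hc ⟨by rw [h.1], h.2⟩, hf, by rw [hbe, ho₅], hrow⟩⟩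
    rw [(hoff j hj).1, (hoff j hj).2, hseq, hgain]
    exact ⟨rfl, rfl⟩

/-- The merged sequences `mg` and the chosen sequence `S` for the subtree `X` are as the dynamic
program requires. -/
structure IsChoice (N : Network (Fin n)) (es : List (Fin n × Fin n))
    (best : Finset (Fin n) → List (Sym2 (Fin n))) (X : Finset (Fin n))
    (mg : Sym2 (Fin n) → List (Sym2 (Fin n))) (S : List (Sym2 (Fin n))) : Prop where
  merged : ∀ p ∈ es, toEdge p ∈ edgesIn N.graph X → IsMerged N best X p (mg (toEdge p))
  choice : ∃ e ∈ edgesIn N.graph X, S = mg e ∧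
    ∀ e' ∈ edgesIn N.graph X, objOn N X (mg e) ≤ objOn N X (mg e')

/-- The edges of the subtree `X`, in the order of the list `es`. -/
noncomputable def edgeList (N : Network (Fin n)) (X : Finset (Fin n))
    (es : List (Fin n × Fin n)) : List (Sym2 (Fin n)) :=
  (es.map toEdge).filter (· ∈ edgesIn N.graph X)

lemma edgeList_append (l₁ l₂ : List (Fin n × Fin n)) :
    edgeList N X (l₁ ++ l₂) = edgeList N X l₁ ++ edgeList N X l₂ := by simp [edgeList]

/-- What the tables contain when the edges `es` have been tried as last edges for `X`. -/
structure Tried (N : Network (Fin n)) (all es : List (Fin n × Fin n))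
    (best : Finset (Fin n) → List (Sym2 (Fin n))) (X : Finset (Fin n)) (s s' : State)
    (mg : Sym2 (Fin n) → List (Sym2 (Fin n))) : Prop where
  merged : ∀ p ∈ es, toEdge p ∈ edgesIn N.graph X → IsMerged N best X p (mg (toEdge p)) ∧
    Network.Lists (indSub N.graph (X : Set (Fin n))) (mg (toEdge p))
  out : s'.out = s.out ++ (edgeList N X es).flatMap fun e =>
    Network.encodeSeq (all.map toEdge) (mg e)
  off : SameOff n (code N.graph X) s s'
  flag : (s'.word wFlag 0 = 0 ∧ edgeList N X es = []) ∨
    (s'.word wFlag 0 = 1 ∧ ∃ e ∈ edgeList N X es, SeqRow N all s' X (mg e) (N.seqGain (mg e)) ∧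
      s'.num rBest 0 = objOn N X (mg e) ∧
      ∀ e' ∈ edgeList N X es, objOn N X (mg e) ≤ objOn N X (mg e'))

lemma Tried.congr {all : List (Fin n × Fin n)} {best : Finset (Fin n) → List (Sym2 (Fin n))}
    {mg : Sym2 (Fin n) → List (Sym2 (Fin n))} {s'' : State} (h : Tried N all es best X s s' mg)
    (h1 : s''.out = s'.out) (h2 : s''.word wSeq = s'.word wSeq)
    (h3 : s''.num rGain = s'.num rGain) (h4 : s''.word wFlag = s'.word wFlag)
    (h5 : s''.num rBest = s'.num rBest) : Tried N all es best X s s'' mg := by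
  refine ⟨h.merged, by rw [h1, h.out], fun j hj => by rw [h2, h3]; exact h.off j hj, ?_⟩
  rw [h4, h5]
  rcases h.flag with hf | ⟨hf, e, he, hr, hb⟩
  · exact Or.inl hf
  · exact Or.inr ⟨hf, e, he, hr.congr h2 h3, hb⟩

lemma runs_lastEdges (hT : N.graph.IsTree) (hL : ListsEdges N.graph es) (hB : Bounds N M)
    (hq : Complete N qs) (hC : Ctx N es qs X s)
    (htX : s.num rTot (code N.graph X) = N.conWeight (edgesIn N.graph X))
    {best : Finset (Fin n) → List (Sym2 (Fin n))}
    (hrows : ∀ p ∈ es, toEdge p ∈ edgesIn N.graph X → HasSides N es s best X p)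
    (hfl : s.word wFlag 0 = 0) :
    Runs M (forLoop wE mExp
      (.ite (.and (isOne (.read wMem (row (wvar wX) (.read wEA (wvar wE)))))
        (isOne (.read wMem (row (wvar wX) (.read wEB (wvar wE)))))) edgeProg .skip)) s
      (1700 * (n * n)) fun s' => ∃ mg, Tried N es es best X s s' mg := by
  classical
  have h1 := hB.one_mod
  have hlen := hL.length hT
  refine Runs.forLoop (N := es.length) (T := 1600 * n + 50)
    (fun k s' => ∃ mg, Tried N es (es.take k) best X s s' mg) (by decide) (hB.lt (by omega))
    ?_ ?_ ?_ ?_ ?_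
  · intro s' hF
    simp [(hC.env.frame hF rfl).n_eq, h1]; omega
  · refine ⟨fun _ => [], by simp, by simp [edgeList], fun j _ => by simp, Or.inl ⟨?_, ?_⟩⟩
    · simp [hfl]
    · simp [edgeList]
  · rintro k s₁ hk hF hwk ⟨mg, ht⟩
    have hC₁ := hC.frame hF rfl rfl (by decide) (by decide)
    have hrow : ∀ v : Fin n, (code N.graph X * n % M + v) % M = code N.graph X * n + v :=
      fun v => hC₁.row_mod hT hB v.2
    have hadj : N.graph.Adj es[k].1 es[k].2 := hL.mem_edgeSet hk
    have hcond : (Test.and (isOne (.read wMem (row (wvar wX) (.read wEA (wvar wE)))))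
        (isOne (.read wMem (row (wvar wX) (.read wEB (wvar wE)))))).holds M s₁ ↔
        toEdge es[k] ∈ edgesIn N.graph X := by
      have e1 := hC₁.marks.one_le es[k].1
      have e2 := hC₁.marks.one_le es[k].2
      rw [mem_edgesIn_mk, ← e1, ← e2]
      simp only [Test.holds, WExp.eval, Nat.zero_mod, h1, hwk, hC₁.env.ea k hk, hC₁.env.eb k hk,
        hC₁.wx, hC₁.env.n_eq, hrow]
      tauto
    have htake : es.take (k + 1) = es.take k ++ [es[k]] := List.take_succ_eq_append_getElem hk
    refine Runs.ite (T := 1600 * n) (fun hc => ?_) (fun hc => ?_)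
      (by simp only [Test.time, WExp.time]; omega)
    · have hkX := hcond.1 hc
      have hone : edgeList N X [es[k]] = [toEdge es[k]] := by simp [edgeList, -mem_edgesIn, hkX]
      have hmemk : ∀ p ∈ es.take k, toEdge p ≠ toEdge es[k] := by
        intro p hp h
        obtain ⟨i, hi, rfl⟩ := List.mem_iff_getElem.1 hp
        rw [List.getElem_take] at h
        have hik : i < k := by
          rw [List.length_take] at hi; omega
        have := hL.index_inj (by omega) hk h
        omega
      have hsides := hrows _ (List.getElem_mem hk) hkX
      obtain ⟨cA, cB⟩ := conn_sideFin hT hC.conn hkX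
      have hcard := sideFin_card hT hkX
      have hpa := cA.card_pos
      have hpb := cB.card_pos
      have hneA : sideFin N.graph X (toEdge es[k]) es[k].1 ≠ X := fun h => by
        have := congrArg Finset.card h; simp only [toEdge] at this; omega
      have hneB : sideFin N.graph X (toEdge es[k]) es[k].2 ≠ X := fun h => by
        have := congrArg Finset.card h; simp only [toEdge] at this; omega
      have hkeys : ∀ j, OffRow n (code N.graph X) j →
          s₁.num rKeyW j = s.num rKeyW j ∧ s₁.num rKeyP j = s.num rKeyP j := fun j _ => by
        rw [hF.num _ (by decide), hF.num _ (by decide)]; exact ⟨rfl, rfl⟩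
      have hfl₁ : s₁.word wFlag 0 ≤ 1 := by rcases ht.flag with h | h <;> omega
      have hsides₁ : HasSides N es s₁ best X es[k] :=
        ⟨hsides.1.of_off hT hC.conn cA hneA (by rw [hF.num _ (by decide)]) ht.off hkeys,
          hsides.2.of_off hT hC.conn cB hneB (by rw [hF.num _ (by decide)]) ht.off hkeys⟩
      refine (runs_edgeProg hT hL hB hq hC₁ (by rw [hF.num _ (by decide), htX]) hk hwk hkX hsides₁
        hfl₁).imp le_rfl ?_
      rintro s₂ hF₂ ⟨K, hK, hKl, hout, hoff, hch⟩
      set mg' := Function.update mg (toEdge es[k]) K with hmg'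
      have hnew : mg' (toEdge es[k]) = K := by simp [hmg']
      have hold : ∀ p ∈ es.take k, mg' (toEdge p) = mg (toEdge p) := fun p hp => by
        rw [hmg', Function.update_of_ne (hmemk p hp)]
      have holdl : ∀ e ∈ edgeList N X (es.take k), mg' e = mg e := by
        intro e he
        obtain ⟨p, hp, rfl⟩ := List.mem_map.1 (List.mem_filter.1 he).1
        exact hold p hp
      refine ⟨mg', Tried.congr (s' := s₂) ?_ rfl (by funext j; simp) rfl (by funext j; simp) rfl⟩
      refine ⟨fun p hp hpX => ?_, ?_, fun j hj => ?_, ?_⟩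
      · rw [htake, List.mem_append, List.mem_singleton] at hp
        rcases hp with hp | rfl
        · rw [hold p hp]; exact ht.merged p hp hpX
        · rw [hnew]; exact ⟨hK, hKl⟩
      · rw [hout, ht.out, htake, edgeList_append, List.flatMap_append, hone, List.flatMap_singleton,
          hnew, List.append_assoc]
        congr 2
        exact List.flatMap_congr fun e he => by rw [holdl e he]
      · rw [(hoff j hj).1, (hoff j hj).2]; exact ht.off j hj
      · right
        rw [htake, edgeList_append, hone]
        rcases hch with ⟨hf, hle, hf', hb', hs', hg'⟩ | ⟨hnot, hf', hb', hrow'⟩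
        · rcases ht.flag with h0 | ⟨-, e, he, hr, hb, hmin⟩
          · omega
          · refine ⟨by rw [hf', hf], e, List.mem_append_left _ he, ?_, ?_, ?_⟩
            · rw [holdl e he]; exact hr.congr hs' hg'
            · rw [holdl e he, hb', hb]
            · intro e' he'
              rw [holdl e he]
              rcases List.mem_append.1 he' with he' | he'
              · rw [holdl e' he']; exact hmin e' he'
              · rw [List.mem_singleton.1 he', hnew, ← hb]; exact hle
        · refine ⟨hf', toEdge es[k], by simp, by rw [hnew]; exact hrow',
            by rw [hnew]; exact hb', ?_⟩
          intro e' he'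
          rw [hnew]
          rcases List.mem_append.1 he' with he' | he'
          · rw [holdl e' he']
            rcases ht.flag with h0 | ⟨hf1, e, he, hr, hb, hmin⟩
            · rw [h0.2] at he'; simp at he'
            · refine le_trans ?_ (hmin e' he')
              rw [← hb]
              exact (not_le.1 fun h => hnot ⟨hf1, h⟩).le
          · rw [List.mem_singleton.1 he', hnew]
    · have hkX : toEdge es[k] ∉ edgesIn N.graph X := fun h => hc (hcond.2 h)
      have hone : edgeList N X [es[k]] = [] := by simp [edgeList, -mem_edgesIn, hkX]
      refine Runs.basic rfl (by simp [Program.maxTime]; omega)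
        ⟨mg, Tried.congr (s' := s₁) ?_ rfl (by funext j; simp [Program.den]) rfl
          (by funext j; simp [Program.den]) rfl⟩
      refine ⟨fun p hp hpX => ?_, ?_, ht.off, ?_⟩
      · rw [htake, List.mem_append, List.mem_singleton] at hp
        rcases hp with hp | rfl
        · exact ht.merged p hp hpX
        · exact absurd hpX hkX
      · rw [htake, edgeList_append, hone, List.append_nil, ht.out]
      · rw [htake, edgeList_append, hone, List.append_nil]; exact ht.flag
  · rintro s₁ hF ⟨mg, ht⟩
    rw [List.take_length] at ht
    exact ⟨mg, ht⟩
  · simp only [WExp.time]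
    have h2 : es.length * (1600 * n + 50 + (1 + 1 + 1 + 1) + 11) ≤ (n - 1) * (1600 * n + 65) :=
      Nat.mul_le_mul (by omega) (by omega)
    have h3 : (n - 1) * (1600 * n + 65) = 1600 * ((n - 1) * n) + 65 * (n - 1) := by ring
    have h4 : (n - 1) * n + n = n * n := by
      rw [← Nat.succ_mul]; congr 1; omega
    omega

lemma mem_edgeList (hL : ListsEdges N.graph es) {e : Sym2 (Fin n)} :
    e ∈ edgeList N X es ↔ e ∈ edgesIn N.graph X := by
  rw [edgeList, List.mem_filter, decide_eq_true_eq]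
  exact ⟨fun h => h.2, fun h => ⟨(hL.2 e).2 (mem_edgesIn.1 h).1, h⟩⟩

lemma runs_treeProg (hT : N.graph.IsTree) (hL : ListsEdges N.graph es) (hB : Bounds N M)
    (hq : Complete N qs) (hC : Ctx N es qs X s) (hX2 : 2 ≤ X.card)
    {best : Finset (Fin n) → List (Sym2 (Fin n))}
    (hrows : ∀ p ∈ es, toEdge p ∈ edgesIn N.graph X → HasSides N es s best X p) :
    Runs M treeProg s (2500 * (n * n)) fun s' => ∃ mg S, IsChoice N es best X mg S ∧
      Row N es s' X S ∧
      s'.out = s.out ++ ((edgeList N X es).flatMap (fun e =>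
        Network.encodeSeq (es.map toEdge) (mg e)) ++ Network.encodeSeq (es.map toEdge) S) ∧
      ∀ Y T, Y ≠ X → Conn N.graph (Y : Set (Fin n)) → Row N es s Y T → Row N es s' Y T := by
  have h1 := hB.one_mod
  have hlen := hL.length hT
  have hnn : n ≤ n * n := Nat.le_mul_self n
  have hn2 : 2 ≤ n := hX2.trans hC.card_le
  have hnn2 : 2 * n ≤ n * n := Nat.mul_le_mul_right n hn2
  refine Runs.seq (runs_totalProg hT hB hC) (T₂ := 2300 * (n * n)) ?_ (by omega)
  intro s₁ hF₁ ht₁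
  have hC₁ := hC.frame hF₁ rfl rfl (by decide) (by decide)
  refine Runs.seq (T₁ := 5) (T₂ := 2290 * (n * n)) (R := fun s' => s'.word wFlag 0 = 0)
    (Runs.basic rfl (by decide) (by simp [Program.den])) ?_ (by omega)
  intro s₂ hF₂ hf₂
  have hC₂ := hC₁.frame hF₂ rfl rfl (by decide) (by decide)
  have ht₂ : s₂.num rTot =
      Function.update (s.num rTot) (code N.graph X) (N.conWeight (edgesIn N.graph X)) := by
    rw [hF₂.num _ (by decide), ht₁]
  -- the rows of the other subtrees are still valid
  have hkeep₂ : ∀ Y T, Y ≠ X → Conn N.graph (Y : Set (Fin n)) → Row N es s Y T →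
      Row N es s₂ Y T := by
    intro Y T hne hY hR
    refine hR.of_off hT hC.conn hY hne ?_ (fun j _ => ?_) (fun j _ => ?_)
    · rw [ht₂, Function.update_of_ne]
      exact fun h => hne (code_injective hT hY hC.conn h)
    · rw [hF₂.word _ (by decide), hF₁.word _ (by decide), hF₂.num _ (by decide),
        hF₁.num _ (by decide)]
      exact ⟨rfl, rfl⟩
    · rw [hF₂.num _ (by decide), hF₁.num _ (by decide), hF₂.num _ (by decide),
        hF₁.num _ (by decide)]
      exact ⟨rfl, rfl⟩
  have hrows₂ : ∀ p ∈ es, toEdge p ∈ edgesIn N.graph X → HasSides N es s₂ best X p := by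
    intro p hp hpX
    obtain ⟨cA, cB⟩ := conn_sideFin hT hC.conn hpX
    have hcard := sideFin_card hT hpX
    have hpa := cA.card_pos
    have hpb := cB.card_pos
    exact ⟨hkeep₂ _ _ (fun h => by
        have := congrArg Finset.card h; simp only [toEdge] at this; omega) cA (hrows p hp hpX).1,
      hkeep₂ _ _ (fun h => by
        have := congrArg Finset.card h; simp only [toEdge] at this; omega) cB (hrows p hp hpX).2⟩
  refine Runs.seq (runs_lastEdges hT hL hB hq hC₂ (by rw [ht₂]; simp) hrows₂ hf₂)
    (T₂ := 500 * (n * n)) ?_ (by omega)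
  rintro s₃ hF₃ ⟨mg, htr⟩
  have hC₃ := hC₂.frame hF₃ rfl rfl (by decide) (by decide)
  obtain ⟨v, hv⟩ := hC.conn.1
  obtain ⟨w, hvw⟩ := hC.conn.exists_edge (Finset.mem_coe.1 hv) hX2
  rcases htr.flag with hf | ⟨-, e, he, hrow, -, hmin⟩
  · have := (mem_edgeList hL).2 hvw
    rw [hf.2] at this; simp at this
  have heX := (mem_edgeList hL).1 he
  have hlists : Network.Lists (indSub N.graph (X : Set (Fin n))) (mg e) := by
    obtain ⟨p, hp, rfl⟩ := List.mem_map.1 (List.mem_filter.1 he).1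
    exact (htr.merged p hp heX).2
  have hSl := hlists.length_add_one hT hC.conn
  refine Runs.seq (runs_printSeq hT hB hC₃ hSl hrow) (T₂ := 400 * (n * n)) ?_ (by omega)
  intro s₄ hF₄ hout₄
  have hC₄ := hC₃.frame hF₄ rfl rfl (by decide) (by decide)
  have hrow₄ := hrow.congr (hF₄.word _ (by decide)) (hF₄.num _ (by decide))
  refine (runs_keysProg hT hL hB hC₄ hlists.mem_edgeSet hSl hrow₄).imp le_rfl ?_
  rintro s₅ hF₅ ⟨hpos, hkeys, hoff⟩
  have hrow₅ := hrow₄.congr (hF₅.word _ (by decide)) (hF₅.num _ (by decide))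
  have htot₅ : s₅.num rTot = s₂.num rTot := by
    rw [hF₅.num _ (by decide), hF₄.num _ (by decide), hF₃.num _ (by decide)]
  refine ⟨mg, mg e, ⟨fun p hp hpX => (htr.merged p hp hpX).1, e, heX, rfl, fun e' he' =>
    hmin e' ((mem_edgeList hL).2 he')⟩, ⟨hlists, ?_, fun i hi => (hrow₅ i hi).1,
    fun i hi => (hrow₅ i hi).2, hpos, hkeys⟩, ?_, fun Y T hne hY hR => ?_⟩
  · rw [htot₅, ht₂]; simp
  · rw [hF₅.out rfl, hout₄, htr.out, hF₂.out rfl, hF₁.out rfl, List.append_assoc]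
  · refine (hkeep₂ Y T hne hY hR).of_off hT hC.conn hY hne (by rw [htot₅]) (fun j hj => ?_)
      (fun j hj => ?_)
    · rw [hF₅.word _ (by decide), hF₄.word _ (by decide), hF₅.num _ (by decide),
        hF₄.num _ (by decide)]
      exact htr.off j hj
    · rw [(hoff j hj).1, (hoff j hj).2, hF₄.num _ (by decide), hF₃.num _ (by decide),
        hF₄.num _ (by decide), hF₃.num _ (by decide)]
      exact ⟨rfl, rfl⟩

end RAM

/-! ### The dynamic program -/

namespace RAM

variable {n M : ℕ} {N : Network (Fin n)} {es : List (Fin n × Fin n)} {s s' : State}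
  {qs : List (Finset (Fin n))} {X : Finset (Fin n)}

lemma card_sides_lt (hT : N.graph.IsTree) (hX : Conn N.graph (X : Set (Fin n)))
    {p : Fin n × Fin n} (hp : toEdge p ∈ edgesIn N.graph X) :
    (sideFin N.graph X (toEdge p) p.1).card < X.card ∧
      (sideFin N.graph X (toEdge p) p.2).card < X.card := by
  obtain ⟨cA, cB⟩ := conn_sideFin hT hX hp
  have h := sideFin_card hT hp
  have := cA.card_pos
  have := cB.card_pos
  exact ⟨by simp only [toEdge]; omega, by simp only [toEdge]; omega⟩

lemma IsChoice.congr (hT : N.graph.IsTree) (hX : Conn N.graph (X : Set (Fin n)))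
    {best best' : Finset (Fin n) → List (Sym2 (Fin n))} {mg : Sym2 (Fin n) → List (Sym2 (Fin n))}
    {S : List (Sym2 (Fin n))} (h : IsChoice N es best X mg S)
    (hb : ∀ Y : Finset (Fin n), Y.card < X.card → best' Y = best Y) :
    IsChoice N es best' X mg S := by
  refine ⟨fun p hp hpX => ?_, h.choice⟩
  obtain ⟨h1, h2⟩ := card_sides_lt hT hX hpX
  have := h.merged p hp hpX
  rw [IsMerged] at this ⊢
  rw [hb _ h1, hb _ h2]
  exact this

lemma edgesIn_singleton (hT : N.graph.IsTree) (v : Fin n) : edgesIn N.graph {v} = ∅ := by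
  have h := card_edgesIn hT _ {v} rfl (conn_coe_singleton v)
  rw [Finset.card_singleton] at h
  exact Finset.card_eq_zero.1 (by omega)

lemma row_singleton (hT : N.graph.IsTree) (h0 : ∀ i, s.num rTot i = 0) (v : Fin n) :
    Row N es s {v} [] := by
  refine ⟨Network.lists_indSub_iff.2 ⟨by simp, by simp [edgesIn_singleton hT]⟩, ?_, by simp,
    by simp, by simp, fun _ _ => trivial⟩
  rw [h0, edgesIn_singleton hT, Network.conWeight_empty hT]

lemma Enum.getElem_eq (h : Enum N s qs) (v : Fin n) (hv : (v : ℕ) < qs.length) :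
    qs[(v : ℕ)] = {v} := by
  rw [← h.initial.getElem (i := v) (by simp)]; simp

/-- The output for the subtree `X`. -/
noncomputable def report (N : Network (Fin n)) (es : List (Fin n × Fin n))
    (best : Finset (Fin n) → List (Sym2 (Fin n)))
    (merged : Finset (Fin n) → Sym2 (Fin n) → List (Sym2 (Fin n))) (X : Finset (Fin n)) : List ℕ :=
  (edgeList N X es).flatMap (fun e => Network.encodeSeq (es.map toEdge) (merged X e)) ++
    Network.encodeSeq (es.map toEdge) (best X)

/-- The first `k` subtrees have been treated by the dynamic program. -/
structure Treated (N : Network (Fin n)) (es : List (Fin n × Fin n)) (qs : List (Finset (Fin n)))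
    (best : Finset (Fin n) → List (Sym2 (Fin n)))
    (merged : Finset (Fin n) → Sym2 (Fin n) → List (Sym2 (Fin n))) (s s' : State) (k : ℕ) :
    Prop where
  vertex : ∀ v, best {v} = []
  row : ∀ (i : ℕ) (h : i < qs.length), i < n + k → Row N es s' qs[i] (best qs[i])
  choice : ∀ (i : ℕ) (h : i < qs.length), n ≤ i → i < n + k →
    IsChoice N es best qs[i] (merged qs[i]) (best qs[i])
  out : s'.out = s.out ++ ((qs.drop n).take k).flatMap (report N es best merged)

lemma Treated.congr {best : Finset (Fin n) → List (Sym2 (Fin n))}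
    {merged : Finset (Fin n) → Sym2 (Fin n) → List (Sym2 (Fin n))} {s'' : State} {k : ℕ}
    (h : Treated N es qs best merged s s' k) (h1 : s''.num = s'.num)
    (h2 : s''.word wSeq = s'.word wSeq) (h3 : s''.out = s'.out) :
    Treated N es qs best merged s s'' k :=
  ⟨h.vertex, fun i hi hik => (h.row i hi hik).of_eq (by rw [h1]) h2 (by rw [h1]) (by rw [h1])
    (by rw [h1]), h.choice, by rw [h3, h.out]⟩

lemma runs_dpProg (hT : N.graph.IsTree) (hL : ListsEdges N.graph es) (hB : Bounds N M)
    (hE : Env N es s) (hq : Enum N s qs) (hc : Complete N qs) (hS : SideTable N es s)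
    (h0 : ∀ i, s.num rTot i = 0) :
    Runs M dpProg s (2600 * (codeBound N.graph * (n * n))) fun s' =>
      ∃ best merged, Treated N es qs best merged s s' (qs.length - n) := by
  classical
  have h1 := hB.one_mod
  have hlen := hL.length hT
  have hnn : n ≤ n * n := Nat.le_mul_self n
  have hcb : 1 ≤ codeBound N.graph := Nat.one_le_pow _ _ (by omega)
  have hcnn : n * n ≤ codeBound N.graph * (n * n) := Nat.le_mul_of_pos_left _ hcb
  have hlq := hq.length_le hT
  refine Runs.forLoop (N := qs.length - n) (T := 2550 * (n * n))
    (fun k s' => ∃ best merged, Treated N es qs best merged s s' k) (by decide)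
    (hB.lt (by omega)) ?_ ?_ ?_ ?_ ?_
  · intro s' hF
    have e1 : s'.word wCount = s.word wCount := hF.word _ (by decide)
    have e2 : s'.word wN = s.word wN := hF.word _ (by decide)
    simp [e1, e2, hq.count, hE.n_eq]
  · refine ⟨fun _ => [], fun _ _ => [], fun _ => rfl, fun i hi hin => ?_,
      fun i hi h2 h3 => absurd h3 (by omega), by simp⟩
    have e := hq.getElem_eq ⟨i, by omega⟩ hi
    simp only at e
    rw [e]
    exact row_singleton hT (by simp [h0]) _
  · rintro k s₁ hk hF hwk ⟨best, merged, ht⟩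
    have hkq : n + k < qs.length := by omega
    set X := qs[n + k] with hX
    have hXq : X ∈ qs := List.getElem_mem hkq
    have hXc := hq.conn X hXq
    have hX2 : 2 ≤ X.card := hq.card_of_le _ hkq (by omega)
    have hE₁ := hE.frame hF rfl
    have hq₁ : Enum N s₁ qs := hq.frame hF rfl
    have hS₁ : SideTable N es s₁ := fun e he => (hS e he).congr (hF.word _ (by decide))
    refine Runs.seq (T₁ := 10) (T₂ := 2500 * (n * n)) (R := fun s' => Ctx N es qs X s')
      (Runs.basic rfl (by decide) ?_) ?_ (by omega)
    · have hmod : (n + k) % M = n + k := hB.mod_eq (by omega)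
      refine ⟨hE₁.of_eq ?_ ?_ ?_ rfl rfl, hq₁.of_eq ?_ ?_ ?_ ?_, fun e he => (hS₁ e he).congr ?_,
        hXq, ?_⟩
      iterate 8 · funext j; simp [Program.den]
      simp [Program.den, hE₁.n_eq, hwk, hmod, hq₁.queue _ hkq, hX]
    intro s₂ hF₂ hC₂
    have hbefore : ∀ i (hi : i < qs.length), i < n + k → qs[i] ≠ X := fun i hi hik h => by
      have := (hq.nodup.getElem_inj_iff (hi := hi) (hj := hkq)).1 h
      omega
    have hcardle : ∀ i (hi : i < qs.length), i < n + k → qs[i].card ≤ X.card := fun i hi hik =>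
      List.pairwise_iff_getElem.1 hq.sorted i (n + k) hi hkq hik
    have hrow₂ : ∀ (i : ℕ) (h : i < qs.length), i < n + k → Row N es s₂ qs[i] (best qs[i]) :=
      fun i hi hik => (ht.row i hi hik).frame hF₂ rfl
    have hsmall : ∀ Y : Finset (Fin n), Conn N.graph (Y : Set (Fin n)) → Y.card < X.card →
        Row N es s₂ Y (best Y) := by
      intro Y hY hlt
      obtain ⟨i, hi, rfl⟩ := List.mem_iff_getElem.1 (hc Y hY)
      refine hrow₂ i hi ?_
      by_contra hcon
      rcases Nat.lt_or_ge (n + k) i with h | h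
      · have hle : X.card ≤ qs[i].card :=
          List.pairwise_iff_getElem.1 hq.sorted (n + k) i hkq hi h
        exact absurd hlt (not_lt.2 hle)
      · obtain rfl : i = n + k := by omega
        exact lt_irrefl _ hlt
    refine (runs_treeProg hT hL hB hc hC₂ hX2 (best := best) fun p hp hpX => ?_).imp le_rfl ?_
    · obtain ⟨cA, cB⟩ := conn_sideFin hT hXc hpX
      obtain ⟨h2, h3⟩ := card_sides_lt hT hXc hpX
      exact ⟨hsmall _ cA h2, hsmall _ cB h3⟩
    rintro s₃ hF₃ ⟨mg, S, hch, hrow, hout, hkeep⟩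
    have hbest : ∀ Y, Y ≠ X → Function.update best X S Y = best Y := fun Y hY =>
      Function.update_of_ne hY _ _
    have hcong : ∀ Y : Finset (Fin n), Y.card ≤ X.card → ∀ Z : Finset (Fin n), Z.card < Y.card →
        Function.update best X S Z = best Z := by
      intro Y hY Z hZ
      refine hbest Z ?_
      rintro rfl
      omega
    refine ⟨Function.update best X S, Function.update merged X mg, Treated.congr (s' := s₃) ?_ rfl
      (by funext j; simp) rfl⟩
    refine ⟨fun v => ?_, fun i hi hik => ?_, fun i hi hni hik => ?_, ?_⟩
    · rw [hbest _ (fun h => by rw [← h] at hX2; simp at hX2), ht.vertex]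
    · rcases Nat.lt_succ_iff_lt_or_eq.1 (show i < (n + k).succ by omega) with hik | rfl
      · rw [hbest _ (hbefore i hi hik)]
        exact hkeep _ _ (hbefore i hi hik) (hq.conn _ (List.getElem_mem hi)) (hrow₂ i hi hik)
      · rw [← hX, Function.update_self]; exact hrow
    · rcases Nat.lt_succ_iff_lt_or_eq.1 (show i < (n + k).succ by omega) with hik | rfl
      · rw [hbest _ (hbefore i hi hik), Function.update_of_ne (hbefore i hi hik)]
        exact (ht.choice i hi hni hik).congr hT (hq.conn _ (List.getElem_mem hi))
          (hcong _ (hcardle i hi hik))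
      · rw [← hX, Function.update_self, Function.update_self]
        exact hch.congr hT hXc (hcong _ le_rfl)
    · have hk' : k < (qs.drop n).length := by rw [List.length_drop]; omega
      have hXk : (qs.drop n)[k] = X := by rw [List.getElem_drop]
      rw [hout, hF₂.out rfl, ht.out, List.take_succ_eq_append_getElem hk', List.flatMap_append,
        hXk, List.flatMap_singleton, List.append_assoc]
      congr 2
      · refine List.flatMap_congr fun Y hY => ?_
        obtain ⟨i, hi, rfl⟩ := List.mem_iff_getElem.1 hY
        rw [List.length_take, List.length_drop] at hi
        have hne := hbefore (n + i) (by omega) (by omega)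
        simp only [List.getElem_take, List.getElem_drop]
        rw [report, report, hbest _ hne, Function.update_of_ne hne]
      · rw [report, Function.update_self, Function.update_self]
  · exact fun s₁ hF h => h
  · simp only [WExp.time]
    have h2 : (qs.length - n) * (2550 * (n * n) + (1 + 1 + (1 + 1) + 1) + 11) ≤
        codeBound N.graph * (2566 * (n * n)) := Nat.mul_le_mul (by omega) (by omega)
    have h3 : codeBound N.graph * (2566 * (n * n)) = 2566 * (codeBound N.graph * (n * n)) := by
      ring
    omega

/-- The vertices of a subgraph as a finite set. -/
noncomputable def vertFin {G : SimpleGraph (Fin n)} (H : G.Subgraph) : Finset (Fin n) :=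
  open Classical in Finset.univ.filter (· ∈ H.verts)

lemma coe_vertFin {G : SimpleGraph (Fin n)} (H : G.Subgraph) :
    (vertFin H : Set (Fin n)) = H.verts := by ext; simp [vertFin]

@[simp] lemma vertFin_indSub (G : SimpleGraph (Fin n)) (X : Finset (Fin n)) :
    vertFin (indSub G (X : Set (Fin n))) = X := by ext; simp [vertFin]

/-- The record of the execution of the dynamic program. -/
noncomputable def record (N : Network (Fin n)) (es : List (Fin n × Fin n))
    (qs : List (Finset (Fin n))) (best : Finset (Fin n) → List (Sym2 (Fin n)))
    (merged : Finset (Fin n) → Sym2 (Fin n) → List (Sym2 (Fin n))) : N.DPRecord where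
  order := (qs.drop n).map fun X : Finset (Fin n) => indSub N.graph (X : Set (Fin n))
  edgeOrder H := edgeList N (vertFin H) es
  merged H := merged (vertFin H)
  best H := best (vertFin H)

lemma ncard_edgeSet_indSub (hT : N.graph.IsTree) (hX : Conn N.graph (X : Set (Fin n))) :
    (indSub N.graph (X : Set (Fin n))).edgeSet.ncard + 1 = X.card := by
  have : (indSub N.graph (X : Set (Fin n))).edgeSet = (edgesIn N.graph X : Set (Sym2 (Fin n))) := by
    ext e; simp
  rw [this, Set.ncard_coe_finset, card_edgesIn hT _ X rfl hX]

lemma isExecution_record (hT : N.graph.IsTree) (hL : ListsEdges N.graph es) (hq : Enum N s qs)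
    (hc : Complete N qs) {best : Finset (Fin n) → List (Sym2 (Fin n))}
    {merged : Finset (Fin n) → Sym2 (Fin n) → List (Sym2 (Fin n))} {s₀ : State}
    (ht : Treated N es qs best merged s₀ s' (qs.length - n)) :
    (record N es qs best merged).IsExecution := by
  have hdrop : ∀ X ∈ qs.drop n, ∃ (i : ℕ) (h : i < qs.length), n ≤ i ∧ qs[i] = X := by
    intro X hX
    obtain ⟨i, hi, rfl⟩ := List.mem_iff_getElem.1 hX
    rw [List.length_drop] at hi
    exact ⟨n + i, by omega, by omega, by rw [List.getElem_drop]⟩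
  have hconn : ∀ X ∈ qs.drop n, Conn N.graph (X : Set (Fin n)) := fun X hX =>
    hq.conn X (List.mem_of_mem_drop hX)
  have hcard : ∀ X ∈ qs.drop n, 2 ≤ X.card := fun X hX => by
    obtain ⟨i, hi, hni, hXe⟩ := hdrop X hX
    rw [← hXe]
    exact hq.card_of_le i hi hni
  have hmemdrop : ∀ X : Finset (Fin n), Conn N.graph (X : Set (Fin n)) → 2 ≤ X.card →
      X ∈ qs.drop n := by
    intro X hX h2
    obtain ⟨i, hi, rfl⟩ := List.mem_iff_getElem.1 (hc X hX)
    rcases Nat.lt_or_ge i n with hin | hin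
    · have e := hq.getElem_eq ⟨i, hin⟩ hi
      simp only at e
      rw [e] at h2; simp at h2
    · refine List.mem_iff_getElem.2 ⟨i - n, by rw [List.length_drop]; omega, ?_⟩
      rw [List.getElem_drop]
      congr 1; omega
  have hchoice : ∀ X ∈ qs.drop n, IsChoice N es best X (merged X) (best X) := fun X hX => by
    obtain ⟨i, hi, hni, rfl⟩ := hdrop X hX
    exact ht.choice i hi hni (by omega)
  have hmem : ∀ H, H ∈ (record N es qs best merged).order ↔
      ∃ X ∈ qs.drop n, indSub N.graph (X : Set (Fin n)) = H := fun H => List.mem_map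
  have hedge : ∀ (X : Finset (Fin n)) (e : Sym2 (Fin n)),
      e ∈ (indSub N.graph (X : Set (Fin n))).edgeSet ↔ e ∈ edgesIn N.graph X := fun X e => by simp
  refine ⟨?_, fun H => ?_, ?_, fun H _ => ?_, fun H hH e => ?_, fun H hH hemp => ?_,
    fun H hH e he => ?_, fun H hH => ?_⟩
  · refine (List.nodup_map_iff_inj_on (hq.nodup.sublist (List.drop_sublist _ _))).2 ?_
    intro X _ Y _ h
    have := congrArg vertFin h
    simpa using this
  · rw [hmem]
    constructor
    · rintro ⟨X, hX, rfl⟩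
      refine ⟨indSub_isTree hT.isAcyclic (hconn X hX), ?_⟩
      obtain ⟨v, hv⟩ := (hconn X hX).1
      obtain ⟨w, hw⟩ := (hconn X hX).exists_edge (Finset.mem_coe.1 hv) (hcard X hX)
      exact ⟨_, (hedge X _).2 hw⟩
    · rintro ⟨hH, e, he⟩
      have h1 := eq_indSub hT.isAcyclic H hH.connected
      have h2 := conn_of_isTree H hH.connected
      rw [← coe_vertFin] at h1 h2
      refine ⟨vertFin H, hmemdrop _ h2 ?_, h1.symm⟩
      have h3 := card_edgesIn hT _ _ rfl h2
      have h4 : e ∈ edgesIn N.graph (vertFin H) := by rw [← hedge, ← h1]; exact he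
      have := Finset.card_pos.2 ⟨e, h4⟩
      omega
  · change ((qs.drop n).map _).Pairwise _
    rw [List.pairwise_map]
    refine (hq.sorted.sublist (List.drop_sublist n qs)).imp_of_mem fun {X Y} hX hY h => ?_
    have h1 := ncard_edgeSet_indSub hT (hconn X hX)
    have h2 := ncard_edgeSet_indSub hT (hconn Y hY)
    omega
  · exact hL.1.filter _
  · obtain ⟨X, hX, rfl⟩ := (hmem H).1 hH
    change e ∈ edgeList N (vertFin (indSub N.graph (X : Set (Fin n)))) es ↔ _
    rw [vertFin_indSub, mem_edgeList hL, hedge]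
  · have h1 := eq_indSub hT.isAcyclic H hH.connected
    have h2 := conn_of_isTree H hH.connected
    rw [← coe_vertFin] at h1 h2
    have h3 := ncard_edgeSet_indSub hT h2
    rw [← h1, hemp, Set.ncard_empty] at h3
    obtain ⟨v, hv⟩ := Finset.card_eq_one.1 h3.symm
    change best (vertFin H) = []
    rw [hv, ht.vertex]
  · obtain ⟨X, hX, rfl⟩ := (hmem H).1 hH
    have heX := (hedge X e).1 he
    obtain ⟨i, hi, rfl⟩ := hL.exists_index (mem_edgesIn.1 heX).1
    obtain ⟨L, hLo, hLm⟩ := (hchoice X hX).merged es[i] (List.getElem_mem hi) heX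
    refine ⟨_, _, L, Network.isSplit_sideFin hT (hconn X hX) heX, ?_, ?_⟩
    · change N.IsOptimalMerge _ _ (best (vertFin _)) (best (vertFin _)) L
      rw [vertFin_indSub, vertFin_indSub]
      exact hLo
    · change merged (vertFin _) _ = _
      rw [vertFin_indSub]; exact hLm
  · obtain ⟨X, hX, rfl⟩ := (hmem H).1 hH
    obtain ⟨e, he, hbe, hle⟩ := (hchoice X hX).choice
    refine ⟨e, (hedge X e).2 he, ?_, fun e' he' => ?_⟩
    · change best (vertFin _) = merged (vertFin _) e
      rw [vertFin_indSub]; exact hbe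
    · change N.objective _ (merged (vertFin _) e) ≤ N.objective _ (merged (vertFin _) e')
      rw [vertFin_indSub]; exact hle e' ((hedge X e').1 he')

lemma transcript_record (best : Finset (Fin n) → List (Sym2 (Fin n)))
    (merged : Finset (Fin n) → Sym2 (Fin n) → List (Sym2 (Fin n))) :
    (record N es qs best merged).transcript (es.map toEdge) =
      (qs.drop n).flatMap (report N es best merged) ++
        Network.encodeSeq (es.map toEdge) (best Finset.univ) := by
  have htop : vertFin (⊤ : N.graph.Subgraph) = Finset.univ := by ext; simp [vertFin]
  simp only [Network.DPRecord.transcript, record, htop, List.flatMap_map, vertFin_indSub]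
  rfl

lemma Enum.last (h : Enum N s qs) (hT : N.graph.IsTree) (hc : Complete N qs) (hne : 0 < qs.length) :
    qs[qs.length - 1] = Finset.univ := by
  obtain ⟨i, hi, he⟩ := List.mem_iff_getElem.1 (hc Finset.univ (conn_coe_univ hT))
  refine Finset.eq_univ_of_card _ (le_antisymm (Finset.card_le_univ _) ?_)
  rcases Nat.lt_or_ge i (qs.length - 1) with h' | h'
  · have := List.pairwise_iff_getElem.1 h.sorted i (qs.length - 1) hi (by omega) h'
    rw [he, Finset.card_univ] at this
    exact this
  · obtain rfl : i = qs.length - 1 := by omega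
    rw [he, Finset.card_univ]

theorem runs_mainProg (hT : N.graph.IsTree) (hL : ListsEdges N.graph es) (hB : Bounds N M) :
    Runs M mainProg (input N es) (6000 * (codeBound N.graph * (n * n))) fun s' =>
      ∃ R : N.DPRecord, R.IsExecution ∧ s'.out = R.transcript (es.map toEdge) := by
  have h1 := hB.one_mod
  have hlen := hL.length hT
  have hn : 0 < n := by omega
  have hnn : n ≤ n * n := Nat.le_mul_self n
  have hcn : n ≤ codeBound N.graph :=
    (Nat.le_succ n).trans (Nat.le_self_pow (Finset.card_pos.2 (leaves_univ_nonempty hT)).ne' _)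
  have hcb : n * (n * n) ≤ codeBound N.graph * (n * n) := Nat.mul_le_mul_right _ hcn
  have hcnn : n * n ≤ n * (n * n) := Nat.le_mul_of_pos_left _ hn
  have hE := env_input N es
  refine Runs.seq (runs_sideProg hT hL hB hE fun _ => rfl)
    (T₂ := 5000 * (codeBound N.graph * (n * n))) ?_ ?_
  swap
  · have : 1000 * n * n * n = 1000 * (n * (n * n)) := by ring
    omega
  intro s₁ hF₁ hS₁
  have hE₁ := hE.frame hF₁ rfl
  refine Runs.seq (runs_queueProg hT hL hB hE₁ (fun i => by rw [hF₁.word _ (by decide)]; rfl)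
    (fun i => by rw [hF₁.word _ (by decide)]; rfl))
    (T₂ := 3000 * (codeBound N.graph * (n * n))) ?_ (by omega)
  rintro s₂ hF₂ ⟨qs, hq, hc⟩
  have hE₂ := hE₁.frame hF₂ rfl
  have hS₂ : SideTable N es s₂ := fun e he => (hS₁ e he).congr (hF₂.word _ (by decide))
  refine Runs.seq (runs_dpProg hT hL hB hE₂ hq hc hS₂ fun i => by
    rw [hF₂.num _ (by decide), hF₁.num _ (by decide)]; rfl)
    (T₂ := 400 * (codeBound N.graph * (n * n))) ?_ (by omega)
  rintro s₃ hF₃ ⟨best, merged, ht⟩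
  have hE₃ := hE₂.frame hF₃ rfl
  have hq₃ : Enum N s₃ qs := hq.frame hF₃ rfl
  have hS₃ : SideTable N es s₃ := fun e he => (hS₂ e he).congr (hF₃.word _ (by decide))
  have hnq : n ≤ qs.length := by simpa using hq.initial.length_le
  have hlast := hq.last hT hc (by omega)
  have huniv := hc Finset.univ (conn_coe_univ hT)
  refine Runs.seq (T₁ := 10) (T₂ := 390 * (codeBound N.graph * (n * n)))
    (R := fun s' => Ctx N es qs Finset.univ s') (Runs.basic rfl (by decide) ?_) ?_ (by omega)
  · refine ⟨hE₃.of_eq ?_ ?_ ?_ rfl rfl, hq₃.of_eq ?_ ?_ ?_ ?_, fun e he => (hS₃ e he).congr ?_,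
      huniv, ?_⟩
    iterate 8 · funext j; simp [Program.den]
    simp only [Program.den, WExp.eval, Nat.zero_mod, h1, hq₃.count,
      hq₃.queue (qs.length - 1) (by omega), hlast]
    simp
  intro s₄ hF₄ hC₄
  have hrow : Row N es s₄ Finset.univ (best Finset.univ) := by
    have h := ht.row (qs.length - 1) (by omega) (by omega)
    rw [hlast] at h
    exact h.frame hF₄ rfl
  refine (runs_printSeq hT hB hC₄ (hrow.length hT (conn_coe_univ hT)) (g := N.seqGain _)
    fun i hi => ⟨hrow.seq i hi, hrow.gain i hi⟩).imp (by omega) ?_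
  intro s₅ hF₅ hout
  refine ⟨record N es qs best merged, isExecution_record hT hL hq hc ht, ?_⟩
  have htake : (qs.drop n).take (qs.length - n) = qs.drop n :=
    List.take_of_length_le (by rw [List.length_drop])
  rw [transcript_record, hout, hF₄.out rfl, ht.out, htake, hF₂.out rfl, hF₁.out rfl]
  rfl

end RAM

theorem theorem2 :
    ∃ P : RAM.Program, ∀ l : ℕ, ∃ C : ℕ, ∀ (n : ℕ) (N : Network (Fin n)),
      N.graph.IsTree → leafCount N.graph = l →
        {H : N.graph.Subgraph | N.IsSubtree H}.ncard ≤ C * n ^ l ∧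
        (∀ R : N.DPRecord, R.IsExecution →
          N.IsOptimal ⊤ (R.best ⊤) ∧
          ∀ H : N.graph.Subgraph, N.IsSubtree H →
            N.IsOptimal H (R.best H) ∧
            ∀ e ∈ H.edgeSet, N.IsOptimalWithLast H e (R.merged H e)) ∧
        ∀ es : List (Fin n × Fin n), RAM.ListsEdges N.graph es →
          ∀ M : ℕ, C * n ^ C ≤ M →
            ∃ (R : N.DPRecord) (t : ℕ) (s : RAM.State),
              R.IsExecution ∧ RAM.Exec M P (RAM.input N es) t s ∧ t ≤ C * n ^ (l + 2) ∧
              s.out = R.transcript (es.map fun p => s(p.1, p.2)) := by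
  refine ⟨RAM.mainProg, fun l => ⟨6000 * 2 ^ (l + 1) + (l + 2), fun n N hT hl => ?_⟩⟩
  set C := 6000 * 2 ^ (l + 1) + (l + 2) with hC
  have hn : 0 < n := by
    obtain ⟨v⟩ := hT.connected.nonempty
    exact v.pos
  have hcode := codeBound_le hT
  rw [hl] at hcode
  have hpow : 1 ≤ 2 ^ (l + 1) := Nat.one_le_two_pow
  refine ⟨?_, fun R hR => ⟨?_, hR.correct hT⟩, fun es hL M hM => ?_⟩
  · refine ((ncard_subtrees_le N hT).trans hcode).trans (Nat.mul_le_mul_right _ (by omega))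
  · refine (hR.correct hT ⊤ ?_).1
    have h := indSub_isTree hT.isAcyclic (conn_univ hT.connected)
    have e : indSub N.graph Set.univ = ⊤ := by
      refine subgraph_eq_of_edgeSet rfl ?_
      ext x; simp [innerEdges]
    rw [e] at h
    exact h
  · have hB : RAM.Bounds N M := by
      refine ⟨le_trans ?_ hM⟩
      have h1 : n ^ l ≤ n ^ (l + 1) := Nat.pow_le_pow_right hn (by omega)
      have h2 : n ≤ n ^ (l + 1) := Nat.le_self_pow (by omega) n
      have h3 : codeBound N.graph + n + 2 ≤ (2 ^ (l + 1) + 3) * n ^ (l + 1) := by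
        have := Nat.mul_le_mul_left (2 ^ (l + 1)) h1
        rw [Nat.add_mul]
        omega
      calc (codeBound N.graph + n + 2) * (n + 2)
          ≤ ((2 ^ (l + 1) + 3) * n ^ (l + 1)) * (3 * n) := Nat.mul_le_mul h3 (by omega)
        _ = (3 * (2 ^ (l + 1) + 3)) * n ^ (l + 2) := by ring
        _ ≤ C * n ^ C := Nat.mul_le_mul (by omega) (Nat.pow_le_pow_right hn (by omega))
    obtain ⟨t, s, he, ht, R, hR, hout⟩ := RAM.runs_mainProg hT hL hB
    refine ⟨R, t, s, hR, he, ht.trans ?_, hout⟩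
    calc 6000 * (codeBound N.graph * (n * n))
        ≤ 6000 * ((2 ^ (l + 1) * n ^ l) * (n * n)) := by gcongr
      _ = 6000 * 2 ^ (l + 1) * n ^ (l + 2) := by ring
      _ ≤ C * n ^ (l + 2) := Nat.mul_le_mul_right _ (by omega)
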